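/- Let $d\ge 1$ be an integer and let $m>0$, $m\neq 1$. Let $\mathbb T^d=\mathbb R^d/\mathbb Z^d$, and let $\mathsf g\in L^1(\mathbb T^d)$ be the Green kernel of the torus, $-\Delta \mathsf g=\delta_0-1$ in the sense of distributions, with (integrable) weak gradient $\nabla\mathsf g$. Consider $$\partial_t u-\operatorname{div}(u^m\,\nabla \mathsf g*u)=0 \ \text{ in } (0,\infty)\times\mathbb T^d,\qquad u|_{t=0}=u_0,\tag{1}$$ with $0\le u_0\in L^\infty(\mathbb T^d)$. A function $u\in L^\infty((0,\infty)\times\mathbb T^d)$, $u\ge 0$, is an *entropy solution* of (1) if 1. for every $T>0$ and $\varphi\in C^1_c([0,T)\times\mathbb T^d)$, $$\int_0^T\!\!\int_{\mathbb T^d}\big[-u\,\partial_t\varphi+u^m\,(\nabla\mathsf g*u)\cdot\nabla\varphi\big]\,dx\,dt=\int_{\mathbb T^d}u_0\,\varphi(0,\cdot)\,dx;$$ 2. for every convex $\eta\in C^2(\mathbb R)$, with $q(\xi)=\int_0^\xi m\,\eta'(s)s^{m-1}ds$ and $\bar u(t)=\int_{\mathbb T^d}u(t,x)\,dx$, the inequality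 $$\partial_t\eta(u)\le\operatorname{div}\big(q(u)\nabla\mathsf g*u\big)+\big(q(u)-\eta'(u)u^m\big)(u-\bar u)$$ holds in the sense of distributions on $[0,\infty)\times\mathbb T^d$ with initial value $\eta(u_0)$, that is, for every $0\le\varphi\in C^\infty_c([0,\infty)\times\mathbb T^d)$, $$\int_0^\infty\!\!\int_{\mathbb T^d}\Big[\eta(u)\partial_t\varphi-q(u)(\nabla\mathsf g*u)\cdot\nabla\varphi+\big(q(u)-\eta'(u)u^m\big)(u-\bar u)\varphi\Big]dx\,dt+\int_{\mathbb T^d}\eta(u_0)\varphi(0,\cdot)\,dx\ge 0.$$ For a measurable vector field $F$ on $\mathbb T^d$ let $\|F\|_{L^{d,1}}=d\int_0^\infty|\{|F|>s\}|^{1/d}\,ds$ be its Lorentz norm. **Proposition (weak–strong uniqueness).** There is a constant $C>0$ depending only on $d$ and $m$ such that the following holds. Let $u,v$ be entropy solutions of (1) with initial data $u_0,v_0$, and suppose that for a.e. $t>0$ the function $v^{m-1}(t)$ (set to $0$ where $v=0$) is integrable with a weak gradient $\nabla v^{m-1}(t)\in L^1(\mathbb T^d)$, which is measurable in $(t,x)$,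 and that for all $T>0$ $$\int_0^T\|\nabla v^{m-1}(t)\|_{L^{d,1}}\,dt<+\infty.$$ Then for a.e. $t>0$ $$\|(u-v)(t)\|_{L^1}\le\|u_0-v_0\|_{L^1}\exp\Big(C\int_0^t\|v(\tau)\|_{L^\infty}\|\nabla v^{m-1}(\tau)\|_{L^{d,1}}\,d\tau\Big).$$ In particular, if $u_0=v_0$ a.e., then $u=v$ a.e. on $(0,\infty)\times\mathbb T^d$. -/

import Mathlib

open MeasureTheory Set
open scoped ENNReal ContDiff

noncomputable section

namespace CoulombMobility

/-- The flat torus `𝕋^d = ℝ^d / ℤ^d`, of total volume `1`. -/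
abbrev Torus (d : ℕ) : Type := UnitAddTorus (Fin d)

/-- Euclidean space `ℝ^d`, where gradients take their values. -/
abbrev Vec (d : ℕ) : Type := EuclideanSpace ℝ (Fin d)

/-- The quotient map `ℝ^d → 𝕋^d`. -/
def proj {d : ℕ} (x : Vec d) : Torus d := fun i => ((x i : ℝ) : UnitAddCircle)

/-- The classical partial derivative `∂ᵢ φ` of a function on the torus. -/
def partialDeriv {d : ℕ} (i : Fin d) (φ : Torus d → ℝ) (x : Torus d) : ℝ :=
  deriv (fun s : ℝ => φ (x + Pi.single i ((s : ℝ) : UnitAddCircle))) 0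

/-- The classical gradient `∇φ` of a function on the torus. -/
def grad {d : ℕ} (φ : Torus d → ℝ) (x : Torus d) : Vec d :=
  WithLp.toLp 2 fun i => partialDeriv i φ x

/-- The classical Laplacian `Δφ = ∑ᵢ ∂ᵢ∂ᵢ φ` of a function on the torus. -/
def laplacian {d : ℕ} (φ : Torus d → ℝ) (x : Torus d) : ℝ :=
  ∑ i, partialDeriv i (partialDeriv i φ) x

/-- `φ ∈ C^∞(𝕋^d)`: the periodic lift of `φ` to `ℝ^d` is smooth. -/
def IsSmooth {d : ℕ} (φ : Torus d → ℝ) : Prop :=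
  ContDiff ℝ ∞ fun x : Vec d => φ (proj x)

/-- `F` is the weak (distributional) gradient of `f`, both integrable on the torus. -/
structure HasWeakGradient {d : ℕ} (f : Torus d → ℝ) (F : Torus d → Vec d) : Prop where
  integrable_fun : Integrable f
  integrable_grad : Integrable F
  integral_eq : ∀ φ : Torus d → ℝ, IsSmooth φ → ∀ i : Fin d,
    ∫ x, f x * partialDeriv i φ x = -∫ x, F x i * φ x

/-- `g` is a Green kernel of the torus, that is `-Δg = δ₀ - 1` in the sense of distributions, and
`K` is its gradient `∇g`. The equation determines `g` up to an additive constant, and `K` up to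
equality almost everywhere. -/
structure IsGreenKernel {d : ℕ} (g : Torus d → ℝ) (K : Torus d → Vec d) : Prop where
  gradient : HasWeakGradient g K
  equation : ∀ φ : Torus d → ℝ, IsSmooth φ →
    -∫ x, g x * laplacian φ x = φ 0 - ∫ x, φ x

/-- The convolution `K ∗ f`; for `K = ∇g` this is the field `∇g ∗ f`. -/
def convField {d : ℕ} (K : Torus d → Vec d) (f : Torus d → ℝ) (x : Torus d) : Vec d :=
  ∫ y, f y • K (x - y)

/-- The measure `dt dx` on `(0,∞) × 𝕋^d`. -/
def spaceTime (d : ℕ) : Measure (ℝ × Torus d) :=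
  (volume.restrict (Ioi (0 : ℝ))).prod volume

/-- `φ` is (the restriction to `t ≥ 0` of) a function of class `C^n` on `ℝ × 𝕋^d`. -/
def IsTimeSpaceRegular {d : ℕ} (n : WithTop ℕ∞) (φ : ℝ → Torus d → ℝ) : Prop :=
  ContDiff ℝ n fun p : ℝ × Vec d => φ p.1 (proj p.2)

/-- The entropy flux `q` of the entropy `η`: `q'(ξ) = m η'(ξ) ξ^(m-1)`, `q(0) = 0`. -/
def entropyFlux (m : ℝ) (η : ℝ → ℝ) (ξ : ℝ) : ℝ :=
  ∫ s in (0 : ℝ)..ξ, m * deriv η s * s ^ (m - 1)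

/-- `u` is an entropy solution of `∂ₜu = div (u^m ∇g ∗ u)`, `u(0) = u₀`, where `K = ∇g`. -/
structure IsEntropySolution {d : ℕ} (m : ℝ) (K : Torus d → Vec d)
    (u₀ : Torus d → ℝ) (u : ℝ → Torus d → ℝ) : Prop where
  /-- `u₀ ∈ L^∞(𝕋^d)` -/
  initial_memLp : MemLp u₀ ⊤ volume
  /-- `u₀ ≥ 0` -/
  initial_nonneg : ∀ᵐ x, 0 ≤ u₀ x
  /-- `u ∈ L^∞((0,∞) × 𝕋^d)` -/
  memLp : MemLp (Function.uncurry u) ⊤ (spaceTime d)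
  /-- `u ≥ 0` -/
  nonneg : ∀ᵐ p ∂(spaceTime d), 0 ≤ u p.1 p.2
  /-- the weak formulation, for all `T > 0` and `φ ∈ C¹_c([0,T) × 𝕋^d)` -/
  weak : ∀ T : ℝ, 0 < T → ∀ φ : ℝ → Torus d → ℝ, IsTimeSpaceRegular 1 φ →
    (∃ T' < T, ∀ t, T' ≤ t → ∀ x, φ t x = 0) →
    ∫ t in Ioo 0 T, ∫ x,
        (-(u t x * deriv (fun s => φ s x) t)
          + u t x ^ m * inner ℝ (convField K (u t) x) (grad (φ t) x))
      = ∫ x, u₀ x * φ 0 x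
  /-- the entropy inequality
  `∂ₜ η(u) ≤ div (q(u) ∇g ∗ u) + (q(u) - η'(u) u^m) (u - ū)` with initial value `η(u₀)`, tested
  against nonnegative `φ ∈ C^∞_c([0,∞) × 𝕋^d)`, for all convex `η` of class `C²` -/
  entropy : ∀ η : ℝ → ℝ, ContDiff ℝ 2 η → ConvexOn ℝ univ η →
    ∀ φ : ℝ → Torus d → ℝ, IsTimeSpaceRegular ∞ φ → (∀ t x, 0 ≤ φ t x) →
    (∃ T, ∀ t, T ≤ t → ∀ x, φ t x = 0) →
    0 ≤ (∫ t in Ioi (0 : ℝ), ∫ x,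
        (η (u t x) * deriv (fun s => φ s x) t
          - entropyFlux m η (u t x) * inner ℝ (convField K (u t) x) (grad (φ t) x)
          + (entropyFlux m η (u t x) - deriv η (u t x) * u t x ^ m)
            * (u t x - ∫ y, u t y) * φ t x))
      + ∫ x, η (u₀ x) * φ 0 x

/-- The norm of the Lorentz space `L^{p,1}`, `1 ≤ p < ∞`, through the distribution function:
`‖F‖_{L^{p,1}} = p ∫₀^∞ |{‖F‖ > s}|^{1/p} ds = ∫₀^∞ τ^{1/p} F^*(τ) dτ/τ`, where `F^*` is the
decreasing rearrangement. -/
def lorentzNorm {d : ℕ} (p : ℝ) (F : Torus d → Vec d) : ℝ≥0∞ :=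
  ENNReal.ofReal p * ∫⁻ s in Ioi (0 : ℝ), (volume {x | s < ‖F x‖}) ^ (1 / p)

/-- `w` is the spatial weak gradient of `f` at almost every time `t > 0`, and
`w ∈ L¹((0,T); L^{d,1}(𝕋^d))` for all `T > 0`. -/
structure IsLorentzGradient {d : ℕ} (f : ℝ → Torus d → ℝ) (w : ℝ → Torus d → Vec d) : Prop where
  measurable : AEStronglyMeasurable (Function.uncurry w) (spaceTime d)
  gradient : ∀ᵐ t ∂(volume.restrict (Ioi (0 : ℝ))), HasWeakGradient (f t) (w t)
  integrable : ∀ T : ℝ, 0 < T → ∫⁻ t in Ioo 0 T, lorentzNorm d (w t) < ⊤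

end CoulombMobility

end

open MeasureTheory Set
open scoped ENNReal ContDiff

noncomputable section

namespace CoulombMobility

open Filter Topology

variable {d : ℕ}

/-! Write `K = ∇g`, `V = v^m`, `W = ∇V`, and bars for means over the torus. The proof is Kružkov's
argument with only the space variable doubled: `u` enters through its entropy inequalities, `v` only
through its weak formulation.

Kernel bounds. There is `C₀`, depending on `d` only, with `∫_E |K| ≤ C₀ |E|^(1/d)` for all
measurable `E` (`IsGreenKernel.exists_setIntegral_apply_le`, `exists_forall_setLIntegral_le`); it
comes from comparing `K` with an explicit regularized fundamental solution. The layer-cake formula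
turns it into `∫ |K(y - z)| |F(y)| dy ≤ C₀ ‖F‖_{L^{d,1}}` for every `z`
(`lintegral_mul_comp_sub_le_lorentzNorm`). A function with weak gradient `F` is its mean plus a
convolution of `K` with `F`, hence differs from its mean by at most the supremum over `z` of the
same integral (`IsGreenKernel.ae_abs_sub_integral_le`). So `v^(m-1)` is bounded at almost every
time, the chain rule gives `W = m/(m-1) v ∇v^(m-1)`, and with `a = |m/(m-1)| C₀ ‖v‖_∞
‖∇v^(m-1)‖_{L^{d,1}}` one has both `∫ |K(y - z)| |W(y)| dy ≤ a` and `|V - V̄| ≤ a`.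

Moving levels. As `W` is integrable, the equation of `v` has the nonconservative form `∂ₜv = W · (K
∗ v) - V (v - v̄)` with integrable right-hand side, so that `t ↦ v(t, y)` is absolutely continuous
for almost every `y` (`ae_ae_eq_add_primitive`). The entropy inequality of `u` for `|u - k|` can
then be integrated along the moving level `k = v(t, y)` (`integral_nonneg_of_moving_level`,
`IsEntropySolution.integral_moving_level_nonneg`), and no second time variable is needed.

The estimate. Test with `ρ(x - y)`, integrate in `y`, and integrate the flux by parts in `y`. What
remains is `sgn(u(x) - v(y)) ρ(x - y)` times `W(y) · ((K ∗ u)(x) - (K ∗ v)(y)) - V(y) ((u(x) - ū) -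
(v(y) - v̄))`. Up to a translation error the first term costs `∫ |W| |K ∗ (u - v)| ≤ a ‖u - v‖₁`. In
the second, split `V = V̄ + (V - V̄)`. The `V̄` part is at most `V̄ (‖u - v‖₁ - |u - v|)`, because
`|ū - v̄| ≤ ‖u - v‖₁`, and this integrates to zero up to a mollification error; the rest costs `2a
‖u - v‖₁`. Hence only the oscillation of `V`, never its size, enters (`integral_doubled_rate_le`).
When `ρ` concentrates, `d/dt ‖u - v‖₁ ≤ 3a ‖u - v‖₁` in the sense of distributions, and Gronwall's
inequality concludes. -/

instance isProbabilityMeasure_unitAddCircle :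
    IsProbabilityMeasure (volume : Measure UnitAddCircle) := ⟨by simp⟩

instance isProbabilityMeasure_torus : IsProbabilityMeasure (volume : Measure (Torus d)) :=
  inferInstanceAs (IsProbabilityMeasure (Measure.pi fun _ => volume))

instance isNegInvariant_torus : (volume : Measure (Torus d)).IsNegInvariant :=
  Measure.pi.isNegInvariant _

/-! ### Calculus on the torus -/

/-- The lift of `φ` to `ℝ^d` is of class `C^n`. -/
def TorusContDiff (n : WithTop ℕ∞) (φ : Torus d → ℝ) : Prop :=
  ContDiff ℝ n fun x : Vec d => φ (proj x)

theorem IsSmooth.torusContDiff {φ : Torus d → ℝ} (h : IsSmooth φ) {n : ℕ∞} :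
    TorusContDiff n φ := ContDiff.of_le h (by exact_mod_cast le_top)

theorem proj_add (x y : Vec d) : proj (x + y) = proj x + proj y := by
  ext i; simp [proj]

theorem proj_sub (x y : Vec d) : proj (x - y) = proj x - proj y := by
  ext i; simp [proj]

theorem proj_smul_single (i : Fin d) (s : ℝ) :
    proj (s • EuclideanSpace.single i (1 : ℝ)) = Pi.single i ((s : ℝ) : UnitAddCircle) := by
  ext j
  by_cases h : j = i
  · subst h; simp [proj]
  · simp [proj, h]

/-- Regularity on the torus is defined through lifts to `ℝ^d`; the quotient property brings
continuity of a lift back down to the torus. -/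
theorem isOpenQuotientMap_proj : IsOpenQuotientMap (proj : Vec d → Torus d) := by
  have h : IsOpenQuotientMap (Pi.map fun (_ : Fin d) (s : ℝ) => (s : UnitAddCircle)) :=
    IsOpenQuotientMap.piMap fun _ => QuotientAddGroup.isOpenQuotientMap_mk
  exact h.comp (PiLp.continuousLinearEquiv 2 ℝ (fun _ : Fin d => ℝ)).toHomeomorph.isOpenQuotientMap

theorem proj_surjective : Function.Surjective (proj : Vec d → Torus d) :=
  isOpenQuotientMap_proj.surjective

/-- The coordinate `dxᵢ`. -/
def coord (i : Fin d) : Vec d →L[ℝ] ℝ := EuclideanSpace.proj i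

@[simp] theorem coord_apply (i : Fin d) (x : Vec d) : coord i x = x i := rfl

/-- The linear map `∑ᵢ aᵢ dxᵢ`. -/
def coordForm (a : Fin d → ℝ) : Vec d →L[ℝ] ℝ := ∑ i, a i • coord i

theorem eq_coordForm (L : Vec d →L[ℝ] ℝ) :
    L = coordForm fun i => L (EuclideanSpace.single i (1 : ℝ)) := by
  apply ContinuousLinearMap.coe_injective
  apply (EuclideanSpace.basisFun (Fin d) ℝ).toBasis.ext
  intro i
  simp [coordForm, Finset.sum_apply]

namespace TorusContDiff

variable {n : WithTop ℕ∞} {φ ψ : Torus d → ℝ}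

theorem continuous (h : TorusContDiff n φ) : Continuous φ :=
  isOpenQuotientMap_proj.isQuotientMap.continuous_iff.2 (ContDiff.continuous h)

theorem exists_bound (h : TorusContDiff n φ) : ∃ B, 0 ≤ B ∧ ∀ x, |φ x| ≤ B := by
  obtain ⟨B, hB⟩ := isCompact_univ.exists_bound_of_continuousOn h.continuous.continuousOn
  exact ⟨max B 0, le_max_right _ _, fun x => (hB x (mem_univ x)).trans (le_max_left _ _)⟩

theorem hasDerivAt_lift (h : TorusContDiff 1 φ) (i : Fin d) (x : Vec d) (s : ℝ) :
    HasDerivAt (fun s : ℝ => φ (proj x + Pi.single i ((s : ℝ) : UnitAddCircle)))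
      (fderiv ℝ (fun x : Vec d => φ (proj x)) (x + s • EuclideanSpace.single i (1 : ℝ))
        (EuclideanSpace.single i (1 : ℝ))) s := by
  have h1 : HasDerivAt (fun s : ℝ => x + s • EuclideanSpace.single i (1 : ℝ))
      (EuclideanSpace.single i (1 : ℝ)) s := by
    simpa using ((hasDerivAt_id s).smul_const (EuclideanSpace.single i (1 : ℝ))).const_add x
  have h2 := ((ContDiff.differentiable h (by simp)).differentiableAt
    (x := x + s • EuclideanSpace.single i (1 : ℝ))).hasFDerivAt.comp_hasDerivAt s h1
  refine h2.congr_of_eventuallyEq (Eventually.of_forall fun r => ?_)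
  simp [proj_add, proj_smul_single]

theorem partialDeriv_proj (h : TorusContDiff 1 φ) (i : Fin d) (x : Vec d) :
    partialDeriv i φ (proj x) =
      fderiv ℝ (fun x : Vec d => φ (proj x)) x (EuclideanSpace.single i (1 : ℝ)) := by
  have := (h.hasDerivAt_lift i x 0).deriv
  simpa [CoulombMobility.partialDeriv] using this

theorem hasDerivAt (h : TorusContDiff 1 φ) (i : Fin d) (x : Torus d) (s : ℝ) :
    HasDerivAt (fun s : ℝ => φ (x + Pi.single i ((s : ℝ) : UnitAddCircle)))
      (partialDeriv i φ (x + Pi.single i ((s : ℝ) : UnitAddCircle))) s := by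
  obtain ⟨x, rfl⟩ := proj_surjective x
  rw [← proj_smul_single, ← proj_add, h.partialDeriv_proj]
  exact h.hasDerivAt_lift i x s

theorem hasDerivAt_zero (h : TorusContDiff 1 φ) (i : Fin d) (x : Torus d) :
    HasDerivAt (fun s : ℝ => φ (x + Pi.single i ((s : ℝ) : UnitAddCircle)))
      (partialDeriv i φ x) 0 := by
  simpa using h.hasDerivAt i x 0

theorem hasFDerivAt (h : TorusContDiff 1 φ) (x : Vec d) (y : Torus d) :
    HasFDerivAt (fun x : Vec d => φ (proj x - y))
      (coordForm fun i => partialDeriv i φ (proj x - y)) x := by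
  obtain ⟨y, rfl⟩ := proj_surjective y
  have h1 : HasFDerivAt (fun x : Vec d => φ (proj x))
      (coordForm fun i => partialDeriv i φ (proj x - proj y)) (x - y) := by
    have := ((ContDiff.differentiable h (by simp)).differentiableAt (x := x - y)).hasFDerivAt
    rw [eq_coordForm (fderiv ℝ (fun x : Vec d => φ (proj x)) (x - y))] at this
    simpa only [← h.partialDeriv_proj, ← proj_sub] using this
  simpa only [proj_sub, Function.comp_def, ContinuousLinearMap.comp_id] using
    h1.comp x (g := fun x : Vec d => φ (proj x)) (f := fun x : Vec d => x - y)
      ((hasFDerivAt_id x).sub_const y)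

theorem of_le {k : WithTop ℕ∞} (h : TorusContDiff n φ) (hk : k ≤ n) : TorusContDiff k φ :=
  ContDiff.of_le h hk

theorem partialDeriv (h : TorusContDiff (n + 1) φ) (i : Fin d) :
    TorusContDiff n (partialDeriv i φ) := by
  have h1 : TorusContDiff 1 φ := h.of_le le_add_self
  unfold TorusContDiff
  simp_rw [h1.partialDeriv_proj i]
  exact (ContDiff.fderiv_right h le_rfl).clm_apply contDiff_const

theorem comp_sub_left (h : TorusContDiff n φ) (a : Torus d) :
    TorusContDiff n fun x => φ (a - x) := by
  obtain ⟨a, rfl⟩ := proj_surjective a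
  unfold TorusContDiff
  simp_rw [← proj_sub]
  exact ContDiff.comp (g := fun x : Vec d => φ (proj x)) h (contDiff_const.sub contDiff_id)

theorem comp_sub_right (h : TorusContDiff n φ) (a : Torus d) :
    TorusContDiff n fun x => φ (x - a) := by
  obtain ⟨a, rfl⟩ := proj_surjective a
  unfold TorusContDiff
  simp_rw [← proj_sub]
  exact ContDiff.comp (g := fun x : Vec d => φ (proj x)) h (contDiff_id.sub contDiff_const)

theorem comp_add_right (h : TorusContDiff n φ) (a : Torus d) :
    TorusContDiff n fun x => φ (x + a) := by
  simpa using h.comp_sub_right (-a)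

theorem mul (h : TorusContDiff n φ) (h' : TorusContDiff n ψ) :
    TorusContDiff n fun x => φ x * ψ x := ContDiff.mul h h'

theorem sum {ι : Type*} {s : Finset ι} {f : ι → Torus d → ℝ}
    (h : ∀ i ∈ s, TorusContDiff n (f i)) : TorusContDiff n fun x => ∑ i ∈ s, f i x :=
  ContDiff.sum h

theorem comp {η : ℝ → ℝ} (hη : ContDiff ℝ n η) (h : TorusContDiff n φ) :
    TorusContDiff n fun x => η (φ x) := ContDiff.comp hη h

end TorusContDiff

theorem torusContDiff_const {n : WithTop ℕ∞} (c : ℝ) :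
    TorusContDiff n fun _ : Torus d => c := contDiff_const

theorem IsSmooth.contDiffOne {φ : Torus d → ℝ} (h : IsSmooth φ) : TorusContDiff 1 φ :=
  TorusContDiff.of_le h (by exact_mod_cast le_top)

theorem IsSmooth.continuous {φ : Torus d → ℝ} (h : IsSmooth φ) : Continuous φ :=
  TorusContDiff.continuous h

theorem IsSmooth.partialDeriv {φ : Torus d → ℝ} (h : IsSmooth φ) (i : Fin d) :
    IsSmooth (partialDeriv i φ) := TorusContDiff.partialDeriv (n := ∞) h i

theorem integrable_of_continuous {E : Type*} [NormedAddCommGroup E] {f : Torus d → E}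
    (h : Continuous f) : Integrable f :=
  h.integrable_of_hasCompactSupport (HasCompactSupport.of_compactSpace _)

theorem Integrable.mul_continuous {f φ : Torus d → ℝ} (hf : Integrable f) (h : Continuous φ) :
    Integrable fun x => f x * φ x := by
  obtain ⟨B, hB⟩ := isCompact_univ.exists_bound_of_continuousOn h.continuousOn
  exact hf.mul_bdd h.aestronglyMeasurable (Eventually.of_forall fun x => hB x (mem_univ x))

section PartialDeriv

variable {φ ψ : Torus d → ℝ}

theorem partialDeriv_mul (h : TorusContDiff 1 φ) (h' : TorusContDiff 1 ψ) (i : Fin d)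
    (x : Torus d) : partialDeriv i (fun x => φ x * ψ x) x =
      partialDeriv i φ x * ψ x + φ x * partialDeriv i ψ x := by
  have := ((h.hasDerivAt_zero i x).mul (h'.hasDerivAt_zero i x)).deriv
  simp only [AddCircle.coe_zero, Pi.single_zero, add_zero] at this
  exact this

theorem partialDeriv_const_mul (c : ℝ) (i : Fin d) (x : Torus d) :
    partialDeriv i (fun x => c * ψ x) x = c * partialDeriv i ψ x := by
  simp [partialDeriv]

theorem partialDeriv_comp {η : ℝ → ℝ} (hη : DifferentiableAt ℝ η (φ x)) (h : TorusContDiff 1 φ)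
    (i : Fin d) : partialDeriv i (fun x => η (φ x)) x = deriv η (φ x) * partialDeriv i φ x := by
  have h1 : HasDerivAt η (deriv η (φ x)) (φ (x + Pi.single i ((0 : ℝ) : UnitAddCircle))) := by
    simpa using hη.hasDerivAt
  exact (h1.comp (0 : ℝ) (h.hasDerivAt_zero i x)).deriv

theorem partialDeriv_comp_sub_left (h : TorusContDiff 1 φ) (a : Torus d) (i : Fin d) (x : Torus d) :
    partialDeriv i (fun x => φ (a - x)) x = -partialDeriv i φ (a - x) := by
  have h1 : HasDerivAt (fun s : ℝ => φ (a - x + Pi.single i ((s : ℝ) : UnitAddCircle)))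
      (partialDeriv i φ (a - x)) (-(0 : ℝ)) := by simpa using h.hasDerivAt_zero i (a - x)
  have h2 := (h1.comp (0 : ℝ) (hasDerivAt_neg (0 : ℝ))).deriv
  rw [mul_neg_one] at h2
  rw [← h2]
  unfold partialDeriv
  congr 1
  ext s
  simp only [Function.comp, AddCircle.coe_neg, Pi.single_neg]
  congr 1
  abel

theorem partialDeriv_comp_sub_right (a : Torus d) (i : Fin d) (x : Torus d) :
    partialDeriv i (fun x => φ (x - a)) x = partialDeriv i φ (x - a) := by
  unfold partialDeriv
  simp only [sub_add_eq_add_sub]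

theorem partialDeriv_comm (h : TorusContDiff 2 φ) (i j : Fin d) (x : Torus d) :
    partialDeriv i (partialDeriv j φ) x = partialDeriv j (partialDeriv i φ) x := by
  obtain ⟨x, rfl⟩ := proj_surjective x
  have h1 : TorusContDiff 1 φ := h.of_le (by norm_num)
  have h2 : ∀ i, TorusContDiff 1 (partialDeriv i φ) :=
    fun i => TorusContDiff.partialDeriv (n := 1) (by simpa [one_add_one_eq_two] using h) i
  have hd : DifferentiableAt ℝ (fderiv ℝ fun x : Vec d => φ (proj x)) x :=
    ((ContDiff.fderiv_right (m := 1) h (by norm_num)).differentiable (by simp)).differentiableAt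
  have key : ∀ i j, partialDeriv i (partialDeriv j φ) (proj x) =
      fderiv ℝ (fderiv ℝ fun x : Vec d => φ (proj x)) x (EuclideanSpace.single i 1)
        (EuclideanSpace.single j 1) := by
    intro i j
    rw [(h2 j).partialDeriv_proj]
    simp_rw [h1.partialDeriv_proj j]
    rw [fderiv_clm_apply hd (differentiableAt_const _)]
    simp
  rw [key, key]
  exact (ContDiffAt.isSymmSndFDerivAt (n := 2) (ContDiff.contDiffAt h) (by simp)) _ _

theorem TorusContDiff.continuous_partialDeriv (h : TorusContDiff 1 φ) (i : Fin d) :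
    Continuous (CoulombMobility.partialDeriv i φ) :=
  (TorusContDiff.partialDeriv (n := 0) (by simpa using h) i).continuous

theorem TorusContDiff.exists_bound_partialDeriv (h : TorusContDiff 1 φ) (i : Fin d) :
    ∃ B, 0 ≤ B ∧ ∀ x, |CoulombMobility.partialDeriv i φ x| ≤ B :=
  (TorusContDiff.partialDeriv (n := 0) (by simpa using h) i).exists_bound

/-- By translation invariance the integral of a translate of `φ` does not depend on the shift;
differentiating it under the integral sign at shift `0` gives the claim, with no fundamental domain
and no boundary terms. -/
theorem integral_partialDeriv (h : TorusContDiff 1 φ) (i : Fin d) :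
    ∫ x, partialDeriv i φ x = 0 := by
  obtain ⟨B, -, hB⟩ := h.exists_bound_partialDeriv i
  have hc := h.continuous_partialDeriv i
  have h1 : ∀ {f : Torus d → ℝ} (_ : Continuous f) (s : ℝ), Continuous fun x : Torus d =>
      f (x + Pi.single i ((s : ℝ) : UnitAddCircle)) := fun hf s => hf.comp (by fun_prop)
  have key : HasDerivAt
      (fun s : ℝ => ∫ x : Torus d, φ (x + Pi.single i ((s : ℝ) : UnitAddCircle)))
      (∫ x : Torus d, partialDeriv i φ (x + Pi.single i ((0 : ℝ) : UnitAddCircle))) 0 := by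
    refine (hasDerivAt_integral_of_dominated_loc_of_deriv_le
      (μ := (volume : Measure (Torus d)))
      (F := fun (s : ℝ) (x : Torus d) => φ (x + Pi.single i ((s : ℝ) : UnitAddCircle)))
      (F' := fun (s : ℝ) (x : Torus d) =>
        partialDeriv i φ (x + Pi.single i ((s : ℝ) : UnitAddCircle)))
      (x₀ := 0) (s := univ) (bound := fun _ => B) univ_mem ?_ ?_ ?_ ?_ ?_ ?_).2
    · exact Eventually.of_forall fun s => (h1 h.continuous s).aestronglyMeasurable
    · exact integrable_of_continuous (h1 h.continuous 0)
    · exact (h1 hc 0).aestronglyMeasurable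
    · exact Eventually.of_forall fun x s _ => hB _
    · exact integrable_const _
    · exact Eventually.of_forall fun x s _ => h.hasDerivAt i x s
  have h3 : ∀ s : ℝ, ∫ x : Torus d, φ (x + Pi.single i ((s : ℝ) : UnitAddCircle)) = ∫ x, φ x :=
    fun s => integral_add_right_eq_self φ _
  simp only [h3] at key
  rw [← key.unique (hasDerivAt_const _ _)]
  simp

theorem integral_mul_partialDeriv (h : TorusContDiff 1 φ) (h' : TorusContDiff 1 ψ) (i : Fin d) :
    ∫ x, φ x * partialDeriv i ψ x = -∫ x, partialDeriv i φ x * ψ x := by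
  have hφ := (TorusContDiff.partialDeriv (n := 0) (by simpa using h) i).continuous
  have hψ := (TorusContDiff.partialDeriv (n := 0) (by simpa using h') i).continuous
  have key := integral_partialDeriv (h.mul h') i
  simp_rw [partialDeriv_mul h h'] at key
  have := h.continuous
  have := h'.continuous
  rw [integral_add (integrable_of_continuous (by fun_prop))
    (integrable_of_continuous (by fun_prop))] at key
  linarith

end PartialDeriv

/-- The convolution of two scalar functions on the torus. -/
def conv (f φ : Torus d → ℝ) (x : Torus d) : ℝ := ∫ y, f y * φ (x - y)

/-! ### Smoothness of convolutions -/

section Conv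

variable {f φ : Torus d → ℝ}

theorem Integrable.mul_comp_sub (hf : Integrable f) (h : Continuous φ) (x : Torus d) :
    Integrable fun y => f y * φ (x - y) :=
  Integrable.mul_continuous hf (h.comp (by fun_prop))

theorem hasFDerivAt_conv (hf : Integrable f) (h : TorusContDiff 1 φ) (x : Vec d) :
    HasFDerivAt (fun x : Vec d => conv f φ (proj x))
      (coordForm fun i => conv f (partialDeriv i φ) (proj x)) x := by
  choose B hB0 hB using fun i => h.exists_bound_partialDeriv i
  have hfint : ∀ i (x : Torus d), Integrable fun y => f y * partialDeriv i φ (x - y) := fun i x =>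
    Integrable.mul_comp_sub hf (h.continuous_partialDeriv i) x
  have hfint' : ∀ (i : Fin d) (x : Torus d), Integrable
      fun y => (f y * partialDeriv i φ (x - y)) • (coord i : Vec d →L[ℝ] ℝ) :=
    fun i x => (hfint i x).smul_const _
  have hF : Integrable fun y => coordForm fun i => f y * partialDeriv i φ (proj x - y) := by
    unfold coordForm
    exact integrable_finsetSum (f := fun i y => (f y * partialDeriv i φ (proj x - y)) •
      (coord i : Vec d →L[ℝ] ℝ)) _ fun i _ => hfint' i (proj x)
  have heq : (coordForm fun i => conv f (partialDeriv i φ) (proj x)) =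
      ∫ y, coordForm fun i => f y * partialDeriv i φ (proj x - y) := by
    unfold coordForm conv
    rw [integral_finsetSum _ fun i _ => hfint' i (proj x)]
    refine Finset.sum_congr rfl fun i _ => ?_
    rw [integral_smul_const]
  rw [heq]
  refine hasFDerivAt_integral_of_dominated_of_fderiv_le (𝕜 := ℝ)
    (μ := (volume : Measure (Torus d)))
    (F := fun (x : Vec d) (y : Torus d) => f y * φ (proj x - y))
    (F' := fun (x : Vec d) (y : Torus d) =>
      coordForm fun i => f y * partialDeriv i φ (proj x - y))
    (x₀ := x) (s := univ)
    (bound := fun y => ∑ i, |f y| * B i * ‖(coord i : Vec d →L[ℝ] ℝ)‖) univ_mem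
    ?_ ?_ ?_ ?_ ?_ ?_
  · exact Eventually.of_forall fun s =>
      (Integrable.mul_comp_sub hf h.continuous _).aestronglyMeasurable
  · exact Integrable.mul_comp_sub hf h.continuous _
  · exact hF.aestronglyMeasurable
  · refine Eventually.of_forall fun y x _ => ?_
    unfold coordForm
    refine (norm_sum_le _ _).trans (Finset.sum_le_sum fun i _ => ?_)
    rw [norm_smul, Real.norm_eq_abs, abs_mul]
    gcongr
    exact hB i _
  · exact integrable_finsetSum _ fun i _ => (hf.abs.mul_const _).mul_const _
  · refine Eventually.of_forall fun y x _ => ?_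
    have := (h.hasFDerivAt x y).const_mul (f y)
    have h2 : (coordForm fun i => f y * partialDeriv i φ (proj x - y)) =
        f y • coordForm fun i => partialDeriv i φ (proj x - y) := by
      simp only [coordForm, Finset.smul_sum, mul_smul]
    rw [h2]
    exact this

/-- Induction on the order: the derivatives of `conv f φ` are convolutions of `f` with derivatives
of `φ`, so that the induction hypothesis applies to them and `f` is never differentiated. -/
theorem isSmooth_conv (hf : Integrable f) (h : IsSmooth φ) : IsSmooth (conv f φ) := by
  refine contDiff_infty.2 fun n => ?_
  induction n generalizing φ with
  | zero =>
    exact contDiff_zero.2 (continuous_iff_continuousAt.2 fun x =>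
      (hasFDerivAt_conv hf h.contDiffOne x).continuousAt)
  | succ n ih =>
    push_cast
    rw [contDiff_succ_iff_fderiv]
    refine ⟨fun x => (hasFDerivAt_conv hf h.contDiffOne x).differentiableAt, by simp, ?_⟩
    have : (fderiv ℝ fun x : Vec d => conv f φ (proj x)) =
        fun x => coordForm fun i => conv f (partialDeriv i φ) (proj x) := by
      ext1 x; exact (hasFDerivAt_conv hf h.contDiffOne x).fderiv
    rw [this]
    unfold coordForm
    exact ContDiff.sum fun i _ => (ih (h.partialDeriv i)).smul contDiff_const

theorem partialDeriv_conv (hf : Integrable f) (h : IsSmooth φ) (i : Fin d) (x : Torus d) :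
    partialDeriv i (conv f φ) x = conv f (partialDeriv i φ) x := by
  obtain ⟨x, rfl⟩ := proj_surjective x
  rw [(isSmooth_conv hf h).contDiffOne.partialDeriv_proj,
    (hasFDerivAt_conv hf h.contDiffOne x).fderiv]
  simp [coordForm]

end Conv

/-! ### A periodic substitute for `|x|²` -/

theorem periodic_sin_sq : Function.Periodic
    (fun x : ℝ => Real.sin (Real.pi * x) ^ 2 / Real.pi ^ 2) 1 := by
  intro x
  simp [mul_add, Real.sin_add_pi]

/-- The function `sin²(πx) / π²` on the circle. -/
def circleSq : UnitAddCircle → ℝ := periodic_sin_sq.lift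

theorem circleSq_coe (x : ℝ) : circleSq (x : UnitAddCircle) =
    Real.sin (Real.pi * x) ^ 2 / Real.pi ^ 2 := periodic_sin_sq.lift_coe x

/-- For the representative of absolute value at most `1/2` the argument of the sine lies in `[0,
π/2]`, where Jordan's inequality bounds the sine from below. -/
theorem circleSq_eq (x : ℝ) : circleSq (x : UnitAddCircle) =
    Real.sin (Real.pi * |x - round x|) ^ 2 / Real.pi ^ 2 := by
  have h1 : (x : UnitAddCircle) = ((x - round x : ℝ) : UnitAddCircle) := by
    have : ((round x : ℝ) : UnitAddCircle) = 0 :=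
      (AddCircle.coe_eq_zero_iff 1).2 ⟨round x, by simp⟩
    simp [this]
  rw [h1, circleSq_coe]
  rcases abs_choice (x - round x) with h | h <;> rw [h]
  rw [mul_neg, Real.sin_neg, neg_sq]

theorem circleSq_nonneg (x : UnitAddCircle) : 0 ≤ circleSq x := by
  induction x using QuotientAddGroup.induction_on with | H x =>
  rw [circleSq_coe]; positivity

theorem circleSq_le_norm_sq (x : UnitAddCircle) : circleSq x ≤ ‖x‖ ^ 2 := by
  induction x using QuotientAddGroup.induction_on with | H x =>
  rw [circleSq_eq, UnitAddCircle.norm_eq]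
  rw [div_le_iff₀ (by positivity), ← mul_pow, mul_comm |x - round x|]
  rw [sq_le_sq, abs_of_nonneg (a := Real.pi * |x - round x|) (by positivity)]
  simpa [abs_mul, abs_of_pos Real.pi_pos] using Real.abs_sin_le_abs (x := Real.pi * |x - round x|)

theorem norm_sq_le_circleSq (x : UnitAddCircle) :
    (2 / Real.pi * ‖x‖) ^ 2 ≤ circleSq x := by
  induction x using QuotientAddGroup.induction_on with | H x =>
  rw [circleSq_eq, UnitAddCircle.norm_eq]
  have h := abs_sub_round x
  have h1 := Real.mul_le_sin (x := Real.pi * |x - round x|) (by positivity)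
    (by nlinarith [Real.pi_pos])
  rw [le_div_iff₀ (by positivity), ← mul_pow]
  refine pow_le_pow_left₀ (by positivity) ?_ 2
  linarith

/-- The function `∑ᵢ sin²(πxᵢ) / π²` on the torus, comparable to `|x|²`. -/
def torusSq (x : Torus d) : ℝ := ∑ i, circleSq (x i)

theorem isSmooth_circleSq (i : Fin d) : IsSmooth fun x : Torus d => circleSq (x i) := by
  unfold IsSmooth
  simp only [proj, circleSq_coe]
  fun_prop

theorem isSmooth_torusSq : IsSmooth (torusSq : Torus d → ℝ) :=
  TorusContDiff.sum (f := fun i (x : Torus d) => circleSq (x i)) fun i _ => isSmooth_circleSq i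

theorem continuous_torusSq : Continuous (torusSq : Torus d → ℝ) := isSmooth_torusSq.continuous

theorem torusSq_nonneg (x : Torus d) : 0 ≤ torusSq x :=
  Finset.sum_nonneg fun _ _ => circleSq_nonneg _

theorem torusSq_le (x : Torus d) : torusSq x ≤ d * ‖x‖ ^ 2 := by
  calc torusSq x ≤ ∑ _i : Fin d, ‖x‖ ^ 2 := Finset.sum_le_sum fun i _ =>
        (circleSq_le_norm_sq _).trans (pow_le_pow_left₀ (norm_nonneg _) (norm_le_pi_norm x i) 2)
    _ = d * ‖x‖ ^ 2 := by simp

theorem norm_le_sqrt_torusSq (x : Torus d) : ‖x‖ ≤ Real.pi / 2 * √(torusSq x) := by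
  refine (pi_norm_le_iff_of_nonneg (by positivity)).2 fun i => ?_
  have h1 : (2 / Real.pi * ‖x i‖) ^ 2 ≤ torusSq x := (norm_sq_le_circleSq _).trans
    (Finset.single_le_sum (f := fun i => circleSq (x i)) (fun i _ => circleSq_nonneg _)
      (Finset.mem_univ i))
  have h2 := Real.le_sqrt_of_sq_le h1
  calc ‖x i‖ = Real.pi / 2 * (2 / Real.pi * ‖x i‖) := by field_simp
    _ ≤ _ := by gcongr

theorem torusSq_pos {x : Torus d} (hx : x ≠ 0) : 0 < torusSq x := by
  refine (torusSq_nonneg x).lt_of_ne fun h => hx ?_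
  have := norm_le_sqrt_torusSq x
  rw [← h] at this
  simpa using this

theorem torusSq_zero : torusSq (0 : Torus d) = 0 :=
  le_antisymm (by simpa using torusSq_le (0 : Torus d)) (torusSq_nonneg _)

/-! ### Mollifiers -/

/-- A sequence of smooth positive mollifiers on the torus. -/
def mollifier (n : ℕ) (x : Torus d) : ℝ :=
  (∫ y : Torus d, Real.exp (-torusSq y) ^ n)⁻¹ * Real.exp (-torusSq x) ^ n

theorem integral_exp_torusSq_pos (n : ℕ) : 0 < ∫ y : Torus d, Real.exp (-torusSq y) ^ n := by
  have h : Continuous fun y : Torus d => Real.exp (-torusSq y) ^ n := by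
    have := continuous_torusSq (d := d)
    fun_prop
  refine (integral_pos_iff_support_of_nonneg (fun y => by positivity)
    (integrable_of_continuous h)).2 ?_
  have : (Function.support fun y : Torus d => Real.exp (-torusSq y) ^ n) = univ :=
    eq_univ_of_forall fun y => by simp [(Real.exp_pos _).ne']
  rw [this]
  simp

theorem isSmooth_mollifier (n : ℕ) : IsSmooth (mollifier n : Torus d → ℝ) := by
  have h : ContDiff ℝ ∞ fun s : ℝ =>
      (∫ y : Torus d, Real.exp (-torusSq y) ^ n)⁻¹ * Real.exp (-s) ^ n := by fun_prop
  exact TorusContDiff.comp h isSmooth_torusSq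

theorem continuous_mollifier (n : ℕ) : Continuous (mollifier n : Torus d → ℝ) :=
  (isSmooth_mollifier n).continuous

theorem mollifier_nonneg (n : ℕ) (x : Torus d) : 0 ≤ mollifier n x :=
  mul_nonneg (inv_nonneg.2 (integral_exp_torusSq_pos n).le) (by positivity)

theorem integral_mollifier (n : ℕ) : ∫ x : Torus d, mollifier n x = 1 := by
  unfold mollifier
  rw [integral_const_mul]
  exact inv_mul_cancel₀ (integral_exp_torusSq_pos n).ne'

/-- Laplace's principle: `exp (-torusSq)` has its unique maximum at `0`, so its normalized powers
concentrate there. -/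
theorem tendsto_integral_mollifier_mul {h : Torus d → ℝ} (hh : Continuous h) :
    Tendsto (fun n => ∫ x, mollifier n x * h x) atTop (𝓝 (h 0)) := by
  have hc : Continuous fun x : Torus d => Real.exp (-torusSq x) := by
    have := continuous_torusSq (d := d)
    fun_prop
  have key := tendsto_setIntegral_pow_smul_of_unique_maximum_of_isCompact_of_continuousOn
    (μ := (volume : Measure (Torus d))) (x₀ := 0) (g := h) isCompact_univ hc.continuousOn
    (fun y _ hy => by
      simpa [torusSq_zero] using torusSq_pos hy)
    (fun y _ => (Real.exp_pos _).le) (Real.exp_pos _) (by simp) hh.continuousOn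
  simp only [Measure.restrict_univ, smul_eq_mul] at key
  refine key.congr fun n => ?_
  simp only [mollifier, mul_assoc, integral_const_mul]

/-! ### Translations in `L¹` -/

section Translation

variable {E : Type*} [NormedAddCommGroup E]

theorem integrable_comp_sub_prod [NormedSpace ℝ E] {f : Torus d → ℝ} {k : Torus d → E}
    (hf : Integrable f) (hk : Integrable k) :
    Integrable (fun p : Torus d × Torus d => f p.2 • k (p.1 - p.2)) (volume.prod volume) := by
  have h : Integrable (fun p : Torus d × Torus d => f p.2 • k p.1) (volume.prod volume) :=
    (hf.smul_prod hk).swap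
  exact ((measurePreserving_sub_prod (volume : Measure (Torus d)) volume).integrable_comp
    h.aestronglyMeasurable).2 h

/-- The `L¹` modulus of continuity of `f`. -/
def transMod (f : Torus d → E) (z : Torus d) : ℝ := ∫ y, ‖f (y + z) - f y‖

theorem transMod_nonneg (f : Torus d → E) (z : Torus d) : 0 ≤ transMod f z :=
  integral_nonneg fun _ => norm_nonneg _

theorem transMod_zero (f : Torus d → E) : transMod f 0 = 0 := by simp [transMod]

/-- Replacing `f` by a continuous `φ` with `‖f - φ‖₁ ≤ ε/3` changes the modulus by at most `2ε/3`,
uniformly in the shift, and for continuous `φ` dominated convergence applies. -/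
theorem continuous_transMod [NormedSpace ℝ E] {f : Torus d → E} (hf : Integrable f) : Continuous (transMod f) := by
  refine continuous_of_uniform_approx_of_continuous fun u hu => ?_
  obtain ⟨ε, hε, hu⟩ := Metric.mem_uniformity_dist.1 hu
  obtain ⟨φ, -, hφ, hφc, hφi⟩ := hf.exists_hasCompactSupport_integral_sub_le (ε := ε / 3)
    (by positivity)
  refine ⟨transMod φ, ?_, fun z => hu ?_⟩
  · obtain ⟨B, hB⟩ := isCompact_univ.exists_bound_of_continuousOn hφc.continuousOn
    refine continuous_of_dominated (F := fun z y => ‖φ (y + z) - φ y‖) (bound := fun _ => B + B)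
      (fun z => ?_) (fun z => ?_) (integrable_const _) ?_
    · have : Continuous fun y => ‖φ (y + z) - φ y‖ := by fun_prop
      exact this.aestronglyMeasurable
    · refine Eventually.of_forall fun y => ?_
      rw [norm_norm]
      exact (norm_sub_le _ _).trans (add_le_add (hB _ (mem_univ _)) (hB _ (mem_univ _)))
    · refine Eventually.of_forall fun y => ?_
      fun_prop
  · have hfz := hf.comp_add_right z
    have hφz := hφi.comp_add_right z
    have h1 : Integrable fun y => ‖f y - φ y‖ := (hf.sub hφi).norm
    have h2 : Integrable fun y => ‖f (y + z) - f y‖ := (hfz.sub hf).norm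
    have h3 : Integrable fun y => ‖φ (y + z) - φ y‖ := (hφz.sub hφi).norm
    have h4 : Integrable fun y => ‖f (y + z) - φ (y + z)‖ := (hfz.sub hφz).norm
    rw [Real.dist_eq]
    unfold transMod
    rw [← integral_sub h2 h3]
    calc _ ≤ ∫ y, (‖f (y + z) - φ (y + z)‖ + ‖f y - φ y‖) := by
          refine (norm_integral_le_integral_norm _).trans (integral_mono
            (h2.sub h3).norm (h4.add h1) fun y => ?_)
          refine (abs_norm_sub_norm_le _ _).trans ?_
          rw [show f (y + z) - f y - (φ (y + z) - φ y) =
            (f (y + z) - φ (y + z)) - (f y - φ y) by abel]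
          exact norm_sub_le _ _
      _ = (∫ y, ‖f y - φ y‖) + ∫ y, ‖f y - φ y‖ := by
          rw [integral_add h4 h1,
            integral_add_right_eq_self (fun y => ‖f y - φ y‖)]
      _ < ε := by linarith

theorem integral_norm_comp_sub (f : Torus d → E) (x x' : Torus d) :
    ∫ y, ‖f (x - y) - f (x' - y)‖ = transMod f (x - x') := by
  unfold transMod
  rw [← integral_sub_left_eq_self (fun y => ‖f (y + (x - x')) - f y‖) volume x']
  congr 1; ext y; congr 3; abel

end Translation

theorem conv_eq (f φ : Torus d → ℝ) (x : Torus d) : conv f φ x = ∫ z, φ z * f (x - z) := by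
  unfold conv
  rw [← integral_sub_left_eq_self (fun y => f y * φ (x - y)) volume x]
  congr 1; ext y; rw [sub_sub_cancel, mul_comm]

/-- Minkowski's inequality: the difference is an average, with weight `φ`, of `f (x - z) - f x`. The
mass of `φ` is not normalized because the estimate is also applied to `peakPart`, whose mass is only
known to lie between two positive constants. -/
theorem integral_abs_conv_sub_le {f φ : Torus d → ℝ} (hf : Integrable f) (hφ : Integrable φ)
    (hφ0 : ∀ x, 0 ≤ φ x) :
    ∫ x, |conv f φ x - (∫ z, φ z) * f x| ≤ ∫ z, φ z * transMod f (-z) := by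
  have h1 : Integrable (fun p : Torus d × Torus d => φ p.2 * f (p.1 - p.2)) (volume.prod volume) :=
    integrable_comp_sub_prod hφ hf
  have h2 : Integrable (fun p : Torus d × Torus d => φ p.2 * f p.1)
      (volume.prod volume) := by
    simpa [mul_comm] using hf.mul_prod hφ
  have h3 : Integrable (fun p : Torus d × Torus d => |φ p.2 * f (p.1 - p.2) - φ p.2 * f p.1|)
      (volume.prod volume) :=
    (h1.sub h2).abs
  have h4 : ∀ᵐ x : Torus d, |conv f φ x - (∫ z, φ z) * f x| ≤
      ∫ z, |φ z * f (x - z) - φ z * f x| := by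
    filter_upwards [h1.prod_right_ae, h2.prod_right_ae] with x hx1 hx2
    rw [conv_eq, ← integral_mul_const, ← integral_sub hx1 hx2]
    exact abs_integral_le_integral_abs
  calc _ ≤ ∫ x, ∫ z, |φ z * f (x - z) - φ z * f x| := by
        refine integral_mono_ae ?_ h3.integral_prod_left h4
        have h5 := (h1.sub h2).integral_prod_left
        refine h5.abs.congr ?_
        filter_upwards [h1.prod_right_ae, h2.prod_right_ae] with x hx1 hx2
        rw [conv_eq, ← integral_mul_const, ← integral_sub hx1 hx2]
        rfl
    _ = ∫ z, ∫ x, |φ z * f (x - z) - φ z * f x| :=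
        integral_integral_swap (f := fun x z => |φ z * f (x - z) - φ z * f x|) h3
    _ = _ := by
        congr 1; ext z
        simp_rw [← mul_sub, abs_mul, abs_of_nonneg (hφ0 z), integral_const_mul]
        simp [transMod, sub_eq_add_neg]

theorem tendsto_integral_abs_conv_mollifier_sub {f : Torus d → ℝ} (hf : Integrable f) :
    Tendsto (fun n => ∫ x, |conv f (mollifier n) x - f x|) atTop (𝓝 0) := by
  have h := tendsto_integral_mollifier_mul ((continuous_transMod hf).comp continuous_neg)
  simp only [Function.comp, neg_zero, transMod_zero] at h
  refine squeeze_zero (fun n => integral_nonneg fun _ => abs_nonneg _) (fun n => ?_) h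
  simpa [integral_mollifier] using integral_abs_conv_sub_le hf
    (integrable_of_continuous (continuous_mollifier n)) (mollifier_nonneg n)

theorem Integrable.conv_mollifier {f : Torus d → ℝ} (hf : Integrable f) (n : ℕ) :
    Continuous (conv f (mollifier n)) := (isSmooth_conv hf (isSmooth_mollifier n)).continuous

theorem exists_seq_tendsto_conv_mollifier {f : Torus d → ℝ} (hf : Integrable f) :
    ∃ ns : ℕ → ℕ, StrictMono ns ∧
      ∀ᵐ x, Tendsto (fun i => conv f (mollifier (ns i)) x) atTop (𝓝 (f x)) := by
  have h1 := tendstoInMeasure_of_tendsto_eLpNorm (μ := (volume : Measure (Torus d))) (p := 1)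
    (f := fun n => conv f (mollifier n)) (g := f) (l := atTop) one_ne_zero
    (fun n => (Integrable.conv_mollifier hf n).aestronglyMeasurable) hf.aestronglyMeasurable ?_
  · exact h1.exists_seq_tendsto_ae
  · have h2 := (ENNReal.tendsto_ofReal (tendsto_integral_abs_conv_mollifier_sub hf))
    rw [ENNReal.ofReal_zero] at h2
    refine h2.congr fun n => ?_
    rw [eLpNorm_one_eq_lintegral_enorm]
    have h3 : Integrable fun x => |conv f (mollifier n) x - f x| :=
      ((integrable_of_continuous (Integrable.conv_mollifier hf n)).sub hf).abs
    rw [ofReal_integral_eq_lintegral_ofReal h3 (Eventually.of_forall fun _ => abs_nonneg _)]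
    simp [← ofReal_norm, Real.norm_eq_abs]

/-- An integrable function all of whose mollifications are bounded by `B` is bounded by `B`. -/
theorem ae_abs_le_of_conv_mollifier_le {f : Torus d → ℝ} (hf : Integrable f) {B : ℝ}
    (h : ∀ n x, |conv f (mollifier n) x| ≤ B) : ∀ᵐ x, |f x| ≤ B := by
  obtain ⟨ns, -, hns⟩ := exists_seq_tendsto_conv_mollifier hf
  filter_upwards [hns] with x hx
  exact le_of_tendsto hx.abs (Eventually.of_forall fun n => h _ _)

/-! ### The Green kernel -/

theorem IsSmooth.laplacian {φ : Torus d → ℝ} (h : IsSmooth φ) : IsSmooth (laplacian φ) :=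
  TorusContDiff.sum
    (f := fun i => CoulombMobility.partialDeriv i (CoulombMobility.partialDeriv i φ)) fun i _ => (h.partialDeriv i).partialDeriv i

theorem partialDeriv_comp_sub_left' {φ : Torus d → ℝ} (h : IsSmooth φ) (a : Torus d) (i : Fin d) :
    partialDeriv i (fun x => φ (a - x)) = fun x => -partialDeriv i φ (a - x) :=
  funext fun x => partialDeriv_comp_sub_left h.contDiffOne a i x

theorem partialDeriv_neg {φ : Torus d → ℝ} (i : Fin d) (x : Torus d) :
    partialDeriv i (fun x => -φ x) x = -partialDeriv i φ x := by
  simpa using partialDeriv_const_mul (ψ := φ) (-1) i x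

theorem laplacian_comp_sub_left {φ : Torus d → ℝ} (h : IsSmooth φ) (a x : Torus d) :
    laplacian (fun x => φ (a - x)) x = laplacian φ (a - x) := by
  unfold laplacian
  refine Finset.sum_congr rfl fun i _ => ?_
  rw [partialDeriv_comp_sub_left' h, partialDeriv_neg,
    partialDeriv_comp_sub_left (h.partialDeriv i).contDiffOne, neg_neg]

theorem partialDeriv_sum {ι : Type*} {s : Finset ι} {f : ι → Torus d → ℝ}
    (h : ∀ j ∈ s, TorusContDiff 1 (f j)) (i : Fin d) (x : Torus d) :
    partialDeriv i (fun x => ∑ j ∈ s, f j x) x = ∑ j ∈ s, partialDeriv i (f j) x :=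
  (HasDerivAt.fun_sum fun j hj => (h j hj).hasDerivAt_zero i x).deriv

theorem laplacian_partialDeriv {φ : Torus d → ℝ} (h : IsSmooth φ) (i : Fin d) (x : Torus d) :
    laplacian (partialDeriv i φ) x = partialDeriv i (laplacian φ) x := by
  have h2 : ∀ {ψ : Torus d → ℝ}, IsSmooth ψ → TorusContDiff 2 ψ := fun hψ =>
    hψ.torusContDiff (n := 2)
  unfold laplacian
  rw [partialDeriv_sum fun j _ => ((h.partialDeriv j).partialDeriv j).contDiffOne]
  refine Finset.sum_congr rfl fun j _ => ?_
  rw [show partialDeriv j (partialDeriv i φ) = partialDeriv i (partialDeriv j φ) from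
    funext fun x => partialDeriv_comm (h2 h) j i x, partialDeriv_comm (h2 (h.partialDeriv j))]

theorem HasWeakGradient.integrable_apply {f : Torus d → ℝ} {F : Torus d → Vec d}
    (h : HasWeakGradient f F) (i : Fin d) : Integrable fun x => F x i :=
  (coord i).integrable_comp h.integrable_grad

theorem HasWeakGradient.integral_apply_eq_zero {f : Torus d → ℝ} {F : Torus d → Vec d}
    (h : HasWeakGradient f F) (i : Fin d) : ∫ x, F x i = 0 := by
  have := h.integral_eq (fun _ => 1) (torusContDiff_const 1) i
  simpa [partialDeriv] using this

namespace IsGreenKernel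

variable {g : Torus d → ℝ} {K : Torus d → Vec d}

/-- The equation of the kernel, tested with `y ↦ φ (x - y)`. -/
theorem conv_laplacian (h : IsGreenKernel g K) {φ : Torus d → ℝ} (hφ : IsSmooth φ) (x : Torus d) :
    conv g (laplacian φ) x = (∫ y, φ y) - φ x := by
  have h1 := h.equation (fun y => φ (x - y)) (TorusContDiff.comp_sub_left hφ x)
  simp_rw [laplacian_comp_sub_left hφ, sub_zero] at h1
  rw [integral_sub_left_eq_self φ volume x] at h1
  unfold conv
  linarith

/-- The preceding formula is applied to `∂ᵢφ`, which has mean zero, and one derivative is moved onto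
`g`. The result is a representation of `∂ᵢφ` by the integrable kernel `Kᵢ`; it yields both the
uniqueness of `K` and its weak-type bound. -/
theorem partialDeriv_eq (h : IsGreenKernel g K) {φ : Torus d → ℝ} (hφ : IsSmooth φ) (i : Fin d)
    (x : Torus d) : partialDeriv i φ x = -conv (fun y => K y i) (laplacian φ) x := by
  have h1 := h.conv_laplacian (hφ.partialDeriv i) x
  rw [integral_partialDeriv hφ.contDiffOne] at h1
  have h2 := h.gradient.integral_eq (fun y => laplacian φ (x - y))
    (TorusContDiff.comp_sub_left hφ.laplacian x) i
  simp_rw [partialDeriv_comp_sub_left hφ.laplacian.contDiffOne, mul_neg, integral_neg,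
    ← laplacian_partialDeriv hφ] at h2
  unfold conv at h1 ⊢
  linarith

/-- Both kernels represent the derivatives of smooth functions, so convolution with `k = Kᵢ - K'ᵢ`
annihilates Laplacians. For smooth `φ` the function `(∫ φ) - φ` is the Laplacian of `g ∗ φ`, and `k`
has mean zero; hence `k ∗ φ = 0` for all smooth `φ`. This is what makes the constants below depend
on the dimension only. -/
theorem ae_eq (h : IsGreenKernel g K) {g' : Torus d → ℝ} {K' : Torus d → Vec d}
    (h' : IsGreenKernel g' K') : K =ᵐ[volume] K' := by
  have key : ∀ i, ∀ᵐ x, K x i = K' x i := by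
    intro i
    have hi := h.gradient.integrable_apply i
    have hi' := h'.gradient.integrable_apply i
    have hc : ∀ {φ : Torus d → ℝ}, Continuous φ → ∀ x, conv (fun y => K y i - K' y i) φ x =
        conv (fun y => K y i) φ x - conv (fun y => K' y i) φ x := by
      intro φ hφ x
      unfold conv
      rw [← integral_sub (Integrable.mul_comp_sub hi hφ x) (Integrable.mul_comp_sub hi' hφ x)]
      simp_rw [sub_mul]
    have h0 : ∀ φ : Torus d → ℝ, IsSmooth φ → ∀ x, conv (fun y => K y i - K' y i) φ x = 0 := by
      intro φ hφ x
      have hs : IsSmooth (conv g φ) := isSmooth_conv h.gradient.integrable_fun hφ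
      have hl : laplacian (conv g φ) = fun x => (∫ y, φ y) - φ x := by
        ext x
        have hp : ∀ i, partialDeriv i (conv g φ) = conv g (partialDeriv i φ) := fun i =>
          funext fun x => partialDeriv_conv h.gradient.integrable_fun hφ i x
        rw [← h.conv_laplacian hφ]
        unfold laplacian
        simp_rw [hp, fun i => partialDeriv_conv h.gradient.integrable_fun (hφ.partialDeriv i) i x]
        unfold conv
        rw [← integral_finsetSum _ fun i _ => Integrable.mul_comp_sub h.gradient.integrable_fun
          ((hφ.partialDeriv i).partialDeriv i).continuous x]
        simp_rw [Finset.mul_sum]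
      have h1 : conv (fun y => K y i - K' y i) (laplacian (conv g φ)) x = 0 := by
        rw [hc hs.laplacian.continuous]
        linarith [h.partialDeriv_eq hs i x, h'.partialDeriv_eq hs i x]
      rw [hl] at h1
      unfold conv at h1 ⊢
      have hd : Integrable fun y => K y i - K' y i := hi.sub hi'
      simp_rw [mul_sub] at h1
      rw [integral_sub (hd.mul_const _) (Integrable.mul_comp_sub hd hφ.continuous x),
        integral_mul_const, integral_sub hi hi', h.gradient.integral_apply_eq_zero,
        h'.gradient.integral_apply_eq_zero] at h1
      linarith
    have h1 := ae_abs_le_of_conv_mollifier_le (hi.sub hi') (B := 0) fun n x => by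
      have := h0 _ (isSmooth_mollifier n) x
      exact (abs_eq_zero.2 this).le
    filter_upwards [h1] with x hx
    exact sub_eq_zero.1 (abs_nonpos_iff.1 hx)
  filter_upwards [ae_all_iff.2 key] with x hx
  ext i; exact hx i

end IsGreenKernel

/-! ### The Riesz kernel `|x|^(1-d)` on the torus -/

theorem volume_closedBall_zero (r : ℝ) (hr : 0 ≤ r) :
    volume (Metric.closedBall (0 : Torus d) r) = ENNReal.ofReal (min 1 (2 * r)) ^ d := by
  rw [closedBall_pi _ hr, volume_pi_pi]
  simp [AddCircle.volume_closedBall]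

/-- A regularization of `|x|^(1-d)`. -/
def rieszKernel (e : ℝ) (x : Torus d) : ℝ := (torusSq x + e) ^ ((1 - d : ℝ) / 2)

theorem continuous_rieszKernel {e : ℝ} (he : 0 < e) :
    Continuous (rieszKernel e : Torus d → ℝ) := by
  unfold rieszKernel
  refine (continuous_torusSq.add continuous_const).rpow_const fun x => Or.inl ?_
  exact (add_pos_of_nonneg_of_pos (torusSq_nonneg x) he).ne'

theorem rieszKernel_nonneg {e : ℝ} (he : 0 < e) (x : Torus d) : 0 ≤ rieszKernel e x :=
  Real.rpow_nonneg (add_nonneg (torusSq_nonneg x) he.le) _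

/-- Since `‖x‖ ≤ (π/2) √(torusSq x)`, the superlevel set lies in a ball of radius `(π/2)
t^(-1/(d-1))`. The norm is the maximum norm, so a ball of radius `r` is a cube of volume at most
`(2r)^d`. The bound is uniform in `e`. -/
theorem volume_lt_rieszKernel_le {e : ℝ} (he : 0 < e) (hd : 2 ≤ d) {t : ℝ} (ht : 0 < t) :
    volume {x : Torus d | t < rieszKernel e x} ≤
      ENNReal.ofReal (Real.pi ^ d * t ^ (-(d : ℝ) / (d - 1))) := by
  have hd' : (2 : ℝ) ≤ d := by exact_mod_cast hd
  set r : ℝ := t ^ (-1 / ((d : ℝ) - 1)) with hr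
  have hr0 : 0 < r := Real.rpow_pos_of_pos ht _
  have hsub : {x : Torus d | t < rieszKernel e x} ⊆ Metric.closedBall 0 (Real.pi / 2 * r) := by
    intro x hx
    rw [mem_closedBall_zero_iff]
    refine (norm_le_sqrt_torusSq x).trans ?_
    have hx' : t < (torusSq x + e) ^ ((1 - d : ℝ) / 2) := hx
    have hp : 0 < torusSq x + e := by have := torusSq_nonneg x; positivity
    have h1 : torusSq x + e ≤ r ^ 2 := by
      by_contra hlt
      push Not at hlt
      have h2 : (torusSq x + e) ^ ((1 - d : ℝ) / 2) ≤ (r ^ 2) ^ ((1 - d : ℝ) / 2) :=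
        Real.rpow_le_rpow_of_nonpos (by positivity) hlt.le (by linarith)
      have h3 : (r ^ 2) ^ ((1 - d : ℝ) / 2) = t := by
        rw [← Real.rpow_natCast r 2, ← Real.rpow_mul hr0.le, hr, ← Real.rpow_mul ht.le]
        have : (d : ℝ) - 1 ≠ 0 := by linarith
        rw [show -1 / ((d : ℝ) - 1) * (((2 : ℕ) : ℝ) * ((1 - d) / 2)) = 1 by
          push_cast; field_simp; ring]
        exact Real.rpow_one t
      linarith
    gcongr
    exact Real.sqrt_le_iff.2 ⟨hr0.le, by linarith⟩
  refine (measure_mono hsub).trans ?_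
  rw [volume_closedBall_zero _ (by positivity), ← ENNReal.ofReal_pow (by positivity)]
  refine ENNReal.ofReal_le_ofReal ?_
  have h4 : t ^ (-(d : ℝ) / (d - 1)) = r ^ d := by
    rw [hr, ← Real.rpow_natCast, ← Real.rpow_mul ht.le]
    congr 1; ring
  rw [h4, ← mul_pow]
  refine pow_le_pow_left₀ (by positivity) ?_ d
  refine (min_le_right _ _).trans (by linarith)

/-- Layer-cake formula, split at the height `T = |E|^((1-d)/d)`: below `T` the measure of a
superlevel set in `E` is at most `|E|`, above `T` the weak-type bound is integrated, and both parts
are multiples of `|E|^(1/d)`. -/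
theorem lintegral_rieszKernel_le {e : ℝ} (he : 0 < e) (hd : 1 ≤ d) {E : Set (Torus d)}
    (hE : MeasurableSet E) :
    ∫⁻ x in E, ENNReal.ofReal (rieszKernel e x) ≤
      ENNReal.ofReal ((1 + Real.pi ^ d * (d - 1)) * (volume.real E) ^ (1 / (d : ℝ))) := by
  rcases eq_or_ne (volume.real E) 0 with h0 | h0
  · have : volume E = 0 := by simpa [Measure.real, ENNReal.toReal_eq_zero_iff] using h0
    rw [setLIntegral_measure_zero _ _ this]
    exact zero_le
  have hV : 0 < volume.real E := lt_of_le_of_ne measureReal_nonneg h0.symm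
  rcases hd.eq_or_lt with rfl | hd
  -- For `d = 1` the exponent vanishes and the kernel is the constant `1`.
  · simp [rieszKernel, ofReal_measureReal]
  have hd' : (2 : ℝ) ≤ d := by exact_mod_cast hd
  set R : ℝ := (volume.real E) ^ (1 / (d : ℝ)) with hR
  have hR0 : 0 < R := Real.rpow_pos_of_pos hV _
  set T : ℝ := R ^ (1 - d : ℝ) with hT
  have hT0 : 0 < T := Real.rpow_pos_of_pos hR0 _
  have ha : -(d : ℝ) / (d - 1) < -1 := by
    rw [div_lt_iff₀ (by linarith)]; linarith
  rw [lintegral_eq_lintegral_meas_lt _ (Eventually.of_forall fun x => rieszKernel_nonneg he x)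
    (continuous_rieszKernel he).measurable.aemeasurable]
  rw [← Ioc_union_Ioi_eq_Ioi hT0.le, lintegral_union measurableSet_Ioi (by
    rw [Set.disjoint_left]; intro x hx hx'; exact absurd hx.2 (not_le.2 hx'))]
  have h1 : ∫⁻ t in Ioc 0 T, (volume.restrict E) {x | t < rieszKernel e x} ≤ ENNReal.ofReal R := by
    calc _ ≤ ∫⁻ _ in Ioc 0 T, ENNReal.ofReal (volume.real E) := by
          refine lintegral_mono fun t => ?_
          rw [ofReal_measureReal]
          exact (measure_mono (subset_univ _)).trans (by simp)
      _ = ENNReal.ofReal R := by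
          rw [lintegral_const, Measure.restrict_apply_univ, Real.volume_Ioc, sub_zero,
            ← ENNReal.ofReal_mul hV.le]
          congr 1
          have : volume.real E = R ^ (d : ℝ) := by
            rw [hR, ← Real.rpow_mul hV.le, one_div_mul_cancel (by linarith), Real.rpow_one]
          rw [this, hT, ← Real.rpow_add hR0]
          simp
  have h2 : ∫⁻ t in Ioi T, (volume.restrict E) {x | t < rieszKernel e x} ≤
      ENNReal.ofReal (Real.pi ^ d * (d - 1) * R) := by
    calc _ ≤ ∫⁻ t in Ioi T, ENNReal.ofReal (Real.pi ^ d * t ^ (-(d : ℝ) / (d - 1))) := by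
          refine setLIntegral_mono' measurableSet_Ioi fun t ht => ?_
          exact (Measure.restrict_apply_le _ _).trans
            (volume_lt_rieszKernel_le he hd (hT0.trans ht))
      _ = ENNReal.ofReal (∫ t in Ioi T, Real.pi ^ d * t ^ (-(d : ℝ) / (d - 1))) := by
          rw [ofReal_integral_eq_lintegral_ofReal
            ((integrableOn_Ioi_rpow_of_lt ha hT0).const_mul _)]
          refine (ae_restrict_mem measurableSet_Ioi).mono fun t ht => ?_
          have : 0 < t := hT0.trans ht
          positivity
      _ = _ := by
          rw [integral_const_mul, integral_Ioi_rpow_of_lt ha hT0]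
          have hne : (d : ℝ) - 1 ≠ 0 := by linarith
          have e1 : -(d : ℝ) / (d - 1) + 1 = -1 / (d - 1) := by field_simp; ring
          have e2 : T ^ (-1 / ((d : ℝ) - 1)) = R := by
            rw [hT, ← Real.rpow_mul hR0.le]
            rw [show (1 - (d : ℝ)) * (-1 / (d - 1)) = 1 by field_simp; ring, Real.rpow_one]
          rw [e1, e2]
          congr 1
          field_simp
  refine (add_le_add h1 h2).trans ?_
  rw [← ENNReal.ofReal_add hR0.le (mul_nonneg (mul_nonneg (by positivity) (by linarith)) hR0.le)]
  exact ENNReal.ofReal_le_ofReal (by linarith)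

theorem setIntegral_rieszKernel_le {e : ℝ} (he : 0 < e) (hd : 1 ≤ d) {E : Set (Torus d)}
    (hE : MeasurableSet E) :
    ∫ x in E, rieszKernel e x ≤
      (1 + Real.pi ^ d * (d - 1)) * (volume.real E) ^ (1 / (d : ℝ)) := by
  have hd' : (1 : ℝ) ≤ d := by exact_mod_cast hd
  rw [integral_eq_lintegral_of_nonneg_ae (Eventually.of_forall fun x => rieszKernel_nonneg he x)
    (continuous_rieszKernel he).aestronglyMeasurable]
  refine ENNReal.toReal_le_of_le_ofReal ?_ (lintegral_rieszKernel_le he hd hE)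
  have := sub_nonneg.2 hd'
  positivity

/-! ### A parametrix for the Laplacian -/

theorem periodic_sin_two : Function.Periodic
    (fun x : ℝ => Real.sin (2 * Real.pi * x) / Real.pi) 1 := by
  intro x
  simp [mul_add, Real.sin_add_two_pi]

/-- The function `sin(2πx) / π` on the circle, the derivative of `circleSq`. -/
def circleSin : UnitAddCircle → ℝ := periodic_sin_two.lift

theorem circleSin_coe (x : ℝ) : circleSin (x : UnitAddCircle) =
    Real.sin (2 * Real.pi * x) / Real.pi := periodic_sin_two.lift_coe x

theorem partialDeriv_apply_self {F : UnitAddCircle → ℝ} {a : ℝ} {x : Vec d} {i : Fin d}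
    (h : HasDerivAt (fun t : ℝ => F t) a (x i)) :
    partialDeriv i (fun y : Torus d => F (y i)) (proj x) = a := by
  have h1 : HasDerivAt (fun s : ℝ => F ((x i + s : ℝ) : UnitAddCircle)) a 0 := by
    have h2 : HasDerivAt (fun t : ℝ => F t) a (x i + 0) := by simpa using h
    exact h2.comp_const_add (x i) 0
  rw [← h1.deriv]
  unfold partialDeriv
  simp [proj]

theorem partialDeriv_apply_of_ne (F : UnitAddCircle → ℝ) {i j : Fin d} (h : j ≠ i) (x : Torus d) :
    partialDeriv i (fun y : Torus d => F (y j)) x = 0 := by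
  simp [partialDeriv, h]

theorem partialDeriv_torusSq (i : Fin d) :
    partialDeriv i (torusSq : Torus d → ℝ) = fun x => circleSin (x i) := by
  ext x
  obtain ⟨x, rfl⟩ := proj_surjective x
  have h1 := partialDeriv_sum (s := Finset.univ) (f := fun j (x : Torus d) => circleSq (x j))
    (fun j _ => (isSmooth_circleSq j).contDiffOne) i (proj x)
  have h2 : partialDeriv i (torusSq : Torus d → ℝ) (proj x) =
      partialDeriv i (fun y : Torus d => circleSq (y i)) (proj x) := by
    refine h1.trans (Finset.sum_eq_single i (fun j _ hj => partialDeriv_apply_of_ne _ hj _) ?_)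
    simp
  rw [h2]
  refine partialDeriv_apply_self ?_
  simp only [circleSq_coe, proj, circleSin_coe]
  have h3 : HasDerivAt (fun t : ℝ => Real.sin (Real.pi * t) ^ 2 / Real.pi ^ 2)
      (2 * Real.sin (Real.pi * x i) ^ (2 - 1) * (Real.cos (Real.pi * x i) * (Real.pi * 1))
        / Real.pi ^ 2) (x i) :=
    ((((hasDerivAt_id (x i)).const_mul Real.pi).sin).pow 2).div_const _
  convert h3 using 1
  rw [mul_assoc, Real.sin_two_mul, show (2 - 1 : ℕ) = 1 from rfl, pow_one]
  field_simp

theorem partialDeriv_circleSin (i : Fin d) (x : Torus d) :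
    partialDeriv i (fun x : Torus d => circleSin (x i)) x =
      2 - 4 * Real.pi ^ 2 * circleSq (x i) := by
  obtain ⟨x, rfl⟩ := proj_surjective x
  refine partialDeriv_apply_self ?_
  simp only [circleSq_coe, proj, circleSin_coe]
  have h3 : HasDerivAt (fun t : ℝ => Real.sin (2 * Real.pi * t) / Real.pi)
      (Real.cos (2 * Real.pi * x i) * (2 * Real.pi * 1) / Real.pi) (x i) :=
    (((hasDerivAt_id (x i)).const_mul (2 * Real.pi)).sin).div_const _
  convert h3 using 1
  rw [mul_assoc 2 Real.pi (x i), Real.cos_two_mul']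
  have := Real.sin_sq_add_cos_sq (Real.pi * x i)
  field_simp
  linarith

theorem circleSin_sq (x : UnitAddCircle) :
    circleSin x ^ 2 = 4 * circleSq x - 4 * Real.pi ^ 2 * circleSq x ^ 2 := by
  induction x using QuotientAddGroup.induction_on with | H x =>
  rw [circleSin_coe, circleSq_coe, mul_assoc 2 Real.pi x, Real.sin_two_mul]
  have := Real.sin_sq_add_cos_sq (Real.pi * x)
  have h : Real.cos (Real.pi * x) ^ 2 = 1 - Real.sin (Real.pi * x) ^ 2 := by linarith
  field_simp
  ring_nf
  rw [h]
  ring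

theorem isSmooth_circleSin (i : Fin d) : IsSmooth fun x : Torus d => circleSin (x i) := by
  rw [← partialDeriv_torusSq]
  exact isSmooth_torusSq.partialDeriv i

/-- The radial profile of the fundamental solution, as a function of `|x|²`. -/
def greenProfile (d : ℕ) (r : ℝ) : ℝ :=
  if d = 2 then -(Real.log r / 2) else r ^ (1 - (d : ℝ) / 2) / (d - 2)

/-- The logarithm and the power have the same derivative, so from here on `d = 2` is not a special
case. -/
theorem hasDerivAt_greenProfile {r : ℝ} (hr : 0 < r) :
    HasDerivAt (greenProfile d) (-(1 / 2 * r ^ (-(d : ℝ) / 2))) r := by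
  unfold greenProfile
  split_ifs with h
  · subst h
    refine ((Real.hasDerivAt_log hr.ne').div_const 2).neg.congr_deriv ?_
    rw [show -((2 : ℕ) : ℝ) / 2 = -1 by norm_num, Real.rpow_neg_one]
    ring
  · have hne : (d : ℝ) - 2 ≠ 0 := sub_ne_zero.2 (by exact_mod_cast h)
    refine ((Real.hasDerivAt_rpow_const (p := 1 - (d : ℝ) / 2) (Or.inl hr.ne')).div_const
      ((d : ℝ) - 2)).congr_deriv ?_
    rw [show 1 - (d : ℝ) / 2 - 1 = -(d : ℝ) / 2 by ring]
    field_simp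
    ring

theorem contDiffAt_greenProfile {r : ℝ} (hr : 0 < r) : ContDiffAt ℝ ∞ (greenProfile d) r := by
  unfold greenProfile
  split_ifs with h
  · exact ((Real.contDiffAt_log.2 hr.ne').div_const 2).neg
  · exact (Real.contDiffAt_rpow_const_of_ne hr.ne').div_const _

theorem torusSq_add_pos {e : ℝ} (he : 0 < e) (x : Torus d) : 0 < torusSq x + e :=
  add_pos_of_nonneg_of_pos (torusSq_nonneg x) he

theorem isSmooth_comp_torusSq_add {H : ℝ → ℝ} {e : ℝ} (he : 0 < e)
    (h : ∀ r, 0 < r → ContDiffAt ℝ ∞ H r) : IsSmooth fun x : Torus d => H (torusSq x + e) := by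
  refine contDiff_iff_contDiffAt.2 fun x => ?_
  exact (h _ (torusSq_add_pos he (proj x))).comp x
    ((ContDiff.contDiffAt isSmooth_torusSq).add contDiffAt_const)

/-- The regularized fundamental solution of the Laplacian near `0`. -/
def parametrix (e : ℝ) (x : Torus d) : ℝ := greenProfile d (torusSq x + e)

theorem isSmooth_parametrix {e : ℝ} (he : 0 < e) : IsSmooth (parametrix e : Torus d → ℝ) :=
  isSmooth_comp_torusSq_add he fun _ hr => contDiffAt_greenProfile hr

theorem partialDeriv_comp_torusSq_add {H : ℝ → ℝ} {a e : ℝ} {x : Torus d}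
    (h : HasDerivAt H a (torusSq x + e)) (i : Fin d) :
    partialDeriv i (fun x : Torus d => H (torusSq x + e)) x = a * circleSin (x i) := by
  have h1 : HasDerivAt (fun s => H (s + e)) a (torusSq x) := h.comp_add_const (torusSq x) e
  rw [partialDeriv_comp (η := fun s => H (s + e)) h1.differentiableAt
    isSmooth_torusSq.contDiffOne, h1.deriv, partialDeriv_torusSq]

theorem partialDeriv_parametrix {e : ℝ} (he : 0 < e) (i : Fin d) :
    partialDeriv i (parametrix e : Torus d → ℝ) =
      fun x => -(1 / 2 * (torusSq x + e) ^ (-(d : ℝ) / 2)) * circleSin (x i) := by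
  ext x
  exact partialDeriv_comp_torusSq_add (hasDerivAt_greenProfile (torusSq_add_pos he x)) i

/-- The concentrating part of minus the Laplacian of the parametrix. -/
def peakPart (e : ℝ) (x : Torus d) : ℝ := d * e * (torusSq x + e) ^ (-(d : ℝ) / 2 - 1)

/-- The remainder of minus the Laplacian of the parametrix. -/
def restPart (e : ℝ) (x : Torus d) : ℝ :=
  (torusSq x + e) ^ (-(d : ℝ) / 2 - 1) *
    (d * Real.pi ^ 2 * ∑ i, circleSq (x i) ^ 2 - 2 * Real.pi ^ 2 * torusSq x * (torusSq x + e))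

/-- With `s = circleSq (x i)`, the squared `i`-th derivative of `torusSq` is `4s - 4π²s²` and its
second derivative is `2 - 4π²s`. The leading terms `4s` and `2` are those of `|x|²`, for which the
computation leaves only the regularization term `peakPart`; the corrections, one order smaller, are
collected in `restPart`. -/
theorem laplacian_parametrix {e : ℝ} (he : 0 < e) (x : Torus d) :
    laplacian (parametrix e) x = -(peakPart e x + restPart e x) := by
  have hs : IsSmooth fun x : Torus d => -(1 / 2 * (torusSq x + e) ^ (-(d : ℝ) / 2)) :=
    isSmooth_comp_torusSq_add (H := fun r => -(1 / 2 * r ^ (-(d : ℝ) / 2))) he fun r hr =>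
      (contDiffAt_const.mul (Real.contDiffAt_rpow_const_of_ne hr.ne')).neg
  have hp := torusSq_add_pos he x
  have hd : ∀ i, partialDeriv i
      (fun x : Torus d => -(1 / 2 * (torusSq x + e) ^ (-(d : ℝ) / 2))) x =
      (d / 4 * (torusSq x + e) ^ (-(d : ℝ) / 2 - 1)) * circleSin (x i) := by
    intro i
    refine partialDeriv_comp_torusSq_add (H := fun r => -(1 / 2 * r ^ (-(d : ℝ) / 2))) ?_ i
    refine ((Real.hasDerivAt_rpow_const (p := -(d : ℝ) / 2) (Or.inl hp.ne')).const_mul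
      (1 / 2)).neg.congr_deriv ?_
    ring
  have hr : (torusSq x + e) ^ (-(d : ℝ) / 2) =
      (torusSq x + e) ^ (-(d : ℝ) / 2 - 1) * (torusSq x + e) := by
    rw [← Real.rpow_add_one hp.ne']; congr 1; ring
  unfold laplacian
  simp_rw [partialDeriv_parametrix he,
    partialDeriv_mul hs.contDiffOne (isSmooth_circleSin _).contDiffOne, hd,
    partialDeriv_circleSin, mul_assoc (d / 4 * (torusSq x + e) ^ (-(d : ℝ) / 2 - 1)), ← sq,
    circleSin_sq, hr]
  unfold peakPart restPart
  set P := (torusSq x + e) ^ (-(d : ℝ) / 2 - 1)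
  have h1 : ∑ i, circleSq (x i) = torusSq x := rfl
  simp_rw [Finset.sum_add_distrib, mul_sub, Finset.sum_sub_distrib, ← mul_assoc,
    ← Finset.mul_sum, h1]
  simp only [Finset.sum_const, Finset.card_univ, Fintype.card_fin, nsmul_eq_mul]
  ring

theorem peakPart_nonneg {e : ℝ} (he : 0 < e) (x : Torus d) : 0 ≤ peakPart e x :=
  mul_nonneg (by positivity) (Real.rpow_nonneg (torusSq_add_pos he x).le _)

theorem continuous_rpow_torusSq_add {e : ℝ} (he : 0 < e) (a : ℝ) :
    Continuous fun x : Torus d => (torusSq x + e) ^ a :=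
  (continuous_torusSq.add continuous_const).rpow_const fun x => Or.inl (torusSq_add_pos he x).ne'

theorem continuous_peakPart {e : ℝ} (he : 0 < e) : Continuous (peakPart e : Torus d → ℝ) :=
  continuous_const.mul (continuous_rpow_torusSq_add he _)

theorem continuous_restPart {e : ℝ} (he : 0 < e) : Continuous (restPart e : Torus d → ℝ) := by
  have h := continuous_torusSq (d := d)
  have h' : ∀ i, Continuous fun x : Torus d => circleSq (x i) := fun i =>
    (isSmooth_circleSq i).continuous
  exact (continuous_rpow_torusSq_add he _).mul (by fun_prop)

theorem torusSq_le_card (x : Torus d) : torusSq x ≤ d := by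
  have h : ∀ y : UnitAddCircle, circleSq y ≤ 1 := fun y => by
    induction y using QuotientAddGroup.induction_on with | H y =>
    rw [circleSq_coe, div_le_one (by positivity)]
    nlinarith [Real.sin_sq_le_one (Real.pi * y), Real.pi_gt_three]
  calc torusSq x ≤ ∑ _i : Fin d, (1 : ℝ) := Finset.sum_le_sum fun i _ => h _
    _ = d := by simp

/-- The bracket is at most quadratic in `r = torusSq x + e`, so the remainder is of order `r^(1 -
d/2)`, half a power better than the Riesz kernel `r^((1-d)/2)`; the surplus `r^(1/2)` is bounded
because `r ≤ d + 1`. -/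
theorem abs_restPart_le {e : ℝ} (he : 0 < e) (he1 : e ≤ 1) (x : Torus d) :
    |restPart e x| ≤ (d + 2) * Real.pi ^ 2 * (d + 1) * rieszKernel e x := by
  have hp := torusSq_add_pos he x
  have hσ := torusSq_nonneg x
  set r := torusSq x + e with hr
  have h1 : ∑ i, circleSq (x i) ^ 2 ≤ r ^ 2 := by
    calc ∑ i, circleSq (x i) ^ 2 ≤ (∑ i, circleSq (x i)) ^ 2 :=
          Finset.sum_sq_le_sq_sum_of_nonneg fun i _ => circleSq_nonneg _
      _ ≤ r ^ 2 := pow_le_pow_left₀ hσ (by linarith [show ∑ i, circleSq (x i) = torusSq x from rfl]) 2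
  have h0 : 0 ≤ ∑ i, circleSq (x i) ^ 2 := Finset.sum_nonneg fun i _ => sq_nonneg _
  have h2 : |d * Real.pi ^ 2 * ∑ i, circleSq (x i) ^ 2 - 2 * Real.pi ^ 2 * torusSq x * r| ≤
      (d + 2) * Real.pi ^ 2 * r ^ 2 := by
    have e1 : (d : ℝ) * Real.pi ^ 2 * ∑ i, circleSq (x i) ^ 2 ≤ d * Real.pi ^ 2 * r ^ 2 := by gcongr
    have e2 : 2 * Real.pi ^ 2 * torusSq x * r ≤ 2 * Real.pi ^ 2 * r ^ 2 := by
      rw [sq r, ← mul_assoc]; gcongr; linarith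
    have e3 : (0 : ℝ) ≤ d * Real.pi ^ 2 * ∑ i, circleSq (x i) ^ 2 := by positivity
    have e4 : 0 ≤ 2 * Real.pi ^ 2 * torusSq x * r := by positivity
    rw [abs_le]; constructor <;> nlinarith
  have h3 : r ^ (-(d : ℝ) / 2 - 1) * r ^ 2 ≤ (d + 1) * r ^ ((1 - d : ℝ) / 2) := by
    have e1 : r ^ (-(d : ℝ) / 2 - 1) * r ^ 2 = r ^ (1 / 2 : ℝ) * r ^ ((1 - d : ℝ) / 2) := by
      rw [← Real.rpow_natCast, ← Real.rpow_add hp, ← Real.rpow_add hp]; congr 1; push_cast; ring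
    rw [e1]
    gcongr
    have hr1 : r ≤ d + 1 := by linarith [torusSq_le_card x]
    have : (1 : ℝ) ≤ d + 1 := by linarith [Nat.cast_nonneg (α := ℝ) d]
    calc r ^ (1 / 2 : ℝ) ≤ (d + 1 : ℝ) ^ (1 / 2 : ℝ) := by gcongr
      _ ≤ (d + 1 : ℝ) ^ (1 : ℝ) := Real.rpow_le_rpow_of_exponent_le this (by norm_num)
      _ = _ := Real.rpow_one _
  unfold restPart
  rw [abs_mul, abs_of_nonneg (Real.rpow_nonneg hp.le _)]
  calc _ ≤ r ^ (-(d : ℝ) / 2 - 1) * ((d + 2) * Real.pi ^ 2 * r ^ 2) := by gcongr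
    _ = (d + 2) * Real.pi ^ 2 * (r ^ (-(d : ℝ) / 2 - 1) * r ^ 2) := by ring
    _ ≤ (d + 2) * Real.pi ^ 2 * ((d + 1) * r ^ ((1 - d : ℝ) / 2)) := by gcongr
    _ = _ := by rw [rieszKernel]; ring

theorem abs_partialDeriv_parametrix_le {e : ℝ} (he : 0 < e) (i : Fin d) (x : Torus d) :
    |partialDeriv i (parametrix e) x| ≤ rieszKernel e x := by
  have hp := torusSq_add_pos he x
  rw [partialDeriv_parametrix he, abs_mul, abs_neg, abs_mul, abs_of_nonneg (a := (1 / 2 : ℝ))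
    (by norm_num), abs_of_nonneg (Real.rpow_nonneg hp.le _)]
  have h1 : |circleSin (x i)| ≤ 2 * (torusSq x + e) ^ (1 / 2 : ℝ) := by
    rw [← Real.sqrt_eq_rpow]
    refine abs_le_of_sq_le_sq ?_ (by positivity)
    rw [mul_pow, Real.sq_sqrt hp.le, circleSin_sq]
    have h2 : circleSq (x i) ≤ torusSq x :=
      Finset.single_le_sum (f := fun i => circleSq (x i)) (fun i _ => circleSq_nonneg _)
        (Finset.mem_univ i)
    nlinarith [sq_nonneg (Real.pi * circleSq (x i))]
  calc _ ≤ 1 / 2 * (torusSq x + e) ^ (-(d : ℝ) / 2) * (2 * (torusSq x + e) ^ (1 / 2 : ℝ)) := by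
        have := Real.rpow_nonneg hp.le (-(d : ℝ) / 2)
        gcongr
    _ = (torusSq x + e) ^ (-(d : ℝ) / 2) * (torusSq x + e) ^ (1 / 2 : ℝ) := by ring
    _ = rieszKernel e x := by
        rw [← Real.rpow_add hp, rieszKernel]; congr 1; ring

/-- A Laplacian has mean zero, so the mass of the peak is minus the mass of the remainder, which is
controlled by the Riesz kernel over the whole torus. -/
theorem integral_peakPart_le {e : ℝ} (he : 0 < e) (he1 : e ≤ 1) (hd : 1 ≤ d) :
    ∫ x : Torus d, peakPart e x ≤
      (d + 2) * Real.pi ^ 2 * (d + 1) * (1 + Real.pi ^ d * (d - 1)) := by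
  have hs := isSmooth_parametrix (d := d) he
  have h0 : ∫ x : Torus d, laplacian (parametrix e) x = 0 := by
    unfold laplacian
    rw [integral_finsetSum _ fun i _ => integrable_of_continuous
      ((hs.partialDeriv i).partialDeriv i).continuous]
    exact Finset.sum_eq_zero fun i _ => integral_partialDeriv (hs.partialDeriv i).contDiffOne i
  simp_rw [laplacian_parametrix he] at h0
  have hA := integrable_of_continuous (continuous_peakPart (d := d) he)
  have hB := integrable_of_continuous (continuous_restPart (d := d) he)
  rw [integral_neg, integral_add hA hB] at h0
  have hN := integrable_of_continuous (continuous_rieszKernel (d := d) he)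
  have h1 : -∫ x : Torus d, restPart e x ≤
      ∫ x : Torus d, (d + 2) * Real.pi ^ 2 * (d + 1) * rieszKernel e x := by
    rw [← integral_neg]
    exact integral_mono hB.neg (hN.const_mul _) fun x =>
      (neg_le_abs _).trans (abs_restPart_le he he1 x)
  have h2 := setIntegral_rieszKernel_le he hd (MeasurableSet.univ (α := Torus d))
  rw [setIntegral_univ] at h2
  simp only [probReal_univ, Real.one_rpow, mul_one] at h2
  rw [integral_const_mul] at h1
  have h3 : 0 ≤ (d + 2) * Real.pi ^ 2 * ((d : ℝ) + 1) := by positivity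
  nlinarith [mul_le_mul_of_nonneg_left h2 h3]

/-- Scaling: on the ball of radius `√e` the peak is at least a constant times `e^(-d/2)`. The
condition `e ≤ 1/4` keeps this ball from wrapping around the torus, so that its volume is exactly
`(2√e)^d`. -/
theorem exists_le_integral_peakPart (hd : 1 ≤ d) :
    ∃ c : ℝ, 0 < c ∧ ∀ e, 0 < e → e ≤ 1 / 4 → c ≤ ∫ x : Torus d, peakPart e x := by
  have hd' : (1 : ℝ) ≤ d := by exact_mod_cast hd
  refine ⟨d * (d + 1 : ℝ) ^ (-(d : ℝ) / 2 - 1) * 2 ^ d, by positivity, fun e he he4 => ?_⟩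
  have hA := integrable_of_continuous (continuous_peakPart (d := d) he)
  have hs : √e ≤ 1 / 2 := Real.sqrt_le_iff.2 ⟨by norm_num, by linarith⟩
  set S := Metric.closedBall (0 : Torus d) (√e)
  have hS : volume.real S = (2 * √e) ^ d := by
    rw [Measure.real, volume_closedBall_zero _ (Real.sqrt_nonneg _), min_eq_right (by linarith),
      ENNReal.toReal_pow, ENNReal.toReal_ofReal (by positivity)]
  have h1 : ∀ x ∈ S, d * e * ((d + 1) * e) ^ (-(d : ℝ) / 2 - 1) ≤ peakPart e x := by
    intro x hx
    rw [mem_closedBall_zero_iff] at hx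
    have h2 : torusSq x ≤ d * e := (torusSq_le x).trans (by
      gcongr
      calc ‖x‖ ^ 2 ≤ √e ^ 2 := by gcongr
        _ = e := Real.sq_sqrt he.le)
    exact mul_le_mul_of_nonneg_left (Real.rpow_le_rpow_of_nonpos (torusSq_add_pos he x)
      (by linarith) (by linarith)) (by positivity)
  calc _ = (d * e * ((d + 1) * e) ^ (-(d : ℝ) / 2 - 1)) * volume.real S := by
        rw [hS, Real.mul_rpow (by positivity) he.le, mul_pow, Real.sqrt_eq_rpow,
          ← Real.rpow_natCast (e ^ (1 / 2 : ℝ)), ← Real.rpow_mul he.le]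
        have : e * e ^ (-(d : ℝ) / 2 - 1) * e ^ (1 / 2 * (d : ℝ)) = 1 := by
          rw [← Real.rpow_one_add' he.le (by
            intro h; linarith), ← Real.rpow_add he]
          rw [show 1 + (-(d : ℝ) / 2 - 1) + 1 / 2 * (d : ℝ) = 0 by ring, Real.rpow_zero]
        linear_combination -(d * (d + 1 : ℝ) ^ (-(d : ℝ) / 2 - 1) * 2 ^ d) * this
    _ = ∫ _ in S, d * e * ((d + 1) * e) ^ (-(d : ℝ) / 2 - 1) := by
        rw [setIntegral_const, smul_eq_mul, mul_comm]
    _ ≤ ∫ x in S, peakPart e x := setIntegral_mono_on (integrable_const _) hA.integrableOn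
        Metric.isClosed_closedBall.measurableSet h1
    _ ≤ ∫ x, peakPart e x := setIntegral_le_integral hA
        (Eventually.of_forall fun x => peakPart_nonneg he x)

/-- The peaks have bounded mass and tend to zero uniformly away from `0`: near `0` the smallness of
`h` is used, elsewhere that of the peak. -/
theorem exists_integral_peakPart_mul_le (hd : 1 ≤ d) {h : Torus d → ℝ} (hh : Continuous h)
    (h0 : h 0 = 0) (hn : ∀ x, 0 ≤ h x) {δ : ℝ} (hδ : 0 < δ) :
    ∃ e, 0 < e ∧ e ≤ 1 / 4 ∧ ∫ x : Torus d, peakPart e x * h x ≤ δ := by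
  have hd' : (1 : ℝ) ≤ d := by exact_mod_cast hd
  set M : ℝ := (d + 2) * Real.pi ^ 2 * (d + 1) * (1 + Real.pi ^ d * (d - 1)) with hM
  have hM0 : 0 < M := by
    have := sub_nonneg.2 hd'
    positivity
  obtain ⟨ρ, hρ, hball⟩ := Metric.continuous_iff.1 hh 0 (δ / (2 * M)) (by positivity)
  obtain ⟨B, hB⟩ := isCompact_univ.exists_bound_of_continuousOn hh.continuousOn
  have hB0 : 0 ≤ B := (norm_nonneg _).trans (hB 0 (mem_univ _))
  set s : ℝ := (2 * ρ / Real.pi / 2) ^ 2 with hs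
  have hs0 : 0 < s := by positivity
  set Q : ℝ := d * s ^ (-(d : ℝ) / 2 - 1) * B with hQ
  have hQ0 : 0 ≤ Q := by positivity
  have key : ∀ e, 0 < e → ∀ x : Torus d,
      peakPart e x * h x ≤ δ / (2 * M) * peakPart e x + e * Q := by
    intro e he x
    have hA := peakPart_nonneg he x
    rcases lt_or_ge ‖x‖ ρ with hx | hx
    · have h1 : h x < δ / (2 * M) := by
        have := hball x (by simpa using hx)
        rw [h0, dist_zero_right, Real.norm_eq_abs] at this
        exact (le_abs_self _).trans_lt this
      have : peakPart e x * h x ≤ peakPart e x * (δ / (2 * M)) := by gcongr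
      have : 0 ≤ e * Q := by positivity
      linarith
    · have h1 : s ≤ torusSq x := by
        have := norm_le_sqrt_torusSq x
        have h2 : 2 * ρ / Real.pi / 2 ≤ √(torusSq x) := by
          have h3 : ρ ≤ Real.pi / 2 * √(torusSq x) := hx.trans this
          rw [div_div, div_le_iff₀ (by positivity)]
          nlinarith [Real.pi_pos, Real.sqrt_nonneg (torusSq x)]
        calc s ≤ √(torusSq x) ^ 2 := by rw [hs]; gcongr
          _ = _ := Real.sq_sqrt (torusSq_nonneg x)
      have h2 : peakPart e x ≤ d * e * s ^ (-(d : ℝ) / 2 - 1) := by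
        exact mul_le_mul_of_nonneg_left (Real.rpow_le_rpow_of_nonpos hs0
          (by linarith) (by linarith)) (by positivity)
      have h3 : h x ≤ B := (le_abs_self _).trans (hB x (mem_univ x))
      have : peakPart e x * h x ≤ (d * e * s ^ (-(d : ℝ) / 2 - 1)) * B := by
        gcongr
        exact hn x
      have h4 : 0 ≤ δ / (2 * M) * peakPart e x := by positivity
      have h5 : e * Q = (d * e * s ^ (-(d : ℝ) / 2 - 1)) * B := by rw [hQ]; ring
      linarith
  -- With this choice `e Q ≤ δ/2`, and the region near `0` contributes the other `δ/2` through the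
  -- mass bound `M`.
  refine ⟨min (1 / 4) (δ / (2 * (Q + 1))), by positivity, min_le_left _ _, ?_⟩
  set e := min (1 / 4) (δ / (2 * (Q + 1)))
  have he : 0 < e := by positivity
  have he4 : e ≤ 1 / 4 := min_le_left _ _
  have hA := integrable_of_continuous (continuous_peakPart (d := d) he)
  calc _ ≤ ∫ x : Torus d, (δ / (2 * M) * peakPart e x + e * Q) :=
        integral_mono (integrable_of_continuous ((continuous_peakPart he).mul hh))
          ((hA.const_mul _).add (integrable_const _)) (key e he)
    _ = δ / (2 * M) * (∫ x : Torus d, peakPart e x) + e * Q := by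
        rw [integral_add (hA.const_mul _) (integrable_const _), integral_const_mul]
        simp
    _ ≤ δ / (2 * M) * M + δ / (2 * (Q + 1)) * (Q + 1) := by
        gcongr
        · exact integral_peakPart_le he (by linarith) hd
        · exact min_le_right _ _
        · linarith
    _ = δ := by field_simp; ring

/-! ### The Green kernel is in weak `L^(d/(d-1))` -/

/-- The hypothesis is invariant under translations of `E`; by Fubini it survives convolution with an
integrable `k`, at the cost of the factor `‖k‖₁`. -/
theorem setIntegral_abs_conv_le {k φ : Torus d → ℝ} (hk : Integrable k) (hφ : Continuous φ)
    {M a : ℝ}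
    (h : ∀ E : Set (Torus d), MeasurableSet E → ∫ x in E, |φ x| ≤ M * volume.real E ^ a)
    {E : Set (Torus d)} (hE : MeasurableSet E) :
    ∫ x in E, |conv k φ x| ≤ (∫ y, |k y|) * (M * volume.real E ^ a) := by
  have h1 : Integrable (fun p : Torus d × Torus d => |k p.2 * φ (p.1 - p.2)|)
      ((volume.restrict E).prod volume) := by
    have h2 : Integrable (fun p : Torus d × Torus d => |k p.2 * φ (p.1 - p.2)|)
        (volume.prod volume) := (integrable_comp_sub_prod hk (integrable_of_continuous hφ)).abs
    refine h2.mono_measure ?_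
    exact Measure.prod_mono Measure.restrict_le_self le_rfl
  calc ∫ x in E, |conv k φ x| ≤ ∫ x in E, ∫ y, |k y * φ (x - y)| := by
        refine integral_mono_of_nonneg (Eventually.of_forall fun _ => abs_nonneg _)
          h1.integral_prod_left (Eventually.of_forall fun x => ?_)
        exact abs_integral_le_integral_abs
    _ = ∫ y, ∫ x in E, |k y * φ (x - y)| :=
        integral_integral_swap (f := fun x y => |k y * φ (x - y)|) h1
    _ ≤ ∫ y, |k y| * (M * volume.real E ^ a) := by
        refine integral_mono h1.integral_prod_right (hk.abs.mul_const _) fun y => ?_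
        simp only [abs_mul]
        rw [integral_const_mul]
        refine mul_le_mul_of_nonneg_left ?_ (abs_nonneg _)
        have hp := measurePreserving_add_right (volume : Measure (Torus d)) y
        have e1 := hp.setIntegral_preimage_emb (measurableEmbedding_addRight y)
          (fun x => |φ (x - y)|) E
        have e2 : volume.real ((fun x => x + y) ⁻¹' E) = volume.real E := by
          rw [Measure.real, hp.measure_preimage hE.nullMeasurableSet, Measure.real]
        simp only [add_sub_cancel_right] at e1
        rw [← e1, ← e2]
        exact h _ (hE.preimage hp.measurable)
    _ = _ := integral_mul_const _ _

/-- The mere integrability of `k = Kᵢ` improves itself. For the parametrix `Φ`, the representation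
formula reads `∂ᵢΦ = k ∗ peakPart + k ∗ restPart`. As the regularization is removed, `k ∗ peakPart`
approaches `(∫ peakPart) k` in `L¹`, with mass bounded below, while `∂ᵢΦ` and `restPart` are
dominated by the Riesz kernel, whose integral over `E` is `O(|E|^(1/d))`; convolution with `k`
preserves that bound. -/
theorem IsGreenKernel.exists_setIntegral_apply_le {g : Torus d → ℝ} {K : Torus d → Vec d}
    (hd : 1 ≤ d) (h : IsGreenKernel g K) (i : Fin d) :
    ∃ C : ℝ, 0 ≤ C ∧ ∀ E : Set (Torus d), MeasurableSet E →
      ∫ x in E, |K x i| ≤ C * volume.real E ^ (1 / (d : ℝ)) := by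
  have hd' : (1 : ℝ) ≤ d := by exact_mod_cast hd
  have hk := h.gradient.integrable_apply i
  obtain ⟨c, hc, hcA⟩ := exists_le_integral_peakPart hd
  set N : ℝ := 1 + Real.pi ^ d * (d - 1)
  have hN : 0 ≤ N := by
    have := sub_nonneg.2 hd'
    positivity
  set M : ℝ := (d + 2) * Real.pi ^ 2 * (d + 1) * N
  have hM : 0 ≤ M := by positivity
  set k : Torus d → ℝ := fun y => K y i
  have hk1 : 0 ≤ ∫ y, |k y| := integral_nonneg fun _ => abs_nonneg _
  refine ⟨(N + (∫ y, |k y|) * M) / c, by positivity, fun E hE => ?_⟩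
  set R := volume.real E ^ (1 / (d : ℝ))
  rw [div_mul_eq_mul_div, le_div_iff₀ hc]
  -- The regularization `e` will depend on `δ`, but the constants `c`, `N`, `M` do not, so `δ` may
  -- be sent to `0`.
  refine le_of_forall_pos_le_add fun δ hδ => ?_
  obtain ⟨e, he, he4, heδ⟩ := exists_integral_peakPart_mul_le hd
    ((continuous_transMod hk).comp continuous_neg) (by simp [transMod_zero])
    (fun x => transMod_nonneg _ _) hδ
  have hA := continuous_peakPart (d := d) he
  have hB := continuous_restPart (d := d) he
  have hs := isSmooth_parametrix (d := d) he
  have hcA' := hcA e he he4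
  set a : ℝ := ∫ x : Torus d, peakPart e x
  have hconv : ∀ x, conv k (peakPart e) x =
      partialDeriv i (parametrix e) x - conv k (restPart e) x := by
    intro x
    rw [h.partialDeriv_eq hs i x]
    unfold conv
    simp_rw [laplacian_parametrix he, mul_neg, mul_add, integral_neg]
    rw [integral_add (Integrable.mul_comp_sub hk hA x) (Integrable.mul_comp_sub hk hB x)]
    ring
  have hcB : Continuous (conv k (restPart e)) := by
    have : Integrable (fun y => restPart e y : Torus d → ℝ) := integrable_of_continuous hB
    obtain ⟨B, hB'⟩ := isCompact_univ.exists_bound_of_continuousOn hB.continuousOn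
    refine continuous_of_dominated (F := fun x y => k y * restPart e (x - y))
      (bound := fun y => |k y| * B) (fun x => (Integrable.mul_comp_sub hk hB x).aestronglyMeasurable)
      (fun x => Eventually.of_forall fun y => ?_) (hk.abs.mul_const _)
      (Eventually.of_forall fun y => ?_)
    · rw [norm_mul, Real.norm_eq_abs]
      exact mul_le_mul_of_nonneg_left (hB' _ (mem_univ _)) (abs_nonneg _)
    · exact continuous_const.mul (hB.comp (by fun_prop))
  have hcP : Continuous (partialDeriv i (parametrix e) : Torus d → ℝ) :=
    (hs.partialDeriv i).continuous
  have hcC : Continuous (conv k (peakPart e)) := by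
    rw [show conv k (peakPart e) = fun x => partialDeriv i (parametrix e) x -
      conv k (restPart e) x from funext hconv]
    exact hcP.sub hcB
  have i1 : ∫ x in E, |partialDeriv i (parametrix e) x| ≤ N * R := by
    refine le_trans ?_ (setIntegral_rieszKernel_le he hd hE)
    exact setIntegral_mono (integrable_of_continuous hcP).abs.integrableOn
      (integrable_of_continuous (continuous_rieszKernel he)).integrableOn
      fun x => abs_partialDeriv_parametrix_le he i x
  have i2 : ∫ x in E, |conv k (restPart e) x| ≤ (∫ y, |k y|) * (M * R) := by
    refine setIntegral_abs_conv_le hk hB (fun E hE => ?_) hE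
    have hNc := integrable_of_continuous (continuous_rieszKernel (d := d) he)
    calc ∫ x in E, |restPart e x| ≤ ∫ x in E, (d + 2) * Real.pi ^ 2 * (d + 1) * rieszKernel e x :=
          setIntegral_mono (integrable_of_continuous hB).abs.integrableOn
            (hNc.const_mul _).integrableOn fun x => abs_restPart_le he (by linarith) x
      _ ≤ _ := by
          rw [integral_const_mul]
          calc _ ≤ (d + 2) * Real.pi ^ 2 * (d + 1) * (N * volume.real E ^ (1 / (d : ℝ))) := by
                gcongr
                exact setIntegral_rieszKernel_le he hd hE
            _ = _ := by ring
  have i3 : ∫ x in E, |conv k (peakPart e) x - a * k x| ≤ δ := by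
    have hfint : Integrable fun x => |conv k (peakPart e) x - a * k x| :=
      ((integrable_of_continuous hcC).sub (hk.const_mul a)).abs
    refine (setIntegral_le_integral hfint (Eventually.of_forall fun _ => abs_nonneg _)).trans ?_
    exact (integral_abs_conv_sub_le hk (integrable_of_continuous hA)
      (peakPart_nonneg he)).trans heδ
  have j1 := (integrable_of_continuous hcP).abs.integrableOn (s := E)
  have j2 := (integrable_of_continuous hcB).abs.integrableOn (s := E)
  have j12 : IntegrableOn (fun x => |partialDeriv i (parametrix e) x| +
      |conv k (restPart e) x|) E := j1.add j2
  have j3 : IntegrableOn (fun x => |conv k (peakPart e) x - a * k x|) E :=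
    ((integrable_of_continuous hcC).sub (hk.const_mul a)).abs.integrableOn
  have j4 : IntegrableOn (fun x => |k x|) E := hk.abs.integrableOn
  have h0 : 0 ≤ ∫ x in E, |k x| := integral_nonneg fun _ => abs_nonneg _
  calc (∫ x in E, |k x|) * c ≤ (∫ x in E, |k x|) * a := by gcongr
    _ = ∫ x in E, |k x| * a := (integral_mul_const _ _).symm
    _ ≤ ∫ x in E, (|partialDeriv i (parametrix e) x| + |conv k (restPart e) x| +
        |conv k (peakPart e) x - a * k x|) := by
        refine setIntegral_mono (j4.mul_const a) ((j1.add j2).add j3) fun x => ?_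
        have ha : 0 ≤ a := hc.le.trans hcA'
        have e1 : |k x| * a = |a * k x| := by rw [abs_mul, abs_of_nonneg ha, mul_comm]
        have e2 : a * k x = partialDeriv i (parametrix e) x - conv k (restPart e) x -
            (conv k (peakPart e) x - a * k x) := by rw [hconv]; ring
        simp only
        rw [e1]
        conv_lhs => rw [e2]
        exact (abs_sub _ _).trans (add_le_add (abs_sub _ _) le_rfl)
    _ = (∫ x in E, |partialDeriv i (parametrix e) x|) + (∫ x in E, |conv k (restPart e) x|) +
        ∫ x in E, |conv k (peakPart e) x - a * k x| := by
        rw [integral_add j12 j3, integral_add j1 j2]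
    _ ≤ (N + (∫ y, |k y|) * M) * R + δ := by linarith

theorem IsGreenKernel.exists_setLIntegral_le {g : Torus d → ℝ} {K : Torus d → Vec d}
    (hd : 1 ≤ d) (h : IsGreenKernel g K) :
    ∃ C : ℝ, 0 ≤ C ∧ ∀ E : Set (Torus d), MeasurableSet E →
      ∫⁻ x in E, ‖K x‖ₑ ≤ ENNReal.ofReal C * volume E ^ (1 / (d : ℝ)) := by
  choose C hC0 hC using h.exists_setIntegral_apply_le hd
  refine ⟨∑ i, C i, Finset.sum_nonneg fun i _ => hC0 i, fun E hE => ?_⟩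
  have hk := fun i => h.gradient.integrable_apply i
  have h1 : ∀ x, ‖K x‖ ≤ ∑ i, |K x i| := fun x => by
    rw [EuclideanSpace.norm_eq]
    refine Real.sqrt_le_iff.2 ⟨Finset.sum_nonneg fun i _ => abs_nonneg _, ?_⟩
    simp only [Real.norm_eq_abs]
    exact Finset.sum_sq_le_sq_sum_of_nonneg fun i _ => abs_nonneg _
  have h2 : ∫ x in E, ‖K x‖ ≤ (∑ i, C i) * volume.real E ^ (1 / (d : ℝ)) := by
    calc ∫ x in E, ‖K x‖ ≤ ∫ x in E, ∑ i, |K x i| :=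
          setIntegral_mono h.gradient.integrable_grad.norm.integrableOn
            (integrable_finsetSum (f := fun i x => |K x i|) _
              fun i _ => (hk i).abs).integrableOn h1
      _ = ∑ i, ∫ x in E, |K x i| :=
          integral_finsetSum (f := fun i x => |K x i|) _ fun i _ => (hk i).abs.integrableOn
      _ ≤ ∑ i, C i * volume.real E ^ (1 / (d : ℝ)) := Finset.sum_le_sum fun i _ => hC i E hE
      _ = _ := (Finset.sum_mul _ _ _).symm
  calc ∫⁻ x in E, ‖K x‖ₑ = ENNReal.ofReal (∫ x in E, ‖K x‖) := by
        rw [ofReal_integral_norm_eq_lintegral_enorm h.gradient.integrable_grad.integrableOn]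
    _ ≤ ENNReal.ofReal ((∑ i, C i) * volume.real E ^ (1 / (d : ℝ))) := ENNReal.ofReal_le_ofReal h2
    _ = _ := by
        rw [ENNReal.ofReal_mul (Finset.sum_nonneg fun i _ => hC0 i),
          ← ENNReal.ofReal_rpow_of_nonneg measureReal_nonneg (by positivity), ofReal_measureReal]

/-! ### Duality with the Lorentz norm -/

/-- Layer-cake formula for `|F|` with respect to the measure `|K(y - z)| dy`, which gives a set `S`
at most `C |S|^(1/d)`. It is the duality between weak `L^{d/(d-1)}` and `L^{d,1}`, uniform in the
translation. -/
theorem lintegral_mul_comp_sub_le_lorentzNorm (hd : 1 ≤ d) {K F : Torus d → Vec d} {C : ℝ}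
    (hK : AEStronglyMeasurable K volume) (hF : AEStronglyMeasurable F volume)
    (h : ∀ E : Set (Torus d), MeasurableSet E →
      ∫⁻ x in E, ‖K x‖ₑ ≤ ENNReal.ofReal C * volume E ^ (1 / (d : ℝ))) (z : Torus d) :
    ∫⁻ y, ‖K (y - z)‖ₑ * ‖F y‖ₑ ≤ ENNReal.ofReal C * lorentzNorm d F := by
  have hp := measurePreserving_sub_right (volume : Measure (Torus d)) z
  have hKz : AEMeasurable (fun y => ‖K (y - z)‖ₑ) volume :=
    (hK.comp_measurePreserving hp).enorm
  have hq := measurePreserving_add_right (volume : Measure (Torus d)) z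
  set ν := (volume : Measure (Torus d)).withDensity fun y => ‖K (y - z)‖ₑ with hν
  have hac : ν ≪ volume := withDensity_absolutelyContinuous _ _
  -- The superlevel sets of `F` need not be measurable, whence the passage to a measurable hull.
  have h1 : ∀ S : Set (Torus d), ν S ≤ ENNReal.ofReal C * volume S ^ (1 / (d : ℝ)) := by
    intro S
    calc ν S ≤ ν (toMeasurable volume S) := measure_mono (subset_toMeasurable _ _)
      _ = ∫⁻ y in toMeasurable volume S, ‖K (y - z)‖ₑ :=
          withDensity_apply _ (measurableSet_toMeasurable _ _)
      _ = ∫⁻ y in (fun y => y + z) ⁻¹' toMeasurable volume S, ‖K y‖ₑ := by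
          have := hq.setLIntegral_comp_preimage_emb (measurableEmbedding_addRight z)
            (fun y => ‖K (y - z)‖ₑ) (toMeasurable volume S)
          rw [← this]
          simp
      _ ≤ ENNReal.ofReal C *
          volume ((fun y => y + z) ⁻¹' toMeasurable volume S) ^ (1 / (d : ℝ)) :=
          h _ ((measurableSet_toMeasurable _ _).preimage hq.measurable)
      _ = _ := by
          rw [hq.measure_preimage (measurableSet_toMeasurable _ _).nullMeasurableSet,
            measure_toMeasurable]
  calc ∫⁻ y, ‖K (y - z)‖ₑ * ‖F y‖ₑ = ∫⁻ y, ‖F y‖ₑ ∂ν := by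
        rw [hν, lintegral_withDensity_eq_lintegral_mul₀ hKz hF.enorm]
        rfl
    _ = ∫⁻ y, ENNReal.ofReal ‖F y‖ ∂ν := by simp
    _ = ∫⁻ s in Ioi (0 : ℝ), ν {y | s < ‖F y‖} :=
        lintegral_eq_lintegral_meas_lt ν (Eventually.of_forall fun _ => norm_nonneg _)
          (hF.norm.aemeasurable.mono_ac hac)
    _ ≤ ∫⁻ s in Ioi (0 : ℝ), ENNReal.ofReal C * volume {y | s < ‖F y‖} ^ (1 / (d : ℝ)) :=
        lintegral_mono fun s => h1 _
    _ = ENNReal.ofReal C * ∫⁻ s in Ioi (0 : ℝ), volume {y | s < ‖F y‖} ^ (1 / (d : ℝ)) :=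
        lintegral_const_mul' _ _ ENNReal.ofReal_ne_top
    _ ≤ ENNReal.ofReal C * lorentzNorm d F := by
        gcongr
        unfold lorentzNorm
        refine le_mul_of_one_le_left zero_le ?_
        rw [ENNReal.one_le_ofReal]
        exact_mod_cast hd

/-- On a probability space `|S| ≤ |S|^(1/d)`, so the layer-cake formula embeds `L^{d,1}` into `L¹`.
-/
theorem lintegral_enorm_le_lorentzNorm (hd : 1 ≤ d) {F : Torus d → Vec d}
    (hF : AEStronglyMeasurable F volume) : ∫⁻ y, ‖F y‖ₑ ≤ lorentzNorm d F := by
  calc ∫⁻ y, ‖F y‖ₑ = ∫⁻ y, ENNReal.ofReal ‖F y‖ := by simp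
    _ = ∫⁻ s in Ioi (0 : ℝ), volume {y | s < ‖F y‖} :=
        lintegral_eq_lintegral_meas_lt volume (Eventually.of_forall fun _ => norm_nonneg _)
          hF.norm.aemeasurable
    _ ≤ ∫⁻ s in Ioi (0 : ℝ), volume {y | s < ‖F y‖} ^ (1 / (d : ℝ)) := by
        refine lintegral_mono fun s => ?_
        have hd' : (1 : ℝ) ≤ d := by exact_mod_cast hd
        calc volume {y | s < ‖F y‖} = volume {y | s < ‖F y‖} ^ (1 : ℝ) := (ENNReal.rpow_one _).symm
          _ ≤ _ := ENNReal.rpow_le_rpow_of_exponent_ge prob_le_one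
            (by rw [div_le_one (by linarith)]; exact hd')
    _ ≤ lorentzNorm d F := by
        unfold lorentzNorm
        refine le_mul_of_one_le_left zero_le ?_
        rw [ENNReal.one_le_ofReal]
        exact_mod_cast hd

/-! ### Smooth approximations of the absolute value -/

/-- The smooth approximation `√(z² + κ²)` of `|z|`. -/
def softAbs (κ z : ℝ) : ℝ := √(z ^ 2 + κ ^ 2)

/-- The derivative of `softAbs`. -/
def softSgn (κ z : ℝ) : ℝ := z / √(z ^ 2 + κ ^ 2)

/-- The sign function, with value `0` at `0`. -/
def sgn (z : ℝ) : ℝ := z / |z|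

theorem sgn_mul_self (z : ℝ) : sgn z * z = |z| := by
  rcases eq_or_ne z 0 with rfl | h
  · simp
  · rw [sgn, div_mul_eq_mul_div, ← abs_mul_abs_self, mul_div_assoc,
      div_self (abs_ne_zero.2 h), mul_one]

theorem abs_sgn_le (z : ℝ) : |sgn z| ≤ 1 := by
  rw [sgn, abs_div, abs_abs]; exact div_self_le_one _

theorem sgn_of_pos {z : ℝ} (h : 0 < z) : sgn z = 1 := by
  rw [sgn, abs_of_pos h, div_self h.ne']

theorem sgn_of_neg {z : ℝ} (h : z < 0) : sgn z = -1 := by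
  rw [sgn, abs_of_neg h, div_neg, div_self h.ne]

theorem measurable_sgn : Measurable sgn := measurable_id.div continuous_abs.measurable

theorem sq_add_sq_pos {κ : ℝ} (hκ : κ ≠ 0) (z : ℝ) : 0 < z ^ 2 + κ ^ 2 := by positivity

theorem hasDerivAt_softAbs {κ : ℝ} (hκ : κ ≠ 0) (z : ℝ) :
    HasDerivAt (softAbs κ) (softSgn κ z) z := by
  have h1 : HasDerivAt (fun z : ℝ => z ^ 2 + κ ^ 2) (2 * z) z := by
    simpa using (hasDerivAt_pow 2 z).add_const (κ ^ 2)
  refine (h1.sqrt (sq_add_sq_pos hκ z).ne').congr_deriv ?_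
  rw [mul_div_mul_left _ _ two_ne_zero, softSgn]

theorem contDiff_softAbs {κ : ℝ} (hκ : κ ≠ 0) {n : WithTop ℕ∞} : ContDiff ℝ n (softAbs κ) := by
  unfold softAbs
  exact ContDiff.sqrt (by fun_prop) fun z => (sq_add_sq_pos hκ z).ne'

theorem continuous_softSgn {κ : ℝ} (hκ : κ ≠ 0) : Continuous (softSgn κ) := by
  unfold softSgn
  exact continuous_id.div (by fun_prop) fun z => (Real.sqrt_pos.2 (sq_add_sq_pos hκ z)).ne'

/-- `softAbs κ z` is the modulus of the complex number `z + iκ`, so convexity is the triangle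
inequality. -/
theorem convexOn_softAbs (κ : ℝ) : ConvexOn ℝ univ (softAbs κ) := by
  have h : ∀ z, softAbs κ z = ‖(⟨z, κ⟩ : ℂ)‖ := fun z => by
    rw [softAbs, Complex.norm_def, Complex.normSq_mk, sq, sq]
  refine ⟨convex_univ, fun x _ y _ a b ha hb hab => ?_⟩
  simp only [h, smul_eq_mul]
  have e : (⟨a * x + b * y, κ⟩ : ℂ) = (a : ℂ) * ⟨x, κ⟩ + (b : ℂ) * ⟨y, κ⟩ := by
    apply Complex.ext
    · simp
    · simp [← add_mul, hab]
  rw [e]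
  refine (norm_add_le _ _).trans (le_of_eq ?_)
  simp [abs_of_nonneg ha, abs_of_nonneg hb]

theorem abs_le_softAbs (κ z : ℝ) : |z| ≤ softAbs κ z :=
  Real.abs_le_sqrt (by nlinarith [sq_nonneg κ])

theorem softAbs_le (κ z : ℝ) : softAbs κ z ≤ |z| + |κ| := by
  refine Real.sqrt_le_iff.2 ⟨by positivity, ?_⟩
  rw [add_sq, sq_abs, sq_abs]
  nlinarith [mul_nonneg (abs_nonneg z) (abs_nonneg κ)]

theorem softAbs_nonneg (κ z : ℝ) : 0 ≤ softAbs κ z := Real.sqrt_nonneg _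

theorem abs_softSgn_le (κ z : ℝ) : |softSgn κ z| ≤ 1 := by
  rw [softSgn, abs_div, abs_of_nonneg (Real.sqrt_nonneg _)]
  exact div_le_one_of_le₀ (abs_le_softAbs κ z) (Real.sqrt_nonneg _)

/-- A sequence of parameters tending to `0`. -/
def softParam (n : ℕ) : ℝ := 1 / ((n : ℝ) + 1)

theorem softParam_pos (n : ℕ) : 0 < softParam n := by unfold softParam; positivity

theorem softParam_le_one (n : ℕ) : softParam n ≤ 1 := by
  unfold softParam
  exact div_le_one_of_le₀ (by linarith [Nat.cast_nonneg (α := ℝ) n]) (by positivity)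

theorem tendsto_softParam : Tendsto softParam atTop (𝓝 0) := tendsto_one_div_add_atTop_nhds_zero_nat

theorem tendsto_softAbs (z : ℝ) : Tendsto (fun n => softAbs (softParam n) z) atTop (𝓝 |z|) := by
  have h : Continuous fun κ : ℝ => √(z ^ 2 + κ ^ 2) := by fun_prop
  have := (h.tendsto 0).comp tendsto_softParam
  simpa [Real.sqrt_sq_eq_abs, softAbs, Function.comp_def] using this

theorem tendsto_softSgn (z : ℝ) : Tendsto (fun n => softSgn (softParam n) z) atTop (𝓝 (sgn z)) := by
  rcases eq_or_ne z 0 with rfl | h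
  · simp [softSgn, sgn]
  · exact tendsto_const_nhds.div (tendsto_softAbs z) (abs_ne_zero.2 h)

/-! ### Convergence of integrals -/

/-- Split `F n * k n` into `(F n - f) * k n`, small in `L¹` since `k n` is bounded, and `f * k n`,
to which dominated convergence applies. -/
theorem tendsto_integral_mul_of_tendsto_L1 {X : Type*} [MeasurableSpace X] {μ : Measure X}
    {f : X → ℝ} {F : ℕ → X → ℝ}
    (hF : ∀ n, Integrable (F n) μ) (hf : Integrable f μ)
    (h : Tendsto (fun n => ∫ x, |F n x - f x| ∂μ) atTop (𝓝 0)) {k : ℕ → X → ℝ} {B : ℝ}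
    (hk : ∀ n, AEStronglyMeasurable (k n) μ) (hB : ∀ n, ∀ᵐ x ∂μ, |k n x| ≤ B)
    {l : X → ℝ} (hl : ∀ᵐ x ∂μ, Tendsto (fun n => k n x) atTop (𝓝 (l x))) :
    Tendsto (fun n => ∫ x, F n x * k n x ∂μ) atTop (𝓝 (∫ x, f x * l x ∂μ)) := by
  have h1 : Tendsto (fun n => ∫ x, f x * k n x ∂μ) atTop (𝓝 (∫ x, f x * l x ∂μ)) := by
    refine tendsto_integral_of_dominated_convergence (fun x => |f x| * B)
      (fun n => hf.aestronglyMeasurable.mul (hk n)) (hf.abs.mul_const _) (fun n => ?_) ?_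
    · filter_upwards [hB n] with x hx
      rw [norm_mul, Real.norm_eq_abs, Real.norm_eq_abs]
      exact mul_le_mul_of_nonneg_left hx (abs_nonneg _)
    · filter_upwards [hl] with x hx
      exact hx.const_mul _
  have h2 : Tendsto (fun n => ∫ x, (F n x - f x) * k n x ∂μ) atTop (𝓝 0) := by
    refine squeeze_zero_norm (fun n => ?_) (by simpa using h.mul_const B)
    calc ‖∫ x, (F n x - f x) * k n x ∂μ‖ ≤ ∫ x, |F n x - f x| * B ∂μ := by
          refine norm_integral_le_of_norm_le (((hF n).sub hf).abs.mul_const _) ?_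
          filter_upwards [hB n] with x hx
          rw [norm_mul, Real.norm_eq_abs, Real.norm_eq_abs]
          exact mul_le_mul_of_nonneg_left hx (abs_nonneg _)
      _ = _ := integral_mul_const _ _
  have h3 := h2.add h1
  rw [zero_add] at h3
  refine h3.congr fun n => ?_
  have i1 : Integrable (fun x => (F n x - f x) * k n x) μ :=
    ((hF n).sub hf).mul_bdd (hk n) (hB n)
  have i2 : Integrable (fun x => f x * k n x) μ := hf.mul_bdd (hk n) (hB n)
  rw [← integral_add i1 i2]
  congr 1; ext x; ring

theorem tendsto_integral_conv_mollifier_mul {f : Torus d → ℝ} (hf : Integrable f)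
    {k : Torus d → ℝ} {B : ℝ} (hk : AEStronglyMeasurable k volume) (hB : ∀ᵐ x, |k x| ≤ B) :
    Tendsto (fun n => ∫ x, conv f (mollifier n) x * k x) atTop (𝓝 (∫ x, f x * k x)) :=
  tendsto_integral_mul_of_tendsto_L1
    (fun n => integrable_of_continuous (Integrable.conv_mollifier hf n)) hf
    (tendsto_integral_abs_conv_mollifier_sub hf) (fun _ => hk) (fun _ => hB)
    (Eventually.of_forall fun _ => tendsto_const_nhds)

theorem abs_conv_mollifier_le {f : Torus d → ℝ} {B : ℝ} (hB : ∀ᵐ x, |f x| ≤ B) (n : ℕ)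
    (x : Torus d) : |conv f (mollifier n) x| ≤ B := by
  have hm : Integrable fun y => mollifier n (x - y) :=
    (integrable_of_continuous (continuous_mollifier n)).comp_sub_left x
  calc |conv f (mollifier n) x| ≤ ∫ y, B * mollifier n (x - y) := by
        rw [← Real.norm_eq_abs]
        refine norm_integral_le_of_norm_le (hm.const_mul _) ?_
        filter_upwards [hB] with y hy
        rw [norm_mul, Real.norm_eq_abs, Real.norm_eq_abs,
          abs_of_nonneg (mollifier_nonneg n (x - y))]
        exact mul_le_mul_of_nonneg_right hy (mollifier_nonneg _ _)
    _ = B := by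
        rw [integral_const_mul, integral_sub_left_eq_self (fun y => mollifier n y) volume x,
          integral_mollifier, mul_one]

/-! ### Chain rules for weak gradients -/

namespace HasWeakGradient

variable {f : Torus d → ℝ} {F : Torus d → Vec d}

theorem conv_partialDeriv (h : HasWeakGradient f F) {φ : Torus d → ℝ} (hφ : IsSmooth φ)
    (i : Fin d) (x : Torus d) :
    conv f (partialDeriv i φ) x = conv (fun y => F y i) φ x := by
  have h1 := h.integral_eq (fun y => φ (x - y)) (TorusContDiff.comp_sub_left hφ x) i
  simp_rw [partialDeriv_comp_sub_left hφ.contDiffOne, mul_neg, integral_neg] at h1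
  exact neg_injective h1

/-- The classical chain rule holds for the mollifications of `f`, whose gradients are the
mollifications of `F`. Along a subsequence the functions converge almost everywhere and boundedly,
and the gradients converge in `L¹`. Since mollification keeps the values in `[-B, B]`, no global
bound on `η` or its derivative is required. -/
theorem chain (h : HasWeakGradient f F) {B : ℝ} (hB : ∀ᵐ x, |f x| ≤ B) {η : ℝ → ℝ}
    (hη : ContDiff ℝ 1 η) : HasWeakGradient (fun x => η (f x)) fun x => deriv η (f x) • F x := by
  have hη' : Continuous (deriv η) := hη.continuous_deriv le_rfl
  obtain ⟨L, hL⟩ := (isCompact_Icc (a := -B) (b := B)).exists_bound_of_continuousOn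
    hη'.continuousOn
  obtain ⟨M, hM⟩ := (isCompact_Icc (a := -B) (b := B)).exists_bound_of_continuousOn
    hη.continuous.continuousOn
  have hfm := h.integrable_fun.aestronglyMeasurable
  have hmem : ∀ᵐ x, f x ∈ Icc (-B) B := by
    filter_upwards [hB] with x hx
    exact abs_le.1 hx
  refine ⟨?_, ?_, fun φ hφ i => ?_⟩
  · refine (integrable_const M).mono' (hη.continuous.comp_aestronglyMeasurable hfm) ?_
    filter_upwards [hmem] with x hx
    exact hM _ hx
  · refine h.integrable_grad.bdd_smul L (hη'.comp_aestronglyMeasurable hfm) ?_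
    filter_upwards [hmem] with x hx
    exact hL _ hx
  · obtain ⟨ns, hns, hlim⟩ := exists_seq_tendsto_conv_mollifier h.integrable_fun
    have hfi := h.integrable_apply i
    obtain ⟨P, -, hP⟩ := TorusContDiff.exists_bound hφ
    obtain ⟨Q, -, hQ⟩ := hφ.contDiffOne.exists_bound_partialDeriv i
    have hsm : ∀ n, IsSmooth (conv f (mollifier n)) := fun n =>
      isSmooth_conv h.integrable_fun (isSmooth_mollifier n)
    have hmem' : ∀ n x, conv f (mollifier n) x ∈ Icc (-B) B := fun n x =>
      abs_le.1 (abs_conv_mollifier_le hB n x)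
    have hcf : ∀ n, Continuous (conv f (mollifier n)) := fun n => (hsm n).continuous
    have hcφ := hφ.continuous
    have e1 : ∀ n, ∫ x, η (conv f (mollifier (ns n)) x) * partialDeriv i φ x =
        -∫ x, conv (fun y => F y i) (mollifier (ns n)) x *
          (deriv η (conv f (mollifier (ns n)) x) * φ x) := by
      intro n
      rw [integral_mul_partialDeriv (TorusContDiff.comp hη (hsm _).contDiffOne) hφ.contDiffOne]
      congr 2; ext x
      rw [partialDeriv_comp (hη.differentiable one_ne_zero _) (hsm _).contDiffOne,
        partialDeriv_conv h.integrable_fun (isSmooth_mollifier _),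
        h.conv_partialDeriv (isSmooth_mollifier _)]
      ring
    have t1 : Tendsto (fun n => ∫ x, η (conv f (mollifier (ns n)) x) * partialDeriv i φ x) atTop
        (𝓝 (∫ x, η (f x) * partialDeriv i φ x)) := by
      refine tendsto_integral_of_dominated_convergence (fun _ => M * Q)
        (fun n => ((hη.continuous.comp (hcf _)).mul
          (hφ.contDiffOne.continuous_partialDeriv i)).aestronglyMeasurable)
        (integrable_const _) (fun n => Eventually.of_forall fun x => ?_) ?_
      · rw [norm_mul]
        exact mul_le_mul (hM _ (hmem' _ x)) (hQ x) (norm_nonneg _)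
          ((norm_nonneg _).trans (hM _ (hmem' (ns n) x)))
      · filter_upwards [hlim] with x hx
        exact ((hη.continuous.tendsto _).comp hx).mul_const _
    have t2 := tendsto_integral_mul_of_tendsto_L1 (B := L * P)
      (F := fun n => conv (fun y => F y i) (mollifier (ns n)))
      (k := fun n x => deriv η (conv f (mollifier (ns n)) x) * φ x)
      (l := fun x => deriv η (f x) * φ x)
      (fun n => integrable_of_continuous (Integrable.conv_mollifier hfi _)) hfi
      ((tendsto_integral_abs_conv_mollifier_sub hfi).comp hns.tendsto_atTop)
      (fun n => ((hη'.comp (hcf _)).mul hcφ).aestronglyMeasurable)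
      (fun n => Eventually.of_forall fun x => ?_) ?_
    · simp_rw [e1] at t1
      rw [tendsto_nhds_unique t1 t2.neg]
      congr 2; ext x
      simp only [PiLp.smul_apply, smul_eq_mul]
      ring
    · rw [abs_mul]
      exact mul_le_mul (hL _ (hmem' _ x)) (hP x) (abs_nonneg _)
          ((norm_nonneg _).trans (hL _ (hmem' (ns n) x)))
    · filter_upwards [hlim] with x hx
      exact ((hη'.tendsto _).comp hx).mul_const _

/-- The weak gradient of `|c - f|`. -/
theorem integral_abs_sub_mul_partialDeriv (h : HasWeakGradient f F) {B : ℝ}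
    (hB : ∀ᵐ x, |f x| ≤ B) (c : ℝ) {φ : Torus d → ℝ} (hφ : IsSmooth φ) (i : Fin d) :
    ∫ x, |c - f x| * partialDeriv i φ x = ∫ x, sgn (c - f x) * F x i * φ x := by
  obtain ⟨P, -, hP⟩ := TorusContDiff.exists_bound hφ
  obtain ⟨Q, -, hQ⟩ := hφ.contDiffOne.exists_bound_partialDeriv i
  have hfm := h.integrable_fun.aestronglyMeasurable
  have hfi := h.integrable_apply i
  have hη : ∀ n, ContDiff ℝ 1 fun s => softAbs (softParam n) (c - s) := fun n =>
    (contDiff_softAbs (softParam_pos n).ne').comp (contDiff_const.sub contDiff_id)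
  have hd : ∀ n s, deriv (fun s => softAbs (softParam n) (c - s)) s =
      -softSgn (softParam n) (c - s) := fun n s => by
    have := ((hasDerivAt_softAbs (softParam_pos n).ne' (c - s)).comp s
      ((hasDerivAt_id s).const_sub c)).deriv
    rw [mul_neg_one] at this
    exact this
  have e1 : ∀ n, ∫ x, softAbs (softParam n) (c - f x) * partialDeriv i φ x =
      ∫ x, softSgn (softParam n) (c - f x) * F x i * φ x := by
    intro n
    rw [(h.chain hB (hη n)).integral_eq φ hφ i, ← integral_neg]
    congr 1; ext x
    rw [hd]
    simp
  have t1 : Tendsto (fun n => ∫ x, softAbs (softParam n) (c - f x) * partialDeriv i φ x) atTop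
      (𝓝 (∫ x, |c - f x| * partialDeriv i φ x)) := by
    refine tendsto_integral_of_dominated_convergence (fun _ => (|c| + B + 1) * Q)
      (fun n => ((contDiff_softAbs (softParam_pos n).ne' (n := 0)).continuous
        |>.comp_aestronglyMeasurable (aestronglyMeasurable_const.sub hfm)).mul
        (hφ.contDiffOne.continuous_partialDeriv i).aestronglyMeasurable)
      (integrable_const _) (fun n => ?_) ?_
    · filter_upwards [hB] with x hx
      rw [norm_mul, Real.norm_eq_abs, Real.norm_eq_abs, abs_of_nonneg (softAbs_nonneg _ _)]
      have h1 := softAbs_le (softParam n) (c - f x)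
      rw [abs_of_pos (softParam_pos n)] at h1
      have h2 : |c - f x| ≤ |c| + |f x| := abs_sub _ _
      exact mul_le_mul (by linarith [softParam_le_one n]) (hQ x) (abs_nonneg _)
        (by linarith [abs_nonneg c, abs_nonneg (f x)])
    · exact Eventually.of_forall fun x => (tendsto_softAbs _).mul_const _
  have t2 : Tendsto (fun n => ∫ x, softSgn (softParam n) (c - f x) * F x i * φ x) atTop
      (𝓝 (∫ x, sgn (c - f x) * F x i * φ x)) := by
    refine tendsto_integral_of_dominated_convergence (fun x => 1 * |F x i| * P)
      (fun n => (((continuous_softSgn (softParam_pos n).ne').comp_aestronglyMeasurable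
        (aestronglyMeasurable_const.sub hfm)).mul hfi.aestronglyMeasurable).mul
        hφ.continuous.aestronglyMeasurable)
      ((hfi.abs.const_mul _).mul_const _) (fun n => Eventually.of_forall fun x => ?_) ?_
    · rw [norm_mul, norm_mul, Real.norm_eq_abs, Real.norm_eq_abs, Real.norm_eq_abs]
      have := abs_softSgn_le (softParam n) (c - f x)
      have := hP x
      gcongr
    · exact Eventually.of_forall fun x => ((tendsto_softSgn _).mul_const _).mul_const _
  simp_rw [e1] at t1
  exact tendsto_nhds_unique t1 t2

end HasWeakGradient

/-! ### The convolution field -/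

theorem inner_grad (a : Vec d) (φ : Torus d → ℝ) (x : Torus d) :
    inner ℝ a (grad φ x) = ∑ i, a i * partialDeriv i φ x := by
  simp [grad, PiLp.inner_apply, mul_comm]

theorem inner_eq_sum (a b : Vec d) : inner ℝ a b = ∑ i, a i * b i := by
  simp [PiLp.inner_apply, mul_comm]

section ConvField

variable {K : Torus d → Vec d} {f : Torus d → ℝ} {M : ℝ}

theorem integrable_convField_integrand (hK : Integrable K) (hf : AEStronglyMeasurable f volume)
    (hM : ∀ᵐ x, |f x| ≤ M) (x : Torus d) : Integrable fun y => f y • K (x - y) :=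
  (hK.comp_sub_left x).bdd_smul M hf hM

theorem norm_convField_le (hK : Integrable K) (hM : ∀ᵐ x, |f x| ≤ M) (x : Torus d) :
    ‖convField K f x‖ ≤ M * ∫ y, ‖K y‖ := by
  have hKx : Integrable fun y => ‖K (x - y)‖ := (hK.comp_sub_left x).norm
  calc ‖convField K f x‖ ≤ ∫ y, M * ‖K (x - y)‖ := by
        refine norm_integral_le_of_norm_le (hKx.const_mul _) ?_
        filter_upwards [hM] with y hy
        rw [norm_smul]
        exact mul_le_mul_of_nonneg_right hy (norm_nonneg _)
    _ = _ := by
        rw [integral_const_mul, integral_sub_left_eq_self (fun y => ‖K y‖) volume x]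

theorem norm_convField_sub_le (hK : Integrable K) (hf : AEStronglyMeasurable f volume)
    (hM : ∀ᵐ x, |f x| ≤ M) (x x' : Torus d) :
    ‖convField K f x - convField K f x'‖ ≤ M * transMod K (x - x') := by
  have h1 : Integrable fun y => ‖K (x - y) - K (x' - y)‖ :=
    ((hK.comp_sub_left x).sub (hK.comp_sub_left x')).norm
  unfold convField
  rw [← integral_sub (integrable_convField_integrand hK hf hM x)
    (integrable_convField_integrand hK hf hM x'), ← integral_norm_comp_sub, ← integral_const_mul]
  refine norm_integral_le_of_norm_le (h1.const_mul _) ?_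
  filter_upwards [hM] with y hy
  rw [← smul_sub, norm_smul]
  exact mul_le_mul_of_nonneg_right hy (norm_nonneg _)

theorem continuous_convField (hK : Integrable K) (hf : AEStronglyMeasurable f volume)
    (hM : ∀ᵐ x, |f x| ≤ M) : Continuous (convField K f) := by
  refine continuous_iff_continuousAt.2 fun x => ?_
  rw [ContinuousAt, tendsto_iff_norm_sub_tendsto_zero]
  have h : Continuous fun y => M * transMod K (y - x) :=
    continuous_const.mul ((continuous_transMod hK).comp (by fun_prop))
  have h0 := h.tendsto x
  simp only [sub_self, transMod_zero, mul_zero] at h0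
  exact squeeze_zero (fun _ => norm_nonneg _)
    (fun y => norm_convField_sub_le hK hf hM y x) h0

theorem convField_apply (hK : Integrable K) (hf : AEStronglyMeasurable f volume)
    (hM : ∀ᵐ x, |f x| ≤ M) (x : Torus d) (i : Fin d) :
    convField K f x i = conv f (fun y => K y i) x :=
  ((coord i).integral_comp_comm (integrable_convField_integrand hK hf hM x)).symm

theorem convField_sub {f' : Torus d → ℝ} (hK : Integrable K) (hf : AEStronglyMeasurable f volume)
    (hf' : AEStronglyMeasurable f' volume)
    (hM : ∀ᵐ x, |f x| ≤ M) (hM' : ∀ᵐ x, |f' x| ≤ M) (x : Torus d) :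
    convField K (fun x => f x - f' x) x = convField K f x - convField K f' x := by
  unfold convField
  rw [← integral_sub (integrable_convField_integrand hK hf hM x)
    (integrable_convField_integrand hK hf' hM' x)]
  simp_rw [sub_smul]

/-- Tonelli's theorem: the convolution variable is integrated last, so only the supremum over `z` of
`∫ |K(y - z)| |F(y)| dy` is involved. The bound is by the `L¹` norm of `f`, although `K ∗ f` itself
is not bounded by that norm. -/
theorem lintegral_mul_convField_le {F : Torus d → Vec d} {D : ℝ≥0∞}
    (hK : AEStronglyMeasurable K volume) (hF : AEStronglyMeasurable F volume)
    (hf : AEStronglyMeasurable f volume)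
    (h : ∀ z, ∫⁻ y, ‖K (y - z)‖ₑ * ‖F y‖ₑ ≤ D) :
    ∫⁻ y, ‖F y‖ₑ * ‖convField K f y‖ₑ ≤ D * ∫⁻ z, ‖f z‖ₑ := by
  have hKp : AEMeasurable (fun p : Torus d × Torus d => ‖K (p.1 - p.2)‖ₑ)
      (volume.prod volume) :=
    (hK.comp_quasiMeasurePreserving (quasiMeasurePreserving_sub volume volume)).enorm
  calc ∫⁻ y, ‖F y‖ₑ * ‖convField K f y‖ₑ
      ≤ ∫⁻ y, ∫⁻ z, ‖F y‖ₑ * (‖f z‖ₑ * ‖K (y - z)‖ₑ) := by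
        refine lintegral_mono fun y => ?_
        rw [lintegral_const_mul' _ _ enorm_ne_top]
        gcongr
        refine (enorm_integral_le_lintegral_enorm _).trans (le_of_eq ?_)
        simp_rw [enorm_smul]
    _ = ∫⁻ z, ∫⁻ y, ‖F y‖ₑ * (‖f z‖ₑ * ‖K (y - z)‖ₑ) :=
        lintegral_lintegral_swap (hF.comp_fst.enorm.mul (hf.comp_snd.enorm.mul hKp))
    _ ≤ ∫⁻ z, ‖f z‖ₑ * D := by
        refine lintegral_mono fun z => ?_
        calc _ = ∫⁻ y, ‖f z‖ₑ * (‖K (y - z)‖ₑ * ‖F y‖ₑ) := by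
              congr 1; ext y; ring
          _ ≤ _ := by
              rw [lintegral_const_mul' _ _ enorm_ne_top]
              gcongr
              exact h z
    _ = D * ∫⁻ z, ‖f z‖ₑ := by
        rw [lintegral_mul_const'' _ hf.enorm, mul_comm]

end ConvField

namespace IsGreenKernel

variable {g : Torus d → ℝ} {K : Torus d → Vec d} {f : Torus d → ℝ} {M : ℝ}

/-- The equation of the kernel is tested with a translate of `φ` and one derivative is moved onto
`g`: the field `K(· - y)` has divergence `1 - δ_y`. -/
theorem integral_inner_grad (h : IsGreenKernel g K) {φ : Torus d → ℝ} (hφ : IsSmooth φ)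
    (y : Torus d) :
    ∑ i, ∫ x, K (x - y) i * partialDeriv i φ x = φ y - ∫ x, φ x := by
  have hs : IsSmooth fun z => φ (z + y) := TorusContDiff.comp_add_right hφ y
  have e0 : ∀ i, partialDeriv i (fun z => φ (z + y)) = fun z => partialDeriv i φ (z + y) := by
    intro i; ext z
    simpa using partialDeriv_comp_sub_right (φ := φ) (-y) i z
  have h1 := h.equation _ hs
  simp only [zero_add] at h1
  rw [integral_add_right_eq_self φ y] at h1
  rw [← h1]
  unfold laplacian
  simp_rw [Finset.mul_sum]
  rw [integral_finsetSum _ fun i _ => Integrable.mul_continuous h.gradient.integrable_fun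
    ((hs.partialDeriv i).partialDeriv i).continuous, ← Finset.sum_neg_distrib]
  refine Finset.sum_congr rfl fun i _ => ?_
  rw [h.gradient.integral_eq _ (hs.partialDeriv i) i, neg_neg, e0,
    ← integral_add_right_eq_self (fun x => K (x - y) i * partialDeriv i φ x) y]
  simp

/-- The field `∇g ∗ f` has divergence `f̄ - f`. -/
theorem integral_inner_convField_grad (h : IsGreenKernel g K)
    (hf : AEStronglyMeasurable f volume) (hM : ∀ᵐ x, |f x| ≤ M) {φ : Torus d → ℝ}
    (hφ : IsSmooth φ) :
    ∫ x, inner ℝ (convField K f x) (grad φ x) = ∫ x, (f x - ∫ y, f y) * φ x := by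
  have hK := h.gradient.integrable_grad
  have hfi : Integrable f := (integrable_const M).mono' hf hM
  have hcb := continuous_convField hK hf hM
  have hfint : ∀ i, Integrable (fun p : Torus d × Torus d =>
      f p.2 * K (p.1 - p.2) i * partialDeriv i φ p.1) (volume.prod volume) := by
    intro i
    obtain ⟨B, -, hB⟩ := hφ.contDiffOne.exists_bound_partialDeriv i
    exact (integrable_comp_sub_prod hfi (h.gradient.integrable_apply i)).mul_bdd
      ((hφ.contDiffOne.continuous_partialDeriv i).comp continuous_fst).aestronglyMeasurable
      (Eventually.of_forall fun p => hB p.1)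
  have e1 : ∀ i, ∫ x, convField K f x i * partialDeriv i φ x =
      ∫ y, f y * ∫ x, K (x - y) i * partialDeriv i φ x := by
    intro i
    calc _ = ∫ x, ∫ y, f y * K (x - y) i * partialDeriv i φ x := by
          congr 1; ext x
          rw [convField_apply hK hf hM, conv, integral_mul_const]
      _ = ∫ y, ∫ x, f y * K (x - y) i * partialDeriv i φ x :=
          integral_integral_swap (f := fun x y => f y * K (x - y) i * partialDeriv i φ x) (hfint i)
      _ = _ := by
          congr 1; ext y
          rw [← integral_const_mul]
          simp_rw [mul_assoc]
  have hint2 : ∀ i, Integrable fun y => f y * ∫ x, K (x - y) i * partialDeriv i φ x := by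
    intro i
    refine (hfint i).integral_prod_right.congr (Eventually.of_forall fun y => ?_)
    simp only
    rw [← integral_const_mul]
    simp_rw [mul_assoc]
  simp_rw [inner_grad]
  have hint3 : ∀ i, Integrable fun x => convField K f x i * partialDeriv i φ x := fun i =>
    integrable_of_continuous (((coord i).continuous.comp hcb).mul
      (hφ.contDiffOne.continuous_partialDeriv i))
  rw [integral_finsetSum _ fun i _ => hint3 i]
  simp_rw [e1]
  rw [← integral_finsetSum _ fun i _ => hint2 i]
  simp_rw [← Finset.mul_sum, h.integral_inner_grad hφ, mul_sub, sub_mul]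
  rw [integral_sub (Integrable.mul_continuous hfi hφ.continuous) (hfi.mul_const _),
    integral_sub (Integrable.mul_continuous hfi hφ.continuous)
      ((integrable_of_continuous hφ.continuous).const_mul _), integral_mul_const,
    integral_const_mul]

/-- With `χ = mollifier n (x - ·)`, the function `g ∗ χ` has gradient `K ∗ χ` and Laplacian `1 - χ`.
Testing the weak gradient of `f` with its derivatives shows that the mollification of `f - f̄` at
`x` is `∫ F · (K ∗ χ)`, at most `D` because `χ` has mass one. The bound does not depend on `n` and
passes to the limit. -/
theorem ae_abs_sub_integral_le {F : Torus d → Vec d} (h : IsGreenKernel g K)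
    (hf : HasWeakGradient f F) {D : ℝ} (hD0 : 0 ≤ D)
    (hD : ∀ z, ∫⁻ y, ‖K (y - z)‖ₑ * ‖F y‖ₑ ≤ ENNReal.ofReal D) :
    ∀ᵐ x, |f x - ∫ y, f y| ≤ D := by
  have hK := h.gradient.integrable_grad
  have hfi := hf.integrable_fun
  refine ae_abs_le_of_conv_mollifier_le (f := fun x => f x - ∫ y, f y)
    (hfi.sub (integrable_const _)) fun n x => ?_
  set χ : Torus d → ℝ := fun y => mollifier n (x - y) with hχ
  have hχs : IsSmooth χ := TorusContDiff.comp_sub_left (isSmooth_mollifier n) x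
  have hχi : Integrable χ := integrable_of_continuous hχs.continuous
  have hχ1 : ∫ y, χ y = 1 := by
    rw [hχ, integral_sub_left_eq_self (fun y => mollifier n y) volume x, integral_mollifier]
  obtain ⟨P, -, hP⟩ := TorusContDiff.exists_bound hχs
  have hχm := hχs.continuous.aestronglyMeasurable (μ := (volume : Measure (Torus d)))
  have hχb := continuous_convField hK hχm (Eventually.of_forall hP)
  have hgi := h.gradient.integrable_fun
  have hξ : IsSmooth (conv g χ) := isSmooth_conv hgi hχs
  have hgrad : ∀ i y, partialDeriv i (conv g χ) y = convField K χ y i := fun i y => by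
    rw [partialDeriv_conv hgi hχs, h.gradient.conv_partialDeriv hχs,
      convField_apply hK hχm (Eventually.of_forall hP), conv_eq]
    rfl
  have hlap : laplacian (conv g χ) = fun y => 1 - χ y := by
    ext y
    have hp : ∀ i, partialDeriv i (conv g χ) = conv g (partialDeriv i χ) := fun i =>
      funext fun x => partialDeriv_conv hgi hχs i x
    rw [← hχ1, ← h.conv_laplacian hχs]
    unfold laplacian
    simp_rw [hp, fun i => partialDeriv_conv hgi (hχs.partialDeriv i) i y]
    unfold conv
    rw [← integral_finsetSum _ fun i _ => Integrable.mul_comp_sub hgi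
      ((hχs.partialDeriv i).partialDeriv i).continuous y]
    simp_rw [Finset.mul_sum]
  have hFb : ∀ i, Integrable fun y => F y i * convField K χ y i := fun i =>
    Integrable.mul_continuous (hf.integrable_apply i) ((coord i).continuous.comp hχb)
  have e1 : conv (fun x => f x - ∫ y, f y) (mollifier n) x =
      ∫ y, inner ℝ (F y) (convField K χ y) := by
    have h1 : ∫ y, f y * laplacian (conv g χ) y = -∑ i, ∫ y, F y i * convField K χ y i := by
      unfold laplacian
      simp_rw [Finset.mul_sum]
      rw [integral_finsetSum _ fun i _ => Integrable.mul_continuous hfi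
        ((hξ.partialDeriv i).partialDeriv i).continuous, ← Finset.sum_neg_distrib]
      refine Finset.sum_congr rfl fun i _ => ?_
      rw [hf.integral_eq _ (hξ.partialDeriv i) i]
      simp_rw [hgrad]
    rw [hlap] at h1
    have hfχ := Integrable.mul_continuous hfi hχs.continuous
    simp_rw [mul_sub, mul_one] at h1
    rw [integral_sub hfi hfχ] at h1
    simp_rw [inner_eq_sum]
    rw [integral_finsetSum _ fun i _ => hFb i]
    have h2 : conv (fun x => f x - ∫ y, f y) (mollifier n) x =
        (∫ y, f y * χ y) - ∫ y, f y := by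
      unfold conv
      simp_rw [sub_mul]
      rw [integral_sub hfχ (hχi.const_mul _), integral_const_mul, hχ1, mul_one]
    rw [h2]; linarith
  have e2 : ∫⁻ y, ‖inner ℝ (F y) (convField K χ y)‖ₑ ≤ ENNReal.ofReal D := by
    calc _ ≤ ∫⁻ y, ‖F y‖ₑ * ‖convField K χ y‖ₑ := by
          refine lintegral_mono fun y => ?_
          rw [← ofReal_norm, ← ofReal_norm, ← ofReal_norm,
            ← ENNReal.ofReal_mul (norm_nonneg _)]
          exact ENNReal.ofReal_le_ofReal (norm_inner_le_norm _ _)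
      _ ≤ ENNReal.ofReal D * ∫⁻ z, ‖χ z‖ₑ := lintegral_mul_convField_le hK.aestronglyMeasurable
          hf.integrable_grad.aestronglyMeasurable hχm hD
      _ = ENNReal.ofReal D := by
          have : ∫⁻ z, ‖χ z‖ₑ = ENNReal.ofReal (∫ z, ‖χ z‖) :=
            (ofReal_integral_norm_eq_lintegral_enorm hχi).symm
          rw [this]
          simp_rw [Real.norm_eq_abs, hχ, abs_of_nonneg (mollifier_nonneg n _)]
          rw [← hχ, hχ1]; simp
  rw [e1, ← Real.norm_eq_abs]
  have e3 := (enorm_integral_le_lintegral_enorm (μ := (volume : Measure (Torus d)))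
    fun y => inner ℝ (F y) (convField K χ y)).trans e2
  rw [← ofReal_norm] at e3
  exact (ENNReal.ofReal_le_ofReal_iff hD0).1 e3

/-- The divergence of `V ∇g ∗ f`. -/
theorem integral_mul_inner_convField_grad (h : IsGreenKernel g K) {V : Torus d → ℝ}
    {F : Torus d → Vec d} (hV : HasWeakGradient V F)
    (hf : AEStronglyMeasurable f volume) (hM : ∀ᵐ x, |f x| ≤ M)
    {φ : Torus d → ℝ} (hφ : IsSmooth φ) :
    ∫ x, V x * inner ℝ (convField K f x) (grad φ x) =
      -∫ x, (inner ℝ (F x) (convField K f x) - V x * (f x - ∫ y, f y)) * φ x := by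
  have hK := h.gradient.integrable_grad
  have hVi := hV.integrable_fun
  have hfi : Integrable f := (integrable_const M).mono' hf hM
  have hcb := continuous_convField hK hf hM
  have hbi : ∀ i, Continuous fun x => convField K f x i := fun i => (coord i).continuous.comp hcb
  have hcφ := hφ.continuous
  have hpφ : ∀ i, Continuous (partialDeriv i φ) := fun i =>
    hφ.contDiffOne.continuous_partialDeriv i
  obtain ⟨P, hP0, hP⟩ := TorusContDiff.exists_bound hφ
  have hbg : Continuous fun x => inner ℝ (convField K f x) (grad φ x) := by
    simp_rw [inner_grad]
    exact continuous_finsetSum _ fun i _ => (hbi i).mul (hpφ i)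
  have bdd : ∀ {k : Torus d → ℝ}, Continuous k → ∃ B, ∀ x, |k x| ≤ B := fun {k} hk => by
    obtain ⟨B, hB⟩ := isCompact_univ.exists_bound_of_continuousOn hk.continuousOn
    exact ⟨B, fun x => hB x (mem_univ x)⟩
  set m := ∫ y, f y
  have hsm : ∀ n, IsSmooth (conv V (mollifier n)) := fun n =>
    isSmooth_conv hVi (isSmooth_mollifier n)
  -- The divergence identity for `∇g ∗ f`, tested with `φ` times a mollification of `V`. Only the
  -- `L¹` convergence of the mollifications of `V` and of its gradient is needed in the limit, since
  -- all other factors are bounded.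
  have e1 : ∀ n, ∫ x, conv V (mollifier n) x * inner ℝ (convField K f x) (grad φ x) =
      (∫ x, conv V (mollifier n) x * ((f x - m) * φ x)) -
        ∑ i, ∫ x, conv (fun y => F y i) (mollifier n) x * (convField K f x i * φ x) := by
    intro n
    have h1 := h.integral_inner_convField_grad hf hM
      (φ := fun x => conv V (mollifier n) x * φ x) (TorusContDiff.mul (hsm n) hφ)
    have h2 : ∀ x, inner ℝ (convField K f x) (grad (fun x => conv V (mollifier n) x * φ x) x) =
        conv V (mollifier n) x * inner ℝ (convField K f x) (grad φ x) +
        ∑ i, conv (fun y => F y i) (mollifier n) x * (convField K f x i * φ x) := by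
      intro x
      rw [inner_grad, inner_grad, Finset.mul_sum, ← Finset.sum_add_distrib]
      refine Finset.sum_congr rfl fun i _ => ?_
      rw [partialDeriv_mul (hsm n).contDiffOne hφ.contDiffOne,
        partialDeriv_conv hVi (isSmooth_mollifier _), hV.conv_partialDeriv (isSmooth_mollifier _)]
      ring
    have hc : ∀ i, Continuous fun x => conv (fun y => F y i) (mollifier n) x *
        (convField K f x i * φ x) := fun i =>
      (Integrable.conv_mollifier (hV.integrable_apply i) n).mul ((hbi i).mul hcφ)
    simp_rw [h2] at h1
    have hc' : Continuous fun x =>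
        conv V (mollifier n) x * inner ℝ (convField K f x) (grad φ x) :=
      (hsm n).continuous.mul hbg
    rw [integral_add (integrable_of_continuous hc')
      (integrable_of_continuous (continuous_finsetSum _ fun i _ => hc i)),
      integral_finsetSum _ fun i _ => integrable_of_continuous (hc i)] at h1
    have h3 : ∫ x, (f x - m) * (conv V (mollifier n) x * φ x) =
        ∫ x, conv V (mollifier n) x * ((f x - m) * φ x) := by
      congr 1; ext x; ring
    linarith
  obtain ⟨B1, hB1⟩ := bdd hbg
  have t1 := tendsto_integral_conv_mollifier_mul hVi hbg.aestronglyMeasurable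
    (Eventually.of_forall hB1)
  have hfφm : AEStronglyMeasurable (fun x => (f x - m) * φ x) volume :=
    (hf.sub aestronglyMeasurable_const).mul hcφ.aestronglyMeasurable
  have hfφb : ∀ᵐ x, |(f x - m) * φ x| ≤ (M + |m|) * P := by
    filter_upwards [hM] with x hx
    rw [abs_mul]
    have h1 : |f x - m| ≤ |f x| + |m| := abs_sub _ _
    exact mul_le_mul (by linarith) (hP x) (abs_nonneg _)
      (by linarith [abs_nonneg (f x), abs_nonneg m])
  have t2 := tendsto_integral_conv_mollifier_mul hVi hfφm hfφb
  have t3 : Tendsto (fun n => ∑ i, ∫ x, conv (fun y => F y i) (mollifier n) x *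
      (convField K f x i * φ x)) atTop (𝓝 (∑ i, ∫ x, F x i * (convField K f x i * φ x))) := by
    refine tendsto_finsetSum _ fun i _ => ?_
    obtain ⟨B2, hB2⟩ := bdd ((hbi i).mul hcφ)
    exact tendsto_integral_conv_mollifier_mul (hV.integrable_apply i)
      ((hbi i).mul hcφ).aestronglyMeasurable (Eventually.of_forall hB2)
  simp_rw [e1] at t1
  rw [tendsto_nhds_unique t1 (t2.sub t3)]
  have i1 : Integrable fun x => V x * ((f x - m) * φ x) := hVi.mul_bdd hfφm hfφb
  have i2 : ∀ i, Integrable fun x => F x i * (convField K f x i * φ x) := fun i =>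
    Integrable.mul_continuous (hV.integrable_apply i) ((hbi i).mul hcφ)
  have i3 : Integrable fun x => ∑ i, F x i * (convField K f x i * φ x) :=
    integrable_finsetSum _ fun i _ => i2 i
  rw [← integral_finsetSum _ fun i _ => i2 i, ← integral_sub i1 i3, ← integral_neg]
  congr 1; ext x
  rw [inner_eq_sum]
  simp_rw [← mul_assoc]
  rw [← Finset.sum_mul]
  ring

end IsGreenKernel

/-! ### The weak gradient of a power -/

theorem HasWeakGradient.congr {f f' : Torus d → ℝ} {F F' : Torus d → Vec d}
    (h : HasWeakGradient f F) (hf : f =ᵐ[volume] f') (hF : F =ᵐ[volume] F') :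
    HasWeakGradient f' F' := by
  refine ⟨h.integrable_fun.congr hf, h.integrable_grad.congr hF, fun φ hφ i => ?_⟩
  have h1 : ∫ x, f' x * partialDeriv i φ x = ∫ x, f x * partialDeriv i φ x :=
    integral_congr_ae (by filter_upwards [hf] with x hx; rw [hx])
  have h2 : ∫ x, F' x i * φ x = ∫ x, F x i * φ x :=
    integral_congr_ae (by filter_upwards [hF] with x hx; rw [hx])
  rw [h1, h2, h.integral_eq φ hφ i]

/-- A `C¹` function equal to `s ^ p` for `s ≥ c` and vanishing near `0`. -/
def cutRpow (c p s : ℝ) : ℝ := Real.smoothTransition (4 * s / c - 2) * s ^ p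

theorem cutRpow_of_le {c p s : ℝ} (hc : 0 < c) (hs : s ≤ c / 2) : cutRpow c p s = 0 := by
  rw [cutRpow, Real.smoothTransition.zero_of_nonpos, zero_mul]
  rw [sub_nonpos, div_le_iff₀ hc]; linarith

theorem cutRpow_of_ge {c p s : ℝ} (hc : 0 < c) (hs : 3 * c / 4 ≤ s) : cutRpow c p s = s ^ p := by
  rw [cutRpow, Real.smoothTransition.one_of_one_le, one_mul]
  rw [le_sub_iff_add_le, le_div_iff₀ hc]; linarith

theorem contDiff_cutRpow {c : ℝ} (hc : 0 < c) (p : ℝ) : ContDiff ℝ 1 (cutRpow c p) := by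
  refine contDiff_iff_contDiffAt.2 fun s => ?_
  rcases lt_or_ge s (c / 2) with hs | hs
  · refine (contDiffAt_const (c := (0 : ℝ))).congr_of_eventuallyEq ?_
    filter_upwards [Iio_mem_nhds hs] with r hr
    exact cutRpow_of_le hc (le_of_lt hr)
  · have h1 : ContDiff ℝ 1 fun s : ℝ => Real.smoothTransition (4 * s / c - 2) :=
      Real.smoothTransition.contDiff.comp (by fun_prop)
    exact h1.contDiffAt.mul (Real.contDiffAt_rpow_const_of_ne (by linarith [half_pos hc]))

/-- With `p = m/(m-1)`, `f^m` is the `p`-th power of `f^(m-1)`, and the derivative of that power is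
`p f`. For `m > 1` one has `p ≥ 1` and the power is `C¹`. For `m < 1` the exponent is negative, but
`f ≤ M` keeps `f^(m-1)` away from `0` where `f > 0`, while the convention gives `f^(m-1) = 0` where
`f = 0`. The values thus leave a gap `(0, c)`, inside which the power can be cut off. -/
theorem hasWeakGradient_rpow {m : ℝ} (hm : 0 < m) (hm1 : m ≠ 1) {f : Torus d → ℝ}
    {W : Torus d → Vec d} {M B : ℝ} (hf0 : ∀ x, 0 ≤ f x) (hfM : ∀ x, f x ≤ M)
    (h : HasWeakGradient (fun x => f x ^ (m - 1)) W) (hB : ∀ᵐ x, |f x ^ (m - 1)| ≤ B) :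
    HasWeakGradient (fun x => f x ^ m) fun x => (m / (m - 1) * f x) • W x := by
  have hm0 : m - 1 ≠ 0 := sub_ne_zero.2 hm1
  set p := m / (m - 1) with hp
  have e1 : (m - 1) * p = m := by rw [hp]; field_simp
  have e2 : (m - 1) * (p - 1) = 1 := by rw [mul_sub, e1]; ring
  have key1 : ∀ x, (f x ^ (m - 1)) ^ p = f x ^ m := fun x => by
    rw [← Real.rpow_mul (hf0 x), e1]
  have key2 : ∀ x, (f x ^ (m - 1)) ^ (p - 1) = f x := fun x => by
    rw [← Real.rpow_mul (hf0 x), e2, Real.rpow_one]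
  rcases lt_or_gt_of_ne hm1 with hlt | hgt
  · set N := max M 1
    have hN : 0 < N := lt_of_lt_of_le one_pos (le_max_right _ _)
    set c := N ^ (m - 1) with hc
    have hc0 : 0 < c := Real.rpow_pos_of_pos hN _
    refine (h.chain hB (contDiff_cutRpow hc0 p)).congr (Eventually.of_forall fun x => ?_)
      (Eventually.of_forall fun x => ?_)
    · rcases (hf0 x).eq_or_lt with hx | hx
      · simp only [← hx, Real.zero_rpow hm0, Real.zero_rpow hm.ne']
        exact cutRpow_of_le hc0 (by linarith)
      · have h1 : c ≤ f x ^ (m - 1) := Real.rpow_le_rpow_of_nonpos hx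
          ((hfM x).trans (le_max_left _ _)) (by linarith)
        simp only
        rw [cutRpow_of_ge hc0 (by linarith), key1]
    · simp only
      congr 1
      -- At a zero of `f` the cut-off power is locally constant, so its derivative `0` agrees with
      -- the factor `p f`.
      rcases (hf0 x).eq_or_lt with hx | hx
      · rw [← hx, Real.zero_rpow hm0, mul_zero]
        have : cutRpow c p =ᶠ[𝓝 0] fun _ => 0 := by
          filter_upwards [Iio_mem_nhds (half_pos hc0)] with r hr
          exact cutRpow_of_le hc0 (le_of_lt hr)
        rw [this.deriv_eq, deriv_const]
      · have h1 : c ≤ f x ^ (m - 1) := Real.rpow_le_rpow_of_nonpos hx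
          ((hfM x).trans (le_max_left _ _)) (by linarith)
        have : cutRpow c p =ᶠ[𝓝 (f x ^ (m - 1))] fun s => s ^ p := by
          filter_upwards [Ioi_mem_nhds (show 3 * c / 4 < f x ^ (m - 1) by linarith)] with r hr
          exact cutRpow_of_ge hc0 (le_of_lt hr)
        rw [this.deriv_eq, (Real.hasDerivAt_rpow_const (Or.inl (hc0.trans_le h1).ne')).deriv, key2]
  · have hp1 : 1 ≤ p := by rw [hp, le_div_iff₀ (by linarith)]; linarith
    have hη : ContDiff ℝ 1 fun s : ℝ => s ^ p :=
      Real.contDiff_rpow_const_of_le (n := 1) (by simpa using hp1)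
    refine (h.chain hB hη).congr (Eventually.of_forall fun x => key1 x)
      (Eventually.of_forall fun x => ?_)
    simp only
    rw [(Real.hasDerivAt_rpow_const (Or.inr hp1)).deriv, key2]

/-! ### Distributional inequalities on an interval -/

theorem setIntegral_Ioo_eq (f : ℝ → ℝ) {a b : ℝ} (h : a ≤ b) :
    ∫ t in Ioo a b, f t = ∫ t in a..b, f t := by
  rw [intervalIntegral.integral_of_le h, integral_Ioc_eq_integral_Ioo]

theorem contDiff_primitive {α : ℝ → ℝ} (hα : ContDiff ℝ ∞ α) (T : ℝ) :
    ContDiff ℝ ∞ fun t => ∫ s in T..t, α s := by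
  have h : ∀ t, HasDerivAt (fun t => ∫ s in T..t, α s) (α t) t := fun t =>
    intervalIntegral.integral_hasDerivAt_right (hα.continuous.intervalIntegrable _ _)
      hα.continuous.stronglyMeasurable.stronglyMeasurableAtFilter hα.continuous.continuousAt
  refine contDiff_infty_iff_deriv.2 ⟨fun t => (h t).differentiableAt, ?_⟩
  rwa [show deriv (fun t => ∫ s in T..t, α s) = α from funext fun t => (h t).deriv]

theorem deriv_primitive {α : ℝ → ℝ} (hα : Continuous α) (T t : ℝ) :
    deriv (fun t => ∫ s in T..t, α s) t = α t :=
  (intervalIntegral.integral_hasDerivAt_right (hα.intervalIntegrable _ _)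
    hα.stronglyMeasurable.stronglyMeasurableAtFilter hα.continuousAt).deriv

/-- Fubini's theorem on the triangle `0 < t < s < T`. -/
theorem integral_primitive_mul {T : ℝ} {α h : ℝ → ℝ} (hα : Continuous α)
    (hh : IntegrableOn h (Ioo 0 T)) :
    ∫ t in Ioo 0 T, (∫ s in t..T, α s) * h t = ∫ s in Ioo 0 T, α s * ∫ t in (0 : ℝ)..s, h t := by
  set μ := volume.restrict (Ioo (0 : ℝ) T)
  have hαi : Integrable α μ :=
    (hα.continuousOn.integrableOn_compact isCompact_Icc).mono_set Ioo_subset_Icc_self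
  have hset : MeasurableSet {p : ℝ × ℝ | p.1 < p.2} := measurableSet_lt measurable_fst measurable_snd
  set Φ : ℝ → ℝ → ℝ := fun t s => {p : ℝ × ℝ | p.1 < p.2}.indicator (fun p => h p.1 * α p.2) (t, s)
  have hΦ : Integrable (Function.uncurry Φ) (μ.prod μ) := (hh.mul_prod hαi).indicator hset
  have e1 : ∀ t ∈ Ioo 0 T, ∫ s, Φ t s ∂μ = (∫ s in t..T, α s) * h t := by
    intro t ht
    have : ∀ s, Φ t s = (Ioi t).indicator (fun s => h t * α s) s := fun s => by
      simp [Φ, indicator]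
    simp_rw [this]
    rw [integral_indicator measurableSet_Ioi, Measure.restrict_restrict measurableSet_Ioi,
      integral_const_mul, mul_comm]
    congr 1
    rw [← setIntegral_Ioo_eq _ ht.2.le]
    congr 2
    ext s
    simp only [mem_inter_iff, mem_Ioi, mem_Ioo]
    constructor
    · rintro ⟨h1, h2, h3⟩; exact ⟨h1, h3⟩
    · rintro ⟨h1, h2⟩; exact ⟨h1, ht.1.trans h1, h2⟩
  have e2 : ∀ s ∈ Ioo 0 T, ∫ t, Φ t s ∂μ = α s * ∫ t in (0 : ℝ)..s, h t := by
    intro s hs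
    have : ∀ t, Φ t s = (Iio s).indicator (fun t => h t * α s) t := fun t => by
      simp [Φ, indicator]
    simp_rw [this]
    rw [integral_indicator measurableSet_Iio, Measure.restrict_restrict measurableSet_Iio,
      integral_mul_const, mul_comm]
    congr 1
    rw [← setIntegral_Ioo_eq _ hs.1.le]
    congr 2
    ext t
    simp only [mem_inter_iff, mem_Iio, mem_Ioo]
    constructor
    · rintro ⟨h1, h2, h3⟩; exact ⟨h2, h1⟩
    · rintro ⟨h1, h2⟩; exact ⟨h2, h1, h2.trans hs.2⟩
  calc _ = ∫ t, ∫ s, Φ t s ∂μ ∂μ :=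
        setIntegral_congr_fun measurableSet_Ioo fun t ht => (e1 t ht).symm
    _ = ∫ s, ∫ t, Φ t s ∂μ ∂μ := integral_integral_swap hΦ
    _ = _ := setIntegral_congr_fun measurableSet_Ioo e2

theorem exists_lt_forall_ge_eq_zero {α : ℝ → ℝ} {T : ℝ} (hT : 0 < T) (hc : HasCompactSupport α)
    (hs : tsupport α ⊆ Ioo 0 T) : ∃ T', 0 < T' ∧ T' < T ∧ ∀ t, T' ≤ t → α t = 0 := by
  rcases (tsupport α).eq_empty_or_nonempty with h | h
  · refine ⟨T / 2, by linarith, by linarith, fun t _ => image_eq_zero_of_notMem_tsupport ?_⟩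
    rw [h]; exact notMem_empty t
  · obtain ⟨b, hb, hmax⟩ := IsCompact.exists_isGreatest hc h
    have hb' := hs hb
    refine ⟨(b + T) / 2, by linarith [hb'.1], by linarith [hb'.2], fun t ht =>
      image_eq_zero_of_notMem_tsupport fun htm => ?_⟩
    have := hmax htm
    linarith [hb'.2]

theorem primitive_eq_zero {α : ℝ → ℝ} {T T' : ℝ} (hTT : T' ≤ T) (h : ∀ t, T' ≤ t → α t = 0)
    {t : ℝ} (ht : T' ≤ t) : ∫ s in T..t, α s = 0 := by
  rw [intervalIntegral.integral_congr (g := fun _ => 0), intervalIntegral.integral_zero]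
  intro s hs
  refine h s ?_
  rcases le_total T t with h1 | h1
  · rw [uIcc_of_le h1] at hs; exact hTT.trans hs.1
  · rw [uIcc_of_ge h1] at hs; exact ht.trans hs.1

theorem integrableOn_of_continuous_mul {f α : ℝ → ℝ} {T : ℝ} (hα : Continuous α)
    (hf : IntegrableOn f (Ioo 0 T)) : IntegrableOn (fun t => α t * f t) (Ioo 0 T) := by
  obtain ⟨B, hB⟩ := isCompact_Icc (a := (0 : ℝ)) (b := T).exists_bound_of_continuousOn
    hα.continuousOn
  refine hf.bdd_mul (c := B) hα.aestronglyMeasurable ?_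
  filter_upwards [ae_restrict_mem measurableSet_Ioo] with t ht
  exact hB t (Ioo_subset_Icc_self ht)

theorem continuousOn_primitive_Icc {h : ℝ → ℝ} {T : ℝ} (hT : 0 ≤ T)
    (hh : IntegrableOn h (Ioo 0 T)) :
    ContinuousOn (fun t => ∫ s in (0 : ℝ)..t, h s) (Icc 0 T) := by
  have : IntegrableOn h (uIcc 0 T) := by
    rw [uIcc_of_le hT, integrableOn_Icc_iff_integrableOn_Ioo]; exact hh
  simpa [uIcc_of_le hT] using intervalIntegral.continuousOn_primitive_interval this

theorem integrableOn_primitive {h : ℝ → ℝ} {T : ℝ} (hT : 0 ≤ T) (hh : IntegrableOn h (Ioo 0 T)) :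
    IntegrableOn (fun t => ∫ s in (0 : ℝ)..t, h s) (Ioo 0 T) :=
  ((continuousOn_primitive_Icc hT hh).integrableOn_compact isCompact_Icc).mono_set
    Ioo_subset_Icc_self

/-- A function whose distributional derivative is `h` is a primitive of `h`. -/
theorem ae_eq_add_primitive {T : ℝ} (hT : 0 < T) {f h : ℝ → ℝ} {c : ℝ}
    (hf : IntegrableOn f (Ioo 0 T)) (hh : IntegrableOn h (Ioo 0 T))
    (hw : ∀ χ : ℝ → ℝ, ContDiff ℝ ∞ χ → (∃ T' < T, ∀ t, T' ≤ t → χ t = 0) →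
      ∫ t in Ioo 0 T, (deriv χ t * f t + χ t * h t) = -(χ 0 * c)) :
    ∀ᵐ t ∂volume.restrict (Ioo 0 T), f t = c + ∫ s in (0 : ℝ)..t, h s := by
  have hH := integrableOn_primitive hT.le hh
  have hD : IntegrableOn (fun t => f t - (c + ∫ s in (0 : ℝ)..t, h s)) (Ioo 0 T) :=
    hf.sub ((integrable_const c).add hH)
  have key := isOpen_Ioo.ae_eq_zero_of_integral_contDiff_smul_eq_zero
    (μ := volume) (U := Ioo 0 T) (f := fun t => f t - (c + ∫ s in (0 : ℝ)..t, h s))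
    hD.locallyIntegrableOn ?_
  · rw [ae_restrict_iff' measurableSet_Ioo]
    filter_upwards [key] with t ht htm
    exact sub_eq_zero.1 (ht htm)
  · intro α hα hc hs
    obtain ⟨T', hT0, hT', hz⟩ := exists_lt_forall_ge_eq_zero hT hc hs
    -- This primitive of `α` vanishes near `T`, since `α` has compact support in `(0, T)`, and
    -- equals `-∫₀ᵀ α` at `0`, which is where the constant `c` comes from.
    have h1 := hw (fun t => ∫ s in T..t, α s) (contDiff_primitive hα T)
      ⟨T', hT', fun t ht => primitive_eq_zero hT'.le hz ht⟩
    have h2 := integral_primitive_mul hα.continuous hh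
    simp_rw [deriv_primitive hα.continuous] at h1
    have i1 := integrableOn_of_continuous_mul hα.continuous hf
    have i2 : IntegrableOn (fun t => (∫ s in T..t, α s) * h t) (Ioo 0 T) :=
      integrableOn_of_continuous_mul (contDiff_primitive hα T).continuous hh
    have i3 := integrableOn_of_continuous_mul hα.continuous hH
    have i4 : IntegrableOn (fun t => α t * c) (Ioo 0 T) :=
      integrableOn_of_continuous_mul hα.continuous (integrable_const c)
    rw [integral_add i1 i2] at h1
    have h3 : ∫ t in Ioo 0 T, (∫ s in T..t, α s) * h t =
        -∫ t in Ioo 0 T, (∫ s in t..T, α s) * h t := by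
      rw [← integral_neg]
      congr 1; ext t
      rw [intervalIntegral.integral_symm]; ring
    rw [h3, h2, intervalIntegral.integral_symm, ← setIntegral_Ioo_eq _ hT.le] at h1
    have h4 : ∫ t, α t • (f t - (c + ∫ s in (0 : ℝ)..t, h s)) =
        ∫ t in Ioo 0 T, α t • (f t - (c + ∫ s in (0 : ℝ)..t, h s)) := by
      rw [setIntegral_eq_integral_of_forall_compl_eq_zero fun t ht => ?_]
      rw [image_eq_zero_of_notMem_tsupport fun h => ht (hs h), zero_smul]
    have h5 : ∫ t in Ioo 0 T, α t • (f t - (c + ∫ s in (0 : ℝ)..t, h s)) =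
        (∫ t in Ioo 0 T, α t * f t) - ((∫ t in Ioo 0 T, α t * c) +
          ∫ t in Ioo 0 T, α t * ∫ s in (0 : ℝ)..t, h s) := by
      have i5 : IntegrableOn (fun t => α t * c + α t * ∫ s in (0 : ℝ)..t, h s) (Ioo 0 T) :=
        i4.add i3
      rw [← integral_add i4 i3, ← integral_sub i1 i5]
      congr 1; ext t; simp only [smul_eq_mul]; ring
    rw [h4, h5, integral_mul_const]
    linarith

/-- A sequence of bump functions on `ℝ` with supports shrinking to `0`. -/
def bumpSeq (j : ℕ) : ContDiffBump (0 : ℝ) where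
  rIn := 1 / (2 * ((j : ℝ) + 1))
  rOut := 1 / ((j : ℝ) + 1)
  rIn_pos := by positivity
  rIn_lt_rOut := by
    apply one_div_lt_one_div_of_lt (by positivity)
    linarith [Nat.cast_nonneg (α := ℝ) j]

theorem tendsto_bumpSeq_rOut : Tendsto (fun j => (bumpSeq j).rOut) atTop (𝓝 0) :=
  tendsto_one_div_add_atTop_nhds_zero_nat

theorem bumpSeq_rOut_le_one (j : ℕ) : (bumpSeq j).rOut ≤ 1 := by
  simp only [bumpSeq]
  exact div_le_one_of_le₀ (by linarith [Nat.cast_nonneg (α := ℝ) j]) (by positivity)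

/-- The normalized bump functions. -/
def timeMollifier (j : ℕ) (t : ℝ) : ℝ := (bumpSeq j).normed volume t

theorem contDiff_timeMollifier (j : ℕ) : ContDiff ℝ ∞ (timeMollifier j) :=
  (bumpSeq j).contDiff_normed

theorem timeMollifier_nonneg (j : ℕ) (t : ℝ) : 0 ≤ timeMollifier j t :=
  (bumpSeq j).nonneg_normed t

theorem integral_timeMollifier (j : ℕ) : ∫ t, timeMollifier j t = 1 := (bumpSeq j).integral_normed

theorem hasCompactSupport_timeMollifier (j : ℕ) : HasCompactSupport (timeMollifier j) :=
  (bumpSeq j).hasCompactSupport_normed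

theorem timeMollifier_eq_zero {j : ℕ} {t : ℝ} (h : (bumpSeq j).rOut ≤ |t|) :
    timeMollifier j t = 0 := by
  have : t ∉ Function.support ((bumpSeq j).normed volume) := by
    rw [(bumpSeq j).support_normed_eq]
    simpa using h
  simpa [timeMollifier] using this

/-- Once its support fits into `(0, T)`, a mollifier centred at `t` is an admissible test function,
and the mollifications of `D` converge to `D t` at almost every `t`. -/
theorem ae_nonneg_of_integral_mul_nonneg {T : ℝ} {D : ℝ → ℝ} (hD : IntegrableOn D (Ioo 0 T))
    (h : ∀ α : ℝ → ℝ, ContDiff ℝ ∞ α → (∀ t, 0 ≤ α t) → HasCompactSupport α →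
      tsupport α ⊆ Ioo 0 T → 0 ≤ ∫ t in Ioo 0 T, α t * D t) :
    ∀ᵐ t ∂volume.restrict (Ioo 0 T), 0 ≤ D t := by
  have hDi : Integrable ((Ioo 0 T).indicator D) := (integrable_indicator_iff measurableSet_Ioo).2 hD
  have key := ContDiffBump.ae_convolution_tendsto_right_of_locallyIntegrable
    (μ := (volume : Measure ℝ)) (φ := bumpSeq) (l := atTop) (K := 2) tendsto_bumpSeq_rOut
    (Eventually.of_forall fun j => le_of_eq (by simp [bumpSeq]; field_simp))
    hDi.locallyIntegrable
  rw [ae_restrict_iff' measurableSet_Ioo]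
  filter_upwards [key] with t ht htm
  rw [indicator_of_mem htm] at ht
  refine ge_of_tendsto ht ?_
  have hmin : 0 < min t (T - t) := lt_min htm.1 (by linarith [htm.2])
  filter_upwards [tendsto_bumpSeq_rOut.eventually (gt_mem_nhds hmin)] with j hj
  have h1 : ∀ s, s ∉ Ioo 0 T → (bumpSeq j).rOut ≤ |t - s| := by
    intro s hs
    by_contra hlt
    push Not at hlt
    have h2 := abs_lt.1 (hlt.trans hj)
    exact hs ⟨by linarith [min_le_left t (T - t)], by linarith [min_le_right t (T - t)]⟩
  have h2 := h (fun s => timeMollifier j (t - s))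
    ((contDiff_timeMollifier j).comp (contDiff_const.sub contDiff_id))
    (fun s => timeMollifier_nonneg _ _)
    ((hasCompactSupport_timeMollifier j).comp_homeomorph (Homeomorph.subLeft t)) ?_
  · refine h2.trans_eq (Eq.symm ?_)
    rw [convolution_def, ← integral_sub_left_eq_self _ volume t]
    rw [← integral_indicator measurableSet_Ioo]
    congr 1; ext s
    simp only [ContinuousLinearMap.lsmul_apply, sub_sub_cancel, smul_eq_mul]
    by_cases hs : s ∈ Ioo 0 T
    · rw [indicator_of_mem hs, indicator_of_mem hs]; rfl
    · rw [indicator_of_notMem hs, indicator_of_notMem hs, mul_zero]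
  · have h3 : tsupport (fun s => timeMollifier j (t - s)) ⊆
        Metric.closedBall t (bumpSeq j).rOut := by
      refine closure_minimal (fun s hs => ?_) Metric.isClosed_closedBall
      rw [Metric.mem_closedBall, Real.dist_eq, abs_sub_comm]
      by_contra hlt
      push Not at hlt
      exact hs (timeMollifier_eq_zero hlt.le)
    refine h3.trans fun s hs => ?_
    by_contra hn
    rw [Metric.mem_closedBall, Real.dist_eq, abs_sub_comm] at hs
    have h4 := abs_le.1 hs
    exact hn ⟨by linarith [min_le_left t (T - t)], by linarith [min_le_right t (T - t)]⟩

theorem tendsto_integral_timeMollifier_mul {f : ℝ → ℝ} (hf : Continuous f) (t : ℝ) :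
    Tendsto (fun j => ∫ s, timeMollifier j (t - s) * f s) atTop (𝓝 (f t)) := by
  refine (ContDiffBump.convolution_tendsto_right_of_continuous (μ := (volume : Measure ℝ))
    tendsto_bumpSeq_rOut hf t).congr fun j => ?_
  rw [convolution_def, ← integral_sub_left_eq_self _ volume t]
  congr 1; ext s
  simp only [ContinuousLinearMap.lsmul_apply, sub_sub_cancel, smul_eq_mul]
  rfl

theorem continuous_timeMollifier (j : ℕ) : Continuous (timeMollifier j) :=
  (contDiff_timeMollifier j).continuous

theorem hasCompactSupport_timeMollifier_sub (j : ℕ) (t : ℝ) :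
    HasCompactSupport fun s => timeMollifier j (t - s) :=
  (hasCompactSupport_timeMollifier j).comp_homeomorph (Homeomorph.subLeft t)

theorem integrable_timeMollifier_sub (j : ℕ) (t : ℝ) :
    Integrable fun s => timeMollifier j (t - s) :=
  ((continuous_timeMollifier j).comp (continuous_const.sub continuous_id)).integrable_of_hasCompactSupport
    (hasCompactSupport_timeMollifier_sub j t)

theorem abs_integral_timeMollifier_mul_le {f : ℝ → ℝ} {B : ℝ} (hB : ∀ s, |f s| ≤ B)
    (j : ℕ) (t : ℝ) : |∫ s, timeMollifier j (t - s) * f s| ≤ B := by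
  calc |∫ s, timeMollifier j (t - s) * f s| ≤ ∫ s, timeMollifier j (t - s) * B := by
        rw [← Real.norm_eq_abs]
        refine norm_integral_le_of_norm_le ((integrable_timeMollifier_sub j t).mul_const _)
          (Eventually.of_forall fun s => ?_)
        rw [norm_mul, Real.norm_eq_abs, Real.norm_eq_abs,
          abs_of_nonneg (timeMollifier_nonneg _ _)]
        exact mul_le_mul_of_nonneg_left (hB s) (timeMollifier_nonneg _ _)
    _ = B := by
        rw [integral_mul_const, integral_sub_left_eq_self (timeMollifier j) volume t,
          integral_timeMollifier, one_mul]

theorem deriv_timeMollifier_eq_zero {j : ℕ} {t : ℝ} (h : (bumpSeq j).rOut < |t|) :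
    deriv (timeMollifier j) t = 0 := by
  have : timeMollifier j =ᶠ[𝓝 t] fun _ => 0 := by
    filter_upwards [continuous_abs.continuousAt.eventually (lt_mem_nhds h)] with s hs
    exact timeMollifier_eq_zero hs.le
  rw [this.deriv_eq, deriv_const]

theorem continuous_deriv_timeMollifier (j : ℕ) : Continuous (deriv (timeMollifier j)) :=
  (contDiff_timeMollifier j).continuous_deriv (by norm_num)

theorem hasDerivAt_timeMollifier (j : ℕ) (t : ℝ) :
    HasDerivAt (timeMollifier j) (deriv (timeMollifier j) t) t :=
  ((contDiff_timeMollifier j).differentiable (by norm_num) t).hasDerivAt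

theorem integral_deriv_timeMollifier_mul {p p' : ℝ → ℝ} (hp : ∀ s, HasDerivAt p (p' s) s)
    (hp' : Continuous p') (j : ℕ) (t : ℝ) :
    ∫ s, deriv (timeMollifier j) (t - s) * p s = ∫ s, timeMollifier j (t - s) * p' s := by
  have hpc : Continuous p := continuous_iff_continuousAt.2 fun s => (hp s).continuousAt
  have hsub : Continuous fun s : ℝ => t - s := continuous_const.sub continuous_id
  have hc := hasCompactSupport_timeMollifier_sub j t
  have hc' : HasCompactSupport fun s => deriv (timeMollifier j) (t - s) :=
    (hasCompactSupport_timeMollifier j).deriv.comp_homeomorph (Homeomorph.subLeft t)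
  have i1 : Integrable fun s => timeMollifier j (t - s) * p' s :=
    (((continuous_timeMollifier j).comp hsub).mul hp').integrable_of_hasCompactSupport
      hc.mul_right
  have i2 : Integrable fun s => deriv (timeMollifier j) (t - s) * p s :=
    (((continuous_deriv_timeMollifier j).comp hsub).mul hpc).integrable_of_hasCompactSupport
      hc'.mul_right
  have i3 : Integrable fun s => timeMollifier j (t - s) * p s :=
    (((continuous_timeMollifier j).comp hsub).mul hpc).integrable_of_hasCompactSupport
      hc.mul_right
  have hd : ∀ s, HasDerivAt (fun s => timeMollifier j (t - s) * p s)
      (timeMollifier j (t - s) * p' s - deriv (timeMollifier j) (t - s) * p s) s := fun s => by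
    have h1 := (hasDerivAt_timeMollifier j (t - s)).comp s ((hasDerivAt_id s).const_sub t)
    exact (h1.mul (hp s)).congr_deriv (by simp only [Function.comp]; ring)
  have := integral_eq_zero_of_hasDerivAt_of_integrable hd (i1.sub i2) i3
  rw [integral_sub i1 i2] at this
  linarith

/-- A family of differential inequalities indexed by a level `k`, integrated along a `C¹` curve of
levels. -/
theorem integral_nonneg_of_moving_level_of_hasDerivAt {T B : ℝ} {P Q R : ℝ → ℝ → ℝ} {P₀ k k' : ℝ → ℝ}
    (hP : ∀ l t, HasDerivAt (fun l => P l t) (-Q l t) l)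
    (hQ : ∀ t, Continuous fun l => Q l t) (hR : ∀ t, Continuous fun l => R l t)
    (hPm : ∀ l, Measurable (P l)) (hQm : ∀ l, Measurable (Q l)) (hRm : ∀ l, Measurable (R l))
    (hP₀ : Continuous P₀) (hk : ∀ t, HasDerivAt k (k' t) t) (hk' : Continuous k')
    (hPB : ∀ s t, |P (k s) t| ≤ B) (hQB : ∀ s t, |Q (k s) t * k' s| ≤ B)
    (hRB : ∀ s t, |R (k s) t| ≤ B)
    (h : ∀ l, ∀ χ : ℝ → ℝ, ContDiff ℝ ∞ χ → (∀ t, 0 ≤ χ t) → (∀ t, T ≤ t → χ t = 0) →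
      0 ≤ (∫ t in Ioo 0 T, (P l t * deriv χ t + R l t * χ t)) + P₀ l * χ 0)
    {χ : ℝ → ℝ} (hχ : ContDiff ℝ ∞ χ) (hχ0 : ∀ t, 0 ≤ χ t) (hχT : ∀ t, T ≤ t → χ t = 0) :
    0 ≤ (∫ t in Ioo 0 T, (P (k t) t * deriv χ t + (R (k t) t - Q (k t) t * k' t) * χ t))
      + P₀ (k 0) * χ 0 := by
  have hkc : Continuous k := continuous_iff_continuousAt.2 fun s => (hk s).continuousAt
  have hPc : ∀ t, Continuous fun l => P l t := fun t =>
    continuous_iff_continuousAt.2 fun l => (hP l t).continuousAt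
  have hχ' : Continuous (deriv χ) := hχ.continuous_deriv (by norm_num)
  have hB0 : 0 ≤ B := (abs_nonneg _).trans (hPB 0 0)
  obtain ⟨X, hX⟩ := isCompact_Icc (a := (0 : ℝ)) (b := T).exists_bound_of_continuousOn
    hχ.continuous.continuousOn
  obtain ⟨X', hX'⟩ := isCompact_Icc (a := (0 : ℝ)) (b := T).exists_bound_of_continuousOn
    hχ'.continuousOn
  set μ := volume.restrict (Ioo (0 : ℝ) T)
  -- The mollifiers have radius at most `1`, so only `s ∈ J` contributes when `t ∈ [0, T]`; the
  -- bounded interval makes Fubini's theorem applicable.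
  set J := Icc (-2 : ℝ) (T + 2)
  set ν := volume.restrict J
  set Ψ : ℝ → ℝ → ℝ := fun s t =>
    P (k s) t * deriv χ t + (R (k s) t - Q (k s) t * k' s) * χ t with hΨ
  have hmP : Measurable fun p : ℝ × ℝ => P (k p.1) p.2 :=
    (measurable_uncurry_of_continuous_of_measurable hPc hPm).comp
      ((hkc.measurable.comp measurable_fst).prodMk measurable_snd)
  have hmQ : Measurable fun p : ℝ × ℝ => Q (k p.1) p.2 :=
    (measurable_uncurry_of_continuous_of_measurable hQ hQm).comp
      ((hkc.measurable.comp measurable_fst).prodMk measurable_snd)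
  have hmR : Measurable fun p : ℝ × ℝ => R (k p.1) p.2 :=
    (measurable_uncurry_of_continuous_of_measurable hR hRm).comp
      ((hkc.measurable.comp measurable_fst).prodMk measurable_snd)
  have hΨm : Measurable (Function.uncurry Ψ) :=
    (hmP.mul (hχ'.measurable.comp measurable_snd)).add
      ((hmR.sub (hmQ.mul (hk'.measurable.comp measurable_fst))).mul
        (hχ.continuous.measurable.comp measurable_snd))
  have hΨc : ∀ t, Continuous fun s => Ψ s t := fun t =>
    (((hPc t).comp hkc).mul continuous_const).add
      ((((hR t).comp hkc).sub (((hQ t).comp hkc).mul hk')).mul continuous_const)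
  have hΨB : ∀ t ∈ Ioo 0 T, ∀ s, |Ψ s t| ≤ B * X' + (B + B) * X := by
    intro t ht s
    have ht' := Ioo_subset_Icc_self ht
    refine (abs_add_le _ _).trans (add_le_add ?_ ?_)
    · rw [abs_mul]
      exact mul_le_mul (hPB s t) (hX' t ht') (abs_nonneg _) hB0
    · rw [abs_mul]
      exact mul_le_mul ((abs_sub _ _).trans (add_le_add (hRB s t) (hQB s t))) (hX t ht')
        (abs_nonneg _) (by linarith)
  -- The level is frozen at `k s`, the inequality is tested with `χ t * θ (t - s)`, and the result
  -- is integrated in `s`. The mollifier is two-sided and `k` is defined for negative times too, so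
  -- it has full mass at `t = 0` and the initial term keeps its weight.
  have key : ∀ j, 0 ≤ (∫ t in Ioo 0 T, ∫ s, timeMollifier j (t - s) * Ψ s t) +
      ∫ s, timeMollifier j (0 - s) * (P₀ (k s) * χ 0) := by
    intro j
    set θ := timeMollifier j
    set θ' := deriv (timeMollifier j)
    obtain ⟨Y, hY⟩ := (hasCompactSupport_timeMollifier j).exists_bound_of_continuous
      (continuous_timeMollifier j)
    obtain ⟨Y', hY'⟩ := (hasCompactSupport_timeMollifier j).deriv.exists_bound_of_continuous
      (continuous_deriv_timeMollifier j)
    set Θ : ℝ → ℝ → ℝ := fun s t => P (k s) t * (deriv χ t * θ (t - s) + χ t * θ' (t - s)) +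
      R (k s) t * (χ t * θ (t - s)) with hΘ
    have hθm : Measurable fun p : ℝ × ℝ => θ (p.2 - p.1) :=
      (continuous_timeMollifier j).measurable.comp (measurable_snd.sub measurable_fst)
    have hθ'm : Measurable fun p : ℝ × ℝ => θ' (p.2 - p.1) :=
      (continuous_deriv_timeMollifier j).measurable.comp (measurable_snd.sub measurable_fst)
    have hΘm : Measurable (Function.uncurry Θ) :=
      (hmP.mul (((hχ'.measurable.comp measurable_snd).mul hθm).add
        ((hχ.continuous.measurable.comp measurable_snd).mul hθ'm))).add
        (hmR.mul ((hχ.continuous.measurable.comp measurable_snd).mul hθm))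
    have hΘi : Integrable (Function.uncurry Θ) (ν.prod μ) := by
      refine Integrable.of_bound hΘm.aestronglyMeasurable
        (B * (X' * Y + X * Y') + B * (X * Y)) ?_
      have : ∀ᵐ p ∂(ν.prod μ), p.2 ∈ Ioo 0 T :=
        Measure.quasiMeasurePreserving_snd.ae (ae_restrict_mem measurableSet_Ioo)
      filter_upwards [this] with p hp
      have ht' := Ioo_subset_Icc_self hp
      have x1 := hX _ ht'
      have x2 := hX' _ ht'
      have x0 : 0 ≤ X := (norm_nonneg _).trans x1
      have x0' : 0 ≤ X' := (norm_nonneg _).trans x2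
      rw [Real.norm_eq_abs] at x1 x2 ⊢
      have y1 : |θ (p.2 - p.1)| ≤ Y := hY _
      have y2 : |θ' (p.2 - p.1)| ≤ Y' := hY' _
      refine (abs_add_le _ _).trans (add_le_add ?_ ?_)
      · rw [abs_mul]
        refine mul_le_mul (hPB _ _) ((abs_add_le _ _).trans (add_le_add ?_ ?_)) (abs_nonneg _) hB0
        · rw [abs_mul]; exact mul_le_mul x2 y1 (abs_nonneg _) x0'
        · rw [abs_mul]; exact mul_le_mul x1 y2 (abs_nonneg _) x0
      · rw [abs_mul, abs_mul]
        exact mul_le_mul (hRB _ _) (mul_le_mul x1 y1 (abs_nonneg _) x0) (by positivity) hB0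
    have h1 : ∀ s, 0 ≤ (∫ t in Ioo 0 T, Θ s t) + P₀ (k s) * (χ 0 * θ (0 - s)) := by
      intro s
      have hθs : ContDiff ℝ ∞ fun t => θ (t - s) :=
        (contDiff_timeMollifier j).comp (contDiff_id.sub contDiff_const)
      have h2 := h (k s) (fun t => χ t * θ (t - s)) (hχ.mul hθs)
        (fun t => mul_nonneg (hχ0 t) (timeMollifier_nonneg _ _))
        (fun t ht => by rw [hχT t ht, zero_mul])
      refine h2.trans_eq ?_
      congr 2
      ext t
      have hd : HasDerivAt (fun t => χ t * θ (t - s)) (deriv χ t * θ (t - s) + χ t * θ' (t - s)) t :=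
        (hχ.differentiable (by norm_num) t).hasDerivAt.mul
          ((hasDerivAt_timeMollifier j (t - s)).comp_sub_const t s)
      rw [hd.deriv]
    have hint0 : Integrable (fun s => θ (0 - s) * (P₀ (k s) * χ 0)) :=
      (((continuous_timeMollifier j).comp (continuous_const.sub continuous_id)).mul
        ((hP₀.comp hkc).mul continuous_const)).integrable_of_hasCompactSupport
          (hasCompactSupport_timeMollifier_sub j 0).mul_right
    have hout : ∀ t ∈ Icc 0 T, ∀ s, s ∉ J → (bumpSeq j).rOut < |t - s| := by
      intro t ht s hs
      by_contra hlt
      push Not at hlt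
      have h3 := abs_le.1 (hlt.trans (bumpSeq_rOut_le_one j))
      exact hs ⟨by linarith [ht.1], by linarith [ht.2]⟩
    rcases le_or_gt T 0 with hT | hT
    · have hχ00 : χ 0 = 0 := hχT 0 hT
      simp [hχ00, Ioo_eq_empty (not_lt.2 hT)]
    have e0 : ∫ s in J, P₀ (k s) * (χ 0 * θ (0 - s)) = ∫ s, θ (0 - s) * (P₀ (k s) * χ 0) := by
      rw [setIntegral_eq_integral_of_forall_compl_eq_zero]
      · congr 1; ext s; ring
      · intro s hs
        simp only [θ]
        rw [timeMollifier_eq_zero (hout 0 ⟨le_rfl, hT.le⟩ s hs).le, mul_zero, mul_zero]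
    have e1 : ∀ t ∈ Ioo 0 T, ∫ s in J, Θ s t = ∫ s, θ (t - s) * Ψ s t := by
      intro t ht
      have hsub : Continuous fun s : ℝ => t - s := continuous_const.sub continuous_id
      have hpd : ∀ s, HasDerivAt (fun s => P (k s) t) (-(Q (k s) t * k' s)) s := fun s =>
        ((hP (k s) t).comp s (hk s)).congr_deriv (by ring)
      have hpc' : Continuous fun s => -(Q (k s) t * k' s) := (((hQ t).comp hkc).mul hk').neg
      -- Integrating by parts in `s` moves the derivative from `θ` onto the level, where `∂ₛ P(k(s),
      -- t) = -Q(k(s), t) k'(s)`; this produces the extra term of the moving level.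
      have ibp := integral_deriv_timeMollifier_mul hpd hpc' j t
      have hθc : Continuous fun s => θ (t - s) := (continuous_timeMollifier j).comp hsub
      have hθ'c : Continuous fun s => θ' (t - s) := (continuous_deriv_timeMollifier j).comp hsub
      have cs : HasCompactSupport fun s => θ (t - s) := hasCompactSupport_timeMollifier_sub j t
      have cs' : HasCompactSupport fun s => θ' (t - s) :=
        (hasCompactSupport_timeMollifier j).deriv.comp_homeomorph (Homeomorph.subLeft t)
      have i1 : Integrable fun s => θ (t - s) * (P (k s) t * deriv χ t + R (k s) t * χ t) :=
        (hθc.mul ((((hPc t).comp hkc).mul continuous_const).add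
          (((hR t).comp hkc).mul continuous_const))).integrable_of_hasCompactSupport cs.mul_right
      have i2 : Integrable fun s => χ t * (θ' (t - s) * P (k s) t) :=
        ((hθ'c.mul ((hPc t).comp hkc)).integrable_of_hasCompactSupport cs'.mul_right).const_mul _
      have i3 : Integrable fun s => χ t * (θ (t - s) * -(Q (k s) t * k' s)) :=
        ((hθc.mul hpc').integrable_of_hasCompactSupport cs.mul_right).const_mul _
      rw [setIntegral_eq_integral_of_forall_compl_eq_zero]
      · calc ∫ s, Θ s t = ∫ s, (θ (t - s) * (P (k s) t * deriv χ t + R (k s) t * χ t) +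
              χ t * (θ' (t - s) * P (k s) t)) := by
              congr 1; ext s; simp only [hΘ]; ring
          _ = ∫ s, (θ (t - s) * (P (k s) t * deriv χ t + R (k s) t * χ t) +
              χ t * (θ (t - s) * -(Q (k s) t * k' s))) := by
              rw [integral_add i1 i2, integral_add i1 i3, integral_const_mul, integral_const_mul,
                ibp]
          _ = _ := by
              congr 1; ext s; simp only [hΨ]; ring
      · intro s hs
        have := hout t (Ioo_subset_Icc_self ht) s hs
        simp only [hΘ, θ, θ']
        rw [timeMollifier_eq_zero this.le, deriv_timeMollifier_eq_zero this]
        ring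
    have i4 : Integrable (fun s => ∫ t in Ioo 0 T, Θ s t) ν := hΘi.integral_prod_left
    have i5 : Integrable (fun s => P₀ (k s) * (χ 0 * θ (0 - s))) ν :=
      (hint0.integrableOn (s := J)).congr (Eventually.of_forall fun s => by simp only; ring)
    have h2 : 0 ≤ ∫ s in J, ((∫ t in Ioo 0 T, Θ s t) + P₀ (k s) * (χ 0 * θ (0 - s))) :=
      integral_nonneg h1
    rw [integral_add i4 i5, e0, integral_integral_swap hΘi] at h2
    refine h2.trans_eq ?_
    congr 1
    exact setIntegral_congr_fun measurableSet_Ioo e1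
  refine ge_of_tendsto' (x := atTop) (Tendsto.add (a := ∫ t in Ioo 0 T, Ψ t t) ?_ ?_) key
  · refine tendsto_integral_of_dominated_convergence (fun _ => B * X' + (B + B) * X) (fun j => ?_)
      (integrable_const _) (fun j => ?_) (Eventually.of_forall fun t => ?_)
    · refine (StronglyMeasurable.integral_prod_right
        (f := fun t s => timeMollifier j (t - s) * Ψ s t) ?_).aestronglyMeasurable
      exact (((continuous_timeMollifier j).measurable.comp
        (measurable_fst.sub measurable_snd)).mul (hΨm.comp measurable_swap)).stronglyMeasurable
    · filter_upwards [ae_restrict_mem measurableSet_Ioo] with t ht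
      exact abs_integral_timeMollifier_mul_le (hΨB t ht) j t
    · exact tendsto_integral_timeMollifier_mul (hΨc t) t
  · exact tendsto_integral_timeMollifier_mul ((hP₀.comp hkc).mul continuous_const) 0

theorem abs_primitive_le {h : ℝ → ℝ} (hh : Integrable h) (t : ℝ) :
    |∫ s in (0 : ℝ)..t, h s| ≤ ∫ s, |h s| := by
  rw [← Real.norm_eq_abs]
  refine (intervalIntegral.norm_integral_le_integral_norm_uIoc).trans ?_
  exact setIntegral_le_integral hh.norm (Eventually.of_forall fun s => norm_nonneg _)

/-- A family of differential inequalities indexed by a level `k`, integrated along an absolutely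
continuous curve of levels. -/
theorem integral_nonneg_of_moving_level {T B : ℝ} {P Q R : ℝ → ℝ → ℝ} {P₀ h : ℝ → ℝ}
    (hP : ∀ l t, HasDerivAt (fun l => P l t) (-Q l t) l)
    (hQ : ∀ t, Continuous fun l => Q l t) (hR : ∀ t, Continuous fun l => R l t)
    (hPm : ∀ l, Measurable (P l)) (hQm : ∀ l, Measurable (Q l)) (hRm : ∀ l, Measurable (R l))
    (hP₀ : Continuous P₀)
    (hPB : ∀ l t, |P l t| ≤ B * (1 + |l|)) (hQB : ∀ l t, |Q l t| ≤ B)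
    (hRB : ∀ l t, |R l t| ≤ B)
    (hineq : ∀ l, ∀ χ : ℝ → ℝ, ContDiff ℝ ∞ χ → (∀ t, 0 ≤ χ t) → (∀ t, T ≤ t → χ t = 0) →
      0 ≤ (∫ t in Ioo 0 T, (P l t * deriv χ t + R l t * χ t)) + P₀ l * χ 0)
    (hh : Integrable h) (k₀ : ℝ)
    {χ : ℝ → ℝ} (hχ : ContDiff ℝ ∞ χ) (hχ0 : ∀ t, 0 ≤ χ t) (hχT : ∀ t, T ≤ t → χ t = 0) :
    0 ≤ (∫ t in Ioo 0 T, (P (k₀ + ∫ s in (0 : ℝ)..t, h s) t * deriv χ t +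
        (R (k₀ + ∫ s in (0 : ℝ)..t, h s) t - Q (k₀ + ∫ s in (0 : ℝ)..t, h s) t * h t) * χ t))
      + P₀ k₀ * χ 0 := by
  have hB0 : 0 ≤ B := (abs_nonneg _).trans (hQB 0 0)
  have hPc : ∀ t, Continuous fun l => P l t := fun t =>
    continuous_iff_continuousAt.2 fun l => (hP l t).continuousAt
  have hχ' : Continuous (deriv χ) := hχ.continuous_deriv (by norm_num)
  obtain ⟨X, hX⟩ := isCompact_Icc (a := (0 : ℝ)) (b := T).exists_bound_of_continuousOn
    hχ.continuous.continuousOn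
  obtain ⟨X', hX'⟩ := isCompact_Icc (a := (0 : ℝ)) (b := T).exists_bound_of_continuousOn
    hχ'.continuousOn
  set μ := volume.restrict (Ioo (0 : ℝ) T)
  -- The derivative `h` of the curve is approximated in `L¹` by continuous functions, so the curve
  -- is a uniform limit of `C¹` curves. In the product `Q * h` the factor `h` converges in `L¹` and
  -- `Q` converges pointwise and boundedly.
  choose H hHc hHle hHcont hHi using fun n : ℕ =>
    hh.exists_hasCompactSupport_integral_sub_le (Nat.one_div_pos_of_nat (α := ℝ) (n := n))
  set k : ℝ → ℝ := fun t => k₀ + ∫ s in (0 : ℝ)..t, h s with hk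
  set K : ℕ → ℝ → ℝ := fun n t => k₀ + ∫ s in (0 : ℝ)..t, H n s with hK
  have hkcont : Continuous k := continuous_const.add
    (intervalIntegral.continuous_primitive (fun _ _ => hh.intervalIntegrable) 0)
  have hKcont : ∀ n, Continuous (K n) := fun n => continuous_const.add
    (intervalIntegral.continuous_primitive (fun _ _ => (hHi n).intervalIntegrable) 0)
  have hKd : ∀ n t, HasDerivAt (K n) (H n t) t := fun n t =>
    (intervalIntegral.integral_hasDerivAt_right (hHi n).intervalIntegrable
      (hHcont n).stronglyMeasurable.stronglyMeasurableAtFilter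
      (hHcont n).continuousAt).const_add k₀
  have hlim0 : Tendsto (fun n : ℕ => 1 / ((n : ℝ) + 1)) atTop (𝓝 0) :=
    tendsto_one_div_add_atTop_nhds_zero_nat
  have hHabs : ∀ n, ∫ s, |H n s - h s| ≤ 1 / ((n : ℝ) + 1) := fun n => by
    refine le_trans (le_of_eq ?_) (hHle n)
    congr 1; ext s; rw [Real.norm_eq_abs, abs_sub_comm]
  have hKsub : ∀ n t, |K n t - k t| ≤ 1 / ((n : ℝ) + 1) := fun n t => by
    have : K n t - k t = ∫ s in (0 : ℝ)..t, (H n s - h s) := by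
      rw [intervalIntegral.integral_sub (hHi n).intervalIntegrable hh.intervalIntegrable]
      simp only [hK, hk]; ring
    rw [this]
    exact (abs_primitive_le ((hHi n).sub hh) t).trans (hHabs n)
  have hKlim : ∀ t, Tendsto (fun n => K n t) atTop (𝓝 (k t)) := fun t => by
    rw [tendsto_iff_norm_sub_tendsto_zero]
    exact squeeze_zero (fun n => norm_nonneg _) (fun n => hKsub n t) hlim0
  set N := |k₀| + ∫ s, |h s|
  have hkN : ∀ t, |k t| ≤ N := fun t =>
    (abs_add_le _ _).trans (add_le_add le_rfl (abs_primitive_le hh t))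
  have hKN : ∀ n t, |K n t| ≤ N + 1 := fun n t => by
    have h1 : |K n t| ≤ |K n t - k t| + |k t| := by
      simpa using abs_add_le (K n t - k t) (k t)
    have h2 : 1 / ((n : ℝ) + 1) ≤ 1 := by
      rw [div_le_one (by positivity)]; linarith [Nat.cast_nonneg (α := ℝ) n]
    linarith [hKsub n t, hkN t]
  have hHL1 : Tendsto (fun n => ∫ t, |H n t - h t| ∂μ) atTop (𝓝 0) := by
    refine squeeze_zero (fun n => integral_nonneg fun t => abs_nonneg _) (fun n => ?_) hlim0
    exact (setIntegral_le_integral ((hHi n).sub hh).abs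
      (Eventually.of_forall fun s => abs_nonneg _)).trans (hHabs n)
  have hmeas : ∀ {Z : ℝ → ℝ → ℝ}, (∀ t, Continuous fun l => Z l t) → (∀ l, Measurable (Z l)) →
      ∀ n, Measurable fun t => Z (K n t) t := fun hZ hZm n =>
    (measurable_uncurry_of_continuous_of_measurable hZ hZm).comp
      ((hKcont n).measurable.prodMk measurable_id)
  have hmeas' : ∀ {Z : ℝ → ℝ → ℝ}, (∀ t, Continuous fun l => Z l t) → (∀ l, Measurable (Z l)) →
      Measurable fun t => Z (k t) t := fun hZ hZm =>
    (measurable_uncurry_of_continuous_of_measurable hZ hZm).comp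
      (hkcont.measurable.prodMk measurable_id)
  have hN0 : 0 ≤ N := (abs_nonneg _).trans (hkN 0)
  have hbd : ∀ l, |l| ≤ N + 1 → ∀ t ∈ Ioo 0 T,
      |P l t * deriv χ t + R l t * χ t| ≤ B * (2 + N) * X' + B * X := by
    intro l hl t ht
    have ht' := Ioo_subset_Icc_self ht
    refine (abs_add_le _ _).trans (add_le_add ?_ ?_)
    · rw [abs_mul]
      refine mul_le_mul ((hPB l t).trans (mul_le_mul_of_nonneg_left (by linarith) hB0)) (hX' t ht')
        (abs_nonneg _) (by positivity)
    · rw [abs_mul]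
      exact mul_le_mul (hRB l t) (hX t ht') (abs_nonneg _) hB0
  have hbdQ : ∀ l, ∀ t ∈ Ioo 0 T, |Q l t * χ t| ≤ B * X := by
    intro l t ht
    rw [abs_mul]
    exact mul_le_mul (hQB l t) (hX t (Ioo_subset_Icc_self ht)) (abs_nonneg _) hB0
  have i1 : ∀ n, Integrable (fun t => P (K n t) t * deriv χ t + R (K n t) t * χ t) μ := fun n =>
    Integrable.of_bound (((hmeas hPc hPm n).mul hχ'.measurable).add
      ((hmeas hR hRm n).mul hχ.continuous.measurable)).aestronglyMeasurable
      (B * (2 + N) * X' + B * X) (by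
        filter_upwards [ae_restrict_mem measurableSet_Ioo] with t ht
        exact hbd _ (hKN n t) t ht)
  have i1' : Integrable (fun t => P (k t) t * deriv χ t + R (k t) t * χ t) μ :=
    Integrable.of_bound (((hmeas' hPc hPm).mul hχ'.measurable).add
      ((hmeas' hR hRm).mul hχ.continuous.measurable)).aestronglyMeasurable
      (B * (2 + N) * X' + B * X) (by
        filter_upwards [ae_restrict_mem measurableSet_Ioo] with t ht
        exact hbd _ ((hkN t).trans (by linarith)) t ht)
  have hQχm : ∀ n, AEStronglyMeasurable (fun t => Q (K n t) t * χ t) μ := fun n =>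
    ((hmeas hQ hQm n).mul hχ.continuous.measurable).aestronglyMeasurable
  have i2 : ∀ n, Integrable (fun t => H n t * (Q (K n t) t * χ t)) μ := fun n =>
    (hHi n).integrableOn.mul_bdd (c := B * X) (hQχm n) (by
      filter_upwards [ae_restrict_mem measurableSet_Ioo] with t ht
      exact hbdQ _ t ht)
  have i2' : Integrable (fun t => h t * (Q (k t) t * χ t)) μ :=
    hh.integrableOn.mul_bdd (c := B * X)
      ((hmeas' hQ hQm).mul hχ.continuous.measurable).aestronglyMeasurable (by
      filter_upwards [ae_restrict_mem measurableSet_Ioo] with t ht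
      exact hbdQ _ t ht)
  have key : ∀ n, 0 ≤ (∫ t, (P (K n t) t * deriv χ t + R (K n t) t * χ t) ∂μ) -
      (∫ t, H n t * (Q (K n t) t * χ t) ∂μ) + P₀ k₀ * χ 0 := by
    intro n
    obtain ⟨Y, hY⟩ := (hHc n).exists_bound_of_continuous (hHcont n)
    have hY0 : 0 ≤ Y := (norm_nonneg _).trans (hY 0)
    have h1 := integral_nonneg_of_moving_level_of_hasDerivAt (B := B * (2 + N) + B * Y + B)
      hP hQ hR hPm hQm hRm hP₀ (hKd n) (hHcont n) (fun s t => ?_) (fun s t => ?_) (fun s t => ?_)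
      hineq hχ hχ0 hχT
    · refine h1.trans_eq ?_
      rw [← integral_sub (i1 n) (i2 n)]
      congr 1
      · congr 1; ext t; ring
      · simp [hK]
    · refine (hPB _ t).trans ?_
      have := mul_le_mul_of_nonneg_left (show 1 + |K n s| ≤ 2 + N by linarith [hKN n s]) hB0
      nlinarith [mul_nonneg hB0 hY0]
    · rw [abs_mul]
      have := mul_le_mul (hQB (K n s) t) (hY s) (norm_nonneg _) hB0
      rw [Real.norm_eq_abs] at this
      nlinarith [mul_nonneg hB0 (show 0 ≤ 2 + N by linarith)]
    · refine (hRB _ t).trans ?_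
      nlinarith [mul_nonneg hB0 (show 0 ≤ 2 + N by linarith), mul_nonneg hB0 hY0]
  have hfin : (∫ t, (P (k t) t * deriv χ t + (R (k t) t - Q (k t) t * h t) * χ t) ∂μ) =
      (∫ t, (P (k t) t * deriv χ t + R (k t) t * χ t) ∂μ) -
        ∫ t, h t * (Q (k t) t * χ t) ∂μ := by
    rw [← integral_sub i1' i2']
    congr 1; ext t; ring
  rw [hfin]
  refine ge_of_tendsto' (x := atTop) (Tendsto.add (Tendsto.sub ?_ ?_) tendsto_const_nhds) key
  · refine tendsto_integral_of_dominated_convergence (fun _ => B * (2 + N) * X' + B * X)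
      (fun n => (i1 n).aestronglyMeasurable) (integrable_const _) (fun n => ?_)
      (Eventually.of_forall fun t => ?_)
    · filter_upwards [ae_restrict_mem measurableSet_Ioo] with t ht
      exact hbd _ (hKN n t) t ht
    · exact ((((hPc t).tendsto _).comp (hKlim t)).mul_const _).add
        ((((hR t).tendsto _).comp (hKlim t)).mul_const _)
  · refine tendsto_integral_mul_of_tendsto_L1 (B := B * X) (fun n => (hHi n).integrableOn)
      hh.integrableOn hHL1 hQχm (fun n => ?_) (Eventually.of_forall fun t => ?_)
    · filter_upwards [ae_restrict_mem measurableSet_Ioo] with t ht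
      exact hbdQ _ t ht
    · exact (((hQ t).tendsto _).comp (hKlim t)).mul_const _

/-- A Gronwall inequality for a bounded function and an integrable rate. -/
theorem le_mul_exp_of_le_add_primitive {T A₀ B : ℝ} (hT : 0 < T) {A a : ℝ → ℝ}
    (hA : Measurable A) (hA0 : ∀ t, 0 ≤ A t) (hAB : ∀ t, A t ≤ B)
    (ha : Integrable a) (ha0 : ∀ t, 0 ≤ a t)
    (h : ∀ᵐ t ∂volume.restrict (Ioo 0 T), A t ≤ A₀ + ∫ s in (0 : ℝ)..t, a s * A s) :
    ∀ᵐ t ∂volume.restrict (Ioo 0 T), A t ≤ A₀ * Real.exp (∫ s in (0 : ℝ)..t, a s) := by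
  have hB0 : 0 ≤ B := (hA0 0).trans (hAB 0)
  have haA : Integrable fun s => a s * A s := ha.mul_bdd (c := B) hA.aestronglyMeasurable
    (Eventually.of_forall fun t => by rw [Real.norm_eq_abs, abs_of_nonneg (hA0 t)]; exact hAB t)
  set Y : ℝ → ℝ := fun t => A₀ + ∫ s in (0 : ℝ)..t, a s * A s with hY
  have hYc : Continuous Y := continuous_const.add
    (intervalIntegral.continuous_primitive (fun _ _ => haA.intervalIntegrable) 0)
  -- The rate is only integrable; replacing it by the continuous `|H n|` makes the comparison
  -- function differentiable. The error `B/(n+1)` is absorbed into the initial value.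
  choose H hHc hHle hHcont hHi using fun n : ℕ =>
    ha.exists_hasCompactSupport_integral_sub_le (Nat.one_div_pos_of_nat (α := ℝ) (n := n))
  have hlim0 : Tendsto (fun n : ℕ => 1 / ((n : ℝ) + 1)) atTop (𝓝 0) :=
    tendsto_one_div_add_atTop_nhds_zero_nat
  set b : ℕ → ℝ → ℝ := fun n t => |H n t| with hb
  have hbc : ∀ n, Continuous (b n) := fun n => (hHcont n).abs
  have hbi : ∀ n, Integrable (b n) := fun n => (hHi n).abs
  have hab : ∀ n, ∫ s, |a s - b n s| ≤ 1 / ((n : ℝ) + 1) := fun n => by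
    refine le_trans (integral_mono ((ha.sub (hbi n)).abs) (ha.sub (hHi n)).norm fun s => ?_)
      (hHle n)
    simp only [hb, Pi.sub_apply, Real.norm_eq_abs]
    have := abs_abs_sub_abs_le (a s) (H n s)
    rwa [abs_of_nonneg (ha0 s)] at this
  have hprim : ∀ t, Tendsto (fun n => ∫ s in (0 : ℝ)..t, b n s) atTop
      (𝓝 (∫ s in (0 : ℝ)..t, a s)) := fun t => by
    rw [tendsto_iff_norm_sub_tendsto_zero]
    refine squeeze_zero (fun n => norm_nonneg _) (fun n => ?_) hlim0
    rw [← intervalIntegral.integral_sub (hbi n).intervalIntegrable ha.intervalIntegrable]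
    refine (abs_primitive_le ((hbi n).sub ha) t).trans (le_trans (le_of_eq ?_) (hab n))
    congr 1; ext s; rw [abs_sub_comm]; rfl
  filter_upwards [h, ae_restrict_mem measurableSet_Ioo] with t ht htm
  have key : ∀ n : ℕ, Y t ≤ (A₀ + B * (1 / ((n : ℝ) + 1))) * Real.exp (∫ s in (0 : ℝ)..t, b n s) := by
    intro n
    set c := A₀ + B * (1 / ((n : ℝ) + 1))
    have hbY : Continuous fun s => b n s * Y s := (hbc n).mul hYc
    set Z : ℝ → ℝ := fun t => c + ∫ s in (0 : ℝ)..t, b n s * Y s with hZ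
    have hZd : ∀ t, HasDerivAt Z (b n t * Y t) t := fun t =>
      (intervalIntegral.integral_hasDerivAt_right (hbY.intervalIntegrable _ _)
        hbY.stronglyMeasurable.stronglyMeasurableAtFilter hbY.continuousAt).const_add c
    have hEd : ∀ t, HasDerivAt (fun t => Real.exp (-∫ s in (0 : ℝ)..t, b n s))
        (Real.exp (-∫ s in (0 : ℝ)..t, b n s) * -b n t) t := fun t =>
      (intervalIntegral.integral_hasDerivAt_right ((hbc n).intervalIntegrable _ _)
        (hbc n).stronglyMeasurable.stronglyMeasurableAtFilter (hbc n).continuousAt).neg.exp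
    have hYZ : ∀ t ∈ Icc 0 T, Y t ≤ Z t := by
      intro t ht
      have i1 : IntervalIntegrable (fun s => a s * A s) volume 0 t := haA.intervalIntegrable
      have i2 : IntervalIntegrable (fun s => b n s * A s) volume 0 t :=
        ((hbi n).mul_bdd (c := B) hA.aestronglyMeasurable (Eventually.of_forall fun t => by
          rw [Real.norm_eq_abs, abs_of_nonneg (hA0 t)]; exact hAB t)).intervalIntegrable
      have i3 : IntervalIntegrable (fun s => b n s * Y s) volume 0 t :=
        hbY.intervalIntegrable _ _
      have h1 : ∫ s in (0 : ℝ)..t, a s * A s ≤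
          (∫ s in (0 : ℝ)..t, b n s * A s) + B * (1 / ((n : ℝ) + 1)) := by
        have h2 : (∫ s in (0 : ℝ)..t, a s * A s) - ∫ s in (0 : ℝ)..t, b n s * A s =
            ∫ s in (0 : ℝ)..t, (a s - b n s) * A s := by
          rw [← intervalIntegral.integral_sub i1 i2]
          congr 1; ext s; ring
        have hdi : Integrable fun s => (a s - b n s) * A s :=
          (ha.sub (hbi n)).mul_bdd (c := B) hA.aestronglyMeasurable (Eventually.of_forall fun t => by
            rw [Real.norm_eq_abs, abs_of_nonneg (hA0 t)]; exact hAB t)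
        have h3 := (le_abs_self _).trans (abs_primitive_le hdi t)
        have h4 : ∫ s, |(a s - b n s) * A s| ≤ ∫ s, |a s - b n s| * B := by
          refine integral_mono hdi.abs ((ha.sub (hbi n)).abs.mul_const B) fun s => ?_
          simp only [abs_mul]
          rw [abs_of_nonneg (hA0 s)]
          exact mul_le_mul_of_nonneg_left (hAB s) (abs_nonneg _)
        rw [integral_mul_const] at h4
        have := mul_le_mul_of_nonneg_left (hab n) hB0
        linarith
      have h5 : ∫ s in (0 : ℝ)..t, b n s * A s ≤ ∫ s in (0 : ℝ)..t, b n s * Y s := by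
        refine intervalIntegral.integral_mono_ae_restrict ht.1 i2 i3 ?_
        refine (ae_restrict_iff' measurableSet_Icc).2 ?_
        rw [ae_restrict_iff' measurableSet_Ioo] at h
        filter_upwards [h, Measure.ae_ne volume (0 : ℝ), Measure.ae_ne volume T]
          with s hs hs0 hsT hsm
        exact mul_le_mul_of_nonneg_left
          (hs ⟨lt_of_le_of_ne hsm.1 (Ne.symm hs0), lt_of_le_of_ne (hsm.2.trans ht.2) hsT⟩)
          (abs_nonneg _)
      simp only [hY, hZ, c]
      linarith
    -- From `Y ≤ Z` and `Z' = b Y` it follows that `Z' ≤ b Z`, so that multiplication by the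
    -- integrating factor gives a nonincreasing function.
    have hanti : AntitoneOn (fun t => Z t * Real.exp (-∫ s in (0 : ℝ)..t, b n s)) (Icc 0 T) := by
      have hd : ∀ t, HasDerivAt (fun t => Z t * Real.exp (-∫ s in (0 : ℝ)..t, b n s))
          (b n t * (Y t - Z t) * Real.exp (-∫ s in (0 : ℝ)..t, b n s)) t := fun t =>
        ((hZd t).mul (hEd t)).congr_deriv (by ring)
      refine antitoneOn_of_deriv_nonpos (convex_Icc 0 T)
        (fun t _ => (hd t).continuousAt.continuousWithinAt)
        (fun t _ => (hd t).differentiableAt.differentiableWithinAt) fun t ht => ?_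
      rw [interior_Icc] at ht
      rw [(hd t).deriv]
      exact mul_nonpos_of_nonpos_of_nonneg (mul_nonpos_of_nonneg_of_nonpos (abs_nonneg _)
        (sub_nonpos.2 (hYZ t (Ioo_subset_Icc_self ht)))) (Real.exp_pos _).le
    have h6 := hanti (left_mem_Icc.2 hT.le) (Ioo_subset_Icc_self htm) htm.1.le
    simp only [hZ, intervalIntegral.integral_same, neg_zero, Real.exp_zero, add_zero, mul_one]
      at h6
    rw [Real.exp_neg, ← div_eq_mul_inv, div_le_iff₀ (Real.exp_pos _)] at h6
    exact (hYZ t (Ioo_subset_Icc_self htm)).trans h6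
  refine ht.trans (ge_of_tendsto' (x := atTop) ?_ key)
  have h7 := (tendsto_const_nhds (x := A₀)).add (hlim0.const_mul B)
  rw [mul_zero, add_zero] at h7
  exact h7.mul ((Real.continuous_exp.tendsto _).comp (hprim t))

/-- A differential Gronwall inequality in the sense of distributions. -/
theorem le_mul_exp_of_integral_nonneg {T A₀ B : ℝ} (hT : 0 < T) {A a : ℝ → ℝ}
    (hA : Measurable A) (hA0 : ∀ t, 0 ≤ A t) (hAB : ∀ t, A t ≤ B)
    (ha : Integrable a) (ha0 : ∀ t, 0 ≤ a t)
    (h : ∀ χ : ℝ → ℝ, ContDiff ℝ ∞ χ → (∀ t, 0 ≤ χ t) → (∀ t, T ≤ t → χ t = 0) →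
      0 ≤ (∫ t in Ioo 0 T, (deriv χ t * A t + χ t * (a t * A t))) + χ 0 * A₀) :
    ∀ᵐ t ∂volume.restrict (Ioo 0 T), A t ≤ A₀ * Real.exp (∫ s in (0 : ℝ)..t, a s) := by
  refine le_mul_exp_of_le_add_primitive hT hA hA0 hAB ha ha0 ?_
  have haA : Integrable fun s => a s * A s := ha.mul_bdd (c := B) hA.aestronglyMeasurable
    (Eventually.of_forall fun t => by rw [Real.norm_eq_abs, abs_of_nonneg (hA0 t)]; exact hAB t)
  have hAi : IntegrableOn A (Ioo 0 T) := Integrable.of_bound hA.aestronglyMeasurable B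
    (Eventually.of_forall fun t => by rw [Real.norm_eq_abs, abs_of_nonneg (hA0 t)]; exact hAB t)
  have hH := integrableOn_primitive hT.le haA.integrableOn
  have hH' : IntegrableOn (fun t => A₀ + ∫ s in (0 : ℝ)..t, a s * A s) (Ioo 0 T) :=
    (integrable_const A₀).add hH
  have hD : IntegrableOn (fun t => (A₀ + ∫ s in (0 : ℝ)..t, a s * A s) - A t) (Ioo 0 T) :=
    hH'.sub hAi
  have := ae_nonneg_of_integral_mul_nonneg hD fun α hα hα0 hc hs => ?_
  · filter_upwards [this] with t ht
    linarith
  · obtain ⟨T', hT0, hT', hz⟩ := exists_lt_forall_ge_eq_zero hT hc hs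
    have hχ : ContDiff ℝ ∞ fun t => ∫ s in t..T, α s := by
      have := (contDiff_primitive hα T).neg
      simpa only [← intervalIntegral.integral_symm] using this
    have hdχ : ∀ t, deriv (fun t => ∫ s in t..T, α s) t = -α t := fun t => by
      have e : (fun t => ∫ s in t..T, α s) = fun t => -∫ s in T..t, α s :=
        funext fun t => intervalIntegral.integral_symm _ _
      rw [e, deriv.fun_neg, deriv_primitive hα.continuous]
    have hz' : ∀ t, T ≤ t → ∫ s in t..T, α s = 0 := fun t ht => by
      rw [intervalIntegral.integral_symm, primitive_eq_zero hT'.le hz (hT'.le.trans ht), neg_zero]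
    -- The backward primitive of a nonnegative `α` is an admissible test function with derivative
    -- `-α`; it turns the differential inequality into its integrated form, tested with `α`.
    have h1 := h (fun t => ∫ s in t..T, α s) hχ (fun t => ?_) hz'
    · simp_rw [hdχ] at h1
      have i1 : IntegrableOn (fun t => α t * A t) (Ioo 0 T) :=
        integrableOn_of_continuous_mul hα.continuous hAi
      have i1' : IntegrableOn (fun t => -α t * A t) (Ioo 0 T) :=
        integrableOn_of_continuous_mul hα.continuous.neg hAi
      have i2 : IntegrableOn (fun t => (∫ s in t..T, α s) * (a t * A t)) (Ioo 0 T) :=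
        integrableOn_of_continuous_mul hχ.continuous haA.integrableOn
      have i3 : IntegrableOn (fun t => α t * ∫ s in (0 : ℝ)..t, a s * A s) (Ioo 0 T) :=
        integrableOn_of_continuous_mul hα.continuous hH
      have i4 : IntegrableOn (fun t => α t * A₀) (Ioo 0 T) :=
        integrableOn_of_continuous_mul hα.continuous (integrable_const A₀)
      have i5 : IntegrableOn (fun t => α t * (A₀ + ∫ s in (0 : ℝ)..t, a s * A s)) (Ioo 0 T) :=
        integrableOn_of_continuous_mul hα.continuous hH'
      rw [integral_add i1' i2, integral_primitive_mul hα.continuous haA.integrableOn,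
        ← setIntegral_Ioo_eq _ hT.le] at h1
      have e1 : ∫ t in Ioo 0 T, -α t * A t = -∫ t in Ioo 0 T, α t * A t := by
        rw [← integral_neg]; congr 1; ext t; ring
      have e2 : ∫ t in Ioo 0 T, α t * ((A₀ + ∫ s in (0 : ℝ)..t, a s * A s) - A t) =
          (∫ t in Ioo 0 T, α t * A₀) + (∫ t in Ioo 0 T, α t * ∫ s in (0 : ℝ)..t, a s * A s) -
            ∫ t in Ioo 0 T, α t * A t := by
        rw [← integral_add i4 i3]
        have i6 : IntegrableOn (fun t => α t * A₀ + α t * ∫ s in (0 : ℝ)..t, a s * A s)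
          (Ioo 0 T) := i4.add i3
        rw [← integral_sub i6 i1]
        congr 1; ext t; ring
      rw [e2, integral_mul_const]
      linarith
    · rcases le_total t T with h2 | h2
      · exact intervalIntegral.integral_nonneg h2 fun s _ => hα0 s
      · rw [hz' t h2]

/-! ### Bounded densities -/

/-- A jointly measurable family of functions with values in `[0, M]`. -/
structure IsBoundedDensity (M : ℝ) (u : ℝ → Torus d → ℝ) : Prop where
  measurable : Measurable (Function.uncurry u)
  nonneg : ∀ t x, 0 ≤ u t x
  le : ∀ t x, u t x ≤ M

namespace IsBoundedDensity

variable {M m : ℝ} {u : ℝ → Torus d → ℝ} {K : Torus d → Vec d}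

theorem measurable_slice (h : IsBoundedDensity M u) (t : ℝ) : Measurable (u t) :=
  h.measurable.comp measurable_prodMk_left

theorem abs_le (h : IsBoundedDensity M u) (t : ℝ) (x : Torus d) : |u t x| ≤ M := by
  rw [abs_of_nonneg (h.nonneg t x)]; exact h.le t x

theorem ae_abs_le (h : IsBoundedDensity M u) (t : ℝ) : ∀ᵐ x, |u t x| ≤ M :=
  Eventually.of_forall (h.abs_le t)

theorem bound_nonneg (h : IsBoundedDensity M u) : 0 ≤ M := (h.nonneg 0 0).trans (h.le 0 0)

theorem integrable (h : IsBoundedDensity M u) (t : ℝ) : Integrable (u t) :=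
  Integrable.of_bound (h.measurable_slice t).aestronglyMeasurable M (h.ae_abs_le t)

theorem measurable_mean (h : IsBoundedDensity M u) : Measurable fun t => ∫ x, u t x :=
  (StronglyMeasurable.integral_prod_right h.measurable.stronglyMeasurable).measurable

theorem mean_nonneg (h : IsBoundedDensity M u) (t : ℝ) : 0 ≤ ∫ x, u t x :=
  integral_nonneg (h.nonneg t)

theorem mean_le (h : IsBoundedDensity M u) (t : ℝ) : ∫ x, u t x ≤ M := by
  simpa using integral_mono (h.integrable t) (integrable_const M) (h.le t)

theorem abs_sub_mean_le (h : IsBoundedDensity M u) (t : ℝ) (x : Torus d) :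
    |u t x - ∫ y, u t y| ≤ M :=
  abs_sub_le_of_le_of_le (h.nonneg t x) (h.le t x) (h.mean_nonneg t) (h.mean_le t)
    |>.trans (by simp)

theorem measurable_rpow (h : IsBoundedDensity M u) :
    Measurable fun p : ℝ × Torus d => u p.1 p.2 ^ m :=
  h.measurable.pow_const m

theorem rpow_le (h : IsBoundedDensity M u) (hm : 0 < m) (t : ℝ) (x : Torus d) :
    u t x ^ m ≤ M ^ m := Real.rpow_le_rpow (h.nonneg t x) (h.le t x) hm.le

theorem stronglyMeasurable_convField (h : IsBoundedDensity M u) (hK : StronglyMeasurable K) :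
    StronglyMeasurable fun p : ℝ × Torus d => convField K (u p.1) p.2 := by
  refine StronglyMeasurable.integral_prod_right
    (f := fun (p : ℝ × Torus d) (y : Torus d) => u p.1 y • K (p.2 - y)) ?_
  have h1 : Measurable fun q : (ℝ × Torus d) × Torus d => u q.1.1 q.2 :=
    h.measurable.comp ((measurable_fst.comp measurable_fst).prodMk measurable_snd)
  have h2 : StronglyMeasurable fun q : (ℝ × Torus d) × Torus d => K (q.1.2 - q.2) :=
    hK.comp_measurable ((measurable_snd.comp measurable_fst).sub measurable_snd)
  exact h1.stronglyMeasurable.smul h2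

theorem norm_convField_le (h : IsBoundedDensity M u) (hK : Integrable K) (t : ℝ) (x : Torus d) :
    ‖convField K (u t) x‖ ≤ M * ∫ y, ‖K y‖ :=
  CoulombMobility.norm_convField_le hK (h.ae_abs_le t) x

end IsBoundedDensity

/-- The right-hand side of the nonconservative form of the equation,
`∇(v^m) · (∇g ∗ v) - v^m (v - v̄)`, where `F = ∇(v^m)`. -/
def source (m : ℝ) (K : Torus d → Vec d) (F : ℝ → Torus d → Vec d) (v : ℝ → Torus d → ℝ)
    (t : ℝ) (y : Torus d) : ℝ :=
  inner ℝ (F t y) (convField K (v t) y) - v t y ^ m * (v t y - ∫ z, v t z)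

theorem isTimeSpaceRegular_mul {n : WithTop ℕ∞} {χ : ℝ → ℝ} {ψ : Torus d → ℝ}
    (hχ : ContDiff ℝ n χ) (hψ : TorusContDiff n ψ) :
    IsTimeSpaceRegular n fun t x => χ t * ψ x :=
  (hχ.comp contDiff_fst).mul (ContDiff.comp (g := fun x : Vec d => ψ (proj x)) hψ contDiff_snd)

theorem grad_const_mul (c : ℝ) (ψ : Torus d → ℝ) (x : Torus d) :
    grad (fun x => c * ψ x) x = c • grad ψ x := by
  ext i
  simp [grad, partialDeriv_const_mul]

theorem restrict_prod_volume (s : Set ℝ) :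
    (volume.restrict s).prod (volume : Measure (Torus d)) =
      (volume.prod volume).restrict (s ×ˢ univ) := by
  rw [← Measure.prod_restrict, Measure.restrict_univ]

/-- The moving endpoint is encoded as an indicator in the variables `(t, y, s)`, after which
measurability of parameter integrals applies. -/
theorem stronglyMeasurable_setIntegral_Ioo {S : ℝ → Torus d → ℝ}
    (hS : Measurable (Function.uncurry S)) :
    StronglyMeasurable fun p : ℝ × Torus d => ∫ s in Ioo 0 p.1, S s p.2 := by
  have hS' : Measurable fun q : (ℝ × Torus d) × ℝ => S q.2 q.1.2 :=
    hS.comp (measurable_snd.prodMk (measurable_snd.comp measurable_fst))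
  have hset : MeasurableSet {q : (ℝ × Torus d) × ℝ | 0 < q.2 ∧ q.2 < q.1.1} :=
    (measurableSet_lt measurable_const measurable_snd).inter
      (measurableSet_lt measurable_snd (measurable_fst.comp measurable_fst))
  set Φ : (ℝ × Torus d) × ℝ → ℝ :=
    {q : (ℝ × Torus d) × ℝ | 0 < q.2 ∧ q.2 < q.1.1}.indicator fun q => S q.2 q.1.2 with hΦ
  have hΦm : StronglyMeasurable Φ := (hS'.indicator hset).stronglyMeasurable
  have e : (fun p : ℝ × Torus d => ∫ s in Ioo 0 p.1, S s p.2) = fun p => ∫ s, Φ (p, s) := by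
    ext p
    rw [← integral_indicator measurableSet_Ioo]
    rfl
  rw [e]
  exact hΦm.integral_prod_right'

section Source

variable {M m T : ℝ} {v : ℝ → Torus d → ℝ} {v₀ : Torus d → ℝ} {K : Torus d → Vec d}
  {g : Torus d → ℝ} {F : ℝ → Torus d → Vec d}

theorem stronglyMeasurable_source (hv : IsBoundedDensity M v) (hK : StronglyMeasurable K)
    (hF : StronglyMeasurable (Function.uncurry F)) :
    StronglyMeasurable (Function.uncurry (source m K F v)) := by
  have h1 : StronglyMeasurable fun p : ℝ × Torus d =>
      inner ℝ (F p.1 p.2) (convField K (v p.1) p.2) :=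
    StronglyMeasurable.inner hF (hv.stronglyMeasurable_convField hK)
  exact h1.sub ((hv.measurable_rpow).mul
    (hv.measurable.sub (hv.measurable_mean.comp measurable_fst))).stronglyMeasurable

theorem abs_source_le (hm : 0 < m) (hv : IsBoundedDensity M v) (hK : Integrable K)
    (t : ℝ) (y : Torus d) :
    |source m K F v t y| ≤ ‖F t y‖ * (M * ∫ z, ‖K z‖) + M ^ m * M := by
  refine (abs_sub _ _).trans (add_le_add ?_ ?_)
  · exact (abs_real_inner_le_norm _ _).trans
      (mul_le_mul_of_nonneg_left (hv.norm_convField_le hK t y) (norm_nonneg _))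
  · rw [abs_mul, abs_of_nonneg (Real.rpow_nonneg (hv.nonneg t y) m)]
    exact mul_le_mul (hv.rpow_le hm t y) (hv.abs_sub_mean_le t y) (abs_nonneg _)
      (Real.rpow_nonneg hv.bound_nonneg m)

theorem integrable_source (hm : 0 < m) (hv : IsBoundedDensity M v) (hK : StronglyMeasurable K)
    (hKi : Integrable K) (hF : StronglyMeasurable (Function.uncurry F))
    (hFi : Integrable (Function.uncurry F) ((volume.restrict (Ioo 0 T)).prod volume)) :
    Integrable (Function.uncurry (source m K F v)) ((volume.restrict (Ioo 0 T)).prod volume) := by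
  refine Integrable.mono' ((hFi.norm.mul_const (M * ∫ z, ‖K z‖)).add (integrable_const (M ^ m * M)))
    (stronglyMeasurable_source hv hK hF).aestronglyMeasurable
    (Eventually.of_forall fun p => abs_source_le hm hv hKi p.1 p.2)

/-- The product rule for the divergence of `v^m ∇g ∗ v` converts the weak formulation into the
nonconservative form. The constants `c` and `c'` stand for the values of a time cut-off and of its
derivative. -/
theorem integral_source_mul (h : IsGreenKernel g K) (hv : IsBoundedDensity M v)
    {ψ : Torus d → ℝ} (hψ : IsSmooth ψ) {t : ℝ}
    (ht : HasWeakGradient (fun x => v t x ^ m) (F t)) (c c' : ℝ) :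
    ∫ x, (-(v t x * (c' * ψ x)) + v t x ^ m * inner ℝ (convField K (v t) x)
        (grad (fun x => c * ψ x) x)) =
      -(c' * (∫ x, v t x * ψ x) + c * ∫ x, source m K F v t x * ψ x) := by
  have hK := h.gradient.integrable_grad
  have hmeas := (hv.measurable_slice t).aestronglyMeasurable (μ := volume)
  have hcb := continuous_convField hK hmeas (hv.ae_abs_le t)
  have hcg : Continuous fun x => inner ℝ (convField K (v t) x) (grad ψ x) := by
    simp_rw [inner_grad]
    refine continuous_finsetSum _ fun i _ => ?_
    exact ((coord i).continuous.comp hcb).mul (hψ.contDiffOne.continuous_partialDeriv i)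
  have i1 : Integrable fun x => c' * (v t x * ψ x) :=
    (Integrable.mul_continuous (hv.integrable t) hψ.continuous).const_mul c'
  have i2 : Integrable fun x => c * (v t x ^ m * inner ℝ (convField K (v t) x) (grad ψ x)) :=
    (Integrable.mul_continuous ht.integrable_fun hcg).const_mul c
  have e : ∀ x, -(v t x * (c' * ψ x)) + v t x ^ m * inner ℝ (convField K (v t) x)
      (grad (fun x => c * ψ x) x) = c * (v t x ^ m * inner ℝ (convField K (v t) x) (grad ψ x)) -
        c' * (v t x * ψ x) := fun x => by
    rw [grad_const_mul, inner_smul_right]; ring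
  simp_rw [e]
  rw [integral_sub i2 i1, integral_const_mul, integral_const_mul,
    h.integral_mul_inner_convField_grad ht hmeas (hv.ae_abs_le t) hψ]
  simp only [source]
  ring

theorem integrable_mul_slice {S : ℝ → Torus d → ℝ} {ψ : Torus d → ℝ}
    (hS : Integrable (Function.uncurry S) ((volume.restrict (Ioo 0 T)).prod volume))
    (hψ : Continuous ψ) :
    Integrable (Function.uncurry fun t x => S t x * ψ x)
      ((volume.restrict (Ioo 0 T)).prod volume) := by
  obtain ⟨B, hB⟩ := isCompact_univ.exists_bound_of_continuousOn hψ.continuousOn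
  exact hS.mul_bdd (c := B) (hψ.measurable.comp measurable_snd).aestronglyMeasurable
    (Eventually.of_forall fun p => hB p.2 (mem_univ _))

/-- The equation tested with a fixed function of space. -/
theorem ae_integral_mul_eq_add_primitive (hT : 0 < T) (h : IsGreenKernel g K)
    (hm : 0 < m) (hv : IsBoundedDensity M v) (hK : StronglyMeasurable K)
    (hsol : IsEntropySolution m K v₀ v) (hF : StronglyMeasurable (Function.uncurry F))
    (hFi : Integrable (Function.uncurry F) ((volume.restrict (Ioo 0 T)).prod volume))
    (hVF : ∀ᵐ t ∂volume.restrict (Ioo 0 T), HasWeakGradient (fun x => v t x ^ m) (F t))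
    {ψ : Torus d → ℝ} (hψ : IsSmooth ψ) :
    ∀ᵐ t ∂volume.restrict (Ioo 0 T), ∫ x, v t x * ψ x =
      (∫ x, v₀ x * ψ x) + ∫ s in (0 : ℝ)..t, ∫ x, source m K F v s x * ψ x := by
  have hvi : Integrable (Function.uncurry v) ((volume.restrict (Ioo 0 T)).prod volume) :=
    Integrable.of_bound hv.measurable.aestronglyMeasurable M
      (Eventually.of_forall fun p => hv.abs_le p.1 p.2)
  have hSi := integrable_source hm hv hK h.gradient.integrable_grad hF hFi
  refine ae_eq_add_primitive hT (integrable_mul_slice hvi hψ.continuous).integral_prod_left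
    (integrable_mul_slice hSi hψ.continuous).integral_prod_left fun χ hχ hχT => ?_
  obtain ⟨T', hT', hz⟩ := hχT
  have hw := hsol.weak T hT (fun t x => χ t * ψ x)
    (isTimeSpaceRegular_mul (hχ.of_le (by exact_mod_cast le_top)) hψ.contDiffOne)
    ⟨T', hT', fun t ht x => by rw [hz t ht, zero_mul]⟩
  have e1 : ∫ x, v₀ x * (χ 0 * ψ x) = χ 0 * ∫ x, v₀ x * ψ x := by
    rw [← integral_const_mul]; congr 1; ext x; ring
  rw [e1] at hw
  rw [← hw, ← integral_neg]
  refine integral_congr_ae ?_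
  filter_upwards [hVF] with t ht
  have hd : ∀ x, deriv (fun s => χ s * ψ x) t = deriv χ t * ψ x := fun x => by
    rw [deriv_mul_const (hχ.differentiable (by norm_num) t)]
  simp only [hd]
  rw [integral_source_mul h hv hψ ht, neg_neg]

/-- `v` is almost everywhere the primitive in time of its source. -/
theorem ae_ae_eq_add_primitive (hT : 0 < T) (h : IsGreenKernel g K)
    (hm : 0 < m) (hv : IsBoundedDensity M v) (hK : StronglyMeasurable K)
    (hv₀ : Measurable v₀) (hv₀i : Integrable v₀)
    (hsol : IsEntropySolution m K v₀ v) (hF : StronglyMeasurable (Function.uncurry F))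
    (hFi : Integrable (Function.uncurry F) ((volume.restrict (Ioo 0 T)).prod volume))
    (hVF : ∀ᵐ t ∂volume.restrict (Ioo 0 T), HasWeakGradient (fun x => v t x ^ m) (F t)) :
    ∀ᵐ y, ∀ᵐ t ∂volume.restrict (Ioo 0 T),
      v t y = v₀ y + ∫ s in (0 : ℝ)..t, source m K F v s y := by
  have hSi := integrable_source hm hv hK h.gradient.integrable_grad hF hFi
  have hSm := stronglyMeasurable_source (m := m) hv hK hF
  set S := source m K F v
  have hD := TopologicalSpace.exists_countable_dense (Torus d)
  obtain ⟨D, hDc, hDd⟩ := hD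
  -- Only countably many test functions are used, mollifiers centred at the points of a countable
  -- dense set, so that one null set of times serves them all. Continuity of the mollifications
  -- recovers the remaining centres.
  have h1 : ∀ᵐ t ∂volume.restrict (Ioo 0 T), ∀ n : ℕ, ∀ z ∈ D,
      ∫ x, v t x * mollifier n (z - x) = (∫ x, v₀ x * mollifier n (z - x)) +
        ∫ s in (0 : ℝ)..t, ∫ x, S s x * mollifier n (z - x) := by
    rw [ae_all_iff]
    intro n
    refine (ae_ball_iff hDc).2 fun z _ => ?_
    exact ae_integral_mul_eq_add_primitive hT h hm hv hK hsol hF hFi hVF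
      (TorusContDiff.comp_sub_left (isSmooth_mollifier n) z)
  have hIm : StronglyMeasurable fun p : ℝ × Torus d => ∫ s in Ioo 0 p.1, S s p.2 := 
    stronglyMeasurable_setIntegral_Ioo hSm.measurable
  have h2 : ∀ᵐ t ∂volume.restrict (Ioo 0 T), ∀ᵐ y, v t y = v₀ y + ∫ s in Ioo 0 t, S s y := by
    filter_upwards [h1, ae_restrict_mem measurableSet_Ioo] with t ht htm
    have hSit : Integrable (Function.uncurry S) ((volume.restrict (Ioo 0 t)).prod volume) := by
      rw [restrict_prod_volume] at hSi ⊢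
      exact hSi.mono_measure
        (Measure.restrict_mono (prod_mono (Ioo_subset_Ioo_right htm.2.le) subset_rfl) le_rfl)
    have hpi : Integrable fun y => ∫ s in Ioo 0 t, S s y := hSit.integral_prod_right
    set N : Torus d → ℝ := fun y => v t y - v₀ y - ∫ s in Ioo 0 t, S s y
    have hN : Integrable N := ((hv.integrable t).sub hv₀i).sub hpi
    have hz : ∀ n, ∀ z ∈ D, conv N (mollifier n) z = 0 := by
      intro n z hz
      have hc : Continuous fun y : Torus d => mollifier n (z - y) :=
        (continuous_mollifier n).comp (by fun_prop)
      have i1 := Integrable.mul_continuous (hv.integrable t) hc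
      have i2 := Integrable.mul_continuous hv₀i hc
      have i3 := Integrable.mul_continuous hpi hc
      have i4 : Integrable fun y => v t y * mollifier n (z - y) - v₀ y * mollifier n (z - y) :=
        i1.sub i2
      have e1 : conv N (mollifier n) z = ∫ y, (v t y * mollifier n (z - y) -
          v₀ y * mollifier n (z - y) - (∫ s in Ioo 0 t, S s y) * mollifier n (z - y)) := by
        unfold conv
        congr 1; ext y; simp only [N]; ring
      have e2 : ∫ s in (0 : ℝ)..t, ∫ x, S s x * mollifier n (z - x) =
          ∫ y, (∫ s in Ioo 0 t, S s y) * mollifier n (z - y) := by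
        rw [← setIntegral_Ioo_eq _ htm.1.le,
          integral_integral_swap (integrable_mul_slice hSit hc)]
        congr 1; ext y
        rw [integral_mul_const]
      rw [e1, integral_sub i4 i3, integral_sub i1 i2, ht n z hz, e2]
      ring
    have hz' : ∀ n x, |conv N (mollifier n) x| ≤ 0 := by
      intro n x
      have : conv N (mollifier n) = fun _ => 0 :=
        (Integrable.conv_mollifier hN n).ext_on hDd continuous_const fun z hzD => hz n z hzD
      rw [this, abs_zero]
    filter_upwards [ae_abs_le_of_conv_mollifier_le hN hz'] with y hy
    have := abs_nonpos_iff.1 hy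
    simp only [N] at this
    linarith
  -- Exchanging "almost every `t`, almost every `y`" requires the set where the identity holds to be
  -- measurable.
  have hmeas : MeasurableSet {p : ℝ × Torus d | v p.1 p.2 = v₀ p.2 + ∫ s in Ioo 0 p.1, S s p.2} :=
    measurableSet_eq_fun hv.measurable ((hv₀.comp measurable_snd).add hIm.measurable)
  have h3 := (Measure.ae_ae_comm (p := fun t y => v t y = v₀ y + ∫ s in Ioo 0 t, S s y) hmeas).1 h2
  filter_upwards [h3] with y hy
  filter_upwards [hy, ae_restrict_mem measurableSet_Ioo] with t ht htm
  rw [ht, setIntegral_Ioo_eq _ htm.1.le]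

end Source

/-! ### Entropy fluxes of the soft absolute values -/

theorem deriv_softAbs_sub {κ : ℝ} (hκ : κ ≠ 0) (l z : ℝ) :
    deriv (fun z => softAbs κ (z - l)) z = softSgn κ (z - l) :=
  ((hasDerivAt_softAbs hκ (z - l)).comp_sub_const z l).deriv

/-- The entropy flux of `z ↦ softAbs κ (z - l)`. -/
def softFlux (m κ l ξ : ℝ) : ℝ := ∫ s in (0 : ℝ)..ξ, m * softSgn κ (s - l) * s ^ (m - 1)

theorem entropyFlux_softAbs (m : ℝ) {κ : ℝ} (hκ : κ ≠ 0) (l ξ : ℝ) :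
    entropyFlux m (fun z => softAbs κ (z - l)) ξ = softFlux m κ l ξ := by
  simp only [entropyFlux, softFlux, deriv_softAbs_sub hκ]

theorem integral_mul_rpow_sub_one {m : ℝ} (hm : 0 < m) (a b : ℝ) :
    ∫ s in a..b, m * s ^ (m - 1) = b ^ m - a ^ m := by
  rw [intervalIntegral.integral_const_mul, integral_rpow (Or.inl (by linarith)), sub_add_cancel]
  field_simp

theorem intervalIntegrable_mul_rpow_sub_one {m : ℝ} (hm : 0 < m) (a b : ℝ) :
    IntervalIntegrable (fun s : ℝ => m * s ^ (m - 1)) volume a b :=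
  (intervalIntegral.intervalIntegrable_rpow' (by linarith)).const_mul m

theorem aestronglyMeasurable_mul_rpow {m : ℝ} {σ : ℝ → ℝ} (hσ : Measurable σ) (μ : Measure ℝ) :
    AEStronglyMeasurable (fun s : ℝ => m * σ s * s ^ (m - 1)) μ :=
  ((hσ.const_mul m).mul (measurable_id.pow_const (m - 1))).aestronglyMeasurable

theorem norm_mul_rpow_le {m : ℝ} (hm : 0 < m) {c s : ℝ} (hc : |c| ≤ 1) (hs : 0 ≤ s) :
    ‖m * c * s ^ (m - 1)‖ ≤ m * s ^ (m - 1) := by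
  have h := Real.rpow_nonneg hs (m - 1)
  rw [norm_mul, norm_mul, Real.norm_of_nonneg hm.le, Real.norm_of_nonneg h, Real.norm_eq_abs]
  refine mul_le_mul_of_nonneg_right ?_ h
  nlinarith

theorem abs_softFlux_le {m : ℝ} (hm : 0 < m) (κ l : ℝ) {ξ : ℝ} (hξ : 0 ≤ ξ) :
    |softFlux m κ l ξ| ≤ ξ ^ m := by
  have h := intervalIntegral.norm_integral_le_of_norm_le (μ := volume) hξ
    (f := fun s => m * softSgn κ (s - l) * s ^ (m - 1)) (g := fun s => m * s ^ (m - 1))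
    (Eventually.of_forall fun s hs => norm_mul_rpow_le hm (abs_softSgn_le _ _) hs.1.le)
    (intervalIntegrable_mul_rpow_sub_one hm 0 ξ)
  rwa [integral_mul_rpow_sub_one hm, Real.zero_rpow hm.ne', sub_zero] at h

theorem continuous_softFlux_level {m κ : ℝ} (hm : 0 < m) (hκ : κ ≠ 0) {ξ : ℝ} (hξ : 0 ≤ ξ) :
    Continuous fun l => softFlux m κ l ξ := by
  refine intervalIntegral.continuous_of_dominated_interval (bound := fun s => m * s ^ (m - 1))
    (fun l => ?_) (fun l => ?_) (intervalIntegrable_mul_rpow_sub_one hm 0 ξ) ?_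
  · exact aestronglyMeasurable_mul_rpow
      ((continuous_softSgn hκ).measurable.comp (measurable_id.sub_const l)) _
  · refine Eventually.of_forall fun s hs => norm_mul_rpow_le hm (abs_softSgn_le _ _) ?_
    rw [uIoc_of_le hξ] at hs
    exact hs.1.le
  · refine Eventually.of_forall fun s _ => ?_
    have := continuous_softSgn hκ
    fun_prop

theorem continuous_softFlux {m κ : ℝ} (hm : 0 < m) (hκ : κ ≠ 0) (l : ℝ) :
    Continuous (softFlux m κ l) := by
  refine intervalIntegral.continuous_primitive (fun a b => ?_) 0
  have h : Continuous fun s : ℝ => softSgn κ (s - l) :=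
    (continuous_softSgn hκ).comp (continuous_id.sub continuous_const)
  have := (intervalIntegrable_mul_rpow_sub_one hm a b).mul_continuousOn h.continuousOn
  refine this.congr fun s _ => ?_
  ring

theorem abs_rpow_sub_rpow {m : ℝ} (hm : 0 < m) {a b : ℝ} (ha : 0 ≤ a) (hb : 0 ≤ b) :
    |a ^ m - b ^ m| = sgn (a - b) * (a ^ m - b ^ m) := by
  rcases lt_trichotomy a b with h | h | h
  · have := Real.rpow_lt_rpow ha h hm
    rw [sgn_of_neg (by linarith), abs_of_neg (by linarith)]; ring
  · simp [h]
  · have := Real.rpow_lt_rpow hb h hm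
    rw [sgn_of_pos (by linarith), abs_of_pos (by linarith)]; ring

theorem sgn_rpow_sub_rpow {m : ℝ} (hm : 0 < m) {a b : ℝ} (ha : 0 ≤ a) (hb : 0 ≤ b) :
    sgn (a ^ m - b ^ m) = sgn (a - b) := by
  rcases lt_trichotomy a b with h | h | h
  · have := Real.rpow_lt_rpow ha h hm
    rw [sgn_of_neg (by linarith), sgn_of_neg (by linarith)]
  · simp [h]
  · have := Real.rpow_lt_rpow hb h hm
    rw [sgn_of_pos (by linarith), sgn_of_pos (by linarith)]

/-- On `s ≥ 0` the integrand is the derivative of `|s^m - l^m|`, whose value at `0` is `l^m`. -/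
theorem integral_sgn_mul_rpow {m : ℝ} (hm : 0 < m) {l ξ : ℝ} (hl : 0 ≤ l) (hξ : 0 ≤ ξ) :
    ∫ s in (0 : ℝ)..ξ, m * sgn (s - l) * s ^ (m - 1) = |ξ ^ m - l ^ m| - l ^ m := by
  have hlo : ∀ b, b ≤ l → 0 ≤ b → ∫ s in (0 : ℝ)..b, m * sgn (s - l) * s ^ (m - 1) = -b ^ m := by
    intro b hb hb0
    have : ∫ s in (0 : ℝ)..b, m * sgn (s - l) * s ^ (m - 1) =
        ∫ s in (0 : ℝ)..b, -(m * s ^ (m - 1)) := by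
      refine intervalIntegral.integral_congr_ae ?_
      filter_upwards [Measure.ae_ne volume l] with s hs hsm
      rw [uIoc_of_le hb0] at hsm
      rw [sgn_of_neg (by linarith [lt_of_le_of_ne (hsm.2.trans hb) hs])]
      ring
    rw [this, intervalIntegral.integral_neg, integral_mul_rpow_sub_one hm,
      Real.zero_rpow hm.ne', sub_zero]
  rcases le_total ξ l with h | h
  · have := Real.rpow_le_rpow hξ h hm.le
    rw [hlo ξ h hξ, abs_of_nonpos (by linarith)]
    ring
  · have hi : ∀ a b, 0 ≤ a → 0 ≤ b →
        IntervalIntegrable (fun s : ℝ => m * sgn (s - l) * s ^ (m - 1)) volume a b := by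
      intro a b ha hb
      refine (intervalIntegrable_mul_rpow_sub_one hm a b).mono_fun'
        (aestronglyMeasurable_mul_rpow (measurable_sgn.comp (measurable_id.sub_const l)) _) ?_
      filter_upwards [ae_restrict_mem measurableSet_uIoc] with s hs
      exact norm_mul_rpow_le hm (abs_sgn_le _) ((le_min ha hb).trans hs.1.le)
    have h2 : ∫ s in l..ξ, m * sgn (s - l) * s ^ (m - 1) = ξ ^ m - l ^ m := by
      rw [← integral_mul_rpow_sub_one hm]
      refine intervalIntegral.integral_congr_ae (Eventually.of_forall fun s hs => ?_)
      rw [uIoc_of_le h] at hs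
      rw [sgn_of_pos (by linarith [hs.1]), mul_one]
    have := Real.rpow_le_rpow hl h hm.le
    rw [← intervalIntegral.integral_add_adjacent_intervals (hi 0 l le_rfl hl) (hi l ξ hl hξ),
      hlo l le_rfl hl, h2, abs_of_nonneg (by linarith)]
    ring

theorem tendsto_softFlux {m : ℝ} (hm : 0 < m) {l ξ : ℝ} (hl : 0 ≤ l) (hξ : 0 ≤ ξ) :
    Tendsto (fun n => softFlux m (softParam n) l ξ) atTop (𝓝 (|ξ ^ m - l ^ m| - l ^ m)) := by
  rw [← integral_sgn_mul_rpow hm hl hξ]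
  refine intervalIntegral.tendsto_integral_filter_of_dominated_convergence
    (fun s => m * s ^ (m - 1)) (Eventually.of_forall fun n => ?_) (Eventually.of_forall fun n => ?_)
    (intervalIntegrable_mul_rpow_sub_one hm 0 ξ) (Eventually.of_forall fun s _ => ?_)
  · exact aestronglyMeasurable_mul_rpow
      ((continuous_softSgn (softParam_pos n).ne').measurable.comp (measurable_id.sub_const l)) _
  · refine Eventually.of_forall fun s hs => norm_mul_rpow_le hm (abs_softSgn_le _ _) ?_
    rw [uIoc_of_le hξ] at hs
    exact hs.1.le
  · exact ((tendsto_softSgn (s - l)).const_mul m).mul_const _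

theorem continuous_grad {ψ : Torus d → ℝ} (hψ : IsSmooth ψ) : Continuous (grad ψ) :=
  (PiLp.continuous_toLp 2 _).comp
    (continuous_pi fun i => hψ.contDiffOne.continuous_partialDeriv i)

theorem exists_bound_grad {ψ : Torus d → ℝ} (hψ : IsSmooth ψ) :
    ∃ G, 0 ≤ G ∧ ∀ x, ‖grad ψ x‖ ≤ G := by
  obtain ⟨B, hB⟩ := isCompact_univ.exists_bound_of_continuousOn (continuous_grad hψ).continuousOn
  exact ⟨max B 0, le_max_right _ _, fun x => (hB x (mem_univ x)).trans (le_max_left _ _)⟩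

/-! ### The entropy inequality at a level -/

/-- The soft distance of `f` to the level `l`, tested with `ψ`. -/
def levelDist (κ : ℝ) (f ψ : Torus d → ℝ) (l : ℝ) : ℝ := ∫ x, softAbs κ (f x - l) * ψ x

/-- Minus the derivative of the soft distance of `f` to the level `l`. -/
def levelSide (κ : ℝ) (f ψ : Torus d → ℝ) (l : ℝ) : ℝ := ∫ x, softSgn κ (f x - l) * ψ x

/-- The right-hand side of the entropy inequality at the level `l`, tested with `ψ`. -/
def levelRate (m κ : ℝ) (K : Torus d → Vec d) (f ψ : Torus d → ℝ) (l : ℝ) : ℝ :=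
  ∫ x, (-(softFlux m κ l (f x) * inner ℝ (convField K f x) (grad ψ x)) +
    (softFlux m κ l (f x) - softSgn κ (f x - l) * f x ^ m) * (f x - ∫ y, f y) * ψ x)

section Slice

variable {m κ M B D : ℝ} {K : Torus d → Vec d} {f ψ : Torus d → ℝ}

theorem abs_levelDist_integrand_le (hf0 : ∀ x, 0 ≤ f x) (hfM : ∀ x, f x ≤ M)
    (hB : ∀ x, |ψ x| ≤ B) (hκ : |κ| ≤ 1) (l : ℝ) (x : Torus d) :
    |softAbs κ (f x - l) * ψ x| ≤ (M + 1) * B * (1 + |l|) := by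
  have h1 : |f x| ≤ M := by rw [abs_of_nonneg (hf0 x)]; exact hfM x
  have hM : 0 ≤ M := (abs_nonneg _).trans h1
  have hB0 : 0 ≤ B := (abs_nonneg _).trans (hB x)
  have h2 : softAbs κ (f x - l) ≤ (M + 1) * (1 + |l|) := by
    have := softAbs_le κ (f x - l)
    have := abs_sub (f x) l
    nlinarith [mul_nonneg hM (abs_nonneg l)]
  rw [abs_mul, abs_of_nonneg (softAbs_nonneg _ _)]
  calc softAbs κ (f x - l) * |ψ x| ≤ (M + 1) * (1 + |l|) * B :=
        mul_le_mul h2 (hB x) (abs_nonneg _) (by positivity)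
    _ = _ := by ring

theorem abs_levelSide_integrand_le (hB : ∀ x, |ψ x| ≤ B) (l : ℝ) (x : Torus d) :
    |softSgn κ (f x - l) * ψ x| ≤ B := by
  rw [abs_mul]
  calc |softSgn κ (f x - l)| * |ψ x| ≤ 1 * B :=
        mul_le_mul (abs_softSgn_le _ _) (hB x) (abs_nonneg _) zero_le_one
    _ = B := one_mul B

theorem abs_sub_integral_le (hf : Measurable f) (hf0 : ∀ x, 0 ≤ f x) (hfM : ∀ x, f x ≤ M)
    (x : Torus d) : |f x - ∫ y, f y| ≤ M :=
  IsBoundedDensity.abs_sub_mean_le (u := fun _ => f)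
    ⟨hf.comp measurable_snd, fun _ => hf0, fun _ => hfM⟩ 0 x

theorem abs_levelRate_integrand_le (hm : 0 < m) (hf : Measurable f) (hf0 : ∀ x, 0 ≤ f x)
    (hfM : ∀ x, f x ≤ M) (hB : ∀ x, |ψ x| ≤ B)
    (hD : ∀ x, |inner ℝ (convField K f x) (grad ψ x)| ≤ D) (l : ℝ) (x : Torus d) :
    |-(softFlux m κ l (f x) * inner ℝ (convField K f x) (grad ψ x)) +
      (softFlux m κ l (f x) - softSgn κ (f x - l) * f x ^ m) * (f x - ∫ y, f y) * ψ x| ≤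
      M ^ m * D + (M ^ m + M ^ m) * M * B := by
  have h1 : f x ^ m ≤ M ^ m := Real.rpow_le_rpow (hf0 x) (hfM x) hm.le
  have h0 : 0 ≤ f x ^ m := Real.rpow_nonneg (hf0 x) m
  have hM : 0 ≤ M := (hf0 x).trans (hfM x)
  have hMm : 0 ≤ M ^ m := Real.rpow_nonneg hM m
  have hq : |softFlux m κ l (f x)| ≤ M ^ m := (abs_softFlux_le hm κ l (hf0 x)).trans h1
  have hs : |softSgn κ (f x - l) * f x ^ m| ≤ M ^ m := by
    rw [abs_mul, abs_of_nonneg h0]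
    nlinarith [abs_softSgn_le κ (f x - l)]
  refine (abs_add_le _ _).trans (add_le_add ?_ ?_)
  · rw [abs_neg, abs_mul]
    exact mul_le_mul hq (hD x) (abs_nonneg _) hMm
  · rw [abs_mul, abs_mul]
    exact mul_le_mul (mul_le_mul ((abs_sub _ _).trans (add_le_add hq hs))
      (abs_sub_integral_le hf hf0 hfM x) (abs_nonneg _) (by positivity)) (hB x) (abs_nonneg _)
      (by positivity)

theorem hasDerivAt_levelDist (hf : Measurable f) (hf0 : ∀ x, 0 ≤ f x) (hfM : ∀ x, f x ≤ M)
    (hψ : Continuous ψ) (hB : ∀ x, |ψ x| ≤ B) (hκ : κ ≠ 0) (hκ1 : |κ| ≤ 1) (l : ℝ) :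
    HasDerivAt (levelDist κ f ψ) (-levelSide κ f ψ l) l := by
  have hmA : ∀ l, AEStronglyMeasurable (fun x => softAbs κ (f x - l) * ψ x) volume := fun l =>
    (((contDiff_softAbs hκ (n := 0)).continuous.measurable.comp (hf.sub_const l)).mul
      hψ.measurable).aestronglyMeasurable
  have hmS : AEStronglyMeasurable (fun x => -(softSgn κ (f x - l) * ψ x)) volume :=
    (((continuous_softSgn hκ).measurable.comp (hf.sub_const l)).mul
      hψ.measurable).neg.aestronglyMeasurable
  have h := (hasDerivAt_integral_of_dominated_loc_of_deriv_le (μ := volume) (x₀ := l)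
    (F := fun l x => softAbs κ (f x - l) * ψ x) (F' := fun l x => -(softSgn κ (f x - l) * ψ x))
    (s := univ) (bound := fun _ => B) univ_mem (Eventually.of_forall hmA)
    (Integrable.of_bound (hmA l) _
      (Eventually.of_forall (abs_levelDist_integrand_le hf0 hfM hB hκ1 l)))
    hmS (Eventually.of_forall fun x l _ => ?_) (integrable_const B)
    (Eventually.of_forall fun x l _ => ?_)).2
  · rw [integral_neg] at h
    exact h
  · rw [norm_neg]
    exact abs_levelSide_integrand_le hB l x
  · have h1 := (hasDerivAt_softAbs hκ (f x - l)).comp l ((hasDerivAt_id l).const_sub (f x))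
    exact (h1.mul_const (ψ x)).congr_deriv (by ring)

theorem continuous_levelSide (hf : Measurable f) (hψ : Continuous ψ) (hB : ∀ x, |ψ x| ≤ B)
    (hκ : κ ≠ 0) : Continuous (levelSide κ f ψ) := by
  refine continuous_of_dominated (bound := fun _ => B) (fun l => ?_)
    (fun l => Eventually.of_forall (abs_levelSide_integrand_le hB l)) (integrable_const B)
    (Eventually.of_forall fun x => ?_)
  · exact (((continuous_softSgn hκ).measurable.comp (hf.sub_const l)).mul
      hψ.measurable).aestronglyMeasurable
  · have := continuous_softSgn hκ
    fun_prop

theorem measurable_levelRate_integrand (hm : 0 < m) (hκ : κ ≠ 0) (hf : Measurable f)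
    (hψ : IsSmooth ψ) (hb : Continuous (convField K f)) (l : ℝ) :
    Measurable fun x => -(softFlux m κ l (f x) * inner ℝ (convField K f x) (grad ψ x)) +
      (softFlux m κ l (f x) - softSgn κ (f x - l) * f x ^ m) * (f x - ∫ y, f y) * ψ x := by
  have hq := (continuous_softFlux hm hκ l).measurable.comp hf
  have hs := (continuous_softSgn hκ).measurable.comp (hf.sub_const l)
  have hi : Measurable fun x => inner ℝ (convField K f x) (grad ψ x) :=
    (hb.inner (continuous_grad hψ)).measurable
  exact (hq.mul hi).neg.add (((hq.sub (hs.mul (hf.pow_const m))).mul (hf.sub_const _)).mul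
    hψ.continuous.measurable)

theorem continuous_levelRate (hm : 0 < m) (hκ : κ ≠ 0) (hf : Measurable f) (hf0 : ∀ x, 0 ≤ f x)
    (hfM : ∀ x, f x ≤ M) (hψ : IsSmooth ψ) (hB : ∀ x, |ψ x| ≤ B) (hb : Continuous (convField K f))
    (hD : ∀ x, |inner ℝ (convField K f x) (grad ψ x)| ≤ D) :
    Continuous (levelRate m κ K f ψ) := by
  refine continuous_of_dominated (bound := fun _ => M ^ m * D + (M ^ m + M ^ m) * M * B)
    (fun l => (measurable_levelRate_integrand hm hκ hf hψ hb l).aestronglyMeasurable)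
    (fun l => Eventually.of_forall (abs_levelRate_integrand_le hm hf hf0 hfM hB hD l))
    (integrable_const _) (Eventually.of_forall fun x => ?_)
  have h1 := continuous_softFlux_level hm hκ (hf0 x)
  have h2 := continuous_softSgn hκ
  fun_prop

theorem abs_integral_le_of_bound {f : Torus d → ℝ} {C : ℝ} (h : ∀ x, |f x| ≤ C) :
    |∫ x, f x| ≤ C := by
  simpa using norm_integral_le_of_norm_le_const (μ := (volume : Measure (Torus d)))
    (Eventually.of_forall fun x => (Real.norm_eq_abs _).trans_le (h x))

theorem tendsto_levelDist (hf : Measurable f) (hf0 : ∀ x, 0 ≤ f x) (hfM : ∀ x, f x ≤ M)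
    (hψ : Continuous ψ) (hB : ∀ x, |ψ x| ≤ B) (l : ℝ) :
    Tendsto (fun n => levelDist (softParam n) f ψ l) atTop (𝓝 (∫ x, |f x - l| * ψ x)) := by
  refine tendsto_integral_of_dominated_convergence (fun _ => (M + 1) * B * (1 + |l|)) (fun n => ?_)
    (integrable_const _) (fun n => Eventually.of_forall ?_)
    (Eventually.of_forall fun x => (tendsto_softAbs _).mul_const _)
  · exact (((contDiff_softAbs (softParam_pos n).ne' (n := 0)).continuous.measurable.comp
      (hf.sub_const l)).mul hψ.measurable).aestronglyMeasurable
  · refine abs_levelDist_integrand_le hf0 hfM hB ?_ l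
    rw [abs_of_pos (softParam_pos n)]; exact softParam_le_one n

theorem tendsto_levelSide (hf : Measurable f) (hψ : Continuous ψ) (hB : ∀ x, |ψ x| ≤ B) (l : ℝ) :
    Tendsto (fun n => levelSide (softParam n) f ψ l) atTop (𝓝 (∫ x, sgn (f x - l) * ψ x)) := by
  refine tendsto_integral_of_dominated_convergence (fun _ => B) (fun n => ?_)
    (integrable_const _) (fun n => Eventually.of_forall (abs_levelSide_integrand_le hB l))
    (Eventually.of_forall fun x => (tendsto_softSgn _).mul_const _)
  exact (((continuous_softSgn (softParam_pos n).ne').measurable.comp (hf.sub_const l)).mul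
    hψ.measurable).aestronglyMeasurable

/-- The limit of the right-hand side of the entropy inequality at the level `l`. -/
theorem tendsto_levelRate {g : Torus d → ℝ} (hm : 0 < m) (h : IsGreenKernel g K)
    (hf : Measurable f) (hf0 : ∀ x, 0 ≤ f x) (hfM : ∀ x, f x ≤ M)
    (hψ : IsSmooth ψ) (hB : ∀ x, |ψ x| ≤ B)
    (hD : ∀ x, |inner ℝ (convField K f x) (grad ψ x)| ≤ D) {l : ℝ} (hl : 0 ≤ l) :
    Tendsto (fun n => levelRate m (softParam n) K f ψ l) atTop
      (𝓝 (∫ x, (-(|f x ^ m - l ^ m| * inner ℝ (convField K f x) (grad ψ x)) -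
        sgn (f x - l) * l ^ m * (f x - ∫ y, f y) * ψ x))) := by
  have hab : ∀ᵐ x, |f x| ≤ M := Eventually.of_forall fun x => by
    rw [abs_of_nonneg (hf0 x)]; exact hfM x
  have hb := continuous_convField h.gradient.integrable_grad hf.aestronglyMeasurable hab
  have hi : Continuous fun x => inner ℝ (convField K f x) (grad ψ x) :=
    hb.inner (continuous_grad hψ)
  have hfi : Integrable f := Integrable.of_bound hf.aestronglyMeasurable M hab
  set c := ∫ y, f y
  set I : Torus d → ℝ := fun x => inner ℝ (convField K f x) (grad ψ x) with hI
  have i1 : Integrable fun x => -(|f x ^ m - l ^ m| * I x) -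
      sgn (f x - l) * l ^ m * (f x - c) * ψ x := by
    refine Integrable.of_bound ?_ ((M ^ m + l ^ m) * D + 1 * l ^ m * M * B)
      (Eventually.of_forall fun x => ?_)
    · exact (((((hf.pow_const m).sub_const _).abs.mul hi.measurable).neg).sub
        ((((measurable_sgn.comp (hf.sub_const l)).mul_const _).mul (hf.sub_const c)).mul
          hψ.continuous.measurable)).aestronglyMeasurable
    · have h1 : f x ^ m ≤ M ^ m := Real.rpow_le_rpow (hf0 x) (hfM x) hm.le
      have h0 : 0 ≤ f x ^ m := Real.rpow_nonneg (hf0 x) m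
      have hl0 : 0 ≤ l ^ m := Real.rpow_nonneg hl m
      have hM : 0 ≤ M := (hf0 x).trans (hfM x)
      rw [Real.norm_eq_abs]
      refine (abs_sub _ _).trans (add_le_add ?_ ?_)
      · rw [abs_neg, abs_mul, abs_abs]
        refine mul_le_mul ?_ (hD x) (abs_nonneg _) (by positivity)
        refine (abs_sub _ _).trans ?_
        rw [abs_of_nonneg h0, abs_of_nonneg hl0]
        linarith
      · rw [abs_mul, abs_mul, abs_mul, abs_of_nonneg hl0]
        exact mul_le_mul (mul_le_mul (mul_le_mul_of_nonneg_right (abs_sgn_le _) hl0)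
          (abs_sub_integral_le hf hf0 hfM x) (abs_nonneg _) (by positivity)) (hB x) (abs_nonneg _)
          (by positivity)
  have i2 : Integrable I := integrable_of_continuous hi
  have i3 : Integrable fun x => (f x - c) * ψ x :=
    Integrable.mul_continuous (hfi.sub (integrable_const c)) hψ.continuous
  have i4 : Integrable fun x => I x - (f x - c) * ψ x := i2.sub i3
  -- The divergence of `∇g ∗ f` is `f̄ - f`. Hence the constant `-l^m` in the limiting flux can be
  -- traded for a reaction term, which leaves `|f^m - l^m|` in the flux and `l^m` in place of `f^m`
  -- in the reaction.
  have e0 : ∫ x, (I x - (f x - c) * ψ x) = 0 := by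
    rw [integral_sub i2 i3, sub_eq_zero]
    exact h.integral_inner_convField_grad hf.aestronglyMeasurable hab hψ
  have e1 : ∫ x, (-(|f x ^ m - l ^ m| * I x) - sgn (f x - l) * l ^ m * (f x - c) * ψ x) =
      ∫ x, (-((|f x ^ m - l ^ m| - l ^ m) * I x) + ((|f x ^ m - l ^ m| - l ^ m) -
        sgn (f x - l) * f x ^ m) * (f x - c) * ψ x) := by
    have e2 : ∀ x, -((|f x ^ m - l ^ m| - l ^ m) * I x) + ((|f x ^ m - l ^ m| - l ^ m) -
        sgn (f x - l) * f x ^ m) * (f x - c) * ψ x =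
        (-(|f x ^ m - l ^ m| * I x) - sgn (f x - l) * l ^ m * (f x - c) * ψ x) +
          l ^ m * (I x - (f x - c) * ψ x) := fun x => by
      linear_combination ((f x - c) * ψ x) * abs_rpow_sub_rpow hm (hf0 x) hl
    simp_rw [e2]
    rw [integral_add i1 (i4.const_mul _), integral_const_mul, e0, mul_zero, add_zero]
  rw [e1]
  refine tendsto_integral_of_dominated_convergence
    (fun _ => M ^ m * D + (M ^ m + M ^ m) * M * B)
    (fun n => (measurable_levelRate_integrand hm (softParam_pos n).ne' hf hψ hb
      l).aestronglyMeasurable) (integrable_const _)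
    (fun n => Eventually.of_forall (abs_levelRate_integrand_le hm hf hf0 hfM hB hD l))
    (Eventually.of_forall fun x => ?_)
  have t1 := tendsto_softFlux hm hl (hf0 x)
  have t2 := tendsto_softSgn (f x - l)
  exact ((t1.mul_const _).neg).add (((t1.sub (t2.mul_const _)).mul_const _).mul_const _)

end Slice

section MovingLevel

variable {m M κ T : ℝ} {g : Torus d → ℝ} {K : Torus d → Vec d} {u : ℝ → Torus d → ℝ}
  {u₀ ψ : Torus d → ℝ} {χ : ℝ → ℝ}

theorem IsBoundedDensity.continuous_convField (hu : IsBoundedDensity M u) (hK : Integrable K)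
    (t : ℝ) : Continuous (convField K (u t)) :=
  CoulombMobility.continuous_convField hK (hu.measurable_slice t).aestronglyMeasurable
    (hu.ae_abs_le t)

theorem IsBoundedDensity.abs_inner_convField_le (hu : IsBoundedDensity M u) (hK : Integrable K)
    {G : ℝ} (hG : ∀ x, ‖grad ψ x‖ ≤ G) (t : ℝ) (x : Torus d) :
    |inner ℝ (convField K (u t) x) (grad ψ x)| ≤ M * (∫ y, ‖K y‖) * G :=
  (abs_real_inner_le_norm _ _).trans (mul_le_mul (hu.norm_convField_le hK t x) (hG x)
    (norm_nonneg _) ((norm_nonneg _).trans (hu.norm_convField_le hK t x)))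

/-- The entropy inequality of a solution at a fixed level. -/
theorem IsEntropySolution.integral_level_nonneg (hm : 0 < m) (h : IsGreenKernel g K)
    (hu : IsBoundedDensity M u) (hsol : IsEntropySolution m K u₀ u)
    (hκ : κ ≠ 0) (hκ1 : |κ| ≤ 1) (hψ : IsSmooth ψ) (hψ0 : ∀ x, 0 ≤ ψ x) (l : ℝ)
    (hχ : ContDiff ℝ ∞ χ) (hχ0 : ∀ t, 0 ≤ χ t) (hχT : ∀ t, T ≤ t → χ t = 0) :
    0 ≤ (∫ t in Ioo 0 T, (levelDist κ (u t) ψ l * deriv χ t + levelRate m κ K (u t) ψ l * χ t)) +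
      levelDist κ u₀ ψ l * χ 0 := by
  obtain ⟨B, hB0, hB⟩ := TorusContDiff.exists_bound hψ
  obtain ⟨G, hG0, hG⟩ := exists_bound_grad hψ
  have hK := h.gradient.integrable_grad
  have hη : ContDiff ℝ 2 fun z => softAbs κ (z - l) :=
    (contDiff_softAbs hκ).comp (contDiff_id.sub contDiff_const)
  have hηc : ConvexOn ℝ univ fun z => softAbs κ (z - l) := by
    have := (convexOn_softAbs κ).translate_left (-l)
    simpa [Function.comp_def, sub_eq_add_neg, add_comm] using this
  have h1 := hsol.entropy (fun z => softAbs κ (z - l)) hη hηc (fun t x => χ t * ψ x)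
    (isTimeSpaceRegular_mul hχ hψ) (fun t x => mul_nonneg (hχ0 t) (hψ0 x))
    ⟨T, fun t ht x => by rw [hχT t ht, zero_mul]⟩
  have e0 : ∫ x, softAbs κ (u₀ x - l) * (χ 0 * ψ x) = levelDist κ u₀ ψ l * χ 0 := by
    rw [levelDist, ← integral_mul_const]
    congr 1; ext x; ring
  have e1 : ∀ t, ∫ x, (softAbs κ (u t x - l) * deriv (fun s => χ s * ψ x) t
        - entropyFlux m (fun z => softAbs κ (z - l)) (u t x) *
          inner ℝ (convField K (u t) x) (grad (fun x => χ t * ψ x) x)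
        + (entropyFlux m (fun z => softAbs κ (z - l)) (u t x) -
          deriv (fun z => softAbs κ (z - l)) (u t x) * u t x ^ m) * (u t x - ∫ y, u t y) *
            (χ t * ψ x)) =
      levelDist κ (u t) ψ l * deriv χ t + levelRate m κ K (u t) ψ l * χ t := by
    intro t
    have hf := hu.measurable_slice t
    have i1 : Integrable fun x => softAbs κ (u t x - l) * ψ x :=
      Integrable.of_bound (((contDiff_softAbs hκ (n := 0)).continuous.measurable.comp
        (hf.sub_const l)).mul hψ.continuous.measurable).aestronglyMeasurable _
        (Eventually.of_forall (abs_levelDist_integrand_le (hu.nonneg t) (hu.le t) hB hκ1 l))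
    have i2 := Integrable.of_bound (μ := volume)
      (measurable_levelRate_integrand hm hκ hf hψ (hu.continuous_convField hK t)
        l).aestronglyMeasurable _
      (Eventually.of_forall (abs_levelRate_integrand_le hm hf (hu.nonneg t) (hu.le t) hB
        (hu.abs_inner_convField_le hK hG t) l))
    rw [levelDist, levelRate, ← integral_mul_const, ← integral_mul_const,
      ← integral_add (i1.mul_const _) (i2.mul_const _)]
    congr 1; ext x
    rw [deriv_mul_const (hχ.differentiable (by norm_num) t), grad_const_mul, inner_smul_right,
      entropyFlux_softAbs m hκ, deriv_softAbs_sub hκ]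
    ring
  simp only [e1] at h1
  rw [e0] at h1
  -- Beyond `T` both `χ` and its derivative vanish, so the integral over `(0, ∞)` is one over `(0,
  -- T)`.
  rwa [setIntegral_eq_of_subset_of_ae_sdiff_eq_zero (s := Ioo 0 T)
    measurableSet_Ioi.nullMeasurableSet Ioo_subset_Ioi_self] at h1
  filter_upwards [Measure.ae_ne volume T] with t htT ht
  have hlt : T < t := by
    refine lt_of_le_of_ne ?_ (Ne.symm htT)
    by_contra hlt
    exact ht.2 ⟨ht.1, not_le.1 hlt⟩
  have hd : deriv χ t = 0 := by
    have : χ =ᶠ[𝓝 t] fun _ => 0 := by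
      filter_upwards [lt_mem_nhds hlt] with s hs using hχT s hs.le
    rw [this.deriv_eq, deriv_const]
  rw [hd, hχT t hlt.le, mul_zero, mul_zero, add_zero]

theorem measurable_levelDist (hu : IsBoundedDensity M u) (hκ : κ ≠ 0) (hψ : Continuous ψ) (l : ℝ) :
    Measurable fun t => levelDist κ (u t) ψ l := by
  have h1 : Measurable fun p : ℝ × Torus d => softAbs κ (u p.1 p.2 - l) * ψ p.2 :=
    ((contDiff_softAbs hκ (n := 0)).continuous.measurable.comp (hu.measurable.sub_const l)).mul
      (hψ.measurable.comp measurable_snd)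
  exact h1.stronglyMeasurable.integral_prod_right'.measurable

theorem measurable_levelSide (hu : IsBoundedDensity M u) (hκ : κ ≠ 0) (hψ : Continuous ψ) (l : ℝ) :
    Measurable fun t => levelSide κ (u t) ψ l := by
  have h1 : Measurable fun p : ℝ × Torus d => softSgn κ (u p.1 p.2 - l) * ψ p.2 :=
    ((continuous_softSgn hκ).measurable.comp (hu.measurable.sub_const l)).mul
      (hψ.measurable.comp measurable_snd)
  exact h1.stronglyMeasurable.integral_prod_right'.measurable

theorem measurable_levelRate (hm : 0 < m) (hu : IsBoundedDensity M u) (hK : StronglyMeasurable K)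
    (hκ : κ ≠ 0) (hψ : IsSmooth ψ) (l : ℝ) :
    Measurable fun t => levelRate m κ K (u t) ψ l := by
  have hq : Measurable fun p : ℝ × Torus d => softFlux m κ l (u p.1 p.2) :=
    (continuous_softFlux hm hκ l).measurable.comp hu.measurable
  have hs : Measurable fun p : ℝ × Torus d => softSgn κ (u p.1 p.2 - l) :=
    (continuous_softSgn hκ).measurable.comp (hu.measurable.sub_const l)
  have hi : Measurable fun p : ℝ × Torus d => inner ℝ (convField K (u p.1) p.2) (grad ψ p.2) :=
    (StronglyMeasurable.inner (hu.stronglyMeasurable_convField hK)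
      ((continuous_grad hψ).stronglyMeasurable.comp_measurable measurable_snd)).measurable
  have hc : Measurable fun p : ℝ × Torus d => u p.1 p.2 - ∫ y, u p.1 y :=
    hu.measurable.sub (hu.measurable_mean.comp measurable_fst)
  have h1 : Measurable fun p : ℝ × Torus d =>
      -(softFlux m κ l (u p.1 p.2) * inner ℝ (convField K (u p.1) p.2) (grad ψ p.2)) +
        (softFlux m κ l (u p.1 p.2) - softSgn κ (u p.1 p.2 - l) * u p.1 p.2 ^ m) *
          (u p.1 p.2 - ∫ y, u p.1 y) * ψ p.2 :=
    (hq.mul hi).neg.add (((hq.sub (hs.mul hu.measurable_rpow)).mul hc).mul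
      (hψ.continuous.measurable.comp measurable_snd))
  exact h1.stronglyMeasurable.integral_prod_right'.measurable

/-- The entropy inequality of a solution along an absolutely continuous curve of nonnegative
levels. -/
theorem IsEntropySolution.integral_moving_level_nonneg (hm : 0 < m) (h : IsGreenKernel g K)
    (hKm : StronglyMeasurable K) (hu : IsBoundedDensity M u) (hu₀ : Measurable u₀)
    (hu₀0 : ∀ x, 0 ≤ u₀ x) (hu₀M : ∀ x, u₀ x ≤ M) (hsol : IsEntropySolution m K u₀ u)
    (hψ : IsSmooth ψ) (hψ0 : ∀ x, 0 ≤ ψ x) {k₀ : ℝ} {s : ℝ → ℝ} (hs : Integrable s)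
    {k : ℝ → ℝ} (hk : ∀ᵐ t ∂volume.restrict (Ioo 0 T), k t = k₀ + ∫ τ in (0 : ℝ)..t, s τ)
    (hk0 : ∀ t, 0 ≤ k t)
    (hχ : ContDiff ℝ ∞ χ) (hχ0 : ∀ t, 0 ≤ χ t) (hχT : ∀ t, T ≤ t → χ t = 0) :
    0 ≤ (∫ t in Ioo 0 T, ((∫ x, |u t x - k t| * ψ x) * deriv χ t +
      ((∫ x, (-(|u t x ^ m - k t ^ m| * inner ℝ (convField K (u t) x) (grad ψ x)) -
        sgn (u t x - k t) * k t ^ m * (u t x - ∫ y, u t y) * ψ x)) -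
        (∫ x, sgn (u t x - k t) * ψ x) * s t) * χ t)) + (∫ x, |u₀ x - k₀| * ψ x) * χ 0 := by
  obtain ⟨B, hB0, hB⟩ := TorusContDiff.exists_bound hψ
  obtain ⟨G, hG0, hG⟩ := exists_bound_grad hψ
  have hK := h.gradient.integrable_grad
  have hχ' : Continuous (deriv χ) := hχ.continuous_deriv (by norm_num)
  obtain ⟨X, hX⟩ := isCompact_Icc (a := (0 : ℝ)) (b := T).exists_bound_of_continuousOn
    hχ.continuous.continuousOn
  obtain ⟨X', hX'⟩ := isCompact_Icc (a := (0 : ℝ)) (b := T).exists_bound_of_continuousOn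
    hχ'.continuousOn
  have hκ0 : ∀ n, softParam n ≠ 0 := fun n => (softParam_pos n).ne'
  have hκ1 : ∀ n, |softParam n| ≤ 1 := fun n => by
    rw [abs_of_pos (softParam_pos n)]; exact softParam_le_one n
  have hM := hu.bound_nonneg
  have hMm : 0 ≤ M ^ m := Real.rpow_nonneg hM m
  have hKn : 0 ≤ ∫ y, ‖K y‖ := integral_nonneg fun _ => norm_nonneg _
  set D := M * (∫ y, ‖K y‖) * G
  have hD : ∀ t x, |inner ℝ (convField K (u t) x) (grad ψ x)| ≤ D :=
    hu.abs_inner_convField_le hK hG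
  have hD0 : 0 ≤ D := by positivity
  set R := M ^ m * D + (M ^ m + M ^ m) * M * B
  have hR0 : 0 ≤ R := by positivity
  set B' := (M + 1) * B + B + R
  have hB'0 : 0 ≤ B' := by positivity
  have bP : ∀ n l t, |levelDist (softParam n) (u t) ψ l| ≤ B' * (1 + |l|) := fun n l t => by
    refine (abs_integral_le_of_bound
      (abs_levelDist_integrand_le (hu.nonneg t) (hu.le t) hB (hκ1 n) l)).trans ?_
    refine mul_le_mul_of_nonneg_right ?_ (by positivity)
    simp only [B']; linarith
  have bQ : ∀ n l t, |levelSide (softParam n) (u t) ψ l| ≤ B' := fun n l t => by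
    refine (abs_integral_le_of_bound (abs_levelSide_integrand_le hB l)).trans ?_
    have : 0 ≤ (M + 1) * B := by positivity
    simp only [B']; linarith
  have bR : ∀ n l t, |levelRate m (softParam n) K (u t) ψ l| ≤ B' := fun n l t => by
    refine (abs_integral_le_of_bound (abs_levelRate_integrand_le hm (hu.measurable_slice t)
      (hu.nonneg t) (hu.le t) hB (hD t) l)).trans ?_
    have : 0 ≤ (M + 1) * B := by positivity
    simp only [B', R]; linarith
  set k' : ℝ → ℝ := fun t => k₀ + ∫ τ in (0 : ℝ)..t, s τ with hk'
  have hk'c : Continuous k' := continuous_const.add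
    (intervalIntegral.continuous_primitive (fun _ _ => hs.intervalIntegrable) 0)
  set N := |k₀| + ∫ τ, |s τ|
  have hkN : ∀ t, |k' t| ≤ N := fun t =>
    (abs_add_le _ _).trans (add_le_add le_rfl (abs_primitive_le hs t))
  have hdP : ∀ n l t, HasDerivAt (fun l => levelDist (softParam n) (u t) ψ l)
      (-levelSide (softParam n) (u t) ψ l) l := fun n l t =>
    hasDerivAt_levelDist (hu.measurable_slice t) (hu.nonneg t) (hu.le t) hψ.continuous hB
      (hκ0 n) (hκ1 n) l
  have cP : ∀ n t, Continuous fun l => levelDist (softParam n) (u t) ψ l := fun n t =>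
    continuous_iff_continuousAt.2 fun l => (hdP n l t).continuousAt
  have cQ : ∀ n t, Continuous fun l => levelSide (softParam n) (u t) ψ l := fun n t =>
    continuous_levelSide (hu.measurable_slice t) hψ.continuous hB (hκ0 n)
  have cR : ∀ n t, Continuous fun l => levelRate m (softParam n) K (u t) ψ l := fun n t =>
    continuous_levelRate hm (hκ0 n) (hu.measurable_slice t) (hu.nonneg t) (hu.le t) hψ hB
      (hu.continuous_convField hK t) (hD t)
  have mP : ∀ n l, Measurable fun t => levelDist (softParam n) (u t) ψ l := fun n l =>
    measurable_levelDist hu (hκ0 n) hψ.continuous l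
  have mQ : ∀ n l, Measurable fun t => levelSide (softParam n) (u t) ψ l := fun n l =>
    measurable_levelSide hu (hκ0 n) hψ.continuous l
  have mR : ∀ n l, Measurable fun t => levelRate m (softParam n) K (u t) ψ l := fun n l =>
    measurable_levelRate hm hu hKm (hκ0 n) hψ l
  have cP₀ : ∀ n, Continuous fun l => levelDist (softParam n) u₀ ψ l := fun n =>
    continuous_iff_continuousAt.2 fun l => (hasDerivAt_levelDist hu₀ hu₀0 hu₀M hψ.continuous hB
      (hκ0 n) (hκ1 n) l).continuousAt
  -- The smoothing of the absolute value is kept while the level moves, because differentiability in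
  -- the level is needed there; it is removed afterwards by dominated convergence. Nonnegativity of
  -- the levels matters only in that limit.
  have key : ∀ n, 0 ≤ (∫ t in Ioo 0 T, (levelDist (softParam n) (u t) ψ (k' t) * deriv χ t +
      (levelRate m (softParam n) K (u t) ψ (k' t) - levelSide (softParam n) (u t) ψ (k' t) * s t) *
        χ t)) + levelDist (softParam n) u₀ ψ k₀ * χ 0 := fun n =>
    integral_nonneg_of_moving_level (B := B')
      (P := fun l t => levelDist (softParam n) (u t) ψ l)
      (Q := fun l t => levelSide (softParam n) (u t) ψ l)
      (R := fun l t => levelRate m (softParam n) K (u t) ψ l)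
      (P₀ := fun l => levelDist (softParam n) u₀ ψ l)
      (hdP n) (cQ n) (cR n) (mP n) (mQ n) (mR n) (cP₀ n) (bP n) (bQ n) (bR n)
      (fun l χ h1 h2 h3 => hsol.integral_level_nonneg hm h hu (hκ0 n) (hκ1 n) hψ hψ0 l h1 h2 h3)
      hs k₀ hχ hχ0 hχT
  have hcomp : ∀ {Z : ℝ → ℝ → ℝ}, (∀ t, Continuous fun l => Z l t) → (∀ l, Measurable (Z l)) →
      Measurable fun t => Z (k' t) t := fun hZ hZm =>
    (measurable_uncurry_of_continuous_of_measurable hZ hZm).comp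
      (hk'c.measurable.prodMk measurable_id)
  refine ge_of_tendsto' (x := atTop) (Tendsto.add ?_
    ((tendsto_levelDist hu₀ hu₀0 hu₀M hψ.continuous hB k₀).mul_const _)) key
  refine tendsto_integral_of_dominated_convergence
    (fun t => B' * (1 + N) * X' + (B' + B' * |s t|) * X) (fun n => ?_) ?_ (fun n => ?_) ?_
  · exact (((hcomp (cP n) (mP n)).mul hχ'.measurable).aestronglyMeasurable).add
      (((hcomp (cR n) (mR n)).aestronglyMeasurable.sub
        ((hcomp (cQ n) (mQ n)).aestronglyMeasurable.mul
          hs.aestronglyMeasurable.restrict)).mul hχ.continuous.aestronglyMeasurable)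
  · exact (integrable_const _).add
      (((integrable_const _).add (hs.integrableOn.abs.const_mul B')).mul_const X)
  · filter_upwards [ae_restrict_mem measurableSet_Ioo] with t ht
    have ht' := Ioo_subset_Icc_self ht
    rw [Real.norm_eq_abs]
    refine (abs_add_le _ _).trans (add_le_add ?_ ?_)
    · rw [abs_mul]
      refine mul_le_mul ((bP n _ t).trans ?_) (hX' t ht') (abs_nonneg _)
        (mul_nonneg hB'0 (by linarith [hkN 0, abs_nonneg (k' 0)]))
      exact mul_le_mul_of_nonneg_left (by linarith [hkN t]) hB'0
    · rw [abs_mul]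
      refine mul_le_mul ((abs_sub _ _).trans (add_le_add (bR n _ t) ?_)) (hX t ht') (abs_nonneg _)
        (by positivity)
      rw [abs_mul]
      exact mul_le_mul_of_nonneg_right (bQ n _ t) (abs_nonneg _)
  · filter_upwards [hk] with t ht
    have hk't : k' t = k t := ht.symm
    rw [hk't]
    have hf := hu.measurable_slice t
    exact ((tendsto_levelDist hf (hu.nonneg t) (hu.le t) hψ.continuous hB (k t)).mul_const _).add
      (((tendsto_levelRate hm h hf (hu.nonneg t) (hu.le t) hψ hB (hD t) (hk0 t)).sub
        ((tendsto_levelSide hf hψ.continuous hB (k t)).mul_const _)).mul_const _)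

end MovingLevel

/-! ### Doubling of the space variable -/

theorem grad_comp_sub_right (ρ : Torus d → ℝ) (y x : Torus d) :
    grad (fun x => ρ (x - y)) x = grad ρ (x - y) := by
  ext i
  simp [grad, partialDeriv_comp_sub_right]

/-- The mean `∫ ρ(z) ‖f(· + z) - f‖₁ dz` of the modulus of continuity. -/
def meanMod {E : Type*} [NormedAddCommGroup E] (ρ : Torus d → ℝ) (f : Torus d → E) : ℝ :=
  ∫ z, ρ z * transMod f z

theorem transMod_le {f : Torus d → ℝ} {M : ℝ} (hf0 : ∀ x, 0 ≤ f x) (hfM : ∀ x, f x ≤ M)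
    (z : Torus d) : transMod f z ≤ M := by
  refine (le_abs_self _).trans (abs_integral_le_of_bound fun y => ?_)
  rw [abs_of_nonneg (norm_nonneg _)]
  exact (abs_sub_le_of_le_of_le (hf0 _) (hfM _) (hf0 _) (hfM _)).trans (by simp)

section Doubling

variable {m M a : ℝ} {g : Torus d → ℝ} {K W : Torus d → Vec d} {f f' ρ : Torus d → ℝ}

theorem integral_comp_sub_eq_one (hρ1 : ∫ x, ρ x = 1) (y : Torus d) : ∫ x, ρ (x - y) = 1 := by
  rw [integral_sub_right_eq_self ρ y, hρ1]

theorem integrable_bdd_prod {X Y : Type*} [MeasurableSpace X] [MeasurableSpace Y] {μ : Measure X}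
    {ν : Measure Y} [IsFiniteMeasure μ] [IsFiniteMeasure ν] {I : X × Y → ℝ} (hI : Measurable I)
    {C : ℝ} (hC : ∀ p, |I p| ≤ C) : Integrable I (μ.prod ν) :=
  Integrable.of_bound hI.aestronglyMeasurable C (Eventually.of_forall hC)

/-- Mollified `L¹` distances converge to the `L¹` distance. -/
theorem abs_integral_integral_sub_le (hf : Measurable f) (hf0 : ∀ x, 0 ≤ f x)
    (hfM : ∀ x, f x ≤ M) (hf' : Measurable f') (hf'0 : ∀ x, 0 ≤ f' x) (hf'M : ∀ x, f' x ≤ M)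
    (hρ : Continuous ρ) (hρ0 : ∀ x, 0 ≤ ρ x) (hρ1 : ∫ x, ρ x = 1) :
    |(∫ y, ∫ x, |f x - f' y| * ρ (x - y)) - (∫ x, |f x - f' x|)| ≤ meanMod ρ f' := by
  obtain ⟨B, hB⟩ := isCompact_univ.exists_bound_of_continuousOn hρ.continuousOn
  have hB : ∀ x, |ρ x| ≤ B := fun x => hB x (mem_univ x)
  have hρm : Measurable fun p : Torus d × Torus d => ρ (p.2 - p.1) :=
    hρ.measurable.comp (measurable_snd.sub measurable_fst)
  have hM : 0 ≤ M := (hf0 0).trans (hfM 0)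
  have bnd : ∀ {s t : ℝ}, 0 ≤ s → s ≤ M → 0 ≤ t → t ≤ M → |s - t| ≤ M := fun h1 h2 h3 h4 =>
    (abs_sub_le_of_le_of_le h1 h2 h3 h4).trans (by simp)
  have bnd' : ∀ {s t : ℝ} (p : Torus d), 0 ≤ s → s ≤ M → 0 ≤ t → t ≤ M →
      |(|s - t| * ρ p)| ≤ M * B := fun p h1 h2 h3 h4 => by
    rw [abs_mul, abs_abs]
    exact mul_le_mul (bnd h1 h2 h3 h4) (hB p) (abs_nonneg _) hM
  have i1 : Integrable (fun p : Torus d × Torus d => |f p.2 - f' p.1| * ρ (p.2 - p.1))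
      (volume.prod volume) :=
    integrable_bdd_prod (((hf.comp measurable_snd).sub (hf'.comp measurable_fst)).abs.mul hρm)
      fun p => bnd' _ (hf0 _) (hfM _) (hf'0 _) (hf'M _)
  have i2 : Integrable (fun p : Torus d × Torus d => |f p.2 - f' p.2| * ρ (p.2 - p.1))
      (volume.prod volume) :=
    integrable_bdd_prod (((hf.comp measurable_snd).sub (hf'.comp measurable_snd)).abs.mul hρm)
      fun p => bnd' _ (hf0 _) (hfM _) (hf'0 _) (hf'M _)
  have i3 : Integrable (fun p : Torus d × Torus d => |f' p.2 - f' p.1| * ρ (p.2 - p.1))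
      (volume.prod volume) :=
    integrable_bdd_prod (((hf'.comp measurable_snd).sub (hf'.comp measurable_fst)).abs.mul hρm)
      fun p => bnd' _ (hf'0 _) (hf'M _) (hf'0 _) (hf'M _)
  have i4 : Integrable (fun p : Torus d × Torus d => |f' (p.1 + p.2) - f' p.1| * ρ p.2)
      (volume.prod volume) :=
    integrable_bdd_prod (((hf'.comp (measurable_fst.add measurable_snd)).sub
      (hf'.comp measurable_fst)).abs.mul (hρ.measurable.comp measurable_snd))
      fun p => bnd' _ (hf'0 _) (hf'M _) (hf'0 _) (hf'M _)
  have e1 : ∫ x, |f x - f' x| =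
      ∫ p : Torus d × Torus d, |f p.2 - f' p.2| * ρ (p.2 - p.1) ∂(volume.prod volume) := by
    rw [integral_prod_symm _ i2]
    congr 1; ext x
    dsimp only
    rw [integral_const_mul, integral_sub_left_eq_self ρ volume x, hρ1, mul_one]
  have e2 : meanMod ρ f' =
      ∫ p : Torus d × Torus d, |f' p.2 - f' p.1| * ρ (p.2 - p.1) ∂(volume.prod volume) := by
    rw [integral_prod _ i3]
    have : ∀ y, ∫ x, |f' x - f' y| * ρ (x - y) = ∫ z, |f' (y + z) - f' y| * ρ z := fun y => by
      rw [← integral_sub_right_eq_self (fun z => |f' (y + z) - f' y| * ρ z) y]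
      simp
    simp_rw [this]
    rw [← integral_prod (fun p : Torus d × Torus d => |f' (p.1 + p.2) - f' p.1| * ρ p.2) i4,
      integral_prod_symm _ i4]
    unfold meanMod transMod
    congr 1; ext z
    dsimp only
    rw [integral_mul_const, mul_comm]
    rfl
  rw [← integral_prod (fun p : Torus d × Torus d => |f p.2 - f' p.1| * ρ (p.2 - p.1)) i1, e1, e2,
    ← integral_sub i1 i2, ← Real.norm_eq_abs]
  refine norm_integral_le_of_norm_le i3 (Eventually.of_forall fun p => ?_)
  rw [Real.norm_eq_abs, ← sub_mul, abs_mul, abs_of_nonneg (hρ0 _)]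
  refine mul_le_mul_of_nonneg_right ?_ (hρ0 _)
  refine (abs_abs_sub_abs_le _ _).trans (le_of_eq ?_)
  congr 1; ring

/-- Integration by parts in the second variable. -/
theorem integral_integral_flux_eq (hm : 0 < m) (hK : Integrable K)
    (hf : Measurable f) (hf0 : ∀ x, 0 ≤ f x) (hfM : ∀ x, f x ≤ M)
    (hf' : Measurable f') (hf'0 : ∀ x, 0 ≤ f' x) (hf'M : ∀ x, f' x ≤ M)
    (hW : HasWeakGradient (fun x => f' x ^ m) W) (hρ : IsSmooth ρ) :
    ∫ y, ∫ x, -(|f x ^ m - f' y ^ m| * inner ℝ (convField K f x) (grad ρ (x - y))) =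
      ∫ y, ∫ x, sgn (f x - f' y) * inner ℝ (W y) (convField K f x) * ρ (x - y) := by
  have hab : ∀ᵐ x, |f x| ≤ M := Eventually.of_forall fun x => by
    rw [abs_of_nonneg (hf0 x)]; exact hfM x
  have hb := continuous_convField hK hf.aestronglyMeasurable hab
  have hbM := norm_convField_le hK hab
  obtain ⟨B, hB0, hB⟩ := TorusContDiff.exists_bound hρ
  obtain ⟨G, hG0, hG⟩ := exists_bound_grad hρ
  have hM : 0 ≤ M := (hf0 0).trans (hfM 0)
  have hMm : 0 ≤ M ^ m := Real.rpow_nonneg hM m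
  have hKn : 0 ≤ ∫ y, ‖K y‖ := integral_nonneg fun _ => norm_nonneg _
  have hWi := hW.integrable_grad
  have rp : ∀ {s : ℝ}, 0 ≤ s → s ≤ M → s ^ m ≤ M ^ m := fun h1 h2 =>
    Real.rpow_le_rpow h1 h2 hm.le
  have i1 : Integrable (fun p : Torus d × Torus d =>
      -(|f p.2 ^ m - f' p.1 ^ m| * inner ℝ (convField K f p.2) (grad ρ (p.2 - p.1))))
      (volume.prod volume) := by
    refine integrable_bdd_prod (C := M ^ m * (M * (∫ y, ‖K y‖) * G)) ?_ fun p => ?_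
    · have hin : Measurable fun p : Torus d × Torus d =>
          inner ℝ (convField K f p.2) (grad ρ (p.2 - p.1)) :=
        ((hb.comp continuous_snd).inner ((continuous_grad hρ).comp
          (continuous_snd.sub continuous_fst))).measurable
      exact ((((hf.comp measurable_snd).pow_const m).sub
        ((hf'.comp measurable_fst).pow_const m)).abs.mul hin).neg
    · rw [abs_neg, abs_mul, abs_abs]
      refine mul_le_mul ?_ ?_ (abs_nonneg _) hMm
      · exact (abs_sub_le_of_le_of_le (Real.rpow_nonneg (hf0 _) m) (rp (hf0 _) (hfM _))
          (Real.rpow_nonneg (hf'0 _) m) (rp (hf'0 _) (hf'M _))).trans (by simp)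
      · exact (abs_real_inner_le_norm _ _).trans (mul_le_mul (hbM _) (hG _) (norm_nonneg _)
          (by positivity))
  have i2 : Integrable (fun p : Torus d × Torus d =>
      sgn (f p.2 - f' p.1) * inner ℝ (W p.1) (convField K f p.2) * ρ (p.2 - p.1))
      (volume.prod volume) := by
    have hWp : Integrable (fun p : Torus d × Torus d => W p.1) (volume.prod volume) :=
      hWi.comp_fst volume
    refine Integrable.mono' (hWp.norm.mul_const (M * (∫ y, ‖K y‖) * B)) ?_
      (Eventually.of_forall fun p => ?_)
    · exact ((measurable_sgn.comp ((hf.comp measurable_snd).sub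
        (hf'.comp measurable_fst))).aestronglyMeasurable.mul
        (hWp.aestronglyMeasurable.inner (hb.comp continuous_snd).aestronglyMeasurable)).mul
        (hρ.continuous.comp (continuous_snd.sub continuous_fst)).aestronglyMeasurable
    · rw [norm_mul, norm_mul, Real.norm_eq_abs, Real.norm_eq_abs, Real.norm_eq_abs]
      calc |sgn (f p.2 - f' p.1)| * |inner ℝ (W p.1) (convField K f p.2)| * |ρ (p.2 - p.1)|
          ≤ 1 * (‖W p.1‖ * (M * ∫ y, ‖K y‖)) * B := by
            refine mul_le_mul (mul_le_mul (abs_sgn_le _) ?_ (abs_nonneg _) zero_le_one) (hB _)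
              (abs_nonneg _) (by positivity)
            exact (abs_real_inner_le_norm _ _).trans
              (mul_le_mul_of_nonneg_left (hbM _) (norm_nonneg _))
        _ = _ := by ring
  rw [← integral_prod (fun p : Torus d × Torus d =>
      -(|f p.2 ^ m - f' p.1 ^ m| * inner ℝ (convField K f p.2) (grad ρ (p.2 - p.1)))) i1,
    ← integral_prod (fun p : Torus d × Torus d =>
      sgn (f p.2 - f' p.1) * inner ℝ (W p.1) (convField K f p.2) * ρ (p.2 - p.1)) i2,
    integral_prod_symm _ i1, integral_prod_symm _ i2]
  congr 1; ext x
  have hρx : IsSmooth fun y => ρ (x - y) := TorusContDiff.comp_sub_left hρ x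
  have hVb : ∀ᵐ y, |f' y ^ m| ≤ M ^ m := Eventually.of_forall fun y => by
    rw [abs_of_nonneg (Real.rpow_nonneg (hf'0 y) m)]; exact rp (hf'0 y) (hf'M y)
  have e1 : ∀ y, -(|f x ^ m - f' y ^ m| * inner ℝ (convField K f x) (grad ρ (x - y))) =
      ∑ i, convField K f x i * (|f x ^ m - f' y ^ m| * partialDeriv i (fun y => ρ (x - y)) y) := by
    intro y
    rw [inner_grad, Finset.mul_sum, ← Finset.sum_neg_distrib]
    refine Finset.sum_congr rfl fun i _ => ?_
    rw [partialDeriv_comp_sub_left hρ.contDiffOne]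
    ring
  -- As `s ↦ s^m` is increasing, `f x ^ m - f' y ^ m` and `f x - f' y` have the same sign, so the
  -- weak gradient of `|c - f'^m|` with `c = f x ^ m` carries the sign of `f x - f' y`.
  have e2 : ∀ y, sgn (f x - f' y) * inner ℝ (W y) (convField K f x) * ρ (x - y) =
      ∑ i, convField K f x i * (sgn (f x ^ m - f' y ^ m) * W y i * ρ (x - y)) := by
    intro y
    rw [inner_eq_sum, sgn_rpow_sub_rpow hm (hf0 x) (hf'0 y), Finset.mul_sum, Finset.sum_mul]
    refine Finset.sum_congr rfl fun i _ => ?_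
    ring
  simp_rw [e1, e2]
  rw [integral_finsetSum, integral_finsetSum]
  · refine Finset.sum_congr rfl fun i _ => ?_
    rw [integral_const_mul, integral_const_mul,
      hW.integral_abs_sub_mul_partialDeriv hVb (f x ^ m) hρx i]
  · intro i _
    have h1 : Integrable fun y => sgn (f x ^ m - f' y ^ m) * W y i :=
      (hW.integrable_apply i).bdd_mul (c := 1)
        (measurable_sgn.comp (measurable_const.sub (hf'.pow_const m))).aestronglyMeasurable
        (Eventually.of_forall fun y => abs_sgn_le _)
    exact (Integrable.mul_continuous h1 hρx.continuous).const_mul _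
  · intro i _
    have h1 : Integrable fun y => |f x ^ m - f' y ^ m| :=
      ((integrable_const (f x ^ m)).sub hW.integrable_fun).abs
    exact (Integrable.mul_continuous h1 (hρx.contDiffOne.continuous_partialDeriv i)).const_mul _

theorem integral_norm_mul_norm_convField_le (hK : Integrable K) (hf : Measurable f)
    (hf0 : ∀ x, 0 ≤ f x) (hfM : ∀ x, f x ≤ M) (hf' : Measurable f') (hf'0 : ∀ x, 0 ≤ f' x)
    (hf'M : ∀ x, f' x ≤ M) (hW : Integrable W) (ha : 0 ≤ a)
    (hKW : ∀ z, ∫⁻ y, ‖K (y - z)‖ₑ * ‖W y‖ₑ ≤ ENNReal.ofReal a) :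
    Integrable (fun y => ‖W y‖ * ‖convField K (fun x => f x - f' x) y‖) ∧
      ∫ y, ‖W y‖ * ‖convField K (fun x => f x - f' x) y‖ ≤ a * ∫ x, |f x - f' x| := by
  have hM : ∀ᵐ x, |f x - f' x| ≤ M := Eventually.of_forall fun x =>
    (abs_sub_le_of_le_of_le (hf0 x) (hfM x) (hf'0 x) (hf'M x)).trans (by simp)
  have hm : Measurable fun x => f x - f' x := hf.sub hf'
  have hb := continuous_convField hK hm.aestronglyMeasurable hM
  have hi : Integrable fun y => ‖W y‖ * ‖convField K (fun x => f x - f' x) y‖ :=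
    Integrable.mul_continuous hW.norm hb.norm
  have hdi : Integrable fun x => f x - f' x :=
    Integrable.of_bound hm.aestronglyMeasurable M hM
  refine ⟨hi, ?_⟩
  have h1 := lintegral_mul_convField_le hK.aestronglyMeasurable hW.aestronglyMeasurable
    hm.aestronglyMeasurable hKW
  have e1 : ∫⁻ z, ‖f z - f' z‖ₑ = ENNReal.ofReal (∫ x, |f x - f' x|) := by
    rw [ofReal_integral_eq_lintegral_ofReal hdi.abs (Eventually.of_forall fun x => abs_nonneg _)]
    congr 1; ext x
    rw [← Real.norm_eq_abs, ofReal_norm]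
  have e2 : ∫⁻ y, ‖W y‖ₑ * ‖convField K (fun x => f x - f' x) y‖ₑ =
      ENNReal.ofReal (∫ y, ‖W y‖ * ‖convField K (fun x => f x - f' x) y‖) := by
    rw [ofReal_integral_eq_lintegral_ofReal hi
      (Eventually.of_forall fun x => mul_nonneg (norm_nonneg _) (norm_nonneg _))]
    congr 1; ext x
    rw [ENNReal.ofReal_mul (norm_nonneg _), ofReal_norm, ofReal_norm]
  rw [e1, e2, ← ENNReal.ofReal_mul ha] at h1
  exact (ENNReal.ofReal_le_ofReal_iff (mul_nonneg ha (integral_nonneg fun _ => abs_nonneg _))).1 h1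

end Doubling

section Bracket

variable {m M a : ℝ} {g : Torus d → ℝ} {K W : Torus d → Vec d} {f f' ρ : Torus d → ℝ}

/-- The pointwise estimate of the doubled right-hand side. -/
theorem sgn_mul_bracket_le {σ p q A V Vm a r₁ r₂ δ w : ℝ} (hσ : |σ| ≤ 1)
    (hσpq : σ * (p - q) = |p - q|) (hVm : 0 ≤ Vm) (hV : |V - Vm| ≤ a)
    (hw : |w| ≤ r₁ + r₂) (hδ : |δ| ≤ A) :
    σ * (w - V * ((p - q) - δ)) ≤ r₁ + r₂ + Vm * (A - |p - q|) + a * (|p - q| + A) := by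
  have h1 : σ * w ≤ r₁ + r₂ := by
    refine (le_abs_self _).trans ?_
    rw [abs_mul]
    nlinarith [abs_nonneg w, abs_nonneg σ]
  have h2 : |σ * δ| ≤ A := by
    rw [abs_mul]
    nlinarith [abs_nonneg δ, abs_nonneg σ]
  have h3 : |(|p - q|) - σ * δ| ≤ |p - q| + A :=
    (abs_sub _ _).trans (by rw [abs_abs]; linarith)
  have h4 : -((V - Vm) * (|p - q| - σ * δ)) ≤ a * (|p - q| + A) := by
    refine (neg_le_abs _).trans ?_
    rw [abs_mul]
    exact mul_le_mul hV h3 (abs_nonneg _) ((abs_nonneg _).trans hV)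
  have h5 : Vm * (σ * δ) ≤ Vm * A :=
    mul_le_mul_of_nonneg_left ((le_abs_self _).trans h2) hVm
  -- Only the difference `V - Vm` is estimated by absolute values. The mean `Vm` keeps its
  -- favourable term `-Vm |p - q|`, which after integration compensates `Vm A`; otherwise the size
  -- of `V`, and not only its oscillation, would enter the rate.
  have e : σ * (w - V * ((p - q) - δ)) =
      σ * w - Vm * |p - q| + Vm * (σ * δ) - (V - Vm) * (|p - q| - σ * δ) := by
    rw [← hσpq]; ring
  rw [e]
  linarith

/-- The estimate of the doubled right-hand side. -/
theorem integral_doubled_rate_le (hm : 0 < m) (h : IsGreenKernel g K)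
    (hf : Measurable f) (hf0 : ∀ x, 0 ≤ f x) (hfM : ∀ x, f x ≤ M)
    (hf' : Measurable f') (hf'0 : ∀ x, 0 ≤ f' x) (hf'M : ∀ x, f' x ≤ M)
    (hW : HasWeakGradient (fun x => f' x ^ m) W) (ha : 0 ≤ a)
    (hKW : ∀ z, ∫⁻ y, ‖K (y - z)‖ₑ * ‖W y‖ₑ ≤ ENNReal.ofReal a)
    (hρ : IsSmooth ρ) (hρ0 : ∀ x, 0 ≤ ρ x) (hρ1 : ∫ x, ρ x = 1) :
    ∫ y, ((∫ x, (-(|f x ^ m - f' y ^ m| * inner ℝ (convField K f x) (grad ρ (x - y))) -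
        sgn (f x - f' y) * f' y ^ m * (f x - ∫ z, f z) * ρ (x - y))) -
        (∫ x, sgn (f x - f' y) * ρ (x - y)) *
          (inner ℝ (W y) (convField K f' y) - f' y ^ m * (f' y - ∫ z, f' z))) ≤
      3 * a * (∫ x, |f x - f' x|) + (a + M ^ m) * meanMod ρ f' +
        M * (∫ y, ‖W y‖) * meanMod ρ K := by
  have hK := h.gradient.integrable_grad
  have hab : ∀ᵐ x, |f x| ≤ M := Eventually.of_forall fun x => by
    rw [abs_of_nonneg (hf0 x)]; exact hfM x
  have hab' : ∀ᵐ x, |f' x| ≤ M := Eventually.of_forall fun x => by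
    rw [abs_of_nonneg (hf'0 x)]; exact hf'M x
  have hfi : Integrable f := Integrable.of_bound hf.aestronglyMeasurable M hab
  have hf'i : Integrable f' := Integrable.of_bound hf'.aestronglyMeasurable M hab'
  have hb := continuous_convField hK hf.aestronglyMeasurable hab
  have hb' := continuous_convField hK hf'.aestronglyMeasurable hab'
  have hbM := norm_convField_le hK hab
  obtain ⟨B, hB0, hB⟩ := TorusContDiff.exists_bound hρ
  obtain ⟨G, hG0, hG⟩ := exists_bound_grad hρ
  have hM : 0 ≤ M := (hf0 0).trans (hfM 0)
  have hMm : 0 ≤ M ^ m := Real.rpow_nonneg hM m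
  have hKn : 0 ≤ ∫ y, ‖K y‖ := integral_nonneg fun _ => norm_nonneg _
  have hWi := hW.integrable_grad
  have rp : ∀ {s : ℝ}, 0 ≤ s → s ≤ M → s ^ m ≤ M ^ m := fun h1 h2 =>
    Real.rpow_le_rpow h1 h2 hm.le
  set A := ∫ x, |f x - f' x|
  set S : Torus d → ℝ := fun y => inner ℝ (W y) (convField K f' y) - f' y ^ m * (f' y - ∫ z, f' z)
  have hSi : Integrable S := by
    have i1 : Integrable fun y => inner ℝ (W y) (convField K f' y) := by
      refine Integrable.mono' (hWi.norm.mul_const (M * ∫ y, ‖K y‖))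
        (hWi.aestronglyMeasurable.inner hb'.aestronglyMeasurable) (Eventually.of_forall fun y => ?_)
      exact (abs_real_inner_le_norm _ _).trans
        (mul_le_mul_of_nonneg_left (norm_convField_le hK hab' y) (norm_nonneg _))
    have i2 : Integrable fun y => f' y ^ m * (f' y - ∫ z, f' z) :=
      hW.integrable_fun.mul_bdd (c := M) (hf'.sub_const _).aestronglyMeasurable
        (Eventually.of_forall (abs_sub_integral_le hf' hf'0 hf'M))
    exact i1.sub i2
  set Vm := ∫ y, f' y ^ m
  have hVm0 : 0 ≤ Vm := integral_nonneg fun y => Real.rpow_nonneg (hf'0 y) m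
  have hVmM : Vm ≤ M ^ m := by
    simpa using integral_mono hW.integrable_fun (integrable_const (M ^ m))
      (fun y => rp (hf'0 y) (hf'M y))
  have hV := h.ae_abs_sub_integral_le hW ha hKW
  have hmean : |(∫ z, f z) - ∫ z, f' z| ≤ A := by
    rw [← integral_sub hfi hf'i, ← Real.norm_eq_abs]
    exact norm_integral_le_integral_norm _
  have hσm : Measurable fun p : Torus d × Torus d => sgn (f p.2 - f' p.1) :=
    measurable_sgn.comp ((hf.comp measurable_snd).sub (hf'.comp measurable_fst))
  have hρm : Measurable fun p : Torus d × Torus d => ρ (p.2 - p.1) :=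
    hρ.continuous.measurable.comp (measurable_snd.sub measurable_fst)
  have p2 : Integrable (fun p : Torus d × Torus d =>
      sgn (f p.2 - f' p.1) * inner ℝ (W p.1) (convField K f p.2) * ρ (p.2 - p.1))
      (volume.prod volume) := by
    have hWp : Integrable (fun p : Torus d × Torus d => W p.1) (volume.prod volume) :=
      hWi.comp_fst volume
    refine Integrable.mono' (hWp.norm.mul_const (M * (∫ y, ‖K y‖) * B)) ?_
      (Eventually.of_forall fun p => ?_)
    · exact (hσm.aestronglyMeasurable.mul (hWp.aestronglyMeasurable.inner
        (hb.comp continuous_snd).aestronglyMeasurable)).mul hρm.aestronglyMeasurable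
    · rw [norm_mul, norm_mul, Real.norm_eq_abs, Real.norm_eq_abs, Real.norm_eq_abs]
      calc |sgn (f p.2 - f' p.1)| * |inner ℝ (W p.1) (convField K f p.2)| * |ρ (p.2 - p.1)|
          ≤ 1 * (‖W p.1‖ * (M * ∫ y, ‖K y‖)) * B := by
            refine mul_le_mul (mul_le_mul (abs_sgn_le _) ?_ (abs_nonneg _) zero_le_one) (hB _)
              (abs_nonneg _) (by positivity)
            exact (abs_real_inner_le_norm _ _).trans
              (mul_le_mul_of_nonneg_left (hbM _) (norm_nonneg _))
        _ = _ := by ring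
  have p3 : Integrable (fun p : Torus d × Torus d => -(sgn (f p.2 - f' p.1) * f' p.1 ^ m *
      (f p.2 - ∫ z, f z) * ρ (p.2 - p.1)) - sgn (f p.2 - f' p.1) * ρ (p.2 - p.1) * S p.1)
      (volume.prod volume) := by
    refine Integrable.sub ?_ ?_
    · refine (integrable_bdd_prod (C := 1 * M ^ m * M * B) ?_ fun p => ?_).neg
      · exact ((hσm.mul ((hf'.comp measurable_fst).pow_const m)).mul
          ((hf.comp measurable_snd).sub_const _)).mul hρm
      · rw [abs_mul, abs_mul, abs_mul, abs_of_nonneg (Real.rpow_nonneg (hf'0 _) m)]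
        exact mul_le_mul (mul_le_mul (mul_le_mul (abs_sgn_le _) (rp (hf'0 _) (hf'M _))
          (Real.rpow_nonneg (hf'0 _) m) zero_le_one) (abs_sub_integral_le hf hf0 hfM _)
          (abs_nonneg _) (by positivity)) (hB _) (abs_nonneg _) (by positivity)
    · refine (hSi.comp_fst volume).bdd_mul (c := 1 * B) (hσm.mul hρm).aestronglyMeasurable
        (Eventually.of_forall fun p => ?_)
      rw [norm_mul]
      exact mul_le_mul (abs_sgn_le _) (hB _) (abs_nonneg _) zero_le_one
  have pA : Integrable (fun p : Torus d × Torus d => |f p.2 - f' p.1| * ρ (p.2 - p.1))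
      (volume.prod volume) := by
    refine integrable_bdd_prod (C := M * B)
      (((hf.comp measurable_snd).sub (hf'.comp measurable_fst)).abs.mul hρm) fun p => ?_
    rw [abs_mul, abs_abs]
    exact mul_le_mul ((abs_sub_le_of_le_of_le (hf0 _) (hfM _) (hf'0 _) (hf'M _)).trans (by simp))
      (hB _) (abs_nonneg _) hM
  set H : Torus d → Torus d → ℝ := fun y x => -(sgn (f x - f' y) * f' y ^ m *
      (f x - ∫ z, f z) * ρ (x - y)) - sgn (f x - f' y) * ρ (x - y) * S y with hH
  have e1 : ∀ y, (∫ x, (-(|f x ^ m - f' y ^ m| * inner ℝ (convField K f x) (grad ρ (x - y))) -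
        sgn (f x - f' y) * f' y ^ m * (f x - ∫ z, f z) * ρ (x - y))) -
        (∫ x, sgn (f x - f' y) * ρ (x - y)) * S y =
      (∫ x, -(|f x ^ m - f' y ^ m| * inner ℝ (convField K f x) (grad ρ (x - y)))) +
        ∫ x, H y x := by
    intro y
    have hρy : Continuous fun x => ρ (x - y) := hρ.continuous.comp (by fun_prop)
    have hσy : Measurable fun x => sgn (f x - f' y) := measurable_sgn.comp (hf.sub_const _)
    have hgy : Continuous fun x => inner ℝ (convField K f x) (grad ρ (x - y)) :=
      hb.inner ((continuous_grad hρ).comp (by fun_prop))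
    have hfm : Integrable fun x => |f x ^ m - f' y ^ m| := by
      refine Integrable.of_bound ((hf.pow_const m).sub_const _).abs.aestronglyMeasurable (M ^ m)
        (Eventually.of_forall fun x => ?_)
      rw [norm_abs_eq_norm]
      exact (abs_sub_le_of_le_of_le (Real.rpow_nonneg (hf0 _) m) (rp (hf0 _) (hfM _))
          (Real.rpow_nonneg (hf'0 _) m) (rp (hf'0 _) (hf'M _))).trans (by simp)
    have j1 : Integrable fun x =>
        -(|f x ^ m - f' y ^ m| * inner ℝ (convField K f x) (grad ρ (x - y))) :=
      (Integrable.mul_continuous hfm hgy).neg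
    have hσi : Integrable fun x => sgn (f x - f' y) :=
      Integrable.of_bound hσy.aestronglyMeasurable 1 (Eventually.of_forall fun x => abs_sgn_le _)
    have j2 : Integrable fun x => sgn (f x - f' y) * ρ (x - y) :=
      Integrable.mul_continuous hσi hρy
    have j3 : Integrable fun x => sgn (f x - f' y) * f' y ^ m * (f x - ∫ z, f z) * ρ (x - y) :=
      Integrable.mul_continuous ((hσi.mul_const _).mul_bdd (c := M)
        (hf.sub_const _).aestronglyMeasurable
        (Eventually.of_forall (abs_sub_integral_le hf hf0 hfM))) hρy
    have j4 : Integrable fun x => -(sgn (f x - f' y) * f' y ^ m * (f x - ∫ z, f z) * ρ (x - y)) :=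
      j3.neg
    rw [integral_sub j1 j3, integral_sub j4 (j2.mul_const _), integral_neg, integral_neg,
      integral_mul_const]
    ring
  have q1 : Integrable fun y =>
      ∫ x, -(|f x ^ m - f' y ^ m| * inner ℝ (convField K f x) (grad ρ (x - y))) := by
    have : Integrable (fun p : Torus d × Torus d =>
        -(|f p.2 ^ m - f' p.1 ^ m| * inner ℝ (convField K f p.2) (grad ρ (p.2 - p.1))))
        (volume.prod volume) := by
      refine integrable_bdd_prod (C := M ^ m * (M * (∫ y, ‖K y‖) * G)) ?_ fun p => ?_
      · have hin : Measurable fun p : Torus d × Torus d =>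
            inner ℝ (convField K f p.2) (grad ρ (p.2 - p.1)) :=
          ((hb.comp continuous_snd).inner ((continuous_grad hρ).comp
            (continuous_snd.sub continuous_fst))).measurable
        exact ((((hf.comp measurable_snd).pow_const m).sub
          ((hf'.comp measurable_fst).pow_const m)).abs.mul hin).neg
      · rw [abs_neg, abs_mul, abs_abs]
        refine mul_le_mul ?_ ?_ (abs_nonneg _) hMm
        · exact (abs_sub_le_of_le_of_le (Real.rpow_nonneg (hf0 _) m) (rp (hf0 _) (hfM _))
            (Real.rpow_nonneg (hf'0 _) m) (rp (hf'0 _) (hf'M _))).trans (by simp)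
        · exact (abs_real_inner_le_norm _ _).trans (mul_le_mul (hbM _) (hG _) (norm_nonneg _)
            (by positivity))
    exact this.integral_prod_left
  have q2 : Integrable fun y =>
      ∫ x, sgn (f x - f' y) * inner ℝ (W y) (convField K f x) * ρ (x - y) := p2.integral_prod_left
  have q3 : Integrable fun y => ∫ x, H y x := p3.integral_prod_left
  have qA : Integrable fun y => ∫ x, |f x - f' y| * ρ (x - y) := pA.integral_prod_left
  refine le_of_eq_of_le (integral_congr_ae (Eventually.of_forall e1)) ?_
  rw [integral_add q1 q3, integral_integral_flux_eq hm hK hf hf0 hfM hf' hf'0 hf'M hW hρ,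
    ← integral_add q2 q3]
  obtain ⟨qW, hqW⟩ := integral_norm_mul_norm_convField_le hK hf hf0 hfM hf' hf'0 hf'M hWi ha hKW
  set b₂ : Torus d → ℝ := fun y => ‖convField K (fun x => f x - f' x) y‖
  set Aρ : Torus d → ℝ := fun y => ∫ x, |f x - f' y| * ρ (x - y) with hAρ
  -- After integration in `y` the four terms give: a mollification error of `K`; `a A` by duality;
  -- `Vm (A - ∫ Aρ)`, a mollification error of `f'`; and `2 a A` up to another such error. This is
  -- the origin of the factor `3`.
  have hle : ∀ᵐ y, (∫ x, sgn (f x - f' y) * inner ℝ (W y) (convField K f x) * ρ (x - y)) +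
      ∫ x, H y x ≤ M * ‖W y‖ * meanMod ρ K + ‖W y‖ * b₂ y + Vm * (A - Aρ y) +
        a * (Aρ y + A) := by
    filter_upwards [p2.prod_right_ae, p3.prod_right_ae, hV] with y hy2 hy3 hVy
    have hρy : Continuous fun x => ρ (x - y) := hρ.continuous.comp (by fun_prop)
    have j5 : Integrable fun x => ρ (x - y) := integrable_of_continuous hρy
    have j6 : Integrable fun x => |f x - f' y| * ρ (x - y) :=
      Integrable.mul_continuous (hfi.sub (integrable_const _)).abs hρy
    have hcK : Continuous fun x => ρ (x - y) * transMod K (x - y) :=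
      hρy.mul ((continuous_transMod hK).comp (by fun_prop))
    have j7 : Integrable fun x => ρ (x - y) * transMod K (x - y) := integrable_of_continuous hcK
    have e7 : ∫ x, ρ (x - y) * transMod K (x - y) = meanMod ρ K :=
      integral_sub_right_eq_self (fun z => ρ z * transMod K z) y
    have j8 : Integrable fun x => M * ‖W y‖ * (ρ (x - y) * transMod K (x - y)) := j7.const_mul _
    have j9 : Integrable fun x => (‖W y‖ * b₂ y + Vm * A + a * A) * ρ (x - y) := j5.const_mul _
    have j10 : Integrable fun x => (a - Vm) * (|f x - f' y| * ρ (x - y)) := j6.const_mul _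
    have j11 : Integrable fun x => M * ‖W y‖ * (ρ (x - y) * transMod K (x - y)) +
        (‖W y‖ * b₂ y + Vm * A + a * A) * ρ (x - y) := j8.add j9
    have e8 : M * ‖W y‖ * meanMod ρ K + ‖W y‖ * b₂ y + Vm * (A - Aρ y) + a * (Aρ y + A) =
        ∫ x, (M * ‖W y‖ * (ρ (x - y) * transMod K (x - y)) +
          (‖W y‖ * b₂ y + Vm * A + a * A) * ρ (x - y) +
          (a - Vm) * (|f x - f' y| * ρ (x - y))) := by
      rw [integral_add j11 j10, integral_add j8 j9, integral_const_mul, integral_const_mul,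
        integral_const_mul, e7, integral_comp_sub_eq_one hρ1]
      simp only [hAρ]
      ring
    rw [e8, ← integral_add hy2 hy3]
    refine integral_mono (hy2.add hy3) (j11.add j10) fun x => ?_
    have hw : |inner ℝ (W y) (convField K f x - convField K f' y)| ≤
        M * ‖W y‖ * transMod K (x - y) + ‖W y‖ * b₂ y := by
      -- The first difference compares one field at two nearby points and is controlled by the
      -- modulus of `K`; the second term is evaluated at the same point `y` as `W`, as the duality
      -- estimate requires.
      have h1 : convField K f x - convField K f' y =
          (convField K f x - convField K f y) + convField K (fun x => f x - f' x) y := by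
        rw [convField_sub hK hf.aestronglyMeasurable hf'.aestronglyMeasurable hab hab']
        abel
      have h2 : ‖convField K f x - convField K f' y‖ ≤ M * transMod K (x - y) + b₂ y := by
        rw [h1]
        exact (norm_add_le _ _).trans (add_le_add
          (norm_convField_sub_le hK hf.aestronglyMeasurable hab x y) le_rfl)
      refine (abs_real_inner_le_norm _ _).trans
        ((mul_le_mul_of_nonneg_left h2 (norm_nonneg _)).trans (le_of_eq ?_))
      ring
    have hkey := sgn_mul_bracket_le (abs_sgn_le (f x - f' y)) (sgn_mul_self (f x - f' y)) hVm0 hVy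
      hw hmean
    have := mul_le_mul_of_nonneg_right hkey (hρ0 (x - y))
    rw [inner_sub_right] at this
    simp only [S]
    refine le_trans (le_of_eq ?_) (this.trans (le_of_eq ?_)) <;> ring
  have q4 : Integrable fun y => M * ‖W y‖ * meanMod ρ K := (hWi.norm.const_mul M).mul_const _
  have q5 : Integrable fun y => Vm * (A - Aρ y) := ((integrable_const A).sub qA).const_mul _
  have q6 : Integrable fun y => a * (Aρ y + A) := (qA.add (integrable_const A)).const_mul _
  have q7 : Integrable fun y => M * ‖W y‖ * meanMod ρ K + ‖W y‖ * b₂ y := q4.add qW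
  have q8 : Integrable fun y => M * ‖W y‖ * meanMod ρ K + ‖W y‖ * b₂ y + Vm * (A - Aρ y) :=
    q7.add q5
  have q9 : Integrable fun y => M * ‖W y‖ * meanMod ρ K + ‖W y‖ * b₂ y + Vm * (A - Aρ y) +
      a * (Aρ y + A) := q8.add q6
  refine (integral_mono_ae (q2.add q3) q9 hle).trans ?_
  rw [integral_add q8 q6, integral_add q7 q5, integral_add q4 qW, integral_mul_const,
    integral_const_mul, integral_const_mul, integral_const_mul,
    integral_sub (integrable_const A) qA, integral_add qA (integrable_const A)]
  have hdist := abs_integral_integral_sub_le hf hf0 hfM hf' hf'0 hf'M hρ.continuous hρ0 hρ1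
  have hd1 : -meanMod ρ f' ≤ (∫ y, Aρ y) - A := (abs_le.1 hdist).1
  have hd2 : (∫ y, Aρ y) - A ≤ meanMod ρ f' := (abs_le.1 hdist).2
  have hconst : ∫ _y : Torus d, A = A := by simp
  rw [hconst]
  have hmod0 : 0 ≤ meanMod ρ f' := (abs_nonneg _).trans hdist
  have h9 : Vm * (A - ∫ y, Aρ y) ≤ M ^ m * meanMod ρ f' := by
    have h10 : A - ∫ y, Aρ y ≤ meanMod ρ f' := by linarith
    calc Vm * (A - ∫ y, Aρ y) ≤ Vm * meanMod ρ f' := mul_le_mul_of_nonneg_left h10 hVm0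
      _ ≤ _ := mul_le_mul_of_nonneg_right hVmM hmod0
  have h11 : a * ((∫ y, Aρ y) + A) ≤ a * (2 * A + meanMod ρ f') :=
    mul_le_mul_of_nonneg_left (by linarith) ha
  linarith

end Bracket

/-! ### The doubled inequality in space-time -/

theorem measurable_integral_slice {X : Type*} [MeasurableSpace X] {Φ : X → Torus d → ℝ}
    (h : Measurable fun q : X × Torus d => Φ q.1 q.2) : Measurable fun p => ∫ x, Φ p x :=
  (h.stronglyMeasurable.integral_prod_right' (f := fun q : X × Torus d => Φ q.1 q.2)).measurable

theorem measurable_meanMod {M : ℝ} {v : ℝ → Torus d → ℝ} (hv : IsBoundedDensity M v)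
    {ρ : Torus d → ℝ} (hρ : Continuous ρ) : Measurable fun t => meanMod ρ (v t) := by
  refine measurable_integral_slice (Φ := fun t z => ρ z * transMod (v t) z) ?_
  refine (hρ.measurable.comp measurable_snd).mul ?_
  refine measurable_integral_slice (X := ℝ × Torus d) (Φ := fun p y => ‖v p.1 (y + p.2) - v p.1 y‖) ?_
  have h1 : Measurable fun q : (ℝ × Torus d) × Torus d => v q.1.1 (q.2 + q.1.2) :=
    hv.measurable.comp ((measurable_fst.comp measurable_fst).prodMk
      (measurable_snd.add (measurable_snd.comp measurable_fst)))
  have h2 : Measurable fun q : (ℝ × Torus d) × Torus d => v q.1.1 q.2 :=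
    hv.measurable.comp ((measurable_fst.comp measurable_fst).prodMk measurable_snd)
  exact (h1.sub h2).norm

theorem meanMod_nonneg {E : Type*} [NormedAddCommGroup E] {ρ : Torus d → ℝ} (hρ0 : ∀ x, 0 ≤ ρ x)
    (f : Torus d → E) : 0 ≤ meanMod ρ f :=
  integral_nonneg fun z => mul_nonneg (hρ0 z) (transMod_nonneg f z)

theorem meanMod_le {E : Type*} [NormedAddCommGroup E] [NormedSpace ℝ E] {ρ : Torus d → ℝ}
    (hρ : Continuous ρ) (hρ0 : ∀ x, 0 ≤ ρ x) (hρ1 : ∫ x, ρ x = 1) {f : Torus d → E}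
    (hf : Integrable f) {C : ℝ} (hC : ∀ z, transMod f z ≤ C) : meanMod ρ f ≤ C := by
  have h1 : Integrable fun z => ρ z * transMod f z :=
    integrable_of_continuous (hρ.mul (continuous_transMod hf))
  calc meanMod ρ f ≤ ∫ z, ρ z * C := integral_mono h1 ((integrable_of_continuous hρ).mul_const C)
        fun z => mul_le_mul_of_nonneg_left (hC z) (hρ0 z)
    _ = C := by rw [integral_mul_const, hρ1, one_mul]

/-- The modulus of continuity is continuous and vanishes at `0`. All error terms of the doubling
disappear through this limit. -/
theorem tendsto_meanMod_mollifier {E : Type*} [NormedAddCommGroup E] [NormedSpace ℝ E]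
    {f : Torus d → E} (hf : Integrable f) :
    Tendsto (fun n => meanMod (mollifier n) f) atTop (𝓝 0) := by
  have := tendsto_integral_mollifier_mul (continuous_transMod hf)
  rwa [transMod_zero] at this

section SpaceTime

variable {m M T : ℝ} {g : Torus d → ℝ} {K : Torus d → Vec d} {F : ℝ → Torus d → Vec d}
  {u v : ℝ → Torus d → ℝ} {u₀ v₀ ρ : Torus d → ℝ} {a χ : ℝ → ℝ}

/-- For almost every `y` the curve `t ↦ v t y` is an admissible moving level in the entropy
inequality of `u` tested with `ρ (· - y)`. Integrating in `y` and exchanging with the time integral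
leaves the doubled rate, which `integral_doubled_rate_le` bounds at almost every time. -/
theorem integral_doubled_nonneg (hT : 0 < T) (hm : 0 < m) (h : IsGreenKernel g K)
    (hKm : StronglyMeasurable K) (hu : IsBoundedDensity M u) (hv : IsBoundedDensity M v)
    (hu₀ : Measurable u₀) (hu₀0 : ∀ x, 0 ≤ u₀ x) (hu₀M : ∀ x, u₀ x ≤ M)
    (hv₀ : Measurable v₀) (hv₀0 : ∀ x, 0 ≤ v₀ x) (hv₀M : ∀ x, v₀ x ≤ M)
    (hsolu : IsEntropySolution m K u₀ u) (hsolv : IsEntropySolution m K v₀ v)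
    (hF : StronglyMeasurable (Function.uncurry F))
    (hFi : Integrable (Function.uncurry F) ((volume.restrict (Ioo 0 T)).prod volume))
    (hVF : ∀ᵐ t ∂volume.restrict (Ioo 0 T), HasWeakGradient (fun x => v t x ^ m) (F t))
    (ha : Integrable a) (ha0 : ∀ t, 0 ≤ a t)
    (hKF : ∀ᵐ t ∂volume.restrict (Ioo 0 T), ∀ z,
      ∫⁻ y, ‖K (y - z)‖ₑ * ‖F t y‖ₑ ≤ ENNReal.ofReal (a t))
    (hρ : IsSmooth ρ) (hρ0 : ∀ x, 0 ≤ ρ x) (hρ1 : ∫ x, ρ x = 1)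
    (hχ : ContDiff ℝ ∞ χ) (hχ0 : ∀ t, 0 ≤ χ t) (hχT : ∀ t, T ≤ t → χ t = 0) :
    0 ≤ (∫ t in Ioo 0 T, ((∫ y, ∫ x, |u t x - v t y| * ρ (x - y)) * deriv χ t +
      (3 * a t * (∫ x, |u t x - v t x|) + (a t + M ^ m) * meanMod ρ (v t) +
        M * (∫ y, ‖F t y‖) * meanMod ρ K) * χ t)) +
      (∫ y, ∫ x, |u₀ x - v₀ y| * ρ (x - y)) * χ 0 := by
  have hK := h.gradient.integrable_grad
  set μ := volume.restrict (Ioo (0 : ℝ) T)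
  obtain ⟨B, hB0, hB⟩ := TorusContDiff.exists_bound hρ
  obtain ⟨G, hG0, hG⟩ := exists_bound_grad hρ
  have hM := hu.bound_nonneg
  have hMm : 0 ≤ M ^ m := Real.rpow_nonneg hM m
  have hKn : 0 ≤ ∫ y, ‖K y‖ := integral_nonneg fun _ => norm_nonneg _
  have hχ' : Continuous (deriv χ) := hχ.continuous_deriv (by norm_num)
  obtain ⟨X, hX⟩ := isCompact_Icc (a := (0 : ℝ)) (b := T).exists_bound_of_continuousOn
    hχ.continuous.continuousOn
  obtain ⟨X', hX'⟩ := isCompact_Icc (a := (0 : ℝ)) (b := T).exists_bound_of_continuousOn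
    hχ'.continuousOn
  have hv₀i : Integrable v₀ := Integrable.of_bound hv₀.aestronglyMeasurable M
    (Eventually.of_forall fun x => by rw [Real.norm_of_nonneg (hv₀0 x)]; exact hv₀M x)
  set S := source m K F v
  have hSi : Integrable (Function.uncurry S) (μ.prod volume) :=
    integrable_source hm hv hKm hK hF hFi
  have hSm : Measurable (Function.uncurry S) := (stronglyMeasurable_source hv hKm hF).measurable
  set L₁ : ℝ → Torus d → ℝ := fun t y => ∫ x, |u t x - v t y| * ρ (x - y)
  set L₂ : ℝ → Torus d → ℝ := fun t y => ∫ x,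
    (-(|u t x ^ m - v t y ^ m| * inner ℝ (convField K (u t) x) (grad ρ (x - y))) -
      sgn (u t x - v t y) * v t y ^ m * (u t x - ∫ z, u t z) * ρ (x - y))
  set L₃ : ℝ → Torus d → ℝ := fun t y => ∫ x, sgn (u t x - v t y) * ρ (x - y)
  have mt : Measurable fun q : (ℝ × Torus d) × Torus d => q.1.1 :=
    measurable_fst.comp measurable_fst
  have my : Measurable fun q : (ℝ × Torus d) × Torus d => q.1.2 :=
    measurable_snd.comp measurable_fst
  have mu : Measurable fun q : (ℝ × Torus d) × Torus d => u q.1.1 q.2 :=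
    hu.measurable.comp (mt.prodMk measurable_snd)
  have mv : Measurable fun q : (ℝ × Torus d) × Torus d => v q.1.1 q.1.2 :=
    hv.measurable.comp measurable_fst
  have mρ : Measurable fun q : (ℝ × Torus d) × Torus d => ρ (q.2 - q.1.2) :=
    hρ.continuous.measurable.comp (measurable_snd.sub my)
  have mσ : Measurable fun q : (ℝ × Torus d) × Torus d => sgn (u q.1.1 q.2 - v q.1.1 q.1.2) :=
    measurable_sgn.comp (mu.sub mv)
  have mi : Measurable fun q : (ℝ × Torus d) × Torus d =>
      inner ℝ (convField K (u q.1.1) q.2) (grad ρ (q.2 - q.1.2)) :=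
    (StronglyMeasurable.inner
      ((hu.stronglyMeasurable_convField hKm).comp_measurable (mt.prodMk measurable_snd))
      ((continuous_grad hρ).stronglyMeasurable.comp_measurable (measurable_snd.sub my))).measurable
  have mL₁ : Measurable (Function.uncurry L₁) :=
    measurable_integral_slice (Φ := fun (p : ℝ × Torus d) x => |u p.1 x - v p.1 p.2| * ρ (x - p.2))
      ((mu.sub mv).abs.mul mρ)
  have mL₂ : Measurable (Function.uncurry L₂) :=
    measurable_integral_slice (Φ := fun (p : ℝ × Torus d) x =>
      (-(|u p.1 x ^ m - v p.1 p.2 ^ m| * inner ℝ (convField K (u p.1) x) (grad ρ (x - p.2))) -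
        sgn (u p.1 x - v p.1 p.2) * v p.1 p.2 ^ m * (u p.1 x - ∫ z, u p.1 z) * ρ (x - p.2)))
      ((((mu.pow_const m).sub (mv.pow_const m)).abs.mul mi).neg.sub
        (((mσ.mul (mv.pow_const m)).mul (mu.sub (hu.measurable_mean.comp mt))).mul mρ))
  have mL₃ : Measurable (Function.uncurry L₃) :=
    measurable_integral_slice (Φ := fun (p : ℝ × Torus d) x =>
      sgn (u p.1 x - v p.1 p.2) * ρ (x - p.2)) (mσ.mul mρ)
  have bd : ∀ t x y, |u t x - v t y| ≤ M := fun t x y =>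
    (abs_sub_le_of_le_of_le (hu.nonneg t x) (hu.le t x) (hv.nonneg t y) (hv.le t y)).trans
      (by simp)
  have bdm : ∀ t x y, |u t x ^ m - v t y ^ m| ≤ M ^ m := fun t x y =>
    (abs_sub_le_of_le_of_le (Real.rpow_nonneg (hu.nonneg t x) m) (hu.rpow_le hm t x)
      (Real.rpow_nonneg (hv.nonneg t y) m) (hv.rpow_le hm t y)).trans (by simp)
  have bL₁ : ∀ t y, |L₁ t y| ≤ M * B := fun t y => abs_integral_le_of_bound fun x => by
    rw [abs_mul, abs_abs]
    exact mul_le_mul (bd t x y) (hB _) (abs_nonneg _) hM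
  have bL₂ : ∀ t y, |L₂ t y| ≤ M ^ m * (M * (∫ y, ‖K y‖) * G) + 1 * M ^ m * M * B := fun t y =>
    abs_integral_le_of_bound fun x => by
      refine (abs_sub _ _).trans (add_le_add ?_ ?_)
      · rw [abs_neg, abs_mul, abs_abs]
        refine mul_le_mul (bdm t x y) ?_ (abs_nonneg _) hMm
        exact (abs_real_inner_le_norm _ _).trans (mul_le_mul (hu.norm_convField_le hK t x) (hG _)
          (norm_nonneg _) (by positivity))
      · rw [abs_mul, abs_mul, abs_mul, abs_of_nonneg (Real.rpow_nonneg (hv.nonneg t y) m)]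
        exact mul_le_mul (mul_le_mul (mul_le_mul (abs_sgn_le _) (hv.rpow_le hm t y)
          (Real.rpow_nonneg (hv.nonneg t y) m) zero_le_one) (hu.abs_sub_mean_le t x)
          (abs_nonneg _) (by positivity)) (hB _) (abs_nonneg _) (by positivity)
  have bL₃ : ∀ t y, |L₃ t y| ≤ B := fun t y => abs_integral_le_of_bound fun x => by
    rw [abs_mul]
    calc |sgn (u t x - v t y)| * |ρ (x - y)| ≤ 1 * B :=
          mul_le_mul (abs_sgn_le _) (hB _) (abs_nonneg _) zero_le_one
      _ = B := one_mul B
  have iL₁ : Integrable (Function.uncurry L₁) (μ.prod volume) :=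
    integrable_bdd_prod mL₁ fun p => bL₁ p.1 p.2
  have iL₂ : Integrable (Function.uncurry L₂) (μ.prod volume) :=
    integrable_bdd_prod mL₂ fun p => bL₂ p.1 p.2
  have iL₃ : Integrable (fun p => L₃ p.1 p.2 * S p.1 p.2) (μ.prod volume) :=
    hSi.bdd_mul (c := B) mL₃.aestronglyMeasurable (Eventually.of_forall fun p => bL₃ p.1 p.2)
  have iR : Integrable (fun p => L₂ p.1 p.2 - L₃ p.1 p.2 * S p.1 p.2) (μ.prod volume) :=
    iL₂.sub iL₃
  have hfst : ∀ᵐ p ∂(μ.prod (volume : Measure (Torus d))), p.1 ∈ Ioo 0 T :=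
    Measure.quasiMeasurePreserving_fst.ae (ae_restrict_mem measurableSet_Ioo)
  set E : ℝ → Torus d → ℝ := fun t y => L₁ t y * deriv χ t + (L₂ t y - L₃ t y * S t y) * χ t
  have iE : Integrable (Function.uncurry E) (μ.prod volume) := by
    refine Integrable.add ?_ ?_
    · refine iL₁.mul_bdd (c := X') (hχ'.comp continuous_fst).aestronglyMeasurable ?_
      filter_upwards [hfst] with p hp using hX' _ (Ioo_subset_Icc_self hp)
    · refine iR.mul_bdd (c := X) (hχ.continuous.comp continuous_fst).aestronglyMeasurable ?_
      filter_upwards [hfst] with p hp using hX _ (Ioo_subset_Icc_self hp)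
  set E₀ : Torus d → ℝ := fun y => (∫ x, |u₀ x - v₀ y| * ρ (x - y)) * χ 0
  have iE₀ : Integrable E₀ := by
    refine Integrable.mul_const (Integrable.of_bound (C := M * B) ?_
      (Eventually.of_forall fun y => abs_integral_le_of_bound fun x => ?_)) _
    · exact (measurable_integral_slice (Φ := fun (y : Torus d) x => |u₀ x - v₀ y| * ρ (x - y))
        (((hu₀.comp measurable_snd).sub (hv₀.comp measurable_fst)).abs.mul
          (hρ.continuous.measurable.comp (measurable_snd.sub measurable_fst)))).aestronglyMeasurable
    · rw [abs_mul, abs_abs]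
      exact mul_le_mul ((abs_sub_le_of_le_of_le (hu₀0 x) (hu₀M x) (hv₀0 y) (hv₀M y)).trans
        (by simp)) (hB _) (abs_nonneg _) hM
  have hrep := ae_ae_eq_add_primitive hT h hm hv hKm hv₀ hv₀i hsolv hF hFi hVF
  have hy : ∀ᵐ y, 0 ≤ (∫ t in Ioo 0 T, E t y) + E₀ y := by
    filter_upwards [hrep, hSi.prod_left_ae] with y hyrep hyS
    -- The source is cut off outside `(0, T)` so as to be integrable on the whole line; its
    -- primitive is unchanged for `t` in `(0, T)`.
    have hs : Integrable ((Ioo 0 T).indicator fun t => S t y) :=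
      (integrable_indicator_iff measurableSet_Ioo).2 hyS
    have hk : ∀ᵐ t ∂volume.restrict (Ioo 0 T), v t y =
        v₀ y + ∫ τ in (0 : ℝ)..t, (Ioo 0 T).indicator (fun t => S t y) τ := by
      filter_upwards [hyrep, ae_restrict_mem measurableSet_Ioo] with t ht htm
      rw [ht]
      congr 1
      refine intervalIntegral.integral_congr_ae (Eventually.of_forall fun τ hτ => ?_)
      rw [uIoc_of_le htm.1.le] at hτ
      rw [indicator_of_mem (show τ ∈ Ioo 0 T from ⟨hτ.1, hτ.2.trans_lt htm.2⟩)]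
    have h1 := hsolu.integral_moving_level_nonneg (ψ := fun x => ρ (x - y)) hm h hKm hu hu₀ hu₀0
      hu₀M (TorusContDiff.comp_sub_right hρ y) (fun x => hρ0 _) hs (k := fun t => v t y) hk
      (fun t => hv.nonneg t y) hχ hχ0 hχT
    refine h1.trans_eq ?_
    congr 1
    refine setIntegral_congr_fun measurableSet_Ioo fun t ht => ?_
    simp only [E, L₁, L₂, L₃, grad_comp_sub_right, indicator_of_mem ht]
  have h2 : 0 ≤ ∫ y, ((∫ t in Ioo 0 T, E t y) + E₀ y) := integral_nonneg_of_ae hy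
  have iE' : Integrable fun y => ∫ t in Ioo 0 T, E t y := iE.integral_prod_right
  rw [integral_add iE' iE₀, ← integral_integral_swap iE] at h2
  refine h2.trans (add_le_add ?_ (le_of_eq ?_))
  · have hAm : Measurable fun t => ∫ x, |u t x - v t x| :=
      measurable_integral_slice (Φ := fun t x => |u t x - v t x|) (hu.measurable.sub hv.measurable).abs
    have hAb : ∀ t, |(∫ x, |u t x - v t x|)| ≤ M := fun t => abs_integral_le_of_bound fun x => by
      rw [abs_abs]; exact bd t x x
    have hmm := measurable_meanMod hv hρ.continuous
    have hmb : ∀ t, |meanMod ρ (v t)| ≤ M := fun t => by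
      rw [abs_of_nonneg (meanMod_nonneg hρ0 _)]
      exact meanMod_le hρ.continuous hρ0 hρ1 (hv.integrable t) (transMod_le (hv.nonneg t) (hv.le t))
    have haμ : Integrable a μ := ha.integrableOn
    have iLt : Integrable (fun t => ∫ y, L₁ t y) μ := iL₁.integral_prod_left
    have iFt : Integrable (fun t => ∫ y, ‖F t y‖) μ := hFi.norm.integral_prod_left
    have i5 : Integrable (fun t => 3 * a t * (∫ x, |u t x - v t x|) +
        (a t + M ^ m) * meanMod ρ (v t) + M * (∫ y, ‖F t y‖) * meanMod ρ K) μ :=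
      (((haμ.const_mul 3).mul_bdd (c := M) hAm.aestronglyMeasurable (Eventually.of_forall hAb)).add
        ((haμ.add (integrable_const _)).mul_bdd (c := M) hmm.aestronglyMeasurable
          (Eventually.of_forall hmb))).add ((iFt.const_mul M).mul_const _)
    refine integral_mono_ae iE.integral_prod_left (Integrable.add ?_ ?_) ?_
    · refine iLt.mul_bdd (c := X') hχ'.aestronglyMeasurable ?_
      filter_upwards [ae_restrict_mem measurableSet_Ioo] with t ht
      exact hX' _ (Ioo_subset_Icc_self ht)
    · refine i5.mul_bdd (c := X) hχ.continuous.aestronglyMeasurable ?_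
      filter_upwards [ae_restrict_mem measurableSet_Ioo] with t ht
      exact hX _ (Ioo_subset_Icc_self ht)
    · filter_upwards [iL₁.prod_right_ae, iR.prod_right_ae, hVF, hKF] with t h3 h4 h5 h6
      have h3' : Integrable fun y => L₁ t y * deriv χ t := h3.mul_const _
      have h4' : Integrable fun y => (L₂ t y - L₃ t y * S t y) * χ t := h4.mul_const _
      have e : ∫ y, E t y = (∫ y, L₁ t y) * deriv χ t +
          (∫ y, (L₂ t y - L₃ t y * S t y)) * χ t := by
        rw [← integral_mul_const, ← integral_mul_const, ← integral_add h3' h4']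
      refine e.trans_le (add_le_add le_rfl (mul_le_mul_of_nonneg_right ?_ (hχ0 t)))
      exact integral_doubled_rate_le hm h (hu.measurable_slice t) (hu.nonneg t) (hu.le t)
        (hv.measurable_slice t) (hv.nonneg t) (hv.le t) h5 (ha0 t) h6 hρ hρ0 hρ1
  · exact integral_mul_const _ _

end SpaceTime

/-! ### Removal of the spatial mollification -/

theorem transMod_le_two_mul {E : Type*} [NormedAddCommGroup E] {f : Torus d → E}
    (hf : Integrable f) (z : Torus d) : transMod f z ≤ 2 * ∫ x, ‖f x‖ := by
  have h1 : Integrable fun y => ‖f (y + z)‖ := (hf.comp_add_right z).norm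
  calc transMod f z ≤ ∫ y, (‖f (y + z)‖ + ‖f y‖) :=
        integral_mono ((hf.comp_add_right z).sub hf).norm (h1.add hf.norm)
          fun y => norm_sub_le _ _
    _ = 2 * ∫ x, ‖f x‖ := by
        rw [integral_add h1 hf.norm, integral_add_right_eq_self (fun y => ‖f y‖) z]
        ring

section Stability

variable {m M T : ℝ} {g : Torus d → ℝ} {K : Torus d → Vec d} {F : ℝ → Torus d → Vec d}
  {u v : ℝ → Torus d → ℝ} {u₀ v₀ : Torus d → ℝ} {a : ℝ → ℝ}

/-- The stability estimate, for measurable bounded representatives. -/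
theorem ae_integral_abs_sub_le (hT : 0 < T) (hm : 0 < m) (h : IsGreenKernel g K)
    (hKm : StronglyMeasurable K) (hu : IsBoundedDensity M u) (hv : IsBoundedDensity M v)
    (hu₀ : Measurable u₀) (hu₀0 : ∀ x, 0 ≤ u₀ x) (hu₀M : ∀ x, u₀ x ≤ M)
    (hv₀ : Measurable v₀) (hv₀0 : ∀ x, 0 ≤ v₀ x) (hv₀M : ∀ x, v₀ x ≤ M)
    (hsolu : IsEntropySolution m K u₀ u) (hsolv : IsEntropySolution m K v₀ v)
    (hF : StronglyMeasurable (Function.uncurry F))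
    (hFi : Integrable (Function.uncurry F) ((volume.restrict (Ioo 0 T)).prod volume))
    (hVF : ∀ᵐ t ∂volume.restrict (Ioo 0 T), HasWeakGradient (fun x => v t x ^ m) (F t))
    (ha : Integrable a) (ha0 : ∀ t, 0 ≤ a t)
    (hKF : ∀ᵐ t ∂volume.restrict (Ioo 0 T), ∀ z,
      ∫⁻ y, ‖K (y - z)‖ₑ * ‖F t y‖ₑ ≤ ENNReal.ofReal (a t)) :
    ∀ᵐ t ∂volume.restrict (Ioo 0 T), ∫ x, |u t x - v t x| ≤
      (∫ x, |u₀ x - v₀ x|) * Real.exp (∫ s in (0 : ℝ)..t, 3 * a s) := by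
  have hK := h.gradient.integrable_grad
  have hM := hu.bound_nonneg
  have hMm : 0 ≤ M ^ m := Real.rpow_nonneg hM m
  have hKn : 0 ≤ ∫ y, ‖K y‖ := integral_nonneg fun _ => norm_nonneg _
  have hAm : Measurable fun t => ∫ x, |u t x - v t x| :=
    measurable_integral_slice (Φ := fun t x => |u t x - v t x|)
      (hu.measurable.sub hv.measurable).abs
  have hA0 : ∀ t, 0 ≤ ∫ x, |u t x - v t x| := fun t => integral_nonneg fun _ => abs_nonneg _
  have hAb : ∀ t, ∫ x, |u t x - v t x| ≤ M := fun t => by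
    refine (le_abs_self _).trans (abs_integral_le_of_bound fun x => ?_)
    rw [abs_abs]
    exact (abs_sub_le_of_le_of_le (hu.nonneg t x) (hu.le t x) (hv.nonneg t x) (hv.le t x)).trans
      (by simp)
  refine le_mul_exp_of_integral_nonneg hT hAm hA0 hAb (ha.const_mul 3)
    (fun t => mul_nonneg (by norm_num) (ha0 t)) fun χ hχ hχ0 hχT => ?_
  have key := fun n => integral_doubled_nonneg hT hm h hKm hu hv hu₀ hu₀0 hu₀M hv₀ hv₀0 hv₀M
    hsolu hsolv hF hFi hVF ha ha0 hKF (isSmooth_mollifier n) (mollifier_nonneg n)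
    (integral_mollifier n) hχ hχ0 hχT
  set μ := volume.restrict (Ioo (0 : ℝ) T)
  have hχ' : Continuous (deriv χ) := hχ.continuous_deriv (by norm_num)
  obtain ⟨X, hX⟩ := isCompact_Icc (a := (0 : ℝ)) (b := T).exists_bound_of_continuousOn
    hχ.continuous.continuousOn
  obtain ⟨X', hX'⟩ := isCompact_Icc (a := (0 : ℝ)) (b := T).exists_bound_of_continuousOn
    hχ'.continuousOn
  have hdist : ∀ n t, |(∫ y, ∫ x, |u t x - v t y| * mollifier n (x - y)) -
      (∫ x, |u t x - v t x|)| ≤ meanMod (mollifier n) (v t) := fun n t =>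
    abs_integral_integral_sub_le (hu.measurable_slice t) (hu.nonneg t) (hu.le t)
      (hv.measurable_slice t) (hv.nonneg t) (hv.le t) (continuous_mollifier n)
      (mollifier_nonneg n) (integral_mollifier n)
  have hmod : ∀ n t, meanMod (mollifier n) (v t) ≤ M := fun n t =>
    meanMod_le (continuous_mollifier n) (mollifier_nonneg n) (integral_mollifier n)
      (hv.integrable t) (transMod_le (hv.nonneg t) (hv.le t))
  have hmod0 : ∀ n t, 0 ≤ meanMod (mollifier n) (v t) := fun n t =>
    meanMod_nonneg (mollifier_nonneg n) _
  have hmodK : ∀ n, meanMod (mollifier n) K ≤ 2 * ∫ x, ‖K x‖ := fun n =>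
    meanMod_le (continuous_mollifier n) (mollifier_nonneg n) (integral_mollifier n)
      hK (transMod_le_two_mul hK)
  have hmodK0 : ∀ n, 0 ≤ meanMod (mollifier n) K := fun n => meanMod_nonneg (mollifier_nonneg n) _
  have hlim : ∀ (e : ℕ → ℝ) (c : ℕ → ℝ) {l : ℝ},
      (∀ n, |c n - l| ≤ e n) → Tendsto e atTop (𝓝 0) → Tendsto c atTop (𝓝 l) := by
    intro e c l h1 h2
    rw [tendsto_iff_norm_sub_tendsto_zero]
    exact squeeze_zero (fun n => norm_nonneg _) h1 h2
  have hv₀i : Integrable v₀ := Integrable.of_bound hv₀.aestronglyMeasurable M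
    (Eventually.of_forall fun x => by rw [Real.norm_of_nonneg (hv₀0 x)]; exact hv₀M x)
  have t0 : Tendsto (fun n => ∫ y, ∫ x, |u₀ x - v₀ y| * mollifier n (x - y)) atTop
      (𝓝 (∫ x, |u₀ x - v₀ x|)) :=
    hlim (fun n => meanMod (mollifier n) v₀) _ (fun n =>
      abs_integral_integral_sub_le hu₀ hu₀0 hu₀M hv₀ hv₀0 hv₀M (continuous_mollifier n)
        (mollifier_nonneg n) (integral_mollifier n)) (tendsto_meanMod_mollifier hv₀i)
  have iFt : Integrable (fun t => ∫ y, ‖F t y‖) μ := hFi.norm.integral_prod_left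
  have hF0 : ∀ t, 0 ≤ ∫ y, ‖F t y‖ := fun t => integral_nonneg fun _ => norm_nonneg _
  have haμ : Integrable a μ := ha.integrableOn
  -- The two zeros are the limits of `meanMod` for `v t` and for `K`; in this shape the integrand is
  -- visibly the pointwise limit of the doubled one.
  have hcongr : ∀ t, deriv χ t * (∫ x, |u t x - v t x|) +
      χ t * (3 * a t * ∫ x, |u t x - v t x|) = (∫ x, |u t x - v t x|) * deriv χ t +
      (3 * a t * (∫ x, |u t x - v t x|) + (a t + M ^ m) * 0 + M * (∫ y, ‖F t y‖) * 0) * χ t :=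
    fun t => by ring
  simp_rw [hcongr]
  rw [mul_comm (χ 0)]
  refine ge_of_tendsto' (x := atTop) (Tendsto.add ?_ (t0.mul_const _)) key
  refine tendsto_integral_of_dominated_convergence
    (fun t => (M + M) * X' + (3 * a t * M + (a t + M ^ m) * M +
      M * (∫ y, ‖F t y‖) * (2 * ∫ x, ‖K x‖)) * X) (fun n => ?_) ?_ (fun n => ?_) ?_
  · have hAn : Measurable fun t => ∫ y, ∫ x, |u t x - v t y| * mollifier n (x - y) := by
      refine measurable_integral_slice (Φ := fun t y =>
        ∫ x, |u t x - v t y| * mollifier n (x - y)) ?_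
      refine measurable_integral_slice (X := ℝ × Torus d) (Φ := fun p x =>
        |u p.1 x - v p.1 p.2| * mollifier n (x - p.2)) ?_
      have h1 : Measurable fun q : (ℝ × Torus d) × Torus d => u q.1.1 q.2 :=
        hu.measurable.comp ((measurable_fst.comp measurable_fst).prodMk measurable_snd)
      have h2 : Measurable fun q : (ℝ × Torus d) × Torus d => v q.1.1 q.1.2 :=
        hv.measurable.comp measurable_fst
      exact (h1.sub h2).abs.mul ((continuous_mollifier n).measurable.comp
        (measurable_snd.sub (measurable_snd.comp measurable_fst)))
    have hmm := measurable_meanMod hv (continuous_mollifier n)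
    exact ((hAn.mul hχ'.measurable).aestronglyMeasurable).add
      ((((((haμ.aestronglyMeasurable.const_mul 3).mul hAm.aestronglyMeasurable)).add
        ((haμ.aestronglyMeasurable.add aestronglyMeasurable_const).mul
          hmm.aestronglyMeasurable)).add
          ((iFt.aestronglyMeasurable.const_mul M).mul_const _)).mul
            hχ.continuous.aestronglyMeasurable)
  · exact (integrable_const _).add ((((((haμ.const_mul 3).mul_const M)).add
      ((haμ.add (integrable_const _)).mul_const M)).add
        ((iFt.const_mul M).mul_const _)).mul_const X)
  · filter_upwards [ae_restrict_mem measurableSet_Ioo] with t ht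
    have ht' := Ioo_subset_Icc_self ht
    have hat := ha0 t
    have hFt := hF0 t
    rw [Real.norm_eq_abs]
    refine (abs_add_le _ _).trans (add_le_add ?_ ?_)
    · rw [abs_mul]
      refine mul_le_mul ?_ (hX' t ht') (abs_nonneg _) (by positivity)
      have h1 := abs_le.1 (hdist n t)
      rw [abs_le]
      constructor <;> linarith [hmod n t, hAb t, hA0 t]
    · rw [abs_mul, abs_of_nonneg (add_nonneg (add_nonneg
        (mul_nonneg (mul_nonneg (by norm_num) hat) (hA0 t))
        (mul_nonneg (add_nonneg hat hMm) (hmod0 n t)))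
        (mul_nonneg (mul_nonneg hM hFt) (hmodK0 n)))]
      refine mul_le_mul ?_ (hX t ht') (abs_nonneg _) (by positivity)
      refine add_le_add (add_le_add ?_ ?_) ?_
      · exact mul_le_mul_of_nonneg_left (hAb t) (by positivity)
      · exact mul_le_mul_of_nonneg_left (hmod n t) (by positivity)
      · exact mul_le_mul_of_nonneg_left (hmodK n) (by positivity)
  · refine Eventually.of_forall fun t => ?_
    have t1 := tendsto_meanMod_mollifier (hv.integrable t)
    have t2 := tendsto_meanMod_mollifier hK
    have t3 := hlim _ _ (fun n => hdist n t) t1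
    exact (t3.mul_const _).add (((tendsto_const_nhds.add (t1.const_mul _)).add
      (t2.const_mul _)).mul_const _)

end Stability

/-! ### Representatives -/

/-- Truncating a measurable version to `[0, M]` makes the bounds hold everywhere, so the whole
argument can work with densities bounded at every point. -/
theorem exists_measurable_rep {X : Type*} [MeasurableSpace X] {μ : Measure X} {f : X → ℝ} {M : ℝ}
    (hM : 0 ≤ M) (hf : AEStronglyMeasurable f μ) (h0 : ∀ᵐ x ∂μ, 0 ≤ f x) (h1 : ∀ᵐ x ∂μ, f x ≤ M) :
    ∃ f' : X → ℝ, Measurable f' ∧ f =ᵐ[μ] f' ∧ (∀ x, 0 ≤ f' x) ∧ ∀ x, f' x ≤ M := by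
  refine ⟨fun x => max 0 (min M (hf.mk f x)),
    measurable_const.max (measurable_const.min hf.stronglyMeasurable_mk.measurable), ?_,
    fun x => le_max_left _ _, fun x => max_le hM (min_le_left _ _)⟩
  filter_upwards [h0, h1, hf.ae_eq_mk] with x hx0 hx1 hx
  rw [← hx, min_eq_right hx1, max_eq_right hx0]

theorem exists_ae_le_of_memLp_top {X : Type*} [MeasurableSpace X] {μ : Measure X} {f : X → ℝ}
    (hf : MemLp f ⊤ μ) : ∃ M, ∀ᵐ x ∂μ, f x ≤ M := by
  refine ⟨(eLpNormEssSup f μ).toReal, ?_⟩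
  have hfin : eLpNormEssSup f μ ≠ ⊤ := by rw [← eLpNorm_exponent_top]; exact hf.2.ne
  filter_upwards [ae_le_eLpNormEssSup (f := f) (μ := μ)] with x hx
  refine (Real.le_norm_self _).trans ?_
  have := ENNReal.toReal_mono hfin hx
  rwa [toReal_enorm] at this

theorem convField_congr {K K' : Torus d → Vec d} {f f' : Torus d → ℝ} (hK : K =ᵐ[volume] K')
    (hf : f =ᵐ[volume] f') (x : Torus d) : convField K f x = convField K' f' x := by
  refine integral_congr_ae ?_
  filter_upwards [hf, (quasiMeasurePreserving_sub_left volume x).ae hK] with y h1 h2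
  rw [h1, h2]

theorem lorentzNorm_congr {p : ℝ} {F F' : Torus d → Vec d} (h : F =ᵐ[volume] F') :
    lorentzNorm p F = lorentzNorm p F' := by
  unfold lorentzNorm
  congr 1
  refine lintegral_congr fun s => ?_
  congr 1
  refine measure_congr ?_
  filter_upwards [h] with x hx
  exact propext (by change s < ‖F x‖ ↔ s < ‖F' x‖; rw [hx])

theorem IsGreenKernel.congr {g : Torus d → ℝ} {K K' : Torus d → Vec d} (h : IsGreenKernel g K)
    (hK : K =ᵐ[volume] K') : IsGreenKernel g K' :=
  ⟨h.gradient.congr (ae_eq_refl g) hK, h.equation⟩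

theorem IsEntropySolution.congr {m : ℝ} {K K' : Torus d → Vec d} {u₀ u₀' : Torus d → ℝ}
    {u u' : ℝ → Torus d → ℝ} (h : IsEntropySolution m K u₀ u) (hK : K =ᵐ[volume] K')
    (hu₀ : u₀ =ᵐ[volume] u₀') (hu : Function.uncurry u =ᵐ[spaceTime d] Function.uncurry u') :
    IsEntropySolution m K' u₀' u' := by
  have hs : ∀ᵐ t ∂volume.restrict (Ioi (0 : ℝ)), u t =ᵐ[volume] u' t :=
    Measure.ae_ae_of_ae_prod hu
  refine ⟨h.initial_memLp.ae_eq hu₀, ?_, h.memLp.ae_eq hu, ?_, ?_, ?_⟩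
  · filter_upwards [h.initial_nonneg, hu₀] with x h1 h2
    rwa [← h2]
  · filter_upwards [h.nonneg, hu] with p h1 h2
    rw [← show u p.1 p.2 = u' p.1 p.2 from h2]
    exact h1
  · intro T hT φ hφ hφT
    have e0 : ∫ x, u₀' x * φ 0 x = ∫ x, u₀ x * φ 0 x :=
      integral_congr_ae (by filter_upwards [hu₀] with x hx; rw [hx])
    rw [e0, ← h.weak T hT φ hφ hφT]
    refine integral_congr_ae ?_
    filter_upwards [ae_restrict_of_ae_restrict_of_subset Ioo_subset_Ioi_self hs] with t ht
    refine integral_congr_ae ?_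
    filter_upwards [ht] with x hx
    rw [hx, convField_congr hK ht]
  · intro η hη hηc φ hφ hφ0 hφT
    have e0 : ∫ x, η (u₀' x) * φ 0 x = ∫ x, η (u₀ x) * φ 0 x :=
      integral_congr_ae (by filter_upwards [hu₀] with x hx; rw [hx])
    rw [e0]
    refine (h.entropy η hη hηc φ hφ hφ0 hφT).trans_eq ?_
    congr 1
    refine integral_congr_ae ?_
    filter_upwards [hs] with t ht
    refine integral_congr_ae ?_
    filter_upwards [ht] with x hx
    rw [hx, convField_congr hK ht, integral_congr_ae ht]

/-! ### Measurability of norms of slices -/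

/-- The norm is at most `c` exactly when the slice of `{|v| > c}` at time `t` is a null set, and
measures of slices are measurable in `t`. -/
theorem measurable_eLpNorm_top {v : ℝ → Torus d → ℝ} (hv : Measurable (Function.uncurry v)) :
    Measurable fun t => eLpNorm (v t) ⊤ volume := by
  refine measurable_of_Iic fun c => ?_
  have h1 : (fun t => eLpNorm (v t) ⊤ volume) ⁻¹' Iic c =
      {t | volume (Prod.mk t ⁻¹' {p : ℝ × Torus d | c < ‖v p.1 p.2‖ₑ}) = 0} := by
    ext t
    simp only [mem_preimage, mem_Iic, mem_ofPred_eq, eLpNorm_exponent_top]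
    constructor
    · intro h
      have := (ae_le_eLpNormEssSup (f := v t) (μ := volume)).mono fun x hx => hx.trans h
      rw [ae_iff] at this
      simpa using this
    · intro h
      refine essSup_le_of_ae_le c ?_
      refine ae_iff.2 ?_
      simpa using h
  rw [h1]
  exact measurable_measure_prodMk_left (measurableSet_lt measurable_const hv.enorm)
    (measurableSet_singleton 0)

theorem measurable_lintegral_distribution_rpow {X : Type*} [MeasurableSpace X] {μ : Measure X}
    [SFinite μ] {N : ℝ × X → ℝ} (hN : Measurable N) (r : ℝ) :
    Measurable fun t : ℝ => ∫⁻ s in Ioi (0 : ℝ), μ {x : X | s < N (t, x)} ^ r := by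
  have hq : Measurable fun q : (ℝ × ℝ) × X => (q.1.1, q.2) := by fun_prop
  have hs : Measurable fun q : (ℝ × ℝ) × X => q.1.2 := by fun_prop
  have h1 : MeasurableSet {q : (ℝ × ℝ) × X | q.1.2 < N (q.1.1, q.2)} :=
    measurableSet_lt hs (hN.comp hq)
  have h2 : Measurable fun q : ℝ × ℝ => μ {x : X | q.2 < N (q.1, x)} :=
    measurable_measure_prodMk_left (ν := μ) h1
  exact Measurable.lintegral_prod_right' (ν := volume.restrict (Ioi (0 : ℝ))) (h2.pow_const r)

theorem measurable_lorentzNorm {w : ℝ → Torus d → Vec d}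
    (hw : StronglyMeasurable (Function.uncurry w)) (p : ℝ) :
    Measurable fun t => lorentzNorm p (w t) :=
  (measurable_lintegral_distribution_rpow (μ := (volume : Measure (Torus d)))
    hw.norm.measurable (1 / p)).const_mul (ENNReal.ofReal p)

/-! ### Stability in terms of the Lorentz norm -/

section Core

variable {m M C₀ : ℝ} {g : Torus d → ℝ} {K : Torus d → Vec d} {w : ℝ → Torus d → Vec d}
  {u v : ℝ → Torus d → ℝ} {u₀ v₀ : Torus d → ℝ}

theorem enorm_le_ofReal {M : ℝ} (hv : IsBoundedDensity M v) (t : ℝ) (x : Torus d) :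
    ‖v t x‖ₑ ≤ ENNReal.ofReal M := by
  rw [← ofReal_norm]
  exact ENNReal.ofReal_le_ofReal (hv.abs_le t x)

theorem eLpNorm_top_le (hv : IsBoundedDensity M v) (t : ℝ) :
    eLpNorm (v t) ⊤ volume ≤ ENNReal.ofReal M := by
  rw [eLpNorm_exponent_top]
  exact essSup_le_of_ae_le _ (Eventually.of_forall fun x => enorm_le_ofReal hv t x)

/-- `v^m` has a weak gradient as soon as `v^(m-1)` has one in the Lorentz space `L^{d,1}`. -/
theorem hasWeakGradient_rpow_of_lorentz (hd : 1 ≤ d) (hm : 0 < m) (hm1 : m ≠ 1)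
    (h : IsGreenKernel g K) (hC0 : 0 ≤ C₀)
    (hC : ∀ E : Set (Torus d), MeasurableSet E →
      ∫⁻ x in E, ‖K x‖ₑ ≤ ENNReal.ofReal C₀ * volume E ^ (1 / (d : ℝ)))
    {f : Torus d → ℝ} {W : Torus d → Vec d} (hf0 : ∀ x, 0 ≤ f x) (hfM : ∀ x, f x ≤ M)
    (hW : HasWeakGradient (fun x => f x ^ (m - 1)) W) (hfin : lorentzNorm d W < ⊤) :
    HasWeakGradient (fun x => f x ^ m) fun x => (m / (m - 1) * f x) • W x := by
  have hb : ∀ z, ∫⁻ y, ‖K (y - z)‖ₑ * ‖W y‖ₑ ≤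
      ENNReal.ofReal (C₀ * (lorentzNorm d W).toReal) := fun z => by
    rw [ENNReal.ofReal_mul hC0, ENNReal.ofReal_toReal hfin.ne]
    exact lintegral_mul_comp_sub_le_lorentzNorm hd h.gradient.integrable_grad.aestronglyMeasurable
      hW.integrable_grad.aestronglyMeasurable hC z
  have h1 := h.ae_abs_sub_integral_le hW (mul_nonneg hC0 ENNReal.toReal_nonneg) hb
  refine hasWeakGradient_rpow hm hm1 hf0 hfM hW
    (B := C₀ * (lorentzNorm d W).toReal + |∫ y, f y ^ (m - 1)|) ?_
  filter_upwards [h1] with x hx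
  have := abs_add_le (f x ^ (m - 1) - ∫ y, f y ^ (m - 1)) (∫ y, f y ^ (m - 1))
  rw [sub_add_cancel] at this
  linarith

/-- The gradient of `v^m` is `(p v) w` with `p = m/(m-1)`, so the kernel bound holds with the rate
`|p| C₀ ‖v‖_∞ ‖w‖_{L^{d,1}}`. This rate is only locally integrable in time, hence the argument runs
on `(0, n + 1)` for each `n` and countably many null sets are discarded. -/
theorem ae_integral_abs_sub_le_lorentz (hd : 1 ≤ d) (hm : 0 < m) (hm1 : m ≠ 1)
    (h : IsGreenKernel g K) (hKm : StronglyMeasurable K) (hC0 : 0 ≤ C₀)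
    (hC : ∀ E : Set (Torus d), MeasurableSet E →
      ∫⁻ x in E, ‖K x‖ₑ ≤ ENNReal.ofReal C₀ * volume E ^ (1 / (d : ℝ)))
    (hu : IsBoundedDensity M u) (hv : IsBoundedDensity M v)
    (hu₀ : Measurable u₀) (hu₀0 : ∀ x, 0 ≤ u₀ x) (hu₀M : ∀ x, u₀ x ≤ M)
    (hv₀ : Measurable v₀) (hv₀0 : ∀ x, 0 ≤ v₀ x) (hv₀M : ∀ x, v₀ x ≤ M)
    (hsolu : IsEntropySolution m K u₀ u) (hsolv : IsEntropySolution m K v₀ v)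
    (hwm : StronglyMeasurable (Function.uncurry w))
    (hw : IsLorentzGradient (fun t x => v t x ^ (m - 1)) w) :
    ∀ᵐ t ∂volume.restrict (Ioi (0 : ℝ)), ∫ x, |u t x - v t x| ≤ (∫ x, |u₀ x - v₀ x|) *
      Real.exp (3 * (|m / (m - 1)| * C₀) *
        (∫⁻ τ in Ioo 0 t, eLpNorm (v τ) ⊤ volume * lorentzNorm d (w τ)).toReal) := by
  set p := m / (m - 1) with hp
  set c := |p| * C₀
  have hc0 : 0 ≤ c := mul_nonneg (abs_nonneg _) hC0
  set Λ : ℝ → ℝ≥0∞ := fun τ => eLpNorm (v τ) ⊤ volume * lorentzNorm d (w τ) with hΛ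
  have hlm : Measurable fun t => lorentzNorm d (w t) := measurable_lorentzNorm hwm d
  have hΛm : Measurable Λ := (measurable_eLpNorm_top hv.measurable).mul hlm
  set F : ℝ → Torus d → Vec d := fun t x => (p * v t x) • w t x
  have hFm : StronglyMeasurable (Function.uncurry F) :=
    (hv.measurable.const_mul p).stronglyMeasurable.smul hwm
  have hwt : ∀ t, StronglyMeasurable (w t) := fun t => hwm.comp_measurable measurable_prodMk_left
  have hFe : ∀ t x, ‖F t x‖ₑ = ‖p‖ₑ * ‖v t x‖ₑ * ‖w t x‖ₑ := fun t x => by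
    simp only [F, enorm_smul, enorm_mul]
  have main : ∀ n : ℕ, ∀ᵐ t ∂volume.restrict (Ioo (0 : ℝ) ((n : ℝ) + 1)),
      ∫ x, |u t x - v t x| ≤ (∫ x, |u₀ x - v₀ x|) *
        Real.exp (3 * c * (∫⁻ τ in Ioo 0 t, Λ τ).toReal) := by
    intro n
    set T : ℝ := (n : ℝ) + 1
    have hT : 0 < T := by positivity
    have hli := hw.integrable T hT
    have hlfin : ∀ᵐ t ∂volume.restrict (Ioo 0 T), lorentzNorm d (w t) < ⊤ :=
      ae_lt_top hlm hli.ne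
    have hΛle : ∀ t, Λ t ≤ ENNReal.ofReal M * lorentzNorm d (w t) := fun t =>
      mul_le_mul_left (eLpNorm_top_le hv t) _
    -- Finiteness guarantees that the `toReal` in the exponent is the actual integral and not the
    -- default value `0`.
    have hΛi : ∫⁻ t in Ioo 0 T, Λ t ≠ ⊤ := by
      refine ne_top_of_le_ne_top ?_ (lintegral_mono hΛle)
      rw [lintegral_const_mul _ hlm]
      exact ENNReal.mul_ne_top ENNReal.ofReal_ne_top hli.ne
    have hΛfin : ∀ᵐ t ∂volume.restrict (Ioo 0 T), Λ t < ⊤ := ae_lt_top hΛm hΛi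
    have hFi : Integrable (Function.uncurry F) ((volume.restrict (Ioo 0 T)).prod volume) := by
      refine ⟨hFm.aestronglyMeasurable, ?_⟩
      rw [HasFiniteIntegral, lintegral_prod _ hFm.enorm.aemeasurable]
      refine lt_of_le_of_lt (lintegral_mono (g := fun t =>
        ‖p‖ₑ * ENNReal.ofReal M * lorentzNorm d (w t)) fun t => ?_) ?_
      · calc ∫⁻ x, ‖F t x‖ₑ ≤ ∫⁻ x, ‖p‖ₑ * ENNReal.ofReal M * ‖w t x‖ₑ := by
              refine lintegral_mono fun x => ?_
              rw [hFe]
              gcongr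
              exact enorm_le_ofReal hv t x
          _ = ‖p‖ₑ * ENNReal.ofReal M * ∫⁻ x, ‖w t x‖ₑ :=
              lintegral_const_mul _ (hwt t).enorm
          _ ≤ _ := by
              exact mul_le_mul_right
                (lintegral_enorm_le_lorentzNorm hd (hwt t).aestronglyMeasurable) _
      · rw [lintegral_const_mul _ hlm]
        exact ENNReal.mul_lt_top (ENNReal.mul_lt_top enorm_lt_top ENNReal.ofReal_lt_top) hli
    have hgrad := ae_restrict_of_ae_restrict_of_subset
      (Ioo_subset_Ioi_self : Ioo 0 T ⊆ Ioi 0) hw.gradient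
    have hVF : ∀ᵐ t ∂volume.restrict (Ioo 0 T),
        HasWeakGradient (fun x => v t x ^ m) (F t) := by
      filter_upwards [hgrad, hlfin] with t ht1 ht2
      exact hasWeakGradient_rpow_of_lorentz hd hm hm1 h hC0 hC (hv.nonneg t) (hv.le t) ht1 ht2
    -- The rate is extended by zero, so that it is integrable on the whole line.
    set a : ℝ → ℝ := (Ioo 0 T).indicator fun t => c * (Λ t).toReal with ha_def
    have ha : Integrable a := (integrable_indicator_iff measurableSet_Ioo).2
      ((integrable_toReal_of_lintegral_ne_top hΛm.aemeasurable hΛi).const_mul c)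
    have ha0 : ∀ t, 0 ≤ a t := fun t =>
      indicator_nonneg (fun t _ => mul_nonneg hc0 ENNReal.toReal_nonneg) t
    have hKF : ∀ᵐ t ∂volume.restrict (Ioo 0 T), ∀ z,
        ∫⁻ y, ‖K (y - z)‖ₑ * ‖F t y‖ₑ ≤ ENNReal.ofReal (a t) := by
      filter_upwards [hΛfin, ae_restrict_mem measurableSet_Ioo] with t ht htm z
      have e1 : ENNReal.ofReal (a t) = ‖p‖ₑ * eLpNorm (v t) ⊤ volume *
          (ENNReal.ofReal C₀ * lorentzNorm d (w t)) := by
        rw [ha_def, indicator_of_mem htm, ENNReal.ofReal_mul hc0, ENNReal.ofReal_toReal ht.ne,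
          ENNReal.ofReal_mul (abs_nonneg _), ← Real.norm_eq_abs, ofReal_norm]
        simp only [hΛ]
        ring
      have hKz : Measurable fun y => ‖K (y - z)‖ₑ :=
        hKm.enorm.comp (measurable_id.sub_const z)
      calc ∫⁻ y, ‖K (y - z)‖ₑ * ‖F t y‖ₑ
          ≤ ∫⁻ y, ‖p‖ₑ * eLpNorm (v t) ⊤ volume * (‖K (y - z)‖ₑ * ‖w t y‖ₑ) := by
            refine lintegral_mono_ae ?_
            filter_upwards [ae_le_eLpNormEssSup (f := v t) (μ := volume)] with y hy
            rw [hFe, eLpNorm_exponent_top]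
            calc ‖K (y - z)‖ₑ * (‖p‖ₑ * ‖v t y‖ₑ * ‖w t y‖ₑ)
                = ‖p‖ₑ * ‖v t y‖ₑ * (‖K (y - z)‖ₑ * ‖w t y‖ₑ) := by ring
              _ ≤ _ := by gcongr
        _ = ‖p‖ₑ * eLpNorm (v t) ⊤ volume * ∫⁻ y, ‖K (y - z)‖ₑ * ‖w t y‖ₑ :=
            lintegral_const_mul _ (hKz.mul (hwt t).enorm)
        _ ≤ _ := by
            rw [e1]
            gcongr
            exact lintegral_mul_comp_sub_le_lorentzNorm hd hKm.aestronglyMeasurable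
              (hwt t).aestronglyMeasurable hC z
    have hfinal := ae_integral_abs_sub_le hT hm h hKm hu hv hu₀ hu₀0 hu₀M hv₀ hv₀0 hv₀M hsolu
      hsolv hFm hFi hVF ha ha0 hKF
    filter_upwards [hfinal, ae_restrict_mem measurableSet_Ioo] with t ht htm
    refine ht.trans_eq ?_
    congr 2
    have hsub : Ioo 0 t ⊆ Ioo 0 T := Ioo_subset_Ioo_right htm.2.le
    rw [← setIntegral_Ioo_eq _ htm.1.le, ← integral_toReal hΛm.aemeasurable
      (ae_restrict_of_ae_restrict_of_subset hsub hΛfin), ← integral_const_mul]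
    refine setIntegral_congr_fun measurableSet_Ioo fun s hs => ?_
    simp only [ha_def, indicator_of_mem (hsub hs)]
    ring
  rw [ae_restrict_iff' measurableSet_Ioi]
  have main' := ae_all_iff.2 fun n => (ae_restrict_iff' measurableSet_Ioo).1 (main n)
  filter_upwards [main'] with t ht ht0
  obtain ⟨n, hn⟩ := exists_nat_gt t
  exact ht n ⟨ht0, by linarith⟩

end Core

/-! ### Passage to arbitrary representatives -/

theorem IsLorentzGradient.congr {f f' : ℝ → Torus d → ℝ} {w w' : ℝ → Torus d → Vec d}
    (h : IsLorentzGradient f w)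
    (hf : ∀ᵐ t ∂volume.restrict (Ioi (0 : ℝ)), f t =ᵐ[volume] f' t)
    (hw : Function.uncurry w =ᵐ[spaceTime d] Function.uncurry w') :
    IsLorentzGradient f' w' := by
  have hs : ∀ᵐ t ∂volume.restrict (Ioi (0 : ℝ)), w t =ᵐ[volume] w' t :=
    Measure.ae_ae_of_ae_prod hw
  refine ⟨h.measurable.congr hw, ?_, fun T hT => ?_⟩
  · filter_upwards [h.gradient, hf, hs] with t h1 h2 h3 using h1.congr h2 h3
  · refine lt_of_eq_of_lt (lintegral_congr_ae ?_) (h.integrable T hT)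
    filter_upwards [ae_restrict_of_ae_restrict_of_subset Ioo_subset_Ioi_self hs] with t ht
    exact (lorentzNorm_congr ht).symm

theorem eLpNorm_one_sub_eq_ofReal {X : Type*} [MeasurableSpace X] {μ : Measure X}
    [IsFiniteMeasure μ] {f f' g g' : X → ℝ} {M : ℝ} (hf : f =ᵐ[μ] f') (hg : g =ᵐ[μ] g')
    (hfm : Measurable f') (hgm : Measurable g') (hf0 : ∀ x, 0 ≤ f' x) (hfM : ∀ x, f' x ≤ M)
    (hg0 : ∀ x, 0 ≤ g' x) (hgM : ∀ x, g' x ≤ M) :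
    eLpNorm (fun x => f x - g x) 1 μ = ENNReal.ofReal (∫ x, |f' x - g' x| ∂μ) := by
  have hi : Integrable (fun x => |f' x - g' x|) μ := by
    refine Integrable.of_bound (hfm.sub hgm).abs.aestronglyMeasurable M
      (Eventually.of_forall fun x => ?_)
    rw [Real.norm_eq_abs, abs_abs, abs_le]
    constructor <;> linarith [hf0 x, hfM x, hg0 x, hgM x]
  rw [eLpNorm_one_eq_lintegral_enorm,
    ofReal_integral_eq_lintegral_ofReal hi (Eventually.of_forall fun x => abs_nonneg _)]
  refine lintegral_congr_ae ?_
  filter_upwards [hf, hg] with x h1 h2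
  rw [h1, h2, ← ofReal_norm, Real.norm_eq_abs]

/-- Passing from slices back to the product measure needs a measurable set, so both functions are
first replaced by measurable versions. -/
theorem ae_eq_spaceTime_of_ae_eq {f g : ℝ → Torus d → ℝ}
    (hf : AEMeasurable (Function.uncurry f) (spaceTime d))
    (hg : AEMeasurable (Function.uncurry g) (spaceTime d))
    (h : ∀ᵐ t ∂volume.restrict (Ioi (0 : ℝ)), f t =ᵐ[volume] g t) :
    Function.uncurry f =ᵐ[spaceTime d] Function.uncurry g := by
  have hs : MeasurableSet {p : ℝ × Torus d | hf.mk _ p = hg.mk _ p} :=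
    measurableSet_eq_fun hf.measurable_mk hg.measurable_mk
  have h1 := Measure.ae_ae_of_ae_prod hf.ae_eq_mk
  have h2 := Measure.ae_ae_of_ae_prod hg.ae_eq_mk
  have h3 : ∀ᵐ p ∂spaceTime d, p ∈ {p : ℝ × Torus d | hf.mk _ p = hg.mk _ p} := by
    refine (Measure.ae_prod_mem_iff_ae_ae_mem hs).2 ?_
    filter_upwards [h, h1, h2] with t ht ht1 ht2
    filter_upwards [ht, ht1, ht2] with x hx hx1 hx2
    exact hx1.symm.trans (hx.trans hx2)
  filter_upwards [h3, hf.ae_eq_mk, hg.ae_eq_mk] with p hp hp1 hp2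
  exact hp1.trans (Eq.trans hp hp2.symm)

/-- The constant in the bound `∫_E |∇g| ≤ C |E|^{1/d}` depends on the dimension only. -/
theorem exists_forall_setLIntegral_le (hd : 1 ≤ d) :
    ∃ C : ℝ, 0 ≤ C ∧ ∀ (g : Torus d → ℝ) (K : Torus d → Vec d), IsGreenKernel g K →
      ∀ E : Set (Torus d), MeasurableSet E →
        ∫⁻ x in E, ‖K x‖ₑ ≤ ENNReal.ofReal C * volume E ^ (1 / (d : ℝ)) := by
  -- All kernels agree almost everywhere, so the constant of any one of them serves for all; if
  -- there were none the claim would be void, so existence of a kernel is not needed.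
  by_cases hex : ∃ (g : Torus d → ℝ) (K : Torus d → Vec d), IsGreenKernel g K
  · obtain ⟨g, K, h⟩ := hex
    obtain ⟨C, hC0, hC⟩ := h.exists_setLIntegral_le hd
    refine ⟨C, hC0, fun g' K' h' E hE => le_of_eq_of_le ?_ (hC E hE)⟩
    refine lintegral_congr_ae (ae_restrict_of_ae ?_)
    filter_upwards [h'.ae_eq h] with x hx
    rw [hx]
  · exact ⟨0, le_rfl, fun g K h => (hex ⟨g, K, h⟩).elim⟩

section Stability

variable {m C₀ : ℝ} {g : Torus d → ℝ} {K : Torus d → Vec d} {w : ℝ → Torus d → Vec d}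
  {u v : ℝ → Torus d → ℝ} {u₀ v₀ : Torus d → ℝ}

/-- Hypotheses and conclusion are insensitive to null sets, so `u`, `v`, the initial data, `K` and
`w` are replaced by measurable representatives, the densities and data being bounded everywhere by
one common `M`, for which the estimate is already available. -/
theorem ae_eLpNorm_sub_le (hd : 1 ≤ d) (hm : 0 < m) (hm1 : m ≠ 1)
    (h : IsGreenKernel g K) (hC0 : 0 ≤ C₀)
    (hC : ∀ E : Set (Torus d), MeasurableSet E →
      ∫⁻ x in E, ‖K x‖ₑ ≤ ENNReal.ofReal C₀ * volume E ^ (1 / (d : ℝ)))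
    (hsolu : IsEntropySolution m K u₀ u) (hsolv : IsEntropySolution m K v₀ v)
    (hw : IsLorentzGradient (fun t x => v t x ^ (m - 1)) w) :
    ∀ᵐ t ∂volume.restrict (Ioi (0 : ℝ)), eLpNorm (fun x => u t x - v t x) 1 volume ≤
      eLpNorm (fun x => u₀ x - v₀ x) 1 volume *
        ENNReal.ofReal (Real.exp (3 * (|m / (m - 1)| * C₀) *
          (∫⁻ τ in Ioo 0 t, eLpNorm (v τ) ⊤ volume * lorentzNorm d (w τ)).toReal)) := by
  obtain ⟨M₁, hM₁⟩ := exists_ae_le_of_memLp_top hsolu.memLp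
  obtain ⟨M₂, hM₂⟩ := exists_ae_le_of_memLp_top hsolv.memLp
  obtain ⟨M₃, hM₃⟩ := exists_ae_le_of_memLp_top hsolu.initial_memLp
  obtain ⟨M₄, hM₄⟩ := exists_ae_le_of_memLp_top hsolv.initial_memLp
  set M : ℝ := |M₁| + |M₂| + |M₃| + |M₄| with hM
  have hM0 : 0 ≤ M := by positivity
  have hle : M₁ ≤ M ∧ M₂ ≤ M ∧ M₃ ≤ M ∧ M₄ ≤ M := by
    have := abs_nonneg M₁
    have := abs_nonneg M₂
    have := abs_nonneg M₃
    have := abs_nonneg M₄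
    refine ⟨?_, ?_, ?_, ?_⟩ <;>
      linarith [le_abs_self M₁, le_abs_self M₂, le_abs_self M₃, le_abs_self M₄]
  obtain ⟨U, hUm, hU, hU0, hUM⟩ := exists_measurable_rep hM0 hsolu.memLp.1 hsolu.nonneg
    (hM₁.mono fun p hp => hp.trans hle.1)
  obtain ⟨V, hVm, hV, hV0, hVM⟩ := exists_measurable_rep hM0 hsolv.memLp.1 hsolv.nonneg
    (hM₂.mono fun p hp => hp.trans hle.2.1)
  obtain ⟨u₀', hu₀m, hu₀, hu₀0, hu₀M⟩ := exists_measurable_rep hM0 hsolu.initial_memLp.1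
    hsolu.initial_nonneg (hM₃.mono fun p hp => hp.trans hle.2.2.1)
  obtain ⟨v₀', hv₀m, hv₀, hv₀0, hv₀M⟩ := exists_measurable_rep hM0 hsolv.initial_memLp.1
    hsolv.initial_nonneg (hM₄.mono fun p hp => hp.trans hle.2.2.2)
  set u' : ℝ → Torus d → ℝ := fun t x => U (t, x)
  set v' : ℝ → Torus d → ℝ := fun t x => V (t, x)
  have hKi := h.gradient.integrable_grad.aestronglyMeasurable
  set K' := hKi.mk K
  have hK : K =ᵐ[volume] K' := hKi.ae_eq_mk
  set w' : ℝ → Torus d → Vec d := fun t x => hw.measurable.mk _ (t, x)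
  have hww : Function.uncurry w =ᵐ[spaceTime d] Function.uncurry w' := hw.measurable.ae_eq_mk
  have hus : ∀ᵐ t ∂volume.restrict (Ioi (0 : ℝ)), u t =ᵐ[volume] u' t :=
    Measure.ae_ae_of_ae_prod hU
  have hvs : ∀ᵐ t ∂volume.restrict (Ioi (0 : ℝ)), v t =ᵐ[volume] v' t :=
    Measure.ae_ae_of_ae_prod hV
  have hws : ∀ᵐ t ∂volume.restrict (Ioi (0 : ℝ)), w t =ᵐ[volume] w' t :=
    Measure.ae_ae_of_ae_prod hww
  have hw' : IsLorentzGradient (fun t x => v' t x ^ (m - 1)) w' := by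
    refine hw.congr ?_ hww
    filter_upwards [hvs] with t ht
    filter_upwards [ht] with x hx
    rw [hx]
  have hC' : ∀ E : Set (Torus d), MeasurableSet E →
      ∫⁻ x in E, ‖K' x‖ₑ ≤ ENNReal.ofReal C₀ * volume E ^ (1 / (d : ℝ)) := fun E hE => by
    refine le_of_eq_of_le (lintegral_congr_ae (ae_restrict_of_ae ?_)) (hC E hE)
    filter_upwards [hK] with x hx
    rw [hx]
  have key := ae_integral_abs_sub_le_lorentz hd hm hm1 (h.congr hK) hKi.stronglyMeasurable_mk
    hC0 hC' (w := w') (u := u') (v := v') ⟨hUm, fun t x => hU0 (t, x), fun t x => hUM (t, x)⟩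
    ⟨hVm, fun t x => hV0 (t, x), fun t x => hVM (t, x)⟩ hu₀m hu₀0 hu₀M hv₀m hv₀0 hv₀M
    (hsolu.congr hK hu₀ hU) (hsolv.congr hK hv₀ hV) hw.measurable.stronglyMeasurable_mk hw'
  filter_upwards [key, hus, hvs] with t ht hut hvt
  have hΛ : ∫⁻ τ in Ioo 0 t, eLpNorm (v τ) ⊤ volume * lorentzNorm d (w τ) =
      ∫⁻ τ in Ioo 0 t, eLpNorm (v' τ) ⊤ volume * lorentzNorm d (w' τ) := by
    refine lintegral_congr_ae ?_
    filter_upwards [ae_restrict_of_ae_restrict_of_subset Ioo_subset_Ioi_self hvs,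
      ae_restrict_of_ae_restrict_of_subset Ioo_subset_Ioi_self hws] with τ h1 h2
    rw [eLpNorm_congr_ae h1, lorentzNorm_congr h2]
  rw [eLpNorm_one_sub_eq_ofReal hut hvt (hUm.comp measurable_prodMk_left)
      (hVm.comp measurable_prodMk_left) (fun x => hU0 (t, x)) (fun x => hUM (t, x))
      (fun x => hV0 (t, x)) (fun x => hVM (t, x)),
    eLpNorm_one_sub_eq_ofReal hu₀ hv₀ hu₀m hv₀m hu₀0 hu₀M hv₀0 hv₀M, hΛ,
    ← ENNReal.ofReal_mul (integral_nonneg fun x => abs_nonneg _)]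
  exact ENNReal.ofReal_le_ofReal ht

end Stability

end CoulombMobility

end

theorem proposition1p3 (d : ℕ) (hd : 1 ≤ d) (m : ℝ) (hm : 0 < m) (hm1 : m ≠ 1) :
    ∃ C : ℝ, 0 < C ∧
      ∀ (g : CoulombMobility.Torus d → ℝ)
        (K : CoulombMobility.Torus d → CoulombMobility.Vec d),
        CoulombMobility.IsGreenKernel g K →
      ∀ (u₀ v₀ : CoulombMobility.Torus d → ℝ) (u v : ℝ → CoulombMobility.Torus d → ℝ),
        CoulombMobility.IsEntropySolution m K u₀ u →
        CoulombMobility.IsEntropySolution m K v₀ v →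
      ∀ w : ℝ → CoulombMobility.Torus d → CoulombMobility.Vec d,
        CoulombMobility.IsLorentzGradient (fun t x => v t x ^ (m - 1)) w →
        (∀ᵐ t ∂(volume.restrict (Ioi (0 : ℝ))),
          eLpNorm (fun x => u t x - v t x) 1 volume ≤
            eLpNorm (fun x => u₀ x - v₀ x) 1 volume *
              ENNReal.ofReal (Real.exp (C *
                (∫⁻ τ in Ioo 0 t,
                  eLpNorm (v τ) ⊤ volume * CoulombMobility.lorentzNorm d (w τ)).toReal))) ∧
        (u₀ =ᵐ[volume] v₀ →
          Function.uncurry u =ᵐ[CoulombMobility.spaceTime d] Function.uncurry v) := by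
  obtain ⟨C₀, hC0, hC⟩ := CoulombMobility.exists_forall_setLIntegral_le (d := d) hd
  have hc : 0 ≤ 3 * (|m / (m - 1)| * C₀) := by positivity
  -- The summand `1` makes the constant positive even when `C₀ = 0`.
  refine ⟨3 * (|m / (m - 1)| * C₀) + 1, by linarith,
    fun g K h u₀ v₀ u v hsolu hsolv w hw => ?_⟩
  have key := CoulombMobility.ae_eLpNorm_sub_le hd hm hm1 h hC0 (hC g K h) hsolu hsolv hw
  refine ⟨?_, fun h0 => ?_⟩
  · filter_upwards [key] with t ht
    refine ht.trans ?_
    gcongr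
    linarith
  · refine CoulombMobility.ae_eq_spaceTime_of_ae_eq hsolu.memLp.1.aemeasurable
      hsolv.memLp.1.aemeasurable ?_
    have hsu := hsolu.memLp.1.prodMk_left
    have hsv := hsolv.memLp.1.prodMk_left
    have hz : eLpNorm (fun x => u₀ x - v₀ x) 1 volume = 0 := by
      rw [eLpNorm_congr_ae (g := 0) (h0.mono fun x hx => by simp [hx]), eLpNorm_zero]
    filter_upwards [key, hsu, hsv] with t ht htu htv
    rw [hz, zero_mul, nonpos_iff_eq_zero] at ht
    filter_upwards [(eLpNorm_eq_zero_iff (htu.sub htv) one_ne_zero).1 ht] with x hx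
    exact sub_eq_zero.1 hx
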